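/- Let $c\in\mathbb C$ be arbitrary and let $\mathrm{Vir}_c=M_{c,0}/\langle L_{-1}\mathbf 1\rangle$ be the universal Virasoro vertex operator algebra of central charge $c$, with vacuum $\mathbf 1$ and conformal vector $\omega=L_{-2}\mathbf 1$ whose modes are $\omega_{(n+1)}=L_n$ (such a VOA structure exists on this space). For a VOA $V$ of CFT type let $\mathscr U=\bigoplus_p\mathscr U_p$ be its graded universal enveloping algebra: the degreewise completion, with respect to the left ideals $U\cdot U_{\le -n}$, of the enveloping algebra $U$ of the Lie algebra of modes $a_{[i]}$ ($a\in V$, $i\in\mathbb Z$, $\deg a_{[i]}=\deg a-i-1$, $\mathbf 1_{[-1]}=1$), modulo the closure of the ideal generated by the Jacobi relations. Let $N_L^n\mathscr U_p$ and $N_R^n\mathscr U_p$ be the images of the closures of $\sum_{j\le -n}U_{p-j}U_j$ and $\sum_{i\ge n}U_iU_{p-i}$; put $N^n\mathscr U_0=N_L^n\mathscr U_0=N_R^n\mathscr U_0$. Let $\mathsf A_d=\mathscr U_0/N^{d+1}\mathscr U_0$ be the $d$-th higher level Zhu algebra, and let $$\mathfrak A=\bigoplus_{i,j}\mathfrak A_{i,j}=(\mathscr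 U/N_L^1\mathscr U)\otimes_{\mathscr U_0}\mathsf A_0\otimes_{\mathscr U_0}(\mathscr U/N_R^1\mathscr U).$$ The $d$-th mode transition algebra is $\mathfrak A_d=\mathfrak A_{d,-d}$, with product $(\alpha\otimes u\otimes\beta)\star(\alpha'\otimes u'\otimes\beta')=\alpha\otimes u(\beta\alpha')u'\otimes\beta'$, and $\mu_d\colon\mathfrak A_d\to\mathsf A_d$ is the map $\alpha\otimes u\otimes\beta\mapsto[\alpha u\beta]_d$. $V$ satisfies smoothing if for all admissible $V$-modules $W^1,\dots,W^n$ and every smoothing family $(\mathscr C,P_\bullet,t_\bullet)$ over $\mathrm{Spec}\,\mathbb C[\![q]\!]$ of an $n$-pointed projective nodal curve with affine complement of the marked points (given by $s_+s_-=q$ at the node, for formal coordinates $s_\pm$ at the two preimages $Q_\pm$ of the node, and trivial away from it), there is $\mathscr I=\sum_{d\ge0}\mathscr I_dq^d\in\mathfrak A[\![q]\!]$ with $\mathscr I_0=1\in\mathfrak A_0$ such that $w\mapsto w\otimes\mathscr I$ extends to a homomorphism $W^\bullet[\![q]\!]\to(W^\bullet\otimes\mathfrak A)[\![q]\!]$ of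 modules over the chiral Lie algebra $\mathcal L_{\mathscr C\setminus P_\bullet}(V)$, where $W^\bullet=W^1\otimes\cdots\otimes W^n$, and $\mathfrak A$ is placed at $Q_\pm$. Then: (a) There is a linear isomorphism $\mathfrak A_1(\mathrm{Vir}_c)\cong\mathbb C[t]$ under which the product $\star$ becomes $f\star g=2t\,fg$. In particular $\mathfrak A_1(\mathrm{Vir}_c)$ has no two-sided identity element; moreover $\mathrm{Vir}_c$ does not satisfy smoothing. (b) The map $\mu_1$ is multiplicative and injective, and its image is the kernel of the canonical projection $\mathsf A_1(\mathrm{Vir}_c)\to\mathsf A_0(\mathrm{Vir}_c)$; that is, $\mu_1$ identifies $\mathfrak A_1(\mathrm{Vir}_c)$ with this kernel. -/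

import Mathlib

open scoped TensorProduct

universe u

noncomputable section

/-- A vertex operator algebra of CFT type over the complex numbers, with underlying space `V`.
`Y a m` is the mode `a_(m)`, so that `Y(a, z) = ∑ a_(m) z^(-m-1)`. -/
structure VOA (V : Type u) [AddCommGroup V] [Module ℂ V] where
  /-- the central charge -/
  charge : ℂ
  /-- the grading by conformal weight -/
  gr : ℕ → Submodule ℂ V
  isInternal : DirectSum.IsInternal gr
  finite_gr : ∀ d, Module.Finite ℂ (gr d)
  finrank_gr_zero : Module.finrank ℂ (gr 0) = 1
  /-- the vacuum vector -/
  vac : V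
  vac_mem : vac ∈ gr 0
  /-- the conformal vector -/
  conf : V
  conf_mem : conf ∈ gr 2
  /-- the vertex operators -/
  Y : V →ₗ[ℂ] (ℤ → Module.End ℂ V)
  field : ∀ a b, ∃ N : ℤ, ∀ m, N ≤ m → Y a m b = 0
  vac_mode : ∀ m, Y vac m = if m = -1 then 1 else 0
  creation : ∀ a, Y a (-1) vac = a
  creation_regular : ∀ a m, 0 ≤ m → Y a m vac = 0
  /-- `(z - w)^N [Y(a, z), Y(b, w)] = 0` for some `N` -/
  weak_comm : ∀ a b, ∃ N : ℕ, ∀ m n : ℤ,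
    ∑ i ∈ Finset.range (N + 1),
      ((-1 : ℤ) ^ i * (N.choose i : ℤ)) • ⁅Y a (m + N - i), Y b (n + i)⁆ = 0
  virasoro : ∀ p q : ℤ, ⁅Y conf (p + 1), Y conf (q + 1)⁆ =
    ((p : ℂ) - q) • Y conf (p + q + 1) +
      (if p + q = 0 then charge / 12 * ((p : ℂ) ^ 3 - p) else 0) • (1 : Module.End ℂ V)
  conf_grading : ∀ d, ∀ a ∈ gr d, Y conf 1 a = (d : ℂ) • a
  translation : ∀ a m, Y (Y conf 0 a) m = -(m : ℂ) • Y a (m - 1)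

namespace VOA

/-! ### The enveloping algebra of the ancillary Lie algebra -/

section Enveloping

variable {V : Type u} [AddCommGroup V] [Module ℂ V] (H : VOA V)

/-- The projection of `V` onto its part of conformal weight `h`. -/
def proj (h : ℕ) : V →ₗ[ℂ] V :=
  (H.gr h).subtype ∘ₗ DirectSum.component ℂ ℕ (fun d => H.gr d) h ∘ₗ
    (LinearEquiv.ofBijective (DirectSum.coeLinearMap H.gr) H.isInternal).symm.toLinearMap

/-- `a ⊗ t^n`, as an element of the tensor algebra of `V ⊗ ℂ[t, t⁻¹]`. -/
def preMode (n : ℤ) : V →ₗ[ℂ] TensorAlgebra ℂ (ℤ →₀ V) :=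
  TensorAlgebra.ι ℂ ∘ₗ Finsupp.lsingle n

/-- The relations of the enveloping algebra: `a_[n]` only depends on the class of `a ⊗ t^n` modulo
the image of `L_{-1} ⊗ 1 + 1 ⊗ d/dt`, commutators are given by the bracket
`[a_[i], b_[j]] = ∑ k, (i choose k) (a_(k) b)_[i+j-k]`, and the central element `1_[-1]` attached to
the vacuum is the identity. -/
inductive URel : TensorAlgebra ℂ (ℤ →₀ V) → TensorAlgebra ℂ (ℤ →₀ V) → Prop
  | deriv (a : V) (n : ℤ) :
      URel (preMode n (H.Y H.conf 0 a) + (n : ℂ) • preMode (n - 1) a) 0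
  | comm (a b : V) (i j : ℤ) :
      URel (preMode i a * preMode j b - preMode j b * preMode i a)
        (∑ᶠ k : ℕ, Ring.choose i k • preMode (i + j - k) (H.Y a k b))
  | vac : URel (preMode (-1) H.vac) 1

/-- The universal enveloping algebra of the Lie algebra
`V ⊗ ℂ[t, t⁻¹] / im (L_{-1} ⊗ 1 + 1 ⊗ d/dt)`, with `1_[-1]` identified with the identity. -/
def U : Type u := RingQuot H.URel

instance : Ring H.U := inferInstanceAs (Ring (RingQuot H.URel))
instance : Algebra ℂ H.U := inferInstanceAs (Algebra ℂ (RingQuot H.URel))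

/-- The generator `a_[n]` of the enveloping algebra. -/
def uMode (n : ℤ) : V →ₗ[ℂ] H.U :=
  (RingQuot.mkAlgHom ℂ H.URel).toLinearMap ∘ₗ preMode n

/-- Monomials of degree `d` in the generators; `a_[n]` has degree `deg a - n - 1`. -/
inductive Homog : ℤ → H.U → Prop
  | one : Homog 0 1
  | mul (k : ℕ) (a : V) (n d : ℤ) (x : H.U) :
      a ∈ H.gr k → Homog d x → Homog (k - n - 1 + d) (H.uMode n a * x)

/-- The part of degree `d` of the enveloping algebra. -/
def Uh (d : ℤ) : Submodule ℂ H.U := Submodule.span ℂ {x | H.Homog d x}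

variable {H}

theorem Homog.mul' {p q : ℤ} {x y : H.U} (hx : H.Homog p x) (hy : H.Homog q y) :
    H.Homog (p + q) (x * y) := by
  induction hx with
  | one => simpa using hy
  | mul k a n d x ha _ ih =>
    rw [mul_assoc, add_assoc]
    exact Homog.mul k a n _ _ ha ih

variable (H)

theorem Uh_mul_Uh (p q : ℤ) : H.Uh p * H.Uh q ≤ H.Uh (p + q) := by
  rw [Uh, Uh, Submodule.span_mul_span]
  refine Submodule.span_mono ?_
  rintro _ ⟨x, hx, y, hy, rfl⟩
  exact Homog.mul' hx hy

theorem one_mem_Uh : (1 : H.U) ∈ H.Uh 0 := Submodule.subset_span Homog.one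

theorem sum_proj (a : V) : ∃ s : Finset ℕ, a = ∑ h ∈ s, H.proj h a := by
  classical
  set e := LinearEquiv.ofBijective (DirectSum.coeLinearMap H.gr) H.isInternal with he
  refine ⟨(e.symm a).support, ?_⟩
  conv_lhs => rw [← e.apply_symm_apply a]
  conv_lhs => rw [← DirectSum.sum_support_of (e.symm a)]
  rw [map_sum]
  refine Finset.sum_congr rfl fun h _ => ?_
  simp only [he]
  exact DirectSum.coeLinearMap_of _ _ _

theorem proj_mem (h : ℕ) (a : V) : H.proj h a ∈ H.gr h := by
  simp [proj]

theorem uMode_mem_Uh {k : ℕ} {a : V} (ha : a ∈ H.gr k) (n : ℤ) :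
    H.uMode n a ∈ H.Uh (k - n - 1) := by
  have := Homog.mul k a n 0 1 ha (Homog.one (H := H))
  rw [mul_one, add_zero] at this
  exact Submodule.subset_span this

theorem iSup_Uh : ⨆ d, H.Uh d = ⊤ := by
  let S : Subalgebra ℂ H.U := Submodule.toSubalgebra (⨆ d, H.Uh d)
    (Submodule.mem_iSup_of_mem 0 H.one_mem_Uh) (fun x y hx hy => by
      have h := Submodule.mul_mem_mul hx hy
      rw [Submodule.iSup_mul] at h
      simp_rw [Submodule.mul_iSup] at h
      exact (iSup_le fun p => iSup_le fun q =>
        (H.Uh_mul_Uh p q).trans (le_iSup H.Uh (p + q))) h)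
  have hS : ∀ x : TensorAlgebra ℂ (ℤ →₀ V), (RingQuot.mkAlgHom ℂ H.URel x : H.U) ∈ S := by
    intro x
    induction x using TensorAlgebra.induction with
    | algebraMap r => rw [AlgHom.commutes]; exact S.algebraMap_mem r
    | ι f =>
      induction f using Finsupp.induction_linear with
      | zero => simp only [map_zero]; exact S.zero_mem
      | add f g hf hg => simp only [map_add]; exact S.add_mem hf hg
      | single n a =>
        change H.uMode n a ∈ ⨆ d, H.Uh d
        obtain ⟨s, hs⟩ := H.sum_proj a
        rw [hs, map_sum]
        exact Submodule.sum_mem _ fun h _ =>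
          Submodule.mem_iSup_of_mem _ (H.uMode_mem_Uh (H.proj_mem h a) n)
    | mul x y hx hy => rw [map_mul]; exact S.mul_mem hx hy
    | add x y hx hy => rw [map_add]; exact S.add_mem hx hy
  refine eq_top_iff.2 fun x _ => ?_
  obtain ⟨y, rfl⟩ := RingQuot.mkAlgHom_surjective ℂ H.URel x
  exact hS y

/-- The left ideal `U · U_{≤ -n}`. -/
def NLtot (n : ℤ) : Submodule ℂ H.U := ⊤ * ⨆ (j : ℤ) (_ : j ≤ -n), H.Uh j

/-- `∑_{j ≤ -n} U_{p-j} U_j`, the part of degree `p` of `U · U_{≤ -n}`. -/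
def NL (n p : ℤ) : Submodule ℂ H.U := ⨆ (j : ℤ) (_ : j ≤ -n), H.Uh (p - j) * H.Uh j

/-- `∑_{i ≥ n} U_i U_{p-i}`, the part of degree `p` of `U_{≥ n} · U`. -/
def NR (n p : ℤ) : Submodule ℂ H.U := ⨆ (i : ℤ) (_ : n ≤ i), H.Uh i * H.Uh (p - i)

theorem NLtot_anti {m n : ℤ} (h : m ≤ n) : H.NLtot n ≤ H.NLtot m :=
  mul_le_mul' le_rfl (iSup₂_le fun j hj => le_iSup₂_of_le j (by omega) le_rfl)

theorem mul_mem_NLtot (n : ℤ) (x : H.U) {y : H.U} (hy : y ∈ H.NLtot n) : x * y ∈ H.NLtot n := by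
  have : x * y ∈ (⊤ : Submodule ℂ H.U) * H.NLtot n := Submodule.mul_mem_mul trivial hy
  rw [NLtot, ← mul_assoc] at this
  exact (mul_le_mul' le_top le_rfl : _ ≤ (⊤ : Submodule ℂ H.U) * _) this

theorem NLtot_mul_Uh (n q : ℤ) : H.NLtot n * H.Uh q ≤ H.NLtot (n - q) := by
  rw [NLtot, mul_assoc]
  refine mul_le_mul' le_rfl ?_
  rw [Submodule.iSup_mul]
  refine iSup_le fun j => ?_
  rw [Submodule.iSup_mul]
  exact iSup_le fun hj => (H.Uh_mul_Uh j q).trans (le_iSup₂_of_le (j + q) (by omega) le_rfl)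

theorem exists_mul_mem_NLtot (n : ℕ) (x : H.U) :
    ∃ m : ℕ, ∀ y ∈ H.NLtot m, y * x ∈ H.NLtot n := by
  have hx : x ∈ ⨆ d, H.Uh d := by rw [H.iSup_Uh]; trivial
  induction hx using Submodule.iSup_induction' with
  | mem q x hx =>
    refine ⟨(n + q).toNat, fun y hy => ?_⟩
    have := H.NLtot_mul_Uh (n + q) q
      (Submodule.mul_mem_mul (H.NLtot_anti (Int.self_le_toNat _) hy) hx)
    simpa using this
  | zero => exact ⟨0, fun y _ => by simp⟩
  | add x y _ _ hx hy =>
    obtain ⟨a, ha⟩ := hx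
    obtain ⟨b, hb⟩ := hy
    refine ⟨max a b, fun z hz => ?_⟩
    rw [mul_add]
    exact Submodule.add_mem _ (ha _ (H.NLtot_anti (by simp) hz))
      (hb _ (H.NLtot_anti (by simp) hz))

theorem isBasis : RingSubgroupsBasis fun n : ℕ => (H.NLtot n).toAddSubgroup where
  inter i j := ⟨max i j, fun x hx => ⟨H.NLtot_anti (by simp) hx, H.NLtot_anti (by simp) hx⟩⟩
  mul i := ⟨i, by rintro _ ⟨x, _, y, hy, rfl⟩; exact H.mul_mem_NLtot _ x hy⟩
  leftMul x i := ⟨i, fun y hy => H.mul_mem_NLtot _ x hy⟩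
  rightMul x i := H.exists_mul_mem_NLtot i x

/-- The linear topology on `U` in which the left ideals `U · U_{≤ -n}` are a basis of
neighbourhoods of zero. -/
instance : TopologicalSpace H.U := H.isBasis.topology

instance : IsTopologicalRing H.U := H.isBasis.toRingFilterBasis.isTopologicalRing

instance : UniformSpace H.U := IsTopologicalAddGroup.rightUniformSpace H.U

instance : IsUniformAddGroup H.U := isUniformAddGroup_of_addCommGroup

theorem mem_nhds_zero {s : Set H.U} : s ∈ nhds (0 : H.U) ↔ ∃ n : ℕ, (H.NLtot n : Set H.U) ⊆ s := by
  simpa using (H.isBasis.hasBasis_nhds_zero).mem_iff (t := s)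

instance : UniformContinuousConstSMul ℂ H.U where
  uniformContinuous_const_smul c := by
    refine uniformContinuous_of_tendsto_zero (f := (c • LinearMap.id : H.U →ₗ[ℂ] H.U)) ?_
    intro s hs
    obtain ⟨n, hn⟩ := H.mem_nhds_zero.1 hs
    exact H.mem_nhds_zero.2 ⟨n, fun x hx => hn ((H.NLtot n).smul_mem c hx)⟩


/-! ### The completed universal enveloping algebra -/

/-- The completion of `U` for the topology given by the left ideals `U · U_{≤ -n}`. -/
abbrev Compl : Type u := UniformSpace.Completion H.U

/-- The canonical map from `U` to its completion. -/
def toCompl : H.U →ₗ[ℂ] H.Compl where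
  toFun x := (x : UniformSpace.Completion H.U)
  map_add' x y := UniformSpace.Completion.coe_add x y
  map_smul' r x := UniformSpace.Completion.coe_smul r x

theorem toCompl_mul (x y : H.U) : H.toCompl (x * y) = H.toCompl x * H.toCompl y :=
  UniformSpace.Completion.coe_mul x y

theorem toCompl_one : H.toCompl 1 = 1 := rfl

/-- The closure in the completion of the image of a subspace of `U`. -/
def clos (S : Submodule ℂ H.U) : Submodule ℂ H.Compl := (S.map H.toCompl).topologicalClosure

/-- The graded completion `⨁ p, Û_p`, where `Û_p`, the inverse limit of the quotients
`U_p / ∑_{j ≤ -n} U_{p-j} U_j`, is the closure of the image of `U_p`. -/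
def Uhat : Subalgebra ℂ H.Compl := Algebra.adjoin ℂ (⋃ p, (H.clos (H.Uh p) : Set H.Compl))

/-- The element `a_[n]` of the completion. -/
def cMode (n : ℤ) : V →ₗ[ℂ] H.Compl := H.toCompl ∘ₗ H.uMode n

/-- The relators of the Jacobi identity. -/
def jacobiRelators : Set H.Uhat :=
  {r | ∃ (a b : V) (l m n : ℤ) (s : H.Compl),
    HasSum (fun i : ℕ => ((-1 : ℤ) ^ i * Ring.choose l i) •
      (H.cMode (m + l - i) a * H.cMode (n + i) b -
        (l.negOnePow : ℤ) • (H.cMode (n + l - i) b * H.cMode (m + i) a))) s ∧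
    (r : H.Compl) = s - ∑ᶠ i : ℕ, Ring.choose m i • H.cMode (m + n - i) (H.Y a (l + i) b)}

/-- The ideal of the graded completion generated by the Jacobi relators. -/
def jacobiIdeal : TwoSidedIdeal H.Uhat := TwoSidedIdeal.span H.jacobiRelators

/-- The degreewise closure of the ideal generated by the Jacobi relators. -/
def jacobiClosure : TwoSidedIdeal H.Uhat :=
  TwoSidedIdeal.span {x | ∃ p, (x : H.Compl) ∈
    closure {y : H.Compl | y ∈ H.clos (H.Uh p) ∧ ∃ z ∈ H.jacobiIdeal, (z : H.Compl) = y}}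

/-- The universal enveloping algebra `𝒰` of the vertex operator algebra. -/
def Env : Type u := H.jacobiClosure.ringCon.Quotient

instance : Ring H.Env := inferInstanceAs (Ring H.jacobiClosure.ringCon.Quotient)
instance : Algebra ℂ H.Env := inferInstanceAs (Algebra ℂ H.jacobiClosure.ringCon.Quotient)

/-- The canonical map from the graded completion to `𝒰`. -/
def toEnv : H.Uhat →ₐ[ℂ] H.Env := RingCon.mkₐ ℂ H.jacobiClosure.ringCon

/-- The image in `𝒰` of the closure of a subspace of `U`. -/
def bar (S : Submodule ℂ H.U) : Submodule ℂ H.Env :=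
  ((H.clos S).comap H.Uhat.val.toLinearMap).map H.toEnv.toLinearMap

theorem clos_mono {S T : Submodule ℂ H.U} (h : S ≤ T) : H.clos S ≤ H.clos T :=
  Submodule.topologicalClosure_mono (Submodule.map_mono h)

theorem bar_mono {S T : Submodule ℂ H.U} (h : S ≤ T) : H.bar S ≤ H.bar T :=
  Submodule.map_mono (Submodule.comap_mono (H.clos_mono h))

theorem mul_mem_clos {S T : Submodule ℂ H.U} {x y : H.Compl} (hx : x ∈ H.clos S)
    (hy : y ∈ H.clos T) : x * y ∈ H.clos (S * T) := by
  refine map_mem_closure₂ continuous_mul hx hy ?_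
  rintro _ ⟨s, hs, rfl⟩ _ ⟨t, ht, rfl⟩
  exact ⟨s * t, Submodule.mul_mem_mul hs ht, H.toCompl_mul s t⟩

theorem mul_mem_bar {S T : Submodule ℂ H.U} {x y : H.Env} (hx : x ∈ H.bar S)
    (hy : y ∈ H.bar T) : x * y ∈ H.bar (S * T) := by
  obtain ⟨x, hx, rfl⟩ := hx
  obtain ⟨y, hy, rfl⟩ := hy
  exact ⟨x * y, H.mul_mem_clos hx hy, map_mul H.toEnv x y⟩

theorem one_mem_bar : (1 : H.Env) ∈ H.bar (H.Uh 0) :=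
  ⟨1, subset_closure ⟨1, H.one_mem_Uh, H.toCompl_one⟩, map_one H.toEnv⟩

/-- The degree `p` part `𝒰_p` of `𝒰`. -/
def deg (p : ℤ) : Submodule ℂ H.Env := H.bar (H.Uh p)

/-- The degree `p` part `N_L^n 𝒰_p` of the left neighbourhood `N_L^n 𝒰` of zero. -/
def envNL (n p : ℤ) : Submodule ℂ H.Env := H.bar (H.NL n p)

/-- The degree `p` part `N_R^n 𝒰_p` of the right neighbourhood `N_R^n 𝒰` of zero. -/
def envNR (n p : ℤ) : Submodule ℂ H.Env := H.bar (H.NR n p)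

theorem Uh_mul_NL (q n p : ℤ) : H.Uh q * H.NL n p ≤ H.NL n (q + p) := by
  simp only [NL, Submodule.mul_iSup]
  refine iSup₂_mono fun j hj => ?_
  rw [← mul_assoc, add_sub_assoc]
  exact mul_le_mul' (H.Uh_mul_Uh _ _) le_rfl

theorem NL_mul_Uh (n p q : ℤ) : H.NL n p * H.Uh q ≤ H.NL (n - q) (p + q) := by
  simp only [NL, Submodule.iSup_mul]
  refine iSup₂_le fun j hj => ?_
  refine le_iSup₂_of_le (j + q) (by omega) ?_
  rw [mul_assoc, show p + q - (j + q) = p - j by ring]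
  exact mul_le_mul' le_rfl (H.Uh_mul_Uh _ _)

theorem NR_eq_NL (n p : ℤ) : H.NR n p = H.NL (n - p) p := by
  apply le_antisymm
  · refine iSup₂_le fun i hi => le_iSup₂_of_le (p - i) (by omega) ?_
    rw [sub_sub_cancel]
  · refine iSup₂_le fun j hj => le_iSup₂_of_le (p - j) (by omega) ?_
    rw [sub_sub_cancel]

theorem NL_le_Uh (n p : ℤ) : H.NL n p ≤ H.Uh p :=
  iSup₂_le fun j _ => (H.Uh_mul_Uh _ _).trans (by rw [sub_add_cancel])

theorem mul_mem_deg {p q : ℤ} {x y : H.Env} (hx : x ∈ H.deg p) (hy : y ∈ H.deg q) :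
    x * y ∈ H.deg (p + q) :=
  H.bar_mono (H.Uh_mul_Uh p q) (H.mul_mem_bar hx hy)

theorem mul_mem_envNL {q n p : ℤ} {x y : H.Env} (hx : x ∈ H.deg q) (hy : y ∈ H.envNL n p) :
    x * y ∈ H.envNL n (q + p) :=
  H.bar_mono (H.Uh_mul_NL q n p) (H.mul_mem_bar hx hy)

theorem envNL_mul_mem {n p q : ℤ} {x y : H.Env} (hx : x ∈ H.envNL n p) (hy : y ∈ H.deg q) :
    x * y ∈ H.envNL (n - q) (p + q) :=
  H.bar_mono (H.NL_mul_Uh n p q) (H.mul_mem_bar hx hy)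

theorem envNR_eq (n p : ℤ) : H.envNR n p = H.envNL (n - p) p := by
  rw [envNR, envNL, NR_eq_NL]

theorem envNL_le (n p : ℤ) : H.envNL n p ≤ H.deg p := H.bar_mono (H.NL_le_Uh n p)

theorem cMode_mem (n : ℤ) (a : V) : H.cMode n a ∈ H.Uhat := by
  obtain ⟨s, hs⟩ := H.sum_proj a
  rw [hs, map_sum]
  exact sum_mem fun h _ => Algebra.subset_adjoin (Set.mem_iUnion.2
    ⟨_, subset_closure ⟨_, H.uMode_mem_Uh (H.proj_mem h a) n, rfl⟩⟩)

/-- The element `a_[n]` of `𝒰`. -/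
def envMode (n : ℤ) : V →ₗ[ℂ] H.Env where
  toFun a := H.toEnv ⟨H.cMode n a, H.cMode_mem n a⟩
  map_add' a b := by
    rw [← map_add]
    exact congrArg H.toEnv (Subtype.ext (map_add _ a b))
  map_smul' r a := by
    rw [RingHom.id_apply, ← map_smul]
    exact congrArg H.toEnv (Subtype.ext (map_smul _ r a))

theorem envMode_mem {k : ℕ} {a : V} (ha : a ∈ H.gr k) (n : ℤ) :
    H.envMode n a ∈ H.deg (k - n - 1) :=
  ⟨_, subset_closure ⟨_, H.uMode_mem_Uh ha n, rfl⟩, rfl⟩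


end Enveloping

/-! ### Higher level Zhu algebras -/

section Zhu

variable {V : Type u} [AddCommGroup V] [Module ℂ V] (H : VOA V)

/-- The degree zero part `𝒰_0` of `𝒰`, as a subalgebra. -/
def U0 : Subalgebra ℂ H.Env where
  carrier := H.deg 0
  mul_mem' hx hy := by simpa using H.mul_mem_deg hx hy
  add_mem' hx hy := (H.deg 0).add_mem hx hy
  algebraMap_mem' r := by
    rw [Algebra.algebraMap_eq_smul_one]
    exact (H.deg 0).smul_mem r H.one_mem_bar

/-- The two-sided ideal `N^{d+1} 𝒰_0` of `𝒰_0`. -/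
def zhuIdeal (d : ℕ) : TwoSidedIdeal H.U0 :=
  TwoSidedIdeal.mk' {x | (x : H.Env) ∈ H.envNL (d + 1) 0} (H.envNL (d + 1) 0).zero_mem
    (fun hx hy => (H.envNL (d + 1) 0).add_mem hx hy) (fun hx => (H.envNL (d + 1) 0).neg_mem hx)
    (fun {x _} hy => by
      have := H.mul_mem_envNL (q := 0) x.2 hy
      rwa [add_zero] at this)
    (fun {_ y} hx => by
      have := H.envNL_mul_mem (q := 0) hx y.2
      rwa [sub_zero, add_zero] at this)

theorem mem_zhuIdeal {d : ℕ} {x : H.U0} :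
    x ∈ H.zhuIdeal d ↔ (x : H.Env) ∈ H.envNL (d + 1) 0 := by
  rw [zhuIdeal, TwoSidedIdeal.mem_mk']
  rfl

/-- The `d`-th higher level Zhu algebra `A_d = 𝒰_0 / N^{d+1} 𝒰_0`. -/
def Zhu (d : ℕ) : Type u := (H.zhuIdeal d).ringCon.Quotient

instance (d : ℕ) : Ring (H.Zhu d) := inferInstanceAs (Ring (H.zhuIdeal d).ringCon.Quotient)
instance (d : ℕ) : Algebra ℂ (H.Zhu d) :=
  inferInstanceAs (Algebra ℂ (H.zhuIdeal d).ringCon.Quotient)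

/-- The quotient map `𝒰_0 → A_d`. -/
def toZhu (d : ℕ) : H.U0 →ₐ[ℂ] H.Zhu d := RingCon.mkₐ ℂ (H.zhuIdeal d).ringCon

theorem toZhu_eq_zero {d : ℕ} {x : H.U0} (hx : (x : H.Env) ∈ H.envNL (d + 1) 0) :
    H.toZhu d x = 0 :=
  (RingCon.eq _).2 (H.mem_zhuIdeal.2 hx)

theorem NL_anti {m n : ℤ} (h : m ≤ n) (p : ℤ) : H.NL n p ≤ H.NL m p :=
  iSup₂_le fun j hj => le_iSup₂_of_le j (by omega) le_rfl

theorem zhuIdeal_anti {m n : ℕ} (h : m ≤ n) : (H.zhuIdeal n).ringCon ≤ (H.zhuIdeal m).ringCon :=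
  fun {_ _} hxy => H.bar_mono (H.NL_anti (by omega) 0) hxy

/-- The canonical projection `A_n → A_m` for `m ≤ n`. -/
def zhuProj {m n : ℕ} (h : m ≤ n) : H.Zhu n →ₐ[ℂ] H.Zhu m := RingCon.factorₐ ℂ (H.zhuIdeal_anti h)

end Zhu

/-! ### Mode transition algebras -/

section ModeTransition

variable {V : Type u} [AddCommGroup V] [Module ℂ V] (H : VOA V)

/-- The product `𝒰_p × 𝒰_q → 𝒰_{p+q}`. -/
def dmul {p q r : ℤ} (h : p + q = r) (x : H.deg p) (y : H.deg q) : H.deg r :=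
  ⟨x * y, h ▸ H.mul_mem_deg x.2 y.2⟩

/-- The product `𝒰_p × 𝒰_q → 𝒰_0` for `p + q = 0`. -/
def dpair {p q : ℤ} (h : p + q = 0) (x : H.deg p) (y : H.deg q) : H.U0 :=
  ⟨x * y, (H.dmul h x y).2⟩

/-- The right action of `𝒰_0` on `𝒰_p`. -/
def rmul0 {p : ℤ} (x : H.deg p) (v : H.U0) : H.deg p := H.dmul (q := 0) (add_zero p) x ⟨v, v.2⟩

/-- The left action of `𝒰_0` on `𝒰_p`. -/
def lmul0 {p : ℤ} (v : H.U0) (x : H.deg p) : H.deg p := H.dmul (p := 0) (zero_add p) ⟨v, v.2⟩ x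

/-- The linear functions out of
`(𝒰_i / N_L^1 𝒰_i) ⊗_{𝒰_0} A_0 ⊗_{𝒰_0} (𝒰_j / N_R^1 𝒰_j)`, regarded as functions on
`𝒰_i × 𝒰_0 × 𝒰_j`. -/
structure Balanced {i j : ℤ} {M : Type*} [AddCommGroup M] [Module ℂ M]
    (f : H.deg i → H.U0 → H.deg j → M) : Prop where
  add_left : ∀ x y u b, f (x + y) u b = f x u b + f y u b
  add_mid : ∀ a u v b, f a (u + v) b = f a u b + f a v b
  add_right : ∀ a u x y, f a u (x + y) = f a u x + f a u y
  smul_mid : ∀ (r : ℂ) a u b, f a (r • u) b = r • f a u b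
  bal_left : ∀ a v u b, f (H.rmul0 a v) u b = f a (v * u) b
  bal_right : ∀ a u v b, f a (u * v) b = f a u (H.lmul0 v b)
  kill_left : ∀ (a : H.deg i) u b, (a : H.Env) ∈ H.envNL 1 i → f a u b = 0
  kill_mid : ∀ a (u : H.U0) b, (u : H.Env) ∈ H.envNL 1 0 → f a u b = 0
  kill_right : ∀ a u (b : H.deg j), (b : H.Env) ∈ H.envNR 1 j → f a u b = 0

/-- The relations of
`(𝒰_i / N_L^1 𝒰_i) ⊗_{𝒰_0} A_0 ⊗_{𝒰_0} (𝒰_j / N_R^1 𝒰_j)`, as elements of the free vector space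
on `𝒰_i × 𝒰_0 × 𝒰_j`. -/
inductive ModeRel (i j : ℤ) : ((H.deg i × H.U0 × H.deg j) →₀ ℂ) → Prop
  | add_left (x y : H.deg i) (u : H.U0) (b : H.deg j) :
      ModeRel i j (.single (x + y, u, b) 1 - .single (x, u, b) 1 - .single (y, u, b) 1)
  | add_mid (a : H.deg i) (u v : H.U0) (b : H.deg j) :
      ModeRel i j (.single (a, u + v, b) 1 - .single (a, u, b) 1 - .single (a, v, b) 1)
  | add_right (a : H.deg i) (u : H.U0) (x y : H.deg j) :
      ModeRel i j (.single (a, u, x + y) 1 - .single (a, u, x) 1 - .single (a, u, y) 1)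
  | smul_mid (r : ℂ) (a : H.deg i) (u : H.U0) (b : H.deg j) :
      ModeRel i j (.single (a, r • u, b) 1 - .single (a, u, b) r)
  | bal_left (a : H.deg i) (v u : H.U0) (b : H.deg j) :
      ModeRel i j (.single (H.rmul0 a v, u, b) 1 - .single (a, v * u, b) 1)
  | bal_right (a : H.deg i) (u v : H.U0) (b : H.deg j) :
      ModeRel i j (.single (a, u * v, b) 1 - .single (a, u, H.lmul0 v b) 1)
  | kill_left (a : H.deg i) (u : H.U0) (b : H.deg j) :
      (a : H.Env) ∈ H.envNL 1 i → ModeRel i j (.single (a, u, b) 1)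
  | kill_mid (a : H.deg i) (u : H.U0) (b : H.deg j) :
      (u : H.Env) ∈ H.envNL 1 0 → ModeRel i j (.single (a, u, b) 1)
  | kill_right (a : H.deg i) (u : H.U0) (b : H.deg j) :
      (b : H.Env) ∈ H.envNR 1 j → ModeRel i j (.single (a, u, b) 1)

/-- The bigraded piece `𝔄_{i,j}` of the mode transition algebra
`𝔄 = (𝒰 / N_L^1 𝒰) ⊗_{𝒰_0} A_0 ⊗_{𝒰_0} (𝒰 / N_R^1 𝒰)`. -/
abbrev Mode (i j : ℤ) : Type u :=
  ((H.deg i × H.U0 × H.deg j) →₀ ℂ) ⧸ Submodule.span ℂ {r | H.ModeRel i j r}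

/-- The element `a ⊗ u ⊗ b` of `𝔄_{i,j}`. -/
def tmul {i j : ℤ} (a : H.deg i) (u : H.U0) (b : H.deg j) : H.Mode i j :=
  Submodule.Quotient.mk (.single (a, u, b) 1)

theorem balanced_tmul (i j : ℤ) : H.Balanced (H.tmul (i := i) (j := j)) where
  add_left x y u b := by
    rw [← sub_eq_zero, ← sub_sub]
    exact (Submodule.Quotient.mk_eq_zero _).2 (Submodule.subset_span (.add_left x y u b))
  add_mid a u v b := by
    rw [← sub_eq_zero, ← sub_sub]
    exact (Submodule.Quotient.mk_eq_zero _).2 (Submodule.subset_span (.add_mid a u v b))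
  add_right a u x y := by
    rw [← sub_eq_zero, ← sub_sub]
    exact (Submodule.Quotient.mk_eq_zero _).2 (Submodule.subset_span (.add_right a u x y))
  smul_mid r a u b := by
    rw [← sub_eq_zero, tmul, tmul, ← Submodule.Quotient.mk_smul, Finsupp.smul_single, smul_eq_mul,
      mul_one]
    exact (Submodule.Quotient.mk_eq_zero _).2 (Submodule.subset_span (.smul_mid r a u b))
  bal_left a v u b := by
    rw [← sub_eq_zero]
    exact (Submodule.Quotient.mk_eq_zero _).2 (Submodule.subset_span (.bal_left a v u b))
  bal_right a u v b := by
    rw [← sub_eq_zero]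
    exact (Submodule.Quotient.mk_eq_zero _).2 (Submodule.subset_span (.bal_right a u v b))
  kill_left a u b h :=
    (Submodule.Quotient.mk_eq_zero _).2 (Submodule.subset_span (.kill_left a u b h))
  kill_mid a u b h :=
    (Submodule.Quotient.mk_eq_zero _).2 (Submodule.subset_span (.kill_mid a u b h))
  kill_right a u b h :=
    (Submodule.Quotient.mk_eq_zero _).2 (Submodule.subset_span (.kill_right a u b h))

variable {H} in
/-- The linear map on `𝔄_{i,j}` given by a balanced function. -/
def lift {i j : ℤ} {M : Type*} [AddCommGroup M] [Module ℂ M] {f : H.deg i → H.U0 → H.deg j → M}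
    (hf : H.Balanced f) : H.Mode i j →ₗ[ℂ] M :=
  Submodule.liftQ _ (Finsupp.linearCombination ℂ fun x => f x.1 x.2.1 x.2.2) (by
    rw [Submodule.span_le]
    rintro _ (⟨x, y, u, b⟩ | ⟨a, u, v, b⟩ | ⟨a, u, x, y⟩ | ⟨r, a, u, b⟩ | ⟨a, v, u, b⟩ |
      ⟨a, u, v, b⟩ | ⟨a, u, b, h⟩ | ⟨a, u, b, h⟩ | ⟨a, u, b, h⟩)
    · simp [hf.add_left]
    · simp [hf.add_mid]
    · simp [hf.add_right]
    · simp [hf.smul_mid]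
    · simp [hf.bal_left]
    · simp [hf.bal_right]
    · simp [hf.kill_left a u b h]
    · simp [hf.kill_mid a u b h]
    · simp [hf.kill_right a u b h])

variable {H} in
theorem lift_tmul {i j : ℤ} {M : Type*} [AddCommGroup M] [Module ℂ M]
    {f : H.deg i → H.U0 → H.deg j → M} (hf : H.Balanced f) (a : H.deg i) (u : H.U0)
    (b : H.deg j) : lift hf (H.tmul a u b) = f a u b := by
  change Finsupp.linearCombination ℂ _ (Finsupp.single _ _) = _
  simp

theorem mode_ext {i j : ℤ} {M : Type*} [AddCommGroup M] [Module ℂ M]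
    {F G : H.Mode i j →ₗ[ℂ] M} (h : ∀ a u b, F (H.tmul a u b) = G (H.tmul a u b)) : F = G := by
  apply Submodule.linearMap_qext
  apply Finsupp.lhom_ext'
  rintro ⟨a, u, b⟩
  apply LinearMap.ext_ring
  exact h a u b

/-- The `d`-th mode transition algebra `𝔄_d = 𝔄_{d,-d}`. -/
abbrev ModeAlg (d : ℕ) : Type u := H.Mode d (-d)


variable {H}

theorem mul_mem_envNL0 {x y : H.Env} (hx : x ∈ H.deg 0) {n p : ℤ} (hy : y ∈ H.envNL n p) :
    x * y ∈ H.envNL n p := by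
  have := H.mul_mem_envNL hx hy
  rwa [zero_add] at this

theorem envNL0_mul_mem {x y : H.Env} {n p : ℤ} (hx : x ∈ H.envNL n p) (hy : y ∈ H.deg 0) :
    x * y ∈ H.envNL n p := by
  have := H.envNL_mul_mem hx hy
  rwa [sub_zero, add_zero] at this

theorem mul_mem_envNL_of_eq {q n p r : ℤ} (h : q + p = r) {x y : H.Env} (hx : x ∈ H.deg q)
    (hy : y ∈ H.envNL n p) : x * y ∈ H.envNL n r := h ▸ H.mul_mem_envNL hx hy

theorem envNR_mul_mem {n p q r : ℤ} (h : p + q = r) {x y : H.Env} (hx : x ∈ H.envNR n p)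
    (hy : y ∈ H.deg q) : x * y ∈ H.envNR n r := by
  rw [envNR_eq] at hx ⊢
  have := H.envNL_mul_mem hx hy
  rwa [h, show n - p - q = n - r by omega] at this

theorem dpair_mem_left {p q : ℤ} (h : p + q = 0) {x : H.deg p} {y : H.deg q}
    (hx : (x : H.Env) ∈ H.envNR 1 p) : (H.dpair h x y : H.Env) ∈ H.envNL 1 0 := by
  have := envNR_mul_mem h hx y.2
  rwa [envNR_eq, sub_zero] at this

theorem dpair_mem_right {p q : ℤ} (h : p + q = 0) {x : H.deg p} {y : H.deg q}
    (hy : (y : H.Env) ∈ H.envNL 1 q) : (H.dpair h x y : H.Env) ∈ H.envNL 1 0 :=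
  mul_mem_envNL_of_eq h x.2 hy

variable (H)

theorem balanced_star (d : ℕ) (a' : H.deg d) (u' : H.U0) (b' : H.deg (-d)) :
    H.Balanced fun (a : H.deg d) (u : H.U0) (b : H.deg (-d)) =>
      H.tmul a (u * H.dpair (neg_add_cancel _) b a' * u') b' := by
  have hb := H.balanced_tmul (d : ℤ) (-d)
  refine ⟨fun _ _ _ _ => hb.add_left _ _ _ _, fun a u v b => ?_, fun a u x y => ?_,
    fun r a u b => ?_, fun a v u b => ?_, fun a u v b => ?_, fun a u b h => hb.kill_left _ _ _ h,
    fun a u b h => hb.kill_mid _ _ _ ?_, fun a u b h => hb.kill_mid _ _ _ ?_⟩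
  · rw [add_mul, add_mul, hb.add_mid]
  · rw [← hb.add_mid, ← add_mul, ← mul_add]
    exact congrArg (fun z => H.tmul a (u * z * u') b') (Subtype.ext (add_mul _ _ _))
  · rw [smul_mul_assoc, smul_mul_assoc, hb.smul_mid]
  · rw [hb.bal_left, ← mul_assoc, ← mul_assoc]
  · rw [mul_assoc u v]
    exact congrArg (fun z => H.tmul a (u * z * u') b') (Subtype.ext (mul_assoc _ _ _).symm)
  · exact envNL0_mul_mem (envNL0_mul_mem h (H.dpair _ b a').2) u'.2
  · exact envNL0_mul_mem (mul_mem_envNL0 u.2 (dpair_mem_left _ h)) u'.2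

theorem balanced_star_right (d : ℕ) :
    H.Balanced fun (a' : H.deg d) (u' : H.U0) (b' : H.deg (-d)) =>
      lift (H.balanced_star d a' u' b') := by
  have hb := H.balanced_tmul (d : ℤ) (-d)
  refine ⟨fun x y u' b' => ?_, fun a' u' v b' => ?_, fun a' u' x y => ?_,
    fun r a' u' b' => ?_, fun a' v u' b' => ?_, fun a' u' v b' => ?_, fun a' u' b' h => ?_,
    fun a' u' b' h => ?_, fun a' u' b' h => ?_⟩ <;> refine H.mode_ext fun a u b => ?_ <;>
    simp only [LinearMap.add_apply, LinearMap.smul_apply, LinearMap.zero_apply, lift_tmul]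
  · rw [← hb.add_mid, ← add_mul, ← mul_add]
    exact congrArg (fun z => H.tmul a (u * z * u') b') (Subtype.ext (mul_add _ _ _))
  · rw [mul_add, hb.add_mid]
  · rw [hb.add_right]
  · rw [mul_smul_comm, hb.smul_mid]
  · rw [← mul_assoc, mul_assoc u _ v]
    exact congrArg (fun z => H.tmul a (u * z * u') b') (Subtype.ext (mul_assoc _ _ _).symm)
  · rw [← mul_assoc, hb.bal_right]
  · exact hb.kill_mid _ _ _ (envNL0_mul_mem (mul_mem_envNL0 u.2 (dpair_mem_right _ h)) u'.2)
  · exact hb.kill_mid _ _ _ (mul_mem_envNL0 (u * H.dpair _ b a').2 h)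
  · exact hb.kill_right _ _ _ h

/-- The product `(a ⊗ u ⊗ b) ⋆ (a' ⊗ u' ⊗ b') = a ⊗ u (b a') u' ⊗ b'` of `𝔄_d`. -/
def star (d : ℕ) (x y : H.ModeAlg d) : H.ModeAlg d := lift (H.balanced_star_right d) y x

theorem star_tmul (d : ℕ) (a a' : H.deg d) (u u' : H.U0) (b b' : H.deg (-d)) :
    H.star d (H.tmul a u b) (H.tmul a' u' b') =
      H.tmul a (u * H.dpair (neg_add_cancel _) b a' * u') b' := by
  rw [star, lift_tmul, lift_tmul]

theorem balanced_mu (d : ℕ) :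
    H.Balanced fun (a : H.deg d) (u : H.U0) (b : H.deg (-d)) =>
      H.toZhu d (H.dpair (add_neg_cancel _) (H.rmul0 a u) b) := by
  have key : ∀ x y z : H.U0, (x : H.Env) = y + z → H.toZhu d x = H.toZhu d y + H.toZhu d z :=
    fun x y z h => by rw [← map_add]; exact congrArg _ (Subtype.ext h)
  refine ⟨fun x y u b => key _ _ _ ?_, fun a u v b => key _ _ _ ?_, fun a u x y => key _ _ _ ?_,
    fun r a u b => ?_, fun a v u b => congrArg _ (Subtype.ext ?_),
    fun a u v b => congrArg _ (Subtype.ext ?_), fun a u b h => H.toZhu_eq_zero ?_,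
    fun a u b h => H.toZhu_eq_zero ?_, fun a u b h => H.toZhu_eq_zero ?_⟩
  · simp [dpair, rmul0, dmul, add_mul]
  · simp [dpair, rmul0, dmul, add_mul, mul_add]
  · simp [dpair, rmul0, dmul, mul_add]
  · rw [← map_smul]
    refine congrArg _ (Subtype.ext ?_)
    simp [dpair, rmul0, dmul]
  · simp [dpair, rmul0, dmul, mul_assoc]
  · simp [dpair, rmul0, lmul0, dmul, mul_assoc]
  · have := H.envNL_mul_mem (envNL0_mul_mem h u.2) b.2
    rwa [add_neg_cancel, sub_neg_eq_add, add_comm] at this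
  · have := H.envNL_mul_mem (H.mul_mem_envNL a.2 h) b.2
    rwa [add_zero, add_neg_cancel, sub_neg_eq_add, add_comm] at this
  · rw [envNR_eq, sub_neg_eq_add, add_comm] at h
    exact mul_mem_envNL_of_eq (add_neg_cancel _) (H.rmul0 a u).2 h

/-- The map `μ_d : 𝔄_d → A_d`, `a ⊗ u ⊗ b ↦ [a u b]`. -/
def mu (d : ℕ) : H.ModeAlg d →ₗ[ℂ] H.Zhu d := lift (H.balanced_mu d)

theorem balanced_left {p i r : ℤ} (h : p + i = r) (x : H.deg p) (j : ℤ) :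
    H.Balanced fun (a : H.deg i) (u : H.U0) (b : H.deg j) => H.tmul (H.dmul h x a) u b := by
  have hb := H.balanced_tmul r j
  refine ⟨fun a a' u b => ?_, fun _ _ _ _ => hb.add_mid _ _ _ _,
    fun _ _ _ _ => hb.add_right _ _ _ _, fun _ _ _ _ => hb.smul_mid _ _ _ _, fun a v u b => ?_,
    fun _ _ _ _ => hb.bal_right _ _ _ _,
    fun a u b ha => hb.kill_left _ _ _ (mul_mem_envNL_of_eq h x.2 ha),
    fun _ _ _ => hb.kill_mid _ _ _, fun _ _ _ => hb.kill_right _ _ _⟩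
  · rw [← hb.add_left]
    exact congrArg (fun z => H.tmul z u b) (Subtype.ext (mul_add _ _ _))
  · rw [← hb.bal_left]
    exact congrArg (fun z => H.tmul z u b) (Subtype.ext (mul_assoc _ _ _).symm)

theorem balanced_right {p j r : ℤ} (h : j + p = r) (x : H.deg p) (i : ℤ) :
    H.Balanced fun (a : H.deg i) (u : H.U0) (b : H.deg j) => H.tmul a u (H.dmul h b x) := by
  have hb := H.balanced_tmul i r
  refine ⟨fun _ _ _ _ => hb.add_left _ _ _ _, fun _ _ _ _ => hb.add_mid _ _ _ _,
    fun a u b b' => ?_, fun _ _ _ _ => hb.smul_mid _ _ _ _, fun _ _ _ _ => hb.bal_left _ _ _ _,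
    fun a u v b => ?_, fun _ _ _ => hb.kill_left _ _ _, fun _ _ _ => hb.kill_mid _ _ _,
    fun a u b hb' => hb.kill_right _ _ _ (envNR_mul_mem h hb' x.2)⟩
  · rw [← hb.add_right]
    exact congrArg (fun z => H.tmul a u z) (Subtype.ext (add_mul _ _ _))
  · rw [hb.bal_right]
    exact congrArg (fun z => H.tmul a u z) (Subtype.ext (mul_assoc _ _ _).symm)

/-- The mode transition algebra `𝔄 = ⨁ 𝔄_{i,j}`. -/
abbrev ModeTotal : Type u := DirectSum (ℤ × ℤ) fun ij => H.Mode ij.1 ij.2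

/-- The element `1 = 1 ⊗ 1 ⊗ 1` of `𝔄_0`, regarded as an element of `𝔄`. -/
def modeOne : H.ModeTotal :=
  DirectSum.lof ℂ (ℤ × ℤ) (fun ij => H.Mode ij.1 ij.2) (0, 0)
    (H.tmul ⟨1, H.one_mem_bar⟩ 1 ⟨1, H.one_mem_bar⟩)

/-- The homogeneous element `a_[n]` of `𝒰`, where `a` is replaced by its component of conformal
weight `h`. -/
def envModeProj (h : ℕ) (n : ℤ) (a : V) : H.deg (h - n - 1) :=
  ⟨H.envMode n (H.proj h a), H.envMode_mem (H.proj_mem h a) n⟩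

/-- Left multiplication by `a_[n]` on `𝔄`. -/
def leftMode (n : ℤ) (a : V) (x : H.ModeTotal) : H.ModeTotal :=
  ∑ᶠ h : ℕ, DirectSum.toModule ℂ (ℤ × ℤ) H.ModeTotal
    (fun ij => DirectSum.lof ℂ (ℤ × ℤ) (fun ij => H.Mode ij.1 ij.2) (h - n - 1 + ij.1, ij.2) ∘ₗ
      lift (H.balanced_left rfl (H.envModeProj h n a) ij.2)) x

/-- Right multiplication by `a_[n]` on `𝔄`. -/
def rightMode (n : ℤ) (a : V) (x : H.ModeTotal) : H.ModeTotal :=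
  ∑ᶠ h : ℕ, DirectSum.toModule ℂ (ℤ × ℤ) H.ModeTotal
    (fun ij => DirectSum.lof ℂ (ℤ × ℤ) (fun ij => H.Mode ij.1 ij.2) (ij.1, ij.2 + (h - n - 1)) ∘ₗ
      lift (H.balanced_right rfl (H.envModeProj h n a) ij.1)) x

end ModeTransition

/-! ### Modules -/

/-- An admissible module `W` over a vertex operator algebra; `act a m` is the mode `a_(m)`. -/
structure Mod {V : Type u} [AddCommGroup V] [Module ℂ V] (H : VOA V) (W : Type u) [AddCommGroup W]
    [Module ℂ W] where
  act : V →ₗ[ℂ] (ℤ → Module.End ℂ W)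
  field : ∀ a w, ∃ N : ℤ, ∀ m, N ≤ m → act a m w = 0
  vac_mode : ∀ m, act H.vac m = if m = -1 then 1 else 0
  jacobi : ∀ (a b : V) (l m n : ℤ) (w : W),
    ∑ᶠ i : ℕ, ((-1 : ℤ) ^ i * Ring.choose l i) •
      (act a (m + l - i) (act b (n + i) w) -
        (l.negOnePow : ℤ) • act b (n + l - i) (act a (m + i) w)) =
    ∑ᶠ i : ℕ, Ring.choose m i • act (H.Y a (l + i) b) (m + n - i) w
  virasoro : ∀ p q : ℤ, ⁅act H.conf (p + 1), act H.conf (q + 1)⁆ =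
    ((p : ℂ) - q) • act H.conf (p + q + 1) +
      (if p + q = 0 then H.charge / 12 * ((p : ℂ) ^ 3 - p) else 0) • (1 : Module.End ℂ W)
  translation : ∀ a m, act (H.Y H.conf 0 a) m = -(m : ℂ) • act a (m - 1)
  exists_grading : ∃ grW : ℕ → Submodule ℂ W, DirectSum.IsInternal grW ∧
    ∀ (k : ℕ), ∀ a ∈ H.gr k, ∀ (m : ℤ) (n : ℕ), ∀ w ∈ grW n,
      act a m w ∈ ⨆ (p : ℕ) (_ : (p : ℤ) = n + k - m - 1), grW p

end VOA

/-! ### Nodal curves and their smoothings -/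

/-- The field `ℂ((t))` of formal Laurent series. -/
def Lau : Type := LaurentSeries ℂ

instance : Field Lau := inferInstanceAs (Field (LaurentSeries ℂ))

instance : Algebra ℂ Lau := HahnSeries.instAlgebra (Γ := ℤ) (R := ℂ) (A := ℂ)

/-- The coefficient of `t^r`. -/
def Lau.coeff (r : ℤ) : Lau →ₗ[ℂ] ℂ where
  toFun f := HahnSeries.coeff f r
  map_add' _ _ := rfl
  map_smul' _ _ := rfl

/-- The divided derivative `(1 / k!) (d/dt)^k`. -/
def Lau.hasse (k : ℕ) (f : Lau) : Lau := LaurentSeries.hasseDeriv ℂ k f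

/-- The special points of the normalization of a nodal curve: `n` marked points, `m` further smooth
points, and the two preimages `Q_+`, `Q_-` of the node. -/
inductive Puncture (n m : ℕ) : Type
  | marked (i : Fin n)
  | extra (j : Fin m)
  | plus
  | minus

/-- The operator `∑_{i ≥ 1} κ_i z^(i+1) d/dz` on power series in `z`, given by their coefficients. -/
def vectorField (κ : ℕ → Lau) (F : ℕ → Lau) (k : ℕ) : Lau :=
  ∑ m ∈ Finset.range k, (m : ℂ) • (κ (k - m) * F m)

/-- A connected projective curve `C₀` over `ℂ` with one node `Q`, otherwise smooth, with `n` distinct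
smooth marked points with affine complement and with formal coordinates at the marked points and at
the two preimages `Q_+`, `Q_-` of `Q` in the normalization. The curve is given by the coordinate
ring `A` of the complement of the node, of the marked points and of finitely many further smooth
points, chosen so that there is a global coordinate `s` on this complement, and by the expansions of
the elements of `A` in formal coordinates at all the removed points of the normalization. -/
structure NodalCurve (n : ℕ) where
  /-- the number of further smooth points that are removed -/
  m : ℕ
  A : Type
  [commRing : CommRing A]
  [algebra : Algebra ℂ A]
  smooth : Algebra.Smooth ℂ A
  /-- a function whose differential is a free generator of the differentials -/
  s : A
  generates : Submodule.span A {KaehlerDifferential.D ℂ A s} = ⊤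
  free : ∀ a : A, a • KaehlerDifferential.D ℂ A s = 0 → a = 0
  /-- the Laurent expansions in the formal coordinates at the removed points -/
  ε : Puncture n m → A →ₐ[ℂ] Lau
  /-- The first cohomology of the structure sheaf of the compactification by the punctures is
  finite-dimensional: all punctures are distinct, and the formal coordinates have order one. -/
  finite_H1 : Module.Finite ℂ ((Puncture n m → Lau) ⧸
    (LinearMap.range (LinearMap.pi fun x => (ε x).toLinearMap) ⊔
      Submodule.span ℂ {f : Puncture n m → Lau | ∀ x, ∀ r < 0, Lau.coeff r (f x) = 0}))
  /-- The regular functions on `C₀` are the constants: `C₀` is complete and connected. -/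
  constants : ∀ f : A, (∀ x, ∀ r < 0, Lau.coeff r (ε x f) = 0) →
    Lau.coeff 0 (ε .plus f) = Lau.coeff 0 (ε .minus f) → ∃ c : ℂ, f = algebraMap ℂ A c
  /-- Every irreducible component carries a marked point. -/
  affine : ∀ e : A, e * e = e → e ≠ 0 → ∃ i, ε (.marked i) e ≠ 0
  /-- The exponents `κ_0, κ_1, …` of the change of coordinates from the formal coordinate `t` at a
  puncture to the coordinate `s`. -/
  κ : Puncture n m → ℕ → Lau
  /-- `s(t + z) - s(t) = exp(∑_{i ≥ 1} κ_i(t) z^(i+1) d/dz) (κ_0(t) z)` -/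
  κ_spec : ∀ x, ∀ k, 1 ≤ k →
    ∑ j ∈ Finset.range k, (1 / (j.factorial : ℂ)) •
      ((vectorField (κ x))^[j] fun i => if i = 1 then κ x 0 else 0) k =
    (ε x s).hasse k

attribute [instance] NodalCurve.commRing NodalCurve.algebra

namespace VOA

section Smoothing

variable {V : Type u} [AddCommGroup V] [Module ℂ V] (H : VOA V)

/-- The coefficient of `t^r` of an element of `V ⊗ ℂ((t))`. -/
def coeffV (r : ℤ) (x : V ⊗[ℂ] Lau) : V :=
  TensorProduct.rid ℂ V (LinearMap.lTensor V (Lau.coeff r) x)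

/-- `κ^(-L_0)` -/
def scaleOp (κ : Lau) (x : V ⊗[ℂ] Lau) : V ⊗[ℂ] Lau :=
  ∑ᶠ h : ℕ, TensorProduct.map (H.proj h) (LinearMap.mulLeft ℂ (κ⁻¹ ^ h)) x

/-- `∑_{i ≥ 1} κ_i L_i` -/
def sumOp (κ : ℕ → Lau) (x : V ⊗[ℂ] Lau) : V ⊗[ℂ] Lau :=
  ∑ᶠ i : ℕ, TensorProduct.map (H.Y H.conf (i + 2)) (LinearMap.mulLeft ℂ (κ (i + 1))) x

/-- The action `R = exp(-∑_{i ≥ 1} κ_i L_i) κ_0^(-L_0)` of a change of coordinates on `V`. -/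
def coordOp (κ : ℕ → Lau) (x : V ⊗[ℂ] Lau) : V ⊗[ℂ] Lau :=
  ∑ᶠ j : ℕ, ((-1) ^ j / (j.factorial : ℂ)) • (H.sumOp κ)^[j] (H.scaleOp (κ 0) x)

/-- The expansion at a puncture, in its formal coordinate `t`, of a section `v ⊗ f ds` of the sheaf
`𝒱 ⊗ ω` on `Spec A`, trivialized by the coordinate `s`; the result `v ⊗ g` stands for
`v ⊗ g dt` in the trivialization by `t`. -/
def expand {n : ℕ} (C : NodalCurve n) (x : Puncture n C.m) (σ : V ⊗[ℂ] C.A) :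
    V ⊗[ℂ] Lau :=
  H.coordOp (C.κ x) (LinearMap.lTensor V (LinearMap.mulLeft ℂ ((C.ε x C.s).hasse 1) ∘ₗ
    (C.ε x).toLinearMap) σ)

/-- The involution `γ(a) = (-1)^(deg a) ∑ i, L_1^i a / i!`. -/
def gam (a : V) : V :=
  ∑ᶠ h : ℕ, ∑ᶠ i : ℕ, ((-1) ^ h / (i.factorial : ℂ)) • ((H.Y H.conf 2) ^ i) (H.proj h a)

/-- The coefficient of `t^r` in the formal sum of the `J_{i-k}(v_i)` over `i ≥ 0`, where
`J_n(a) = a ⊗ t^(deg a - 1 + n)`. -/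
def coeffJ (k : ℕ) (v : ℕ → V) (r : ℤ) : V :=
  ∑ᶠ h : ℕ, if 0 ≤ r + 1 + k - h then H.proj h (v (r + 1 + k - h).toNat) else 0

/-- A section of `𝒱 ⊗ ω` on the complement of the marked points in the smoothing of `C₀` over
`ℂ⟦q⟧` in which `q = s_+ s_-` near the node and which is the trivial deformation away from the node.
It consists of a section `∑ σ_k q^k` over the complement of the node, and of a section
`∑ J_0(g_{i,j}) s_+^i s_-^j` near the node, both of bounded conformal weight, which agree on the
two punctured discs where `s_+` or `s_-` is invertible. -/
structure ChiralSection {n : ℕ} (C : NodalCurve n) where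
  σ : ℕ → V ⊗[ℂ] C.A
  g : ℕ → ℕ → V
  bounded : ∃ N : ℕ, ∀ h, N < h →
    (∀ k, LinearMap.rTensor C.A (H.proj h) (σ k) = 0) ∧ ∀ i j, H.proj h (g i j) = 0
  regular : ∀ k j, ∀ r < 0, coeffV r (H.expand C (.extra j) (σ k)) = 0
  glue_plus : ∀ k r, coeffV r (H.expand C .plus (σ k)) = H.coeffJ k (fun i => g i k) r
  glue_minus : ∀ k r, coeffV r (H.expand C .minus (σ k)) =
    -H.coeffJ k (fun j => H.gam (g k j)) r

/-- The left action of `σ ∈ V ⊗ ℂ((t))` on `𝔄`, where `v ⊗ t^r` acts by `v_[r]`. -/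
def leftAct (σ : V ⊗[ℂ] Lau) (x : H.ModeTotal) : H.ModeTotal :=
  ∑ᶠ r : ℤ, H.leftMode r (coeffV r σ) x

/-- The action of `σ ∈ V ⊗ ℂ((t))` on `𝔄` by right multiplication by `θ(σ)`, where
`θ(a ⊗ t^r) = (-1)^(deg a) ∑ i, (1 / i!) L_1^i a ⊗ t^(2 deg a - r - i - 2)`. -/
def rightThetaAct (σ : V ⊗[ℂ] Lau) (x : H.ModeTotal) : H.ModeTotal :=
  ∑ᶠ r : ℤ, ∑ᶠ h : ℕ, ∑ᶠ i : ℕ, ((-1) ^ h / (i.factorial : ℂ)) •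
    H.rightMode (2 * h - r - i - 2) (((H.Y H.conf 2) ^ i) (H.proj h (coeffV r σ))) x

variable {H}

/-- The action of `σ ∈ V ⊗ ℂ((t))` on a module, where `v ⊗ t^r` acts by `v_(r)`. -/
def Mod.laurentAct {W : Type u} [AddCommGroup W] [Module ℂ W] (M : H.Mod W)
    (σ : V ⊗[ℂ] Lau) (w : W) : W :=
  ∑ᶠ r : ℤ, M.act (coeffV r σ) r w

variable (H)

/-- The action of a section of `𝒱 ⊗ ω` on a pure tensor in the tensor product `W^•` of the modules
attached to the marked points. -/
def actTensor {n : ℕ} (C : NodalCurve n) (W : Fin n → Type u) [∀ i, AddCommGroup (W i)]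
    [∀ i, Module ℂ (W i)] (M : ∀ i, H.Mod (W i)) (σ : V ⊗[ℂ] C.A) (w : ∀ i, W i) :
    PiTensorProduct ℂ W :=
  ∑ i, PiTensorProduct.tprod ℂ
    (Function.update w i ((M i).laurentAct (H.expand C (.marked i) σ) (w i)))

/-- `∑ 𝓘_d q^d` defines a smoothing map for the modules `W^•` over the smoothing of `C`: the constant
term `𝓘_0` is `1`, and `w ↦ w ⊗ 𝓘` is compatible with the actions of the sections of `𝒱 ⊗ ω` over the
complement of the marked points of the smoothing, which act on `W^•` through their expansions at the
marked points, and on `W^• ⊗ 𝔄` through their expansions at the marked points and at `Q_±`. -/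
def IsSmoothingMap {n : ℕ} (C : NodalCurve n) (W : Fin n → Type u) [∀ i, AddCommGroup (W i)]
    [∀ i, Module ℂ (W i)] (M : ∀ i, H.Mod (W i)) (I : ℕ → H.ModeTotal) : Prop :=
  I 0 = H.modeOne ∧
  ∀ (σ : H.ChiralSection C) (w : ∀ i, W i) (d : ℕ),
    ∑ p ∈ Finset.HasAntidiagonal.antidiagonal d, H.actTensor C W M (σ.σ p.1) w ⊗ₜ[ℂ] I p.2 =
      ∑ p ∈ Finset.HasAntidiagonal.antidiagonal d,
        (H.actTensor C W M (σ.σ p.1) w ⊗ₜ[ℂ] I p.2 +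
          PiTensorProduct.tprod ℂ w ⊗ₜ[ℂ] H.leftAct (H.expand C .plus (σ.σ p.1)) (I p.2) +
          PiTensorProduct.tprod ℂ w ⊗ₜ[ℂ] H.rightThetaAct (H.expand C .minus (σ.σ p.1)) (I p.2))

/-- `V` satisfies smoothing: there is a smoothing map for all modules over all smoothing families. -/
def SatisfiesSmoothing : Prop :=
  ∀ (n : ℕ) (C : NodalCurve n) (W : Fin n → Type u) [∀ i, AddCommGroup (W i)]
    [∀ i, Module ℂ (W i)] (M : ∀ i, H.Mod (W i)), ∃ I, H.IsSmoothingMap C W M I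

end Smoothing

end VOA

/-! ### The universal Virasoro vertex operator algebra -/

/-- The relations of the universal enveloping algebra of the Virasoro Lie algebra, with the central
element acting by `c`. -/
inductive VirRel (c : ℂ) : FreeAlgebra ℂ ℤ → FreeAlgebra ℂ ℤ → Prop
  | comm (m n : ℤ) : VirRel c
      (FreeAlgebra.ι ℂ m * FreeAlgebra.ι ℂ n - FreeAlgebra.ι ℂ n * FreeAlgebra.ι ℂ m)
      (((m : ℂ) - n) • FreeAlgebra.ι ℂ (m + n) +
        (if m + n = 0 then c / 12 * ((m : ℂ) ^ 3 - m) else 0) • 1)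

/-- The quotient of the universal enveloping algebra of the Virasoro Lie algebra in which the central
element is `c`. -/
abbrev VirAlg (c : ℂ) : Type := RingQuot (VirRel c)

/-- The element `L_n`. -/
def virL (c : ℂ) (n : ℤ) : VirAlg c := RingQuot.mkAlgHom ℂ (VirRel c) (FreeAlgebra.ι ℂ n)

/-- The left ideal generated by the `L_n` with `n ≥ -1`. -/
def virIdeal (c : ℂ) : Submodule (VirAlg c) (VirAlg c) :=
  Submodule.span (VirAlg c) {x | ∃ n : ℤ, -1 ≤ n ∧ x = virL c n}

/-- The quotient of the Verma module `M_{c,0}` by the submodule generated by `L_{-1} 1`. -/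
abbrev Vir (c : ℂ) : Type := VirAlg c ⧸ virIdeal c

/-- The defining property of the vertex operator algebra structure of `Vir_c`: it has central charge
`c`, vacuum vector `1` and conformal vector `L_{-2} 1`, whose modes are the `L_n`. -/
structure VOA.IsVirasoro {c : ℂ} (H : VOA (Vir c)) : Prop where
  charge_eq : H.charge = c
  vac_eq : H.vac = Submodule.Quotient.mk 1
  conf_eq : H.conf = virL c (-2) • (Submodule.Quotient.mk 1 : Vir c)
  mode_eq : ∀ (n : ℤ) (x : Vir c), H.Y H.conf (n + 1) x = virL c n • x

end

/-! Existence. Let `L_n` be operators satisfying the Virasoro relations such that every vector is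
killed by `L_n` for large `n`. They form a field `L(z)`. The operators `C ↦ L_(n+1) C`, the products
of fields with `L(z)`, again satisfy the Virasoro relations on the space of all fields, because
products of fields obey the same commutator formula as modes (`nprod_nprod`). The identity field is
killed by the products with `n ≥ -1`, so `Vir c` maps to the space of fields. Dong's lemma
(`Local.nprod`) makes the image mutually local, locality gives the Jacobi identity
(`LocalAt.jacobi`), and applying all this to `Vir c` itself gives the vertex operator algebra. The
structure is unique: a field local to `L(z)` that kills the vacuum is zero. Hence everything proved
for the constructed operators holds for an arbitrary `H` with `H.IsVirasoro`, and every highest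
weight module carries an action of `𝒰`.

Upper bound. Modulo `N_L^N`, every element of `𝒰_p` is a finite combination of products (monomial in
the `L_n`, `n < 0`) · `g(L_0)` · (monomial in the `L_n`, `n > 0`, of total degree `> -N`); see
`mem_span_tri`. In degrees `1`, `0`, `-1` this leaves `L_{-1} g(L_0)`, `g(L_0)` and `g(L_0) L_1`. So
`𝔄_1` is spanned by the elements `L_{-1} ⊗ g(L_0) ⊗ L_1`, and since `L_1 L_{-1} = L_{-1} L_1 + 2
L_0` reduces to `2 L_0` in `A_0`, the product becomes `f ⋆ g = 2 t f g`.

Lower bound. `N_L^n` kills all vectors of degree `< n` in a Verma module. The element `L_{-1} g(L_0)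
L_1` sends `L_{-1} v` to `2 h g(h) L_{-1} v` in the Verma module of weight `h`, so if it lies in
`N_L^2` then `g(h) = 0` for all `h ≠ 0`, and `g = 0`. This gives the isomorphism with `ℂ[t]` and the
injectivity of `μ_1` at once. That Verma modules are nonzero for all `c` and `h` is seen on the Fock
space, by the free field realization with background charge. For the image of `μ_1`, an element of
`𝒰_0` is `f(L_0) + L_{-1} g(L_0) L_1` modulo `N_L^2`, and if it lies in `N_L^1` its action on
highest weight vectors forces `f = 0`.

Failure of smoothing. An identity would give `2 t u = 1`. The same equation arises geometrically. On
two projective lines meeting in a point, the section of the smoothing that is `J_0(ω) s_+` near the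
node forces, at first order in `q`, that `L_1 · 𝓘_1 = 1 · L_1` in `𝔄`. Writing the component of
`𝓘_1` in `𝔄_{1,-1}` as `L_{-1} ⊗ g(L_0) ⊗ L_1` and evaluating on Verma modules gives `2 t g = 1`,
which fails at `t = 0`. -/

noncomputable section

namespace VOA

/-! ### Alternating binomial sums -/

section BinomialSum

variable {E E' : Type*} [AddCommGroup E] [AddCommGroup E']

/-- A sequence which vanishes from some point on. -/
def EvZero (F : ℕ → E) : Prop := ∃ N, ∀ i, N ≤ i → F i = 0

/-- A double sequence with finite support. -/
def EvZero₂ (F : ℕ → ℕ → E) : Prop := ∃ N, ∀ i j, N ≤ i ∨ N ≤ j → F i j = 0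

/-- The alternating binomial sum `∑ i, (-1)^i (l choose i) F i`. -/
def bsum (l : ℤ) (F : ℕ → E) : E := ∑ᶠ i : ℕ, ((-1 : ℤ) ^ i * Ring.choose l i) • F i

theorem finsum_eq_sum_range {F : ℕ → E} {N : ℕ} (h : ∀ i, N ≤ i → F i = 0) :
    ∑ᶠ i, F i = ∑ i ∈ Finset.range N, F i := by
  refine finsum_eq_finsetSum_of_support_subset _ fun i hi => ?_
  by_contra hc
  exact hi (h i (by simpa using hc))

theorem bsum_eq_sum {F : ℕ → E} {N : ℕ} (h : ∀ i, N ≤ i → F i = 0) (l : ℤ) :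
    bsum l F = ∑ i ∈ Finset.range N, ((-1 : ℤ) ^ i * Ring.choose l i) • F i :=
  finsum_eq_sum_range fun i hi => by rw [h i hi, smul_zero]

theorem EvZero.succ {F : ℕ → E} (h : EvZero F) : EvZero fun i => F (i + 1) := by
  obtain ⟨N, hN⟩ := h
  exact ⟨N, fun i hi => hN _ (by omega)⟩

theorem EvZero.add {F G : ℕ → E} (hF : EvZero F) (hG : EvZero G) : EvZero fun i => F i + G i := by
  obtain ⟨N, hN⟩ := hF
  obtain ⟨K, hK⟩ := hG
  exact ⟨max N K, fun i hi => by
    beta_reduce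
    rw [hN i (le_of_max_le_left hi), hK i (le_of_max_le_right hi), add_zero]⟩

theorem EvZero.map {F : ℕ → E} (h : EvZero F) (f : ℕ → E →+ E') : EvZero fun i => f i (F i) := by
  obtain ⟨N, hN⟩ := h
  exact ⟨N, fun i hi => by beta_reduce; rw [hN i hi, map_zero]⟩

theorem EvZero.zsmul {F : ℕ → E} (h : EvZero F) (f : ℕ → ℤ) : EvZero fun i => f i • F i :=
  h.map fun i => zsmulAddGroupHom (f i)

theorem bsum_zero (l : ℤ) : bsum l (fun _ => (0 : E)) = 0 := by
  simp [bsum]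

theorem bsum_congr {F G : ℕ → E} (l : ℤ) (h : ∀ i, F i = G i) : bsum l F = bsum l G := by
  rw [funext h]

theorem bsum_add {F G : ℕ → E} (hF : EvZero F) (hG : EvZero G) (l : ℤ) :
    bsum l (fun i => F i + G i) = bsum l F + bsum l G := by
  obtain ⟨N, hN⟩ := hF
  obtain ⟨K, hK⟩ := hG
  have h1 : ∀ i, max N K ≤ i → F i = 0 := fun i hi => hN i (le_of_max_le_left hi)
  have h2 : ∀ i, max N K ≤ i → G i = 0 := fun i hi => hK i (le_of_max_le_right hi)
  rw [bsum_eq_sum h1, bsum_eq_sum h2,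
    bsum_eq_sum (N := max N K) fun i hi => by rw [h1 i hi, h2 i hi, add_zero],
    ← Finset.sum_add_distrib]
  simp only [smul_add]

theorem map_bsum {F : ℕ → E} (hF : EvZero F) (l : ℤ) (f : E →+ E') :
    f (bsum l F) = bsum l fun i => f (F i) := by
  obtain ⟨N, hN⟩ := hF
  rw [bsum_eq_sum hN, bsum_eq_sum (N := N) fun i hi => by rw [hN i hi, map_zero], map_sum]
  simp only [map_zsmul]

theorem bsum_zsmul {F : ℕ → E} (hF : EvZero F) (l z : ℤ) :
    bsum l (fun i => z • F i) = z • bsum l F :=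
  (map_bsum hF l (zsmulAddGroupHom z)).symm

theorem bsum_neg {F : ℕ → E} (hF : EvZero F) (l : ℤ) :
    bsum l (fun i => - F i) = - bsum l F :=
  (map_bsum hF l (-AddMonoidHom.id E)).symm

theorem bsum_sub {F G : ℕ → E} (hF : EvZero F) (hG : EvZero G) (l : ℤ) :
    bsum l (fun i => F i - G i) = bsum l F - bsum l G := by
  have hG' : EvZero fun i => - G i := hG.map fun _ => -AddMonoidHom.id E
  simp only [sub_eq_add_neg]
  rw [bsum_add hF hG', bsum_neg hG]

theorem bsum_finsetSum {ι : Type*} (s : Finset ι) {F : ι → ℕ → E} (hF : ∀ r ∈ s, EvZero (F r))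
    (l : ℤ) : bsum l (fun i => ∑ r ∈ s, F r i) = ∑ r ∈ s, bsum l (F r) := by
  classical
  induction s using Finset.induction_on with
  | empty => simp [bsum_zero]
  | insert a s ha ih =>
    simp only [Finset.sum_insert ha]
    rw [bsum_add (hF a (Finset.mem_insert_self a s)), ih]
    · exact fun r hr => hF r (Finset.mem_insert_of_mem hr)
    · clear ih ha
      induction s using Finset.induction_on with
      | empty => exact ⟨0, fun _ _ => by simp⟩
      | insert b s hb ih =>
        simp only [Finset.sum_insert hb]
        refine EvZero.add (hF b (by simp)) (ih fun r hr => hF r ?_)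
        simp only [Finset.mem_insert] at hr ⊢
        tauto

theorem bsum_zero_left (F : ℕ → E) : bsum 0 F = F 0 := by
  rw [bsum, finsum_eq_single _ 0]
  · simp
  · intro i hi
    rw [Ring.choose_zero_pos ℤ (Nat.pos_of_ne_zero hi), mul_zero, zero_smul]

/-- Pascal's rule. Applied to modes it says that raising `l` by one is multiplication by `z - w`;
all recursions in `l` below descend from it. -/
theorem bsum_succ {F : ℕ → E} (hF : EvZero F) (l : ℤ) :
    bsum (l + 1) F = bsum l F - bsum l (fun i => F (i + 1)) := by
  obtain ⟨N, hN⟩ := hF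
  rw [bsum_eq_sum (N := N + 1) fun i hi => hN i (by omega),
    bsum_eq_sum (N := N + 1) fun i hi => hN i (by omega),
    bsum_eq_sum (N := N) fun i hi => hN _ (by omega), Finset.sum_range_succ', Finset.sum_range_succ']
  simp only [Ring.choose_zero_right, Ring.choose_succ_succ]
  rw [add_sub_right_comm, ← Finset.sum_sub_distrib]
  congr 1
  refine Finset.sum_congr rfl fun i _ => ?_
  rw [← sub_smul]
  congr 1
  ring

/-- Finite support in both indices jointly is needed: it bounds all inner sums by one common `N`,
after which this is an exchange of finite sums. -/
theorem bsum_comm {F : ℕ → ℕ → E} (hF : EvZero₂ F) (l n : ℤ) :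
    bsum l (fun i => bsum n (fun j => F i j)) = bsum n (fun j => bsum l (fun i => F i j)) := by
  obtain ⟨N, hN⟩ := hF
  have h1 : ∀ i, bsum n (fun j => F i j) = _ := fun i =>
    bsum_eq_sum (N := N) (fun j hj => hN i j (.inr hj)) n
  have h2 : ∀ j, bsum l (fun i => F i j) = _ := fun j =>
    bsum_eq_sum (N := N) (fun i hi => hN i j (.inl hi)) l
  simp only [h1, h2]
  rw [bsum_eq_sum (N := N) fun i hi => Finset.sum_eq_zero fun j _ => by
      rw [hN i j (.inl hi), smul_zero],
    bsum_eq_sum (N := N) fun j hj => Finset.sum_eq_zero fun i _ => by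
      rw [hN i j (.inr hj), smul_zero]]
  simp only [Finset.smul_sum]
  rw [Finset.sum_comm]
  simp only [smul_comm ((-1 : ℤ) ^ _ * Ring.choose l _) ((-1 : ℤ) ^ _ * Ring.choose n _)]

theorem EvZero.evZero₂ {F : ℕ → E} (hF : EvZero F) : EvZero₂ fun i j => F (i + j) := by
  obtain ⟨N, hN⟩ := hF
  exact ⟨N, fun i j hij => hN _ (by omega)⟩

theorem EvZero₂.map {F : ℕ → ℕ → E} (h : EvZero₂ F) (f : ℕ → ℕ → E →+ E') :
    EvZero₂ fun i j => f i j (F i j) := by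
  obtain ⟨N, hN⟩ := h
  exact ⟨N, fun i j hij => by beta_reduce; rw [hN i j hij, map_zero]⟩

theorem EvZero₂.right {F : ℕ → ℕ → E} (h : EvZero₂ F) (i : ℕ) : EvZero (F i) := by
  obtain ⟨N, hN⟩ := h
  exact ⟨N, fun j hj => hN i j (.inr hj)⟩

theorem EvZero₂.bsum {F : ℕ → ℕ → E} (h : EvZero₂ F) (n : ℤ) :
    EvZero (fun i => bsum n (F i)) := by
  obtain ⟨N, hN⟩ := h
  refine ⟨N, fun i hi => ?_⟩
  beta_reduce
  rw [bsum_congr n fun j => hN i j (.inl hi), bsum_zero]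

/-- Vandermonde's identity: multiplying by `(1 - x)^l` and by `(1 - x)^n` is multiplying by `(1 -
x)^(l + n)`. -/
theorem bsum_comp {F : ℕ → E} (hF : EvZero F) (l n : ℤ) :
    bsum l (fun i => bsum n (fun j => F (i + j))) = bsum (l + n) F := by
  obtain ⟨N, hN⟩ := hF
  have h1 : ∀ i, bsum n (fun j => F (i + j)) = _ := fun i =>
    bsum_eq_sum (N := N) (fun j hj => hN (i + j) (by omega)) n
  simp only [h1]
  rw [bsum_eq_sum (N := N) fun i hi => Finset.sum_eq_zero fun j _ => by
      rw [hN _ (by omega), smul_zero], bsum_eq_sum (N := N + N) fun i hi => hN i (by omega)]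
  simp only [Finset.smul_sum, smul_smul]
  rw [← Finset.sum_product']
  have key : ∀ k, ((-1 : ℤ) ^ k * Ring.choose (l + n) k) • F k =
      ∑ p ∈ Finset.HasAntidiagonal.antidiagonal k, ((-1 : ℤ) ^ p.1 * Ring.choose l p.1 *
        ((-1 : ℤ) ^ p.2 * Ring.choose n p.2)) • F (p.1 + p.2) := by
    intro k
    rw [Ring.add_choose_eq k (Commute.all l n), Finset.mul_sum, Finset.sum_smul]
    refine Finset.sum_congr rfl fun p hp => ?_
    rw [Finset.HasAntidiagonal.mem_antidiagonal] at hp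
    subst hp
    congr 1
    ring
  simp only [key]
  rw [Finset.sum_sigma']
  symm
  -- One side runs over a square, the other over antidiagonals. Only terms with `i + j < N` can be
  -- nonzero, and these lie in both.
  refine Finset.sum_bij_ne_zero (fun x _ _ => x.2) ?_ ?_ ?_ ?_
  · rintro ⟨k, i, j⟩ h hne
    simp only [Finset.mem_sigma, Finset.mem_range, Finset.HasAntidiagonal.mem_antidiagonal,
      Finset.mem_product] at h ⊢
    by_contra hc
    exact hne (by simp only; rw [hN _ (by omega), smul_zero])
  · rintro ⟨k, i, j⟩ h _ ⟨k', i', j'⟩ h' _ heq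
    simp only [Finset.mem_sigma, Finset.mem_range, Finset.HasAntidiagonal.mem_antidiagonal] at h h'
    simp only at heq
    cases heq
    obtain rfl : k = k' := by omega
    rfl
  · rintro ⟨i, j⟩ h hne
    simp only [Finset.mem_product, Finset.mem_range] at h
    exact ⟨⟨i + j, i, j⟩, by simp; omega, hne, rfl⟩
  · rintro ⟨k, i, j⟩ _ _
    rfl

theorem choose_mul_choose_sub (l : ℤ) (i r : ℕ) :
    Ring.choose l i * Ring.choose (l - i) r = Ring.choose l r * Ring.choose (l - r) i := by
  have h1 := Ring.choose_smul_choose l (Nat.le_add_right i r)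
  have h2 := Ring.choose_smul_choose l (Nat.le_add_left r i)
  rw [Nat.add_sub_cancel_left] at h1
  rw [Nat.add_sub_cancel] at h2
  rw [← h1, ← h2, Nat.choose_symm_add]

/-- Trinomial revision turns `(l choose i) (l - i choose r)` into `(l choose r) (l - r choose i)`.
With `r = 1` this governs derivatives, with general `r` the commutators of products of fields. -/
theorem bsum_choose_sub {F : ℕ → E} (hF : EvZero F) (l : ℤ) (r : ℕ) :
    bsum l (fun i => Ring.choose (l - i) r • F i) = Ring.choose l r • bsum (l - r) F := by
  rw [← bsum_zsmul hF]
  refine finsum_congr fun i => ?_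
  rw [smul_smul, smul_smul, mul_assoc, mul_assoc, choose_mul_choose_sub,
    mul_comm (Ring.choose l r)]

/-- Here `(l choose i) (i choose r) = (l choose r) (l - r choose i - r)`; reindexing `i` by `r`
produces the sign `(-1)^r`. -/
theorem bsum_choose {F : ℕ → E} (hF : EvZero F) (l : ℤ) (r : ℕ) :
    bsum l (fun i => ((i.choose r : ℕ) : ℤ) • F i) =
      ((-1) ^ r * Ring.choose l r) • bsum (l - r) (fun i => F (i + r)) := by
  obtain ⟨N, hN⟩ := hF
  rw [bsum_eq_sum (N := r + N) fun i hi => by rw [hN i (by omega), smul_zero],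
    bsum_eq_sum (N := N) fun i hi => hN _ (by omega), Finset.sum_range_add,
    Finset.sum_eq_zero fun i hi => by
      rw [Nat.choose_eq_zero_of_lt (Finset.mem_range.1 hi), Nat.cast_zero, zero_smul, smul_zero],
    zero_add, Finset.smul_sum]
  refine Finset.sum_congr rfl fun i _ => ?_
  have h2 := Ring.choose_smul_choose l (Nat.le_add_right r i)
  rw [Nat.add_sub_cancel_left, nsmul_eq_mul] at h2
  rw [smul_smul, smul_smul, add_comm r i, mul_assoc, mul_comm (Ring.choose l (i + r)),
    add_comm i r, h2]
  congr 1
  ring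

theorem finsum_choose_eq_bsum (m : ℤ) (F : ℕ → E) :
    ∑ᶠ i : ℕ, Ring.choose m i • F i = bsum m fun i => ((-1 : ℤ) ^ i) • F i := by
  refine finsum_congr fun i => ?_
  rw [smul_smul, mul_right_comm, ← mul_pow]
  simp

end BinomialSum

/-! ### Fields and their products -/

section Fields

variable {M : Type*} [AddCommGroup M] [Module ℂ M]

variable (M) in
/-- The space of fields on `M`, given by their modes. -/
def Fld : Submodule ℂ (ℤ → Module.End ℂ M) where
  carrier := {A | ∀ v, ∃ N : ℤ, ∀ n, N ≤ n → A n v = 0}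
  add_mem' {A B} hA hB v := by
    obtain ⟨N, hN⟩ := hA v
    obtain ⟨K, hK⟩ := hB v
    exact ⟨max N K, fun n hn => by
      simp [hN n (le_of_max_le_left hn), hK n (le_of_max_le_right hn)]⟩
  zero_mem' v := ⟨0, fun _ _ => rfl⟩
  smul_mem' r A hA v := by
    obtain ⟨N, hN⟩ := hA v
    exact ⟨N, fun n hn => by simp [hN n hn]⟩

theorem Fld.ext' {A B : Fld M} (h : ∀ n v, A.1 n v = B.1 n v) : A = B :=
  Subtype.ext (funext fun n => LinearMap.ext (h n))

/-- A field vanishes on finitely many vectors from some mode on. -/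
theorem Fld.exists_bound (B : Fld M) (w : ℕ → M) (K : ℕ) :
    ∃ N : ℤ, ∀ i < K, ∀ n, N ≤ n → B.1 n (w i) = 0 := by
  induction K with
  | zero => exact ⟨0, fun i hi => by omega⟩
  | succ K ih =>
    obtain ⟨N, hN⟩ := ih
    obtain ⟨N', hN'⟩ := B.2 (w K)
    refine ⟨max N N', fun i hi n hn => ?_⟩
    rcases Nat.lt_succ_iff_lt_or_eq.1 hi with h | rfl
    · exact hN i h n (le_of_max_le_left hn)
    · exact hN' n (le_of_max_le_right hn)

theorem Fld.exists_bound_nat (B : Fld M) (v : M) (n : ℤ) :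
    ∃ N : ℕ, ∀ i : ℕ, N ≤ i → B.1 (n + i) v = 0 := by
  obtain ⟨N, hN⟩ := B.2 v
  exact ⟨(N - n).toNat, fun i hi => hN _ (by omega)⟩

theorem Fld.evZero (B : Fld M) (n : ℤ) (v : M) : EvZero fun i : ℕ => B.1 (n + i) v :=
  Fld.exists_bound_nat B v n

theorem Fld.evZero_left (B : Fld M) (n : ℤ) (v : M) (f : ℕ → Module.End ℂ M) :
    EvZero fun i : ℕ => f i (B.1 (n + i) v) :=
  (Fld.evZero B n v).map fun i => (f i).toAddMonoidHom

/-- The sign `(-1)^l`. -/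
abbrev sg (l : ℤ) : ℤ := (l.negOnePow : ℤ)

theorem sg_succ (l : ℤ) : sg (l + 1) = - sg l := by
  rw [sg, Int.negOnePow_succ, Units.val_neg]

theorem sg_mul_self (l : ℤ) : sg l * sg l = 1 := by
  rw [sg, ← Units.val_mul, Int.units_mul_self, Units.val_one]

theorem sg_add (l n : ℤ) : sg (l + n) = sg l * sg n := by
  rw [sg, Int.negOnePow_add, Units.val_mul]

theorem sg_natCast (n : ℕ) : sg (n : ℤ) = (-1) ^ n := by
  induction n with
  | zero => simp [sg]
  | succ n ih => rw [Nat.cast_succ, sg_succ, ih, pow_succ, mul_neg_one]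

theorem sg_sub_nat (l : ℤ) (n : ℕ) : sg (l - n) = sg l * (-1) ^ n := by
  have := sg_add (l - n) n
  rw [sub_add_cancel, sg_natCast] at this
  rw [this, mul_assoc, ← mul_pow]
  simp

/-- The modes of `(z - w)^l z^m A(z) B(w)`, expanded for `|z| > |w|`. -/
def lprod (A B : Fld M) (l m n : ℤ) : Module.End ℂ M where
  toFun v := bsum l fun i => A.1 (m + l - i) (B.1 (n + i) v)
  map_add' v w := by
    rw [← bsum_add (Fld.evZero_left B _ _ _) (Fld.evZero_left B _ _ _)]
    simp only [map_add]
  map_smul' r v := by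
    rw [RingHom.id_apply]
    refine .trans ?_ (map_bsum (Fld.evZero_left B n v fun i => A.1 (m + l - i)) l
      (DistribSMul.toAddMonoidHom M r)).symm
    simp

theorem lprod_apply (A B : Fld M) (l m n : ℤ) (v : M) :
    lprod A B l m n v = bsum l fun i => A.1 (m + l - i) (B.1 (n + i) v) := rfl

/-- The modes of `(z - w)^l z^m [A(z), B(w)]`, in the sense of the Jacobi identity. -/
def jprod (A B : Fld M) (l m n : ℤ) : Module.End ℂ M :=
  lprod A B l m n - sg l • lprod B A l n m

theorem lprod_succ (A B : Fld M) (l m n : ℤ) :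
    lprod A B (l + 1) m n = lprod A B l (m + 1) n - lprod A B l m (n + 1) := by
  ext v
  simp only [lprod_apply, LinearMap.sub_apply]
  rw [bsum_succ (Fld.evZero_left B n v _)]
  congr 1 <;> refine bsum_congr _ fun i => ?_
  · rw [show m + (l + 1) - i = m + 1 + l - i by ring]
  · rw [Nat.cast_succ, show m + (l + 1) - (i + 1) = m + l - i by ring,
      show n + ((i : ℤ) + 1) = n + 1 + i by ring]

/-- The sign in `jprod` is chosen so that the two expansions of `(z - w)^l` obey the same recursion.
Together with `jprod_zero` this recursion is all that locality, Dong's lemma and the Jacobi identity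
use. -/
theorem jprod_succ (A B : Fld M) (l m n : ℤ) :
    jprod A B (l + 1) m n = jprod A B l (m + 1) n - jprod A B l m (n + 1) := by
  rw [jprod, jprod, jprod, lprod_succ, lprod_succ B A, sg_succ, neg_smul, smul_sub]
  abel

theorem lprod_zero (A B : Fld M) (m n : ℤ) : lprod A B 0 m n = A.1 m * B.1 n := by
  ext v
  rw [lprod_apply, bsum_zero_left]
  simp

theorem jprod_zero (A B : Fld M) (m n : ℤ) :
    jprod A B 0 m n = A.1 m * B.1 n - B.1 n * A.1 m := by
  rw [jprod, lprod_zero, lprod_zero]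
  simp [sg]

theorem jprod_swap (A B : Fld M) (l m n : ℤ) : jprod B A l m n = - sg l • jprod A B l n m := by
  rw [jprod, jprod, smul_sub, smul_smul, neg_mul, sg_mul_self, neg_smul, neg_smul, one_smul]
  abel

theorem lprod_add_left (A A' B : Fld M) (l m n : ℤ) :
    lprod (A + A') B l m n = lprod A B l m n + lprod A' B l m n := by
  ext v
  exact bsum_add (Fld.evZero_left B n v _) (Fld.evZero_left B n v _) l

theorem lprod_add_right (A B B' : Fld M) (l m n : ℤ) :
    lprod A (B + B') l m n = lprod A B l m n + lprod A B' l m n := by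
  ext v
  refine .trans ?_ (bsum_add (Fld.evZero_left B n v _) (Fld.evZero_left B' n v _) l)
  exact bsum_congr l fun i => map_add _ _ _

theorem lprod_smul_left (r : ℂ) (A B : Fld M) (l m n : ℤ) :
    lprod (r • A) B l m n = r • lprod A B l m n := by
  ext v
  exact (map_bsum (Fld.evZero_left B n v fun i => A.1 (m + l - i)) l
      (DistribSMul.toAddMonoidHom M r)).symm

theorem lprod_smul_right (r : ℂ) (A B : Fld M) (l m n : ℤ) :
    lprod A (r • B) l m n = r • lprod A B l m n := by
  ext v
  refine .trans ?_ (map_bsum (Fld.evZero_left B n v fun i => A.1 (m + l - i)) l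
      (DistribSMul.toAddMonoidHom M r)).symm
  exact bsum_congr l fun i => map_smul _ _ _

theorem jprod_add_left (A A' B : Fld M) (l m n : ℤ) :
    jprod (A + A') B l m n = jprod A B l m n + jprod A' B l m n := by
  rw [jprod, lprod_add_left, lprod_add_right, jprod, jprod, smul_add]
  abel

theorem jprod_smul_left (r : ℂ) (A B : Fld M) (l m n : ℤ) :
    jprod (r • A) B l m n = r • jprod A B l m n := by
  rw [jprod, lprod_smul_left, lprod_smul_right, jprod, smul_sub, smul_comm r]

theorem lprod_field (A B : Fld M) (l m : ℤ) : (fun n => lprod A B l m n) ∈ Fld M := by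
  intro v
  obtain ⟨N, hN⟩ := B.2 v
  refine ⟨N, fun n hn => ?_⟩
  rw [lprod_apply, bsum_congr l fun i => by rw [hN (n + i) (by omega), map_zero], bsum_zero]

theorem rprod_field (A B : Fld M) (l m : ℤ) : (fun n => lprod B A l n m) ∈ Fld M := by
  intro v
  obtain ⟨K, hK⟩ := Fld.exists_bound_nat A v m
  obtain ⟨N, hN⟩ := Fld.exists_bound B (fun i => A.1 (m + i) v) K
  -- Only the first `K` vectors `A_(m+i) v` are nonzero, and `N` bounds `B` on all of them; adding
  -- `K` absorbs the `-i` in the index `n + l - i`.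
  refine ⟨N - l + K, fun n hn => ?_⟩
  rw [lprod_apply, bsum_congr l fun i => ?_, bsum_zero]
  rcases lt_or_ge i K with h | h
  · exact hN i h _ (by omega)
  · rw [hK i h, map_zero]

/-- Left multiplication by `A(z)` in the `l`-th product. -/
def lmap (A : Fld M) (l : ℤ) : Fld M →ₗ[ℂ] Fld M where
  toFun B := ⟨fun n => lprod A B l 0 n, lprod_field A B l 0⟩
  map_add' B B' := Subtype.ext (funext fun n => lprod_add_right A B B' l 0 n)
  map_smul' r B := Subtype.ext (funext fun n => lprod_smul_right r A B l 0 n)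

/-- Right multiplication by `A(z)` in the `l`-th product. -/
def rmap (A : Fld M) (l : ℤ) : Fld M →ₗ[ℂ] Fld M where
  toFun B := ⟨fun n => lprod B A l n 0, rprod_field A B l 0⟩
  map_add' B B' := Subtype.ext (funext fun n => lprod_add_left B B' A l n 0)
  map_smul' r B := Subtype.ext (funext fun n => lprod_smul_left r B A l n 0)

/-- The `l`-th product of fields, as an operator in the second field. -/
def nprod (A : Fld M) (l : ℤ) : Fld M →ₗ[ℂ] Fld M := lmap A l - sg l • rmap A l

theorem nprod_val (A B : Fld M) (l n : ℤ) : (nprod A l B).1 n = jprod A B l 0 n := rfl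

theorem lmap_apply (A B : Fld M) (l n : ℤ) (v : M) :
    (lmap A l B).1 n v = bsum l fun i => A.1 (l - i) (B.1 (n + i) v) := by
  change lprod A B l 0 n v = _
  rw [lprod_apply, zero_add]

theorem rmap_apply (A B : Fld M) (l n : ℤ) (v : M) :
    (rmap A l B).1 n v = bsum l fun i => B.1 (n + l - i) (A.1 i v) := by
  change lprod B A l n 0 v = _
  rw [lprod_apply]
  simp only [zero_add]

/-! ### Locality and the Jacobi identity -/

/-- `(z - w)^N [A(z), B(w)] = 0` -/
def LocalAt (A B : Fld M) (N : ℕ) : Prop := ∀ m n, jprod A B N m n = 0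

/-- Mutual locality of two fields. -/
def Local (A B : Fld M) : Prop := ∃ N, LocalAt A B N

theorem LocalAt.of_le {A B : Fld M} {N : ℕ} (h : LocalAt A B N) {l : ℤ} (hl : N ≤ l) (m n : ℤ) :
    jprod A B l m n = 0 := by
  obtain ⟨k, rfl⟩ := Int.le.dest hl
  clear hl
  induction k generalizing m n with
  | zero => simpa using h m n
  | succ k ih => rw [Nat.cast_succ, ← add_assoc, jprod_succ, ih, ih, sub_zero]

theorem Local.symm {A B : Fld M} (h : Local A B) : Local B A := by
  obtain ⟨N, hN⟩ := h
  exact ⟨N, fun m n => by rw [jprod_swap, hN, smul_zero]⟩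

theorem Local.add_left {A A' B : Fld M} (h : Local A B) (h' : Local A' B) : Local (A + A') B := by
  obtain ⟨N, hN⟩ := h
  obtain ⟨K, hK⟩ := h'
  exact ⟨max N K, fun m n => by
    rw [jprod_add_left, hN.of_le (by simp), hK.of_le (by simp), add_zero]⟩

theorem Local.smul_left {A B : Fld M} (r : ℂ) (h : Local A B) : Local (r • A) B := by
  obtain ⟨N, hN⟩ := h
  exact ⟨N, fun m n => by rw [jprod_smul_left, hN, smul_zero]⟩

theorem Local.zero_left (B : Fld M) : Local 0 B :=
  ⟨0, fun m n => by
    rw [Nat.cast_zero, jprod_zero]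
    simp⟩

/-- The Jacobi identity for mutually local fields. -/
theorem LocalAt.jacobi {A B : Fld M} {N : ℕ} (h : LocalAt A B N) (l m n : ℤ) :
    jprod A B l m n = ∑ᶠ i : ℕ, Ring.choose m i • (nprod A (l + i) B).1 (m + n - i) := by
  simp only [nprod_val, finsum_choose_eq_bsum]
  set R : ℤ → ℤ → ℤ → Module.End ℂ M := fun l m n =>
    bsum m fun i => ((-1 : ℤ) ^ i) • jprod A B (l + i) 0 (m + n - i) with hR
  have hev : ∀ l s : ℤ, EvZero fun i : ℕ => ((-1 : ℤ) ^ i) • jprod A B (l + i) 0 (s - i) :=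
    fun l s => ⟨(N - l).toNat, fun i hi => by
      beta_reduce
      rw [h.of_le (by omega), smul_zero]⟩
  have hRs : ∀ l m n, R (l + 1) m n = R l (m + 1) n - R l m (n + 1) := by
    intro l m n
    simp only [hR]
    rw [bsum_succ (hev _ _), ← sub_eq_zero,
      show m + 1 + n = m + (n + 1) by ring, sub_sub_cancel_left, sub_neg_eq_add,
      ← bsum_add ((hev _ _)) ((hev l (m + (n + 1))).succ)]
    convert bsum_zero m using 2
    funext i
    rw [pow_succ, mul_neg_one, neg_smul, Nat.cast_succ, show l + 1 + (i : ℤ) = l + (i + 1) by ring,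
      show m + (n + 1) - ((i : ℤ) + 1) = m + n - i by ring, add_neg_cancel]
  -- The defect of the identity satisfies the recursion of `jprod`, vanishes for `m = 0`, and
  -- vanishes for `l ≥ N` by locality. These three facts determine it.
  set D : ℤ → ℤ → ℤ → Module.End ℂ M := fun l m n => jprod A B l m n - R l m n with hD
  have hDs : ∀ l m n, D (l + 1) m n = D l (m + 1) n - D l m (n + 1) := by
    intro l m n
    simp only [hD, hRs, jprod_succ]
    abel
  have hD0 : ∀ l n, D l 0 n = 0 := by
    intro l n
    simp only [hD, hR]
    rw [bsum_zero_left]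
    simp
  have hDl : ∀ l m n, (N : ℤ) ≤ l → D l m n = 0 := by
    intro l m n hl
    simp only [hD, hR]
    rw [h.of_le hl, bsum_congr m fun i => by rw [h.of_le (by omega), smul_zero], bsum_zero,
      sub_zero]
  have hpos : ∀ k : ℕ, ∀ l n, D l k n = 0 := by
    intro k
    induction k with
    | zero => exact hD0
    | succ k ih =>
      intro l n
      have := hDs l k n
      rw [ih, ih, sub_zero] at this
      rw [Nat.cast_succ, ← this]
  -- For negative `m` the recursion trades the defect at `l` for the defect at `l + 1` with the same
  -- `m`. Repeating it reaches `l ≥ N`, so locality is needed here, whereas `m ≥ 0` follows by plain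
  -- induction.
  have hneg : ∀ k : ℕ, ∀ l n, D l (-k) n = 0 := by
    intro k
    induction k with
    | zero => simpa using hD0
    | succ k ih =>
      have step : ∀ l n, D l (-(k + 1 : ℕ)) n = - D (l + 1) (-(k + 1 : ℕ)) (n - 1) := by
        intro l n
        have := hDs l (-(k + 1 : ℕ)) (n - 1)
        rw [show (-((k + 1 : ℕ) : ℤ)) + 1 = -(k : ℤ) by push_cast; ring, ih, sub_add_cancel] at this
        rw [this]
        simp
      have iter : ∀ s : ℕ, ∀ l n, (N : ℤ) ≤ l + s → D l (-(k + 1 : ℕ)) n = 0 := by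
        intro s
        induction s with
        | zero => exact fun l n hl => hDl _ _ _ (by simpa using hl)
        | succ s ihs =>
          intro l n hl
          rw [step, ihs _ _ (by push_cast at hl ⊢; omega), neg_zero]
      exact fun l n => iter (N - l).toNat l n (by omega)
  refine sub_eq_zero.1 (?_ : D l m n = 0)
  rcases Int.eq_nat_or_neg m with ⟨k, rfl | rfl⟩
  · exact hpos k l n
  · exact hneg k l n

/-- This is the Jacobi identity at `l = 0`, with the sum cut off at `N` by locality. -/
theorem LocalAt.commutator {A B : Fld M} {N : ℕ} (h : LocalAt A B N) (m n : ℤ) :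
    A.1 m * B.1 n - B.1 n * A.1 m =
      ∑ i ∈ Finset.range N, Ring.choose m i • (nprod A i B).1 (m + n - i) := by
  rw [← jprod_zero, h.jacobi, finsum_eq_sum_range (N := N)]
  · simp only [zero_add]
  · intro i hi
    rw [nprod_val, h.of_le (by omega), smul_zero]

end Fields

/-! ### Dong's lemma -/

section Dong

variable {M : Type*} [AddCommGroup M] [Module ℂ M]

variable (M) in
/-- Multiplication by `z - x` on formal distributions in `z`, `w`, `x`. -/
def mulZX : Module.End ℂ (ℤ → ℤ → ℤ → M) where
  toFun g m n p := g (m + 1) n p - g m n (p + 1)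
  map_add' f g := by funext m n p; simp; abel
  map_smul' r f := by funext m n p; simp [smul_sub]

variable (M) in
/-- Multiplication by `w - x` on formal distributions in `z`, `w`, `x`. -/
def mulWX : Module.End ℂ (ℤ → ℤ → ℤ → M) where
  toFun g m n p := g m (n + 1) p - g m n (p + 1)
  map_add' f g := by funext m n p; simp; abel
  map_smul' r f := by funext m n p; simp [smul_sub]

theorem mulZX_apply (g : ℤ → ℤ → ℤ → M) (m n p : ℤ) :
    mulZX M g m n p = g (m + 1) n p - g m n (p + 1) := rfl

theorem mulWX_apply (g : ℤ → ℤ → ℤ → M) (m n p : ℤ) :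
    mulWX M g m n p = g m (n + 1) p - g m n (p + 1) := rfl

theorem commute_mulZX_mulWX : Commute (mulZX M) (mulWX M) := by
  refine LinearMap.ext fun g => ?_
  funext m n p
  simp only [Module.End.mul_apply, mulZX_apply, mulWX_apply]
  abel

/-- Write `D' = D - (D - D')` with commuting summands: each term of the expansion of the power `s +
a` contains `s` factors `D - D'` or `a` factors `D`. -/
theorem pow_sub_apply_eq_zero {E : Type*} [AddCommGroup E] [Module ℂ E] {D D' : Module.End ℂ E}
    (hc : Commute D D') {s a : ℕ} {y : E} (h1 : ((D - D') ^ s) y = 0) (h2 : (D ^ a) y = 0) :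
    (D' ^ (s + a)) y = 0 := by
  have hd : Commute D (D - D') := (Commute.refl _).sub_right hc
  obtain ⟨k, hk⟩ : ∃ k, s + a = k := ⟨_, rfl⟩
  induction k generalizing s a y with
  | zero =>
    obtain rfl : s = 0 := by omega
    obtain rfl : a = 0 := by omega
    simpa using h2
  | succ k ih =>
    rcases s with - | s
    · rw [pow_zero, Module.End.one_apply] at h1
      rw [h1, map_zero]
    rcases a with - | a
    · rw [pow_zero, Module.End.one_apply] at h2
      rw [h2, map_zero]
    have e : D' y = D y - (D - D') y := by simp
    rw [hk, pow_succ, Module.End.mul_apply, e, map_sub]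
    rw [pow_succ, Module.End.mul_apply] at h1 h2
    have i1 : (D' ^ (s + 1 + a)) (D y) = 0 := ih (by
      rw [← Module.End.mul_apply, ← (hd.pow_right _).eq, Module.End.mul_apply, pow_succ,
        Module.End.mul_apply, h1, map_zero]) h2 (by omega)
    have i2 : (D' ^ (s + (a + 1))) ((D - D') y) = 0 := ih h1 (by
      rw [← Module.End.mul_apply, (hd.pow_left _).eq, Module.End.mul_apply, pow_succ,
        Module.End.mul_apply, h2, map_zero]) (by omega)
    rw [show k = s + 1 + a by omega, i1, show s + 1 + a = s + (a + 1) by omega, i2, sub_zero]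

/-- The algebra behind Dong's lemma: `w - x = (z - x) - (z - w)`. The previous lemma, applied to `(w
- x)^r q`, removes the powers of `z - x` at the cost of more powers of `w - x`. -/
theorem mulWX_pow_eq_zero {r s : ℕ} {q : ℤ → ℤ → ℤ → M}
    (h1 : ((mulZX M - mulWX M) ^ s) q = 0) (h2 : (mulZX M ^ r) ((mulWX M ^ r) q) = 0) :
    (mulWX M ^ (s + r + r)) q = 0 := by
  have hd : Commute (mulWX M) (mulZX M - mulWX M) :=
    (commute_mulZX_mulWX (M := M)).symm.sub_right (Commute.refl _)
  rw [pow_add, Module.End.mul_apply]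
  refine pow_sub_apply_eq_zero commute_mulZX_mulWX ?_ h2
  rw [← Module.End.mul_apply, ← (hd.pow_pow r s).eq, Module.End.mul_apply, h1, map_zero]

/-- Infinite sums of shifts of a formal distribution. -/
def shiftSum (k : ℤ) (α β : ℕ → ℤ) (T : ℤ → ℤ → ℤ → M) : ℤ → ℤ → ℤ → M :=
  fun m n p => bsum k fun i => T (m + α i) (n + β i) p

/-- The sums of shifts are finite. -/
def ShiftFinite (α β : ℕ → ℤ) (T : ℤ → ℤ → ℤ → M) : Prop :=
  ∀ m n p, EvZero fun i => T (m + α i) (n + β i) p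

variable {k : ℤ} {α β : ℕ → ℤ} {T : ℤ → ℤ → ℤ → M}

theorem EvZero.sub {E : Type*} [AddCommGroup E] {F G : ℕ → E} (hF : EvZero F) (hG : EvZero G) :
    EvZero fun i => F i - G i := by
  have hG' : EvZero fun i => - G i := hG.map fun _ => -AddMonoidHom.id E
  simpa only [sub_eq_add_neg] using hF.add hG'

theorem ShiftFinite.mulZX (h : ShiftFinite α β T) :
    ShiftFinite α β (mulZX M T) ∧ shiftSum k α β (mulZX M T) = mulZX M (shiftSum k α β T) := by
  have e : ∀ m n p i, VOA.mulZX M T (m + α i) (n + β i) p =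
      T (m + 1 + α i) (n + β i) p - T (m + α i) (n + β i) (p + 1) := by
    intro m n p i
    rw [mulZX_apply, add_right_comm]
  refine ⟨fun m n p => ?_, ?_⟩
  · simp only [e]
    exact (h (m + 1) n p).sub (h m n (p + 1))
  · funext m n p
    simp only [shiftSum, e, mulZX_apply]
    exact bsum_sub (h (m + 1) n p) (h m n (p + 1)) k

theorem ShiftFinite.mulWX (h : ShiftFinite α β T) :
    ShiftFinite α β (mulWX M T) ∧ shiftSum k α β (mulWX M T) = mulWX M (shiftSum k α β T) := by
  have e : ∀ m n p i, VOA.mulWX M T (m + α i) (n + β i) p =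
      T (m + α i) (n + 1 + β i) p - T (m + α i) (n + β i) (p + 1) := by
    intro m n p i
    rw [mulWX_apply, add_right_comm n]
  refine ⟨fun m n p => ?_, ?_⟩
  · simp only [e]
    exact (h m (n + 1) p).sub (h m n (p + 1))
  · funext m n p
    simp only [shiftSum, e, mulWX_apply]
    exact bsum_sub (h m (n + 1) p) (h m n (p + 1)) k

theorem ShiftFinite.mulZX_pow (h : ShiftFinite α β T) (r : ℕ) :
    ShiftFinite α β ((VOA.mulZX M ^ r) T) ∧
      shiftSum k α β ((VOA.mulZX M ^ r) T) = (VOA.mulZX M ^ r) (shiftSum k α β T) := by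
  induction r with
  | zero => exact ⟨h, rfl⟩
  | succ r ih =>
    simp only [pow_succ', Module.End.mul_apply]
    rw [← ih.2]
    exact ih.1.mulZX

theorem ShiftFinite.mulWX_pow (h : ShiftFinite α β T) (r : ℕ) :
    ShiftFinite α β ((VOA.mulWX M ^ r) T) ∧
      shiftSum k α β ((VOA.mulWX M ^ r) T) = (VOA.mulWX M ^ r) (shiftSum k α β T) := by
  induction r with
  | zero => exact ⟨h, rfl⟩
  | succ r ih =>
    simp only [pow_succ', Module.End.mul_apply]
    rw [← ih.2]
    exact ih.1.mulWX

/-- Sums of shifts in `z` and `w` commute with multiplication by `z - x` and `w - x`, so an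
annihilator of `T` annihilates them too. -/
theorem ShiftFinite.annihilate (h : ShiftFinite α β T) {r : ℕ}
    (hT : (VOA.mulZX M ^ r) ((VOA.mulWX M ^ r) T) = 0) :
    (VOA.mulZX M ^ r) ((VOA.mulWX M ^ r) (shiftSum k α β T)) = 0 := by
  rw [← (h.mulWX_pow (k := k) r).2, ← ((h.mulWX_pow (k := k) r).1.mulZX_pow r).2, hT]
  funext m n p
  exact bsum_zero k

theorem annihilate_of_add {T₁ T₂ : ℤ → ℤ → ℤ → M} {r : ℕ} (h1 : (mulWX M ^ r) T₁ = 0)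
    (h2 : (mulZX M ^ r) T₂ = 0) : (mulZX M ^ r) ((mulWX M ^ r) (T₁ + T₂)) = 0 := by
  rw [map_add, h1, zero_add, ← Module.End.mul_apply, (commute_mulZX_mulWX.pow_pow r r).eq,
    Module.End.mul_apply, h2, map_zero]

theorem mulWX_pow_family (f : ℤ → ℤ → ℤ → ℤ → M)
    (hf : ∀ l m n p, f (l + 1) m n p = f l m (n + 1) p - f l m n (p + 1)) (r : ℕ) (l : ℤ) :
    (mulWX M ^ r) (f l) = f (l + r) := by
  induction r with
  | zero => simp
  | succ r ih =>
    rw [pow_succ', Module.End.mul_apply, ih]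
    funext m n p
    rw [mulWX_apply, Nat.cast_succ, ← add_assoc, hf]

theorem mulZX_pow_family (f : ℤ → ℤ → ℤ → ℤ → M)
    (hf : ∀ l m n p, f (l + 1) m n p = f l (m + 1) n p - f l m n (p + 1)) (r : ℕ) (l : ℤ) :
    (mulZX M ^ r) (f l) = f (l + r) := by
  induction r with
  | zero => simp
  | succ r ih =>
    rw [pow_succ', Module.End.mul_apply, ih]
    funext m n p
    rw [mulZX_apply, Nat.cast_succ, ← add_assoc, hf]

/-- Dong's lemma: products of mutually local fields are local. -/
theorem Local.nprod {A B C : Fld M} (hAB : Local A B) (hAC : Local A C) (hBC : Local B C) (k : ℤ) :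
    Local (nprod A k B) C := by
  obtain ⟨N, hN⟩ := hAB
  obtain ⟨r₁, h₁⟩ := hAC
  obtain ⟨r₂, h₂⟩ := hBC
  set r := max r₁ r₂
  set s := (N - k).toNat
  have hAC : ∀ m n, jprod A C r m n = 0 := h₁.of_le (by simp [r])
  have hBC : ∀ m n, jprod B C r m n = 0 := h₂.of_le (by simp [r])
  refine ⟨s + r + r, fun n p => LinearMap.ext fun v => ?_⟩
  -- The modes of `(z - w)^l [[A(z), B(w)], C(x)]`. Multiplication by `z - w` raises `l`, so a high
  -- power of it kills `q k` by the locality of `A` and `B`.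
  set q : ℤ → ℤ → ℤ → ℤ → M := fun l m n p =>
    jprod A B l m n (C.1 p v) - C.1 p (jprod A B l m n v) with hq
  have hqs : ∀ l m n p, q (l + 1) m n p = q l (m + 1) n p - q l m (n + 1) p := by
    intro l m n p
    simp only [hq, jprod_succ, LinearMap.sub_apply, map_sub]
    abel
  have h1 : ((mulZX M - mulWX M) ^ s) (q k) = 0 := by
    have : ∀ s : ℕ, ((mulZX M - mulWX M) ^ s) (q k) = q (k + s) := by
      intro s
      induction s with
      | zero => simp
      | succ s ih =>
        rw [pow_succ', Module.End.mul_apply, ih]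
        funext m n p
        rw [Nat.cast_succ, ← add_assoc, hqs]
        simp only [LinearMap.sub_apply, Pi.sub_apply, mulZX_apply, mulWX_apply]
        abel
    rw [this]
    funext m n p
    simp only [hq]
    rw [hN.of_le (by omega)]
    simp
  have h2 : (mulZX M ^ r) ((mulWX M ^ r) (q k)) = 0 := by
    set T : ℤ → ℤ → ℤ → M := fun a b p =>
      A.1 a (B.1 b (C.1 p v)) - C.1 p (A.1 a (B.1 b v)) with hT
    set T' : ℤ → ℤ → ℤ → M := fun a b p =>
      B.1 b (A.1 a (C.1 p v)) - C.1 p (B.1 b (A.1 a v)) with hT'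
    have fT : ShiftFinite (fun i => k - i) (fun i => i) T := fun m n p =>
      ((Fld.evZero_left B n (C.1 p v) _).sub (Fld.evZero_left B n v fun i => C.1 p * A.1 (m + (k - i))))
    have fT' : ShiftFinite (fun i => i) (fun i => k - i) T' := fun m n p =>
      ((Fld.evZero_left A m (C.1 p v) _).sub (Fld.evZero_left A m v fun i => C.1 p * B.1 (n + (k - i))))
    -- Expanding `(z - w)^k` in its two regions writes `q k` through shifts of `[A B, C]` and of `[B
    -- A, C]`.
    have eq : q k = shiftSum k (fun i => k - i) (fun i => i) T -
        sg k • shiftSum k (fun i => i) (fun i => k - i) T' := by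
      funext m n p
      simp only [hq, jprod, LinearMap.sub_apply, LinearMap.smul_apply, map_sub, map_zsmul,
        Pi.sub_apply, Pi.smul_apply, shiftSum, hT, hT', lprod_apply]
      have e3 := bsum_sub (Fld.evZero_left B n (C.1 p v) fun i => A.1 (m + (k - i)))
        (Fld.evZero_left B n v fun i => C.1 p * A.1 (m + (k - i))) k
      have e4 := bsum_sub (Fld.evZero_left A m (C.1 p v) fun i => B.1 (n + (k - i)))
        (Fld.evZero_left A m v fun i => C.1 p * B.1 (n + (k - i))) k
      have e1 := map_bsum (Fld.evZero_left B n v fun i => A.1 (m + k - i)) k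
        (C.1 p).toAddMonoidHom
      have e2 := map_bsum (Fld.evZero_left A m v fun i => B.1 (n + k - i)) k
        (C.1 p).toAddMonoidHom
      simp only [LinearMap.toAddMonoidHom_coe] at e1 e2
      simp only [Module.End.mul_apply] at e3 e4
      rw [e1, e2, e3, e4]
      simp only [add_sub_assoc, smul_sub]
      abel
    -- Leibniz: `[A B, C] = A [B, C] + [A, C] B`. A power of `w - x` kills the first term and a
    -- power of `z - x` the second.
    have aT : (mulZX M ^ r) ((mulWX M ^ r) T) = 0 := by
      have := annihilate_of_add (r := r) (T₁ := fun a b p => A.1 a (jprod B C 0 b p v))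
        (T₂ := fun a b p => jprod A C 0 a p (B.1 b v)) ?_ ?_
      · convert this using 3
        funext a b p
        simp only [hT, Pi.add_apply, jprod_zero, LinearMap.sub_apply, Module.End.mul_apply, map_sub]
        abel
      · rw [mulWX_pow_family (fun l a b p => A.1 a (jprod B C l b p v)) (fun l m n p => by
          simp only [jprod_succ, LinearMap.sub_apply, map_sub])]
        funext a b p
        rw [zero_add, hBC]
        simp
      · rw [mulZX_pow_family (fun l a b p => jprod A C l a p (B.1 b v)) (fun l m n p => by
          simp only [jprod_succ, LinearMap.sub_apply])]
        funext a b p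
        rw [zero_add, hAC]
        simp
    have aT' : (mulZX M ^ r) ((mulWX M ^ r) T') = 0 := by
      have := annihilate_of_add (r := r) (T₁ := fun a b p => jprod B C 0 b p (A.1 a v))
        (T₂ := fun a b p => B.1 b (jprod A C 0 a p v)) ?_ ?_
      · convert this using 3
        funext a b p
        simp only [hT', Pi.add_apply, jprod_zero, LinearMap.sub_apply, Module.End.mul_apply,
          map_sub]
        abel
      · rw [mulWX_pow_family (fun l a b p => jprod B C l b p (A.1 a v)) (fun l m n p => by
          simp only [jprod_succ, LinearMap.sub_apply])]
        funext a b p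
        rw [zero_add, hBC]
        simp
      · rw [mulZX_pow_family (fun l a b p => B.1 b (jprod A C l a p v)) (fun l m n p => by
          simp only [jprod_succ, LinearMap.sub_apply, map_sub])]
        funext a b p
        rw [zero_add, hAC]
        simp
    rw [eq, map_sub, map_sub, map_zsmul, map_zsmul, fT.annihilate aT, fT'.annihilate aT', smul_zero,
      sub_zero]
  -- The `k`-th product is the slice `m = 0` of `q k`, and multiplication by `w - x` does not change
  -- `m`.
  have h3 : ∀ R : ℕ, ∀ n p, jprod (VOA.nprod A k B) C R n p v = ((mulWX M ^ R) (q k)) 0 n p := by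
    intro R
    induction R with
    | zero =>
      intro n p
      rw [Nat.cast_zero, jprod_zero]
      rfl
    | succ R ih =>
      intro n p
      rw [Nat.cast_succ, jprod_succ, LinearMap.sub_apply, ih, ih, pow_succ', Module.End.mul_apply,
        mulWX_apply]
  rw [h3, mulWX_pow_eq_zero h1 h2]
  rfl

end Dong

/-! ### Commutators of the product operators, derivatives and the identity field -/

section Adjoint

variable {M : Type*} [AddCommGroup M] [Module ℂ M]

theorem Fld.evZero_apply (B : Fld M) (v : M) (f : ℕ → Module.End ℂ M) :
    EvZero fun i : ℕ => f i (B.1 i v) := by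
  simpa using Fld.evZero_left B 0 v f

theorem EvZero.shift {E : Type*} [AddCommGroup E] {F : ℕ → E} (h : EvZero F) (r : ℕ) :
    EvZero fun i => F (i + r) := by
  obtain ⟨N, hN⟩ := h
  exact ⟨N, fun i hi => hN _ (by omega)⟩

/-- Both sides are the same double sum of terms `A C B`. It is finite because `B_j v` is nonzero for
finitely many `j ≥ 0`, and `C` is truncated uniformly on those vectors. -/
theorem lmap_rmap (A B C : Fld M) (l n : ℤ) : lmap A l (rmap B n C) = rmap B n (lmap A l C) := by
  refine Fld.ext' fun p v => ?_
  rw [lmap_apply, rmap_apply]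
  have e1 : ∀ i : ℕ, A.1 (l - i) ((rmap B n C).1 (p + i) v) =
      bsum n fun j => A.1 (l - i) (C.1 (p + i + n - j) (B.1 j v)) := by
    intro i
    rw [rmap_apply]
    exact map_bsum (Fld.evZero_apply B v fun j => C.1 (p + i + n - j)) n (A.1 (l - i)).toAddMonoidHom
  have e2 : ∀ j : ℕ, (lmap A l C).1 (p + n - j) (B.1 j v) =
      bsum l fun i => A.1 (l - i) (C.1 (p + i + n - j) (B.1 j v)) := by
    intro j
    rw [lmap_apply]
    refine bsum_congr l fun i => ?_
    rw [show p + n - j + (i : ℤ) = p + i + n - j by ring]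
  simp only [e1, e2]
  refine bsum_comm ?_ l n
  obtain ⟨K, hK⟩ := Fld.exists_bound_nat B v 0
  obtain ⟨N, hN⟩ := Fld.exists_bound C (fun j => B.1 j v) K
  refine ⟨max K (N - p - n + K).toNat, fun i j hij => ?_⟩
  beta_reduce
  rcases lt_or_ge j K with hj | hj
  · rw [hN j hj _ (by omega), map_zero]
  · have := hK j hj
    rw [zero_add] at this
    rw [this, map_zero, map_zero]

variable {A B : Fld M} {E : ℕ → Fld M} {N : ℕ}

/-- The hypothesis gives the commutator of single modes with coefficient `(l - i choose r)`.
Trinomial revision extracts `(l choose r)`, and Vandermonde merges the sums over `i` and `j` into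
one with exponent `l + n - r`. -/
theorem lmap_lmap (h : ∀ a b, A.1 a * B.1 b - B.1 b * A.1 a =
      ∑ r ∈ Finset.range N, Ring.choose a r • (E r).1 (a + b - r)) (C : Fld M) (l n : ℤ) :
    lmap A l (lmap B n C) - lmap B n (lmap A l C) =
      ∑ r ∈ Finset.range N, Ring.choose l r • lmap (E r) (l + n - r) C := by
  refine Fld.ext' fun p v => ?_
  set F : ℕ → M := fun k => C.1 (p + k) v with hF
  have evF : EvZero F := Fld.evZero C p v
  have e1 : (lmap A l (lmap B n C)).1 p v =
      bsum l fun i => bsum n fun j => A.1 (l - i) (B.1 (n - j) (F (i + j))) := by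
    rw [lmap_apply]
    refine bsum_congr l fun i => ?_
    rw [lmap_apply]
    refine (map_bsum (Fld.evZero_left C (p + i) v fun j => B.1 (n - j)) n
      (A.1 (l - i)).toAddMonoidHom).trans (bsum_congr n fun j => ?_)
    simp only [hF, Nat.cast_add, add_assoc, LinearMap.toAddMonoidHom_coe]
  have e2 : (lmap B n (lmap A l C)).1 p v =
      bsum n fun j => bsum l fun i => B.1 (n - j) (A.1 (l - i) (F (i + j))) := by
    rw [lmap_apply]
    refine bsum_congr n fun j => ?_
    rw [lmap_apply]
    refine (map_bsum (Fld.evZero_left C (p + j) v fun i => A.1 (l - i)) l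
      (B.1 (n - j)).toAddMonoidHom).trans (bsum_congr l fun i => ?_)
    simp only [hF, Nat.cast_add, LinearMap.toAddMonoidHom_coe, add_assoc, add_comm (i : ℤ)]
  have ev2 := evF.evZero₂
  have ev3 : EvZero₂ fun i j => A.1 (l - i) (B.1 (n - j) (F (i + j))) :=
    ev2.map fun i j => (A.1 (l - i) * B.1 (n - j)).toAddMonoidHom
  have ev4 : EvZero₂ fun i j => B.1 (n - j) (A.1 (l - i) (F (i + j))) :=
    ev2.map fun i j => (B.1 (n - j) * A.1 (l - i)).toAddMonoidHom
  have key : ∀ i j : ℕ, A.1 (l - i) (B.1 (n - j) (F (i + j))) -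
      B.1 (n - j) (A.1 (l - i) (F (i + j))) = ∑ r ∈ Finset.range N,
        Ring.choose (l - i) r • (E r).1 (l + n - r - (i + j : ℕ)) (F (i + j)) := by
    intro i j
    have := LinearMap.congr_fun (h (l - i) (n - j)) (F (i + j))
    simp only [LinearMap.sub_apply, Module.End.mul_apply, LinearMap.sum_apply,
      LinearMap.smul_apply] at this
    rw [this]
    refine Finset.sum_congr rfl fun r _ => ?_
    rw [Nat.cast_add, show l - (i : ℤ) + (n - j) - r = l + n - r - (i + j) by ring]
  have evE : ∀ r : ℕ, EvZero fun k : ℕ => (E r).1 (l + n - r - k) (F k) := fun r =>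
    evF.map fun k => ((E r).1 (l + n - r - k)).toAddMonoidHom
  have eR : (∑ r ∈ Finset.range N, Ring.choose l r • lmap (E r) (l + n - r) C).1 p v =
      ∑ r ∈ Finset.range N, Ring.choose l r •
        bsum (l + n - r) fun k => (E r).1 (l + n - r - k) (F k) := by
    simp only [AddSubmonoidClass.coe_finsetSum, Finset.sum_apply, LinearMap.sum_apply]
    refine Finset.sum_congr rfl fun r _ => ?_
    rw [← lmap_apply]
    rfl
  rw [eR]
  change (lmap A l (lmap B n C)).1 p v - (lmap B n (lmap A l C)).1 p v = _
  rw [e1, e2, ← bsum_comm ev4 l n, ← bsum_sub (ev3.bsum n) (ev4.bsum n)]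
  have e3 : ∀ i : ℕ, (bsum n fun j => A.1 (l - i) (B.1 (n - j) (F (i + j)))) -
      (bsum n fun j => B.1 (n - j) (A.1 (l - i) (F (i + j)))) =
      ∑ r ∈ Finset.range N, Ring.choose (l - i) r •
        bsum n fun j => (E r).1 (l + n - r - (i + j : ℕ)) (F (i + j)) := by
    intro i
    rw [← bsum_sub (ev3.right i) (ev4.right i), bsum_congr n (key i), bsum_finsetSum]
    · exact Finset.sum_congr rfl fun r _ => bsum_zsmul ((evE r).evZero₂.right i) n _
    · exact fun r _ => ((evE r).evZero₂.right i).zsmul _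
  rw [bsum_congr l e3, bsum_finsetSum]
  · refine Finset.sum_congr rfl fun r _ => ?_
    rw [bsum_choose_sub ((evE r).evZero₂.bsum n), bsum_comp (evE r), sub_add_eq_add_sub]
  · exact fun r _ => ((evE r).evZero₂.bsum n).zsmul _

/-- The counterpart of `lmap_lmap`. Now the commutator carries `(i choose r)`, so `bsum_choose`
contributes `(-1)^r`, and the outer minus sign reflects that right multiplications compose in the
opposite order. -/
theorem rmap_rmap (h : ∀ a b, A.1 a * B.1 b - B.1 b * A.1 a =
      ∑ r ∈ Finset.range N, Ring.choose a r • (E r).1 (a + b - r)) (C : Fld M) (l n : ℤ) :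
    rmap A l (rmap B n C) - rmap B n (rmap A l C) =
      - ∑ r ∈ Finset.range N, ((-1) ^ r * Ring.choose l r) • rmap (E r) (l + n - r) C := by
  refine Fld.ext' fun p v => ?_
  have e1 : (rmap A l (rmap B n C)).1 p v =
      bsum l fun i => bsum n fun j => C.1 (p + l + n - i - j) (B.1 j (A.1 i v)) := by
    rw [rmap_apply]
    refine bsum_congr l fun i => ?_
    rw [rmap_apply]
    refine bsum_congr n fun j => ?_
    rw [show p + l - i + n - j = p + l + n - i - j by ring]
  have e2 : (rmap B n (rmap A l C)).1 p v =
      bsum n fun j => bsum l fun i => C.1 (p + l + n - i - j) (A.1 i (B.1 j v)) := by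
    rw [rmap_apply]
    refine bsum_congr n fun j => ?_
    rw [rmap_apply]
    refine bsum_congr l fun i => ?_
    rw [show p + n - j + l - i = p + l + n - i - j by ring]
  have ev : ∀ (A B : Fld M) (f : ℕ → ℕ → ℤ), EvZero₂ fun i j : ℕ =>
      C.1 (f i j) (B.1 j (A.1 i v)) := by
    intro A B f
    obtain ⟨K, hK⟩ := Fld.exists_bound_nat A v 0
    obtain ⟨K', hK'⟩ := Fld.exists_bound B (fun i => A.1 i v) K
    refine ⟨max K K'.toNat, fun i j hij => ?_⟩
    beta_reduce
    rcases lt_or_ge i K with hi | hi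
    · rw [hK' i hi j (by omega), map_zero]
    · have := hK i hi
      rw [zero_add] at this
      rw [this, map_zero, map_zero]
  have ev3 := ev A B fun i j => p + l + n - i - j
  have ev4 : EvZero₂ fun i j : ℕ => C.1 (p + l + n - i - j) (A.1 i (B.1 j v)) := by
    obtain ⟨K, hK⟩ := ev B A fun j i => p + l + n - i - j
    exact ⟨K, fun i j hij => hK j i hij.symm⟩
  have key : ∀ i j : ℕ, C.1 (p + l + n - i - j) (B.1 j (A.1 i v)) -
      C.1 (p + l + n - i - j) (A.1 i (B.1 j v)) = - ∑ r ∈ Finset.range N,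
        (i.choose r : ℤ) • C.1 (p + l + n - i - j) ((E r).1 (i + j - r) v) := by
    intro i j
    have := LinearMap.congr_fun (h i j) v
    simp only [LinearMap.sub_apply, Module.End.mul_apply, LinearMap.sum_apply,
      LinearMap.smul_apply, Ring.choose_natCast] at this
    rw [← map_sub, ← neg_sub (A.1 i (B.1 j v)), this, map_neg, map_sum]
    simp only [map_zsmul]
  have evE : ∀ r : ℕ, EvZero fun k : ℕ => C.1 (p + (l + n - r) - k) ((E r).1 k v) := fun r =>
    Fld.evZero_apply (E r) v fun k => C.1 (p + (l + n - r) - k)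
  have evE₂ : ∀ r : ℕ, EvZero₂ fun i j : ℕ =>
      C.1 (p + l + n - i - j) ((E r).1 (i + j - r) v) := by
    intro r
    obtain ⟨K, hK⟩ := (E r).2 v
    exact ⟨(K + r).toNat, fun i j hij => by beta_reduce; rw [hK _ (by omega), map_zero]⟩
  have eR : (- ∑ r ∈ Finset.range N, ((-1) ^ r * Ring.choose l r) •
      rmap (E r) (l + n - r) C).1 p v = - ∑ r ∈ Finset.range N, ((-1) ^ r * Ring.choose l r) •
        bsum (l + n - r) fun k => C.1 (p + (l + n - r) - k) ((E r).1 k v) := by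
    simp only [NegMemClass.coe_neg, Pi.neg_apply, LinearMap.neg_apply,
      AddSubmonoidClass.coe_finsetSum, Finset.sum_apply, LinearMap.sum_apply]
    congr 1
    refine Finset.sum_congr rfl fun r _ => ?_
    rw [← rmap_apply]
    rfl
  rw [eR]
  change (rmap A l (rmap B n C)).1 p v - (rmap B n (rmap A l C)).1 p v = _
  rw [e1, e2, ← bsum_comm ev4 l n, ← bsum_sub (ev3.bsum n) (ev4.bsum n)]
  have e3 : ∀ i : ℕ, (bsum n fun j => C.1 (p + l + n - i - j) (B.1 j (A.1 i v))) -
      (bsum n fun j => C.1 (p + l + n - i - j) (A.1 i (B.1 j v))) =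
      ∑ r ∈ Finset.range N, (i.choose r : ℤ) •
        - bsum n fun j => C.1 (p + l + n - i - j) ((E r).1 (i + j - r) v) := by
    intro i
    rw [← bsum_sub (ev3.right i) (ev4.right i), bsum_congr n (key i)]
    simp only [← Finset.sum_neg_distrib, ← smul_neg]
    rw [bsum_finsetSum]
    · refine Finset.sum_congr rfl fun r _ => ?_
      rw [← bsum_neg ((evE₂ r).right i)]
      exact bsum_zsmul (((evE₂ r).right i).map fun _ => -AddMonoidHom.id M) n _
    · exact fun r _ => (((evE₂ r).right i).map fun _ => -AddMonoidHom.id M).zsmul _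
  have evb : ∀ r, EvZero fun i : ℕ =>
      - bsum n fun j => C.1 (p + l + n - i - j) ((E r).1 (i + j - r) v) := fun r =>
    ((evE₂ r).bsum n).map fun _ => -AddMonoidHom.id M
  rw [bsum_congr l e3, bsum_finsetSum, ← Finset.sum_neg_distrib]
  · refine Finset.sum_congr rfl fun r _ => ?_
    rw [bsum_choose (evb r), ← smul_neg]
    congr 1
    rw [bsum_neg (((evE₂ r).bsum n).shift r)]
    congr 1
    refine .trans ?_ ((bsum_comp (evE r) (l - r) n).trans (by rw [sub_add_eq_add_sub]))
    refine bsum_congr _ fun i => bsum_congr _ fun j => ?_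
    push_cast
    rw [show p + l + n - (i + r) - j = p + (l + n - r) - (i + j : ℤ) by ring,
      show (i : ℤ) + r + j - r = i + j by ring]
  · exact fun r _ => (evb r).zsmul _

/-- The operators of `l`-th product satisfy the same commutator formula as the modes. -/
theorem nprod_nprod (h : ∀ a b, A.1 a * B.1 b - B.1 b * A.1 a =
      ∑ r ∈ Finset.range N, Ring.choose a r • (E r).1 (a + b - r)) (C : Fld M) (l n : ℤ) :
    nprod A l (nprod B n C) - nprod B n (nprod A l C) =
      ∑ r ∈ Finset.range N, Ring.choose l r • nprod (E r) (l + n - r) C := by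
  have h1 := lmap_lmap h C l n
  have h2 := rmap_rmap h C l n
  have h3 := lmap_rmap A B C l n
  have h4 := lmap_rmap B A C n l
  have e : ∀ r ∈ Finset.range N, Ring.choose l r • nprod (E r) (l + n - r) C =
      Ring.choose l r • lmap (E r) (l + n - r) C -
        (sg l * sg n) • ((-1) ^ r * Ring.choose l r) • rmap (E r) (l + n - r) C := by
    intro r _
    rw [nprod, LinearMap.sub_apply, LinearMap.smul_apply, smul_sub, sg_sub_nat, sg_add, smul_smul,
      smul_smul]
    congr 2
    ring
  -- The signs `(-1)^r` from right multiplications are exactly those in `sg (l + n - r)`, so the two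
  -- halves recombine into products; the mixed terms cancel by `lmap_rmap`.
  rw [Finset.sum_congr rfl e, Finset.sum_sub_distrib, ← Finset.smul_sum, ← h1,
    ← neg_eq_iff_eq_neg.2 h2]
  simp only [nprod, LinearMap.sub_apply, LinearMap.smul_apply, map_sub, map_zsmul, h3, h4,
    smul_sub, smul_smul, smul_neg, mul_comm (sg n) (sg l)]
  abel

/-- The derivative of a field. -/
def dfld : Fld M →ₗ[ℂ] Fld M where
  toFun A := ⟨fun n => (-n : ℤ) • A.1 (n - 1), fun v => by
    obtain ⟨N, hN⟩ := A.2 v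
    exact ⟨N + 1, fun n hn => by
      rw [LinearMap.smul_apply, hN _ (by omega), smul_zero]⟩⟩
  map_add' A B := Subtype.ext (funext fun n => smul_add (-n : ℤ) (A.1 (n - 1)) (B.1 (n - 1)))
  map_smul' r A := Subtype.ext (funext fun n => smul_comm (-n : ℤ) r (A.1 (n - 1)))

theorem dfld_apply (A : Fld M) (n : ℤ) (v : M) :
    (dfld A).1 n v = (-n : ℤ) • A.1 (n - 1) v := rfl

theorem lmap_dfld_left (A C : Fld M) (l : ℤ) :
    lmap (dfld A) l C = (-l : ℤ) • lmap A (l - 1) C := by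
  refine Fld.ext' fun p v => ?_
  have h := bsum_choose_sub (Fld.evZero_left C p v fun i => A.1 (l - 1 - i)) l 1
  simp only [Ring.choose_one_right] at h
  change _ = (-l : ℤ) • (lmap A (l - 1) C).1 p v
  rw [lmap_apply, lmap_apply, neg_smul]
  rw [Nat.cast_one] at h
  rw [← h, ← bsum_neg ((Fld.evZero_left C p v fun i => A.1 (l - 1 - i)).zsmul _)]
  refine bsum_congr l fun i => ?_
  rw [dfld_apply, neg_smul, show l - i - 1 = l - 1 - (i : ℤ) by ring]

theorem rmap_dfld_left (A C : Fld M) (l : ℤ) :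
    rmap (dfld A) l C = (l : ℤ) • rmap A (l - 1) C := by
  refine Fld.ext' fun p v => ?_
  have ev : EvZero fun i : ℕ => C.1 (p + l - i) (A.1 ((i : ℤ) - 1) v) := by
    have := Fld.evZero_left A (-1) v fun i => C.1 (p + l - i)
    simpa only [neg_add_eq_sub] using this
  have h := bsum_choose ev l 1
  change _ = (l : ℤ) • (rmap A (l - 1) C).1 p v
  rw [rmap_apply, rmap_apply]
  simp only [Ring.choose_one_right, Nat.choose_one_right, pow_one, Nat.cast_one, Nat.cast_add,
    add_sub_cancel_right, neg_one_mul] at h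
  have h2 : ∀ i : ℕ, C.1 (p + l - i) ((dfld A).1 i v) =
      - ((i : ℤ) • C.1 (p + l - i) (A.1 ((i : ℤ) - 1) v)) := by
    intro i
    rw [dfld_apply, neg_smul, map_neg, map_zsmul]
  rw [bsum_congr l h2, bsum_neg (ev.zsmul _), h, neg_smul, neg_neg]
  congr 1
  refine bsum_congr _ fun i => ?_
  rw [show p + l - ((i : ℤ) + 1) = p + (l - 1) - i by ring]

theorem nprod_dfld_left (A C : Fld M) (l : ℤ) :
    nprod (dfld A) l C = (-l : ℤ) • nprod A (l - 1) C := by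
  have h : sg (l - 1) = - sg l := by
    rw [← sub_add_cancel l 1, sg_succ, sub_add_cancel, neg_neg]
  rw [nprod, nprod, LinearMap.sub_apply, LinearMap.sub_apply, lmap_dfld_left,
    LinearMap.smul_apply, LinearMap.smul_apply, rmap_dfld_left, smul_sub, h, smul_smul, smul_smul]
  congr 2
  ring

theorem dfld_lmap (A C : Fld M) (l : ℤ) :
    dfld (lmap A l C) = lmap A l (dfld C) - (l : ℤ) • lmap A (l - 1) C := by
  refine Fld.ext' fun p v => ?_
  change _ = (lmap A l (dfld C)).1 p v - (l : ℤ) • (lmap A (l - 1) C).1 p v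
  rw [dfld_apply, lmap_apply, lmap_apply, lmap_apply]
  have ev : EvZero fun i : ℕ => A.1 (l - i) (C.1 (p - 1 + i) v) := Fld.evZero_left C (p - 1) v _
  have h := bsum_choose ev l 1
  simp only [Ring.choose_one_right, Nat.choose_one_right, pow_one, Nat.cast_one, Nat.cast_add,
    neg_one_mul] at h
  have h2 : ∀ i : ℕ, A.1 (l - i) ((dfld C).1 (p + i) v) =
      (-p : ℤ) • A.1 (l - i) (C.1 (p - 1 + i) v) - (i : ℤ) • A.1 (l - i) (C.1 (p - 1 + i) v) := by
    intro i
    rw [dfld_apply, map_zsmul, ← sub_smul, show p + (i : ℤ) - 1 = p - 1 + i by ring,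
      show (-(p + i) : ℤ) = -p - i by ring]
  rw [bsum_congr l h2, bsum_sub (ev.zsmul _) (ev.zsmul _), h, bsum_zsmul ev, neg_smul l,
    sub_neg_eq_add]
  rw [bsum_congr (l - 1) fun i : ℕ => by
    rw [show l - ((i : ℤ) + 1) = l - 1 - i by ring, show p - 1 + ((i : ℤ) + 1) = p + i by ring]]
  abel

theorem dfld_rmap (A C : Fld M) (l : ℤ) :
    dfld (rmap A l C) = rmap A l (dfld C) + (l : ℤ) • rmap A (l - 1) C := by
  refine Fld.ext' fun p v => ?_
  change _ = (rmap A l (dfld C)).1 p v + (l : ℤ) • (rmap A (l - 1) C).1 p v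
  rw [dfld_apply, rmap_apply, rmap_apply, rmap_apply]
  have ev : EvZero fun i : ℕ => C.1 (p - 1 + l - i) (A.1 i v) := Fld.evZero_apply A v _
  have h := bsum_choose_sub ev l 1
  simp only [Ring.choose_one_right, Nat.cast_one] at h
  have h2 : ∀ i : ℕ, (dfld C).1 (p + l - i) (A.1 i v) =
      (-p : ℤ) • C.1 (p - 1 + l - i) (A.1 i v) - (l - i : ℤ) • C.1 (p - 1 + l - i) (A.1 i v) := by
    intro i
    rw [dfld_apply, ← sub_smul, show p + l - (i : ℤ) - 1 = p - 1 + l - i by ring]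
    congr 1
    ring
  have h3 : (bsum (l - 1) fun i : ℕ => C.1 (p + (l - 1) - i) (A.1 i v)) =
      bsum (l - 1) fun i : ℕ => C.1 (p - 1 + l - i) (A.1 i v) :=
    bsum_congr _ fun i => by rw [show p - 1 + l - (i : ℤ) = p + (l - 1) - i by ring]
  rw [bsum_congr l h2, bsum_sub (ev.zsmul _) (ev.zsmul _), h, bsum_zsmul ev, h3]
  abel

/-- The Leibniz rule for the product of fields. -/
theorem dfld_nprod (A C : Fld M) (l : ℤ) :
    dfld (nprod A l C) = nprod A l (dfld C) - (l : ℤ) • nprod A (l - 1) C := by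
  have h : sg (l - 1) = - sg l := by
    rw [← sub_add_cancel l 1, sg_succ, sub_add_cancel, neg_neg]
  simp only [nprod, LinearMap.sub_apply, LinearMap.smul_apply, map_sub, map_zsmul, dfld_lmap,
    dfld_rmap, h, smul_sub, smul_add, neg_smul, smul_neg, smul_comm l (sg l)]
  abel

variable (M) in
/-- The identity field. -/
def idFld : Fld M := ⟨fun n => if n = -1 then 1 else 0, fun v => ⟨0, fun n hn => by
  beta_reduce
  rw [if_neg (by omega)]; rfl⟩⟩

theorem idFld_apply (n : ℤ) (v : M) : (idFld M).1 n v = if n = -1 then v else 0 := by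
  change (if n = -1 then (1 : Module.End ℂ M) else 0) v = _
  split_ifs <;> rfl

theorem nprod_idFld_left (C : Fld M) (k : ℤ) :
    nprod (idFld M) k C = if k = -1 then C else 0 := by
  refine Fld.ext' fun p v => ?_
  have e : (nprod (idFld M) k C).1 p v = (lmap (idFld M) k C).1 p v -
    sg k • (rmap (idFld M) k C).1 p v := rfl
  have hr : (rmap (idFld M) k C).1 p v = 0 := by
    rw [rmap_apply, bsum_congr k fun i => by
      rw [idFld_apply, if_neg (by omega), map_zero], bsum_zero]
  rw [e, hr, smul_zero, sub_zero, lmap_apply]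
  simp only [idFld_apply]
  rcases lt_or_ge k (-1) with h | h
  · rw [bsum_congr k fun i => by rw [if_neg (by omega)], bsum_zero, if_neg (by omega)]
    rfl
  · obtain ⟨s, hs⟩ := Int.eq_ofNat_of_zero_le (show 0 ≤ k + 1 by omega)
    obtain rfl : k = (s : ℤ) - 1 := by omega
    -- Only `i = k + 1` meets the single nonzero mode of the identity field, and `(k choose k + 1) =
    -- 0` for `k ≥ 0`.
    rw [bsum, finsum_eq_single _ s]
    · rcases s with - | s
      · simp
      · rw [if_pos (by ring), if_neg (by push_cast; omega), show ((s + 1 : ℕ) : ℤ) - 1 = (s : ℕ) by push_cast; ring,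
          Ring.choose_natCast, Nat.choose_succ_self]
        simp
    · intro i hi
      rw [if_neg (by omega), smul_zero]

theorem nprod_idFld_right_of_nonneg (A : Fld M) {k : ℤ} (hk : 0 ≤ k) : nprod A k (idFld M) = 0 := by
  have h : LocalAt A (idFld M) 0 := by
    intro m n
    rw [Nat.cast_zero, jprod_zero]
    change A.1 m * (if n = -1 then 1 else 0) - (if n = -1 then 1 else 0) * A.1 m = 0
    split_ifs <;> simp
  exact Subtype.ext (funext fun n => h.of_le (by simpa using hk) 0 n)

/-- All coefficients `(-1)^i (-1 choose i)` equal `1`. The left half of the product recovers the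
modes with `p < 0` and the right half those with `p ≥ 0`. -/
theorem nprod_idFld_right_neg_one (A : Fld M) : nprod A (-1) (idFld M) = A := by
  refine Fld.ext' fun p v => ?_
  have e : (nprod A (-1) (idFld M)).1 p v = (lmap A (-1) (idFld M)).1 p v +
      (rmap A (-1) (idFld M)).1 p v := by
    have : sg (-1) = -1 := by simp [sg]
    change (lmap A (-1) (idFld M)).1 p v - sg (-1) • (rmap A (-1) (idFld M)).1 p v = _
    rw [this, neg_smul, one_smul, sub_neg_eq_add]
  have hc : ∀ i : ℕ, (-1 : ℤ) ^ i * Ring.choose (-1 : ℤ) i = 1 := by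
    intro i
    rw [Ring.choose_neg, show (1 : ℤ) + i - 1 = (i : ℕ) by ring, Ring.choose_natCast,
      Nat.choose_self, Units.smul_def, show ((i : ℤ).negOnePow : ℤ) = _ from sg_natCast i,
      Nat.cast_one, smul_eq_mul, mul_one, ← mul_pow]
    simp
  have hb : ∀ F : ℕ → M, bsum (-1) F = ∑ᶠ i, F i := fun F =>
    finsum_congr fun i => by rw [hc, one_smul]
  rw [e, lmap_apply, rmap_apply, hb, hb]
  simp only [idFld_apply]
  rcases lt_or_ge p 0 with hp | hp
  · rw [finsum_eq_single _ (-1 - p).toNat, if_pos (by omega), finsum_eq_zero_of_forall_eq_zero,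
      add_zero, show -1 - ((-1 - p).toNat : ℤ) = p by omega]
    · intro i
      rw [if_neg (by omega)]
    · intro i hi
      rw [if_neg (by omega), map_zero]
  · rw [finsum_eq_zero_of_forall_eq_zero, finsum_eq_single _ p.toNat, if_pos (by omega), zero_add,
      show (p.toNat : ℤ) = p by omega]
    · intro i hi
      rw [if_neg (by omega)]
    · intro i
      rw [if_neg (by omega), map_zero]

end Adjoint

/-! ### Representations of the Virasoro algebra -/

section VirasoroAlgebra

variable {c : ℂ}

theorem virL_comm (m n : ℤ) : virL c m * virL c n - virL c n * virL c m =
    ((m : ℂ) - n) • virL c (m + n) +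
      (if m + n = 0 then c / 12 * ((m : ℂ) ^ 3 - m) else 0) • (1 : VirAlg c) := by
  have := RingQuot.mkAlgHom_rel ℂ (VirRel.comm (c := c) m n)
  simp only [map_sub, map_mul, map_add, map_smul, map_one] at this
  exact this

theorem virL_mul (m n : ℤ) : virL c m * virL c n = virL c n * virL c m +
    (((m : ℂ) - n) • virL c (m + n) +
      (if m + n = 0 then c / 12 * ((m : ℂ) ^ 3 - m) else 0) • (1 : VirAlg c)) := by
  rw [← virL_comm]
  abel

/-- The algebra homomorphism given by operators satisfying the Virasoro relations. -/
def virLift {R : Type*} [Ring R] [Algebra ℂ R] (L : ℤ → R)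
    (h : ∀ m n, L m * L n - L n * L m = ((m : ℂ) - n) • L (m + n) +
      (if m + n = 0 then c / 12 * ((m : ℂ) ^ 3 - m) else 0) • 1) : VirAlg c →ₐ[ℂ] R :=
  RingQuot.liftAlgHom ℂ ⟨FreeAlgebra.lift ℂ L, by
    rintro _ _ ⟨m, n⟩
    simp only [map_sub, map_mul, map_add, map_smul, map_one, FreeAlgebra.lift_ι_apply]
    exact h m n⟩

theorem virLift_virL {R : Type*} [Ring R] [Algebra ℂ R] (L : ℤ → R)
    (h : ∀ m n, L m * L n - L n * L m = ((m : ℂ) - n) • L (m + n) +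
      (if m + n = 0 then c / 12 * ((m : ℂ) ^ 3 - m) else 0) • 1) (n : ℤ) :
    virLift (c := c) L h (virL c n) = L n := by
  rw [virLift, virL, RingQuot.liftAlgHom_mkAlgHom_apply, FreeAlgebra.lift_ι_apply]

theorem virAlg_smul_mem {X : Type*} [AddCommGroup X] [Module ℂ X] [Module (VirAlg c) X]
    [IsScalarTower ℂ (VirAlg c) X] (S : Submodule ℂ X)
    (hS : ∀ n, ∀ x ∈ S, virL c n • x ∈ S) (a : VirAlg c) {x : X} (hx : x ∈ S) : a • x ∈ S := by
  obtain ⟨y, rfl⟩ := RingQuot.mkAlgHom_surjective ℂ (VirRel c) a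
  induction y using FreeAlgebra.induction generalizing x with
  | grade0 r =>
    rw [AlgHom.commutes, algebraMap_smul]
    exact S.smul_mem r hx
  | grade1 n => exact hS n x hx
  | mul a b ha hb =>
    rw [map_mul, mul_smul]
    exact ha (hb hx)
  | add a b ha hb =>
    rw [map_add, add_smul]
    exact S.add_mem (ha hx) (hb hx)

variable (c) in
/-- The vacuum vector of `Vir c`. -/
def virVac : Vir c := Submodule.Quotient.mk 1

theorem smul_virVac (a : VirAlg c) : a • virVac c = Submodule.Quotient.mk a := by
  rw [virVac, ← Submodule.Quotient.mk_smul, smul_eq_mul, mul_one]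

theorem virL_smul_virVac {n : ℤ} (hn : -1 ≤ n) : virL c n • virVac c = 0 := by
  rw [smul_virVac]
  exact (Submodule.Quotient.mk_eq_zero _).2 (Submodule.subset_span ⟨n, hn, rfl⟩)

/-- `Vir c` is generated by the vacuum. This is the induction principle behind all statements about
its vertex operators. -/
theorem vir_eq_top {S : Submodule ℂ (Vir c)} (h : virVac c ∈ S)
    (hS : ∀ n, ∀ x ∈ S, virL c n • x ∈ S) : S = ⊤ := by
  refine eq_top_iff.2 fun x _ => ?_
  obtain ⟨a, rfl⟩ := Submodule.Quotient.mk_surjective _ x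
  rw [← smul_virVac]
  exact virAlg_smul_mem S hS a h

variable (c) in
/-- A representation of the Virasoro algebra of central charge `c` in which every vector is
annihilated by `L_n` for large `n`. -/
structure VirRep (M : Type*) [AddCommGroup M] [Module ℂ M] where
  L : ℤ → Module.End ℂ M
  comm : ∀ m n, L m * L n - L n * L m = ((m : ℂ) - n) • L (m + n) +
    (if m + n = 0 then c / 12 * ((m : ℂ) ^ 3 - m) else 0) • 1
  trunc : ∀ v, ∃ N : ℤ, ∀ n, N ≤ n → L n v = 0

variable (c) in
/-- The operator of multiplication by `L_n` on a module over the Virasoro algebra. -/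
def lsmulL (X : Type*) [AddCommGroup X] [Module ℂ X] [Module (VirAlg c) X]
    [IsScalarTower ℂ (VirAlg c) X] (n : ℤ) : Module.End ℂ X :=
  Algebra.lsmul ℂ ℂ X (virL c n)

theorem lsmulL_apply {X : Type*} [AddCommGroup X] [Module ℂ X] [Module (VirAlg c) X]
    [IsScalarTower ℂ (VirAlg c) X] (n : ℤ) (x : X) : lsmulL c X n x = virL c n • x := rfl

theorem lsmulL_comm {X : Type*} [AddCommGroup X] [Module ℂ X] [Module (VirAlg c) X]
    [IsScalarTower ℂ (VirAlg c) X] (m n : ℤ) : lsmulL c X m * lsmulL c X n -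
      lsmulL c X n * lsmulL c X m = ((m : ℂ) - n) • lsmulL c X (m + n) +
    (if m + n = 0 then c / 12 * ((m : ℂ) ^ 3 - m) else 0) • 1 := by
  have := congrArg (Algebra.lsmul ℂ ℂ X) (virL_comm (c := c) m n)
  simp only [map_sub, map_mul, map_add, map_smul, map_one] at this
  exact this

/-- A module over the Virasoro algebra generated by a vector which is annihilated by `L_n` for large
`n` is a representation of the above kind. -/
def virRepOfGenerator {X : Type*} [AddCommGroup X] [Module ℂ X] [Module (VirAlg c) X]
    [IsScalarTower ℂ (VirAlg c) X] (x₀ : X) (hx : ∀ x, ∃ a : VirAlg c, x = a • x₀)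
    (h₀ : ∃ N : ℤ, ∀ n, N ≤ n → virL c n • x₀ = 0) : VirRep c X where
  L := lsmulL c X
  comm := lsmulL_comm
  trunc x := by
    let S : Submodule ℂ X :=
      { carrier := {x | ∃ N : ℤ, ∀ n, N ≤ n → virL c n • x = 0}
        add_mem' := by
          rintro a b ⟨N, hN⟩ ⟨K, hK⟩
          exact ⟨max N K, fun n hn => by
            rw [smul_add, hN n (le_of_max_le_left hn), hK n (le_of_max_le_right hn), add_zero]⟩
        zero_mem' := ⟨0, fun n _ => smul_zero _⟩
        smul_mem' := by
          rintro r a ⟨N, hN⟩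
          exact ⟨N, fun n hn => by rw [smul_comm, hN n hn, smul_zero]⟩ }
    obtain ⟨a, rfl⟩ := hx x
    refine virAlg_smul_mem S ?_ a h₀
    rintro m x ⟨N, hN⟩
    -- In `L_n L_m x = L_m L_n x + [L_n, L_m] x` the bound `N` kills the first term, `N - m` kills
    -- the multiple of `L_{n+m} x`, and `1 - m` makes `n + m` nonzero, so that no central term
    -- occurs.
    refine ⟨max N (max (N - m) (1 - m)), fun n hn => ?_⟩
    rw [← mul_smul, virL_mul, add_smul, add_smul, mul_smul, hN n (by omega), smul_zero, smul_assoc,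
      hN (n + m) (by omega), if_neg (by omega), zero_smul, zero_smul, smul_zero, add_zero, add_zero]

variable (c) in
/-- The representation on `Vir c`. -/
def virSelf : VirRep c (Vir c) :=
  virRepOfGenerator (virVac c) (fun x => by
    obtain ⟨a, rfl⟩ := Submodule.Quotient.mk_surjective _ x
    exact ⟨a, (smul_virVac a).symm⟩) ⟨-1, fun _ hn => virL_smul_virVac hn⟩

end VirasoroAlgebra

/-! ### Vertex operators of `Vir c` on a Virasoro representation -/

section VirasoroField

variable {c : ℂ} {M : Type*} [AddCommGroup M] [Module ℂ M]

theorem nprod_smul_left (r : ℂ) (A B : Fld M) (k : ℤ) :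
    nprod (r • A) k B = r • nprod A k B :=
  Subtype.ext (funext fun n => jprod_smul_left r A B k 0 n)

theorem nprod_zero_left (B : Fld M) (k : ℤ) : nprod 0 k B = 0 := by
  have := nprod_smul_left 0 (0 : Fld M) B k
  rwa [zero_smul, zero_smul] at this

/-- With `n = m + 1` this converts the fourth-order pole `c / 2` into the central term `c (m^3 - m)
/ 12`. -/
theorem six_mul_choose_three (n : ℤ) : 6 * Ring.choose n 3 = n * (n - 1) * (n - 2) := by
  have := Ring.descPochhammer_eq_factorial_smul_choose n 3
  simp only [descPochhammer_succ_right, descPochhammer_zero] at this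
  rw [show Nat.factorial 3 = 6 from rfl] at this
  simp [Polynomial.smeval_mul, Polynomial.smeval_sub, Polynomial.smeval_X,
    Polynomial.smeval_natCast, -Nat.cast_ofNat] at this
  linarith

/-- The singular products of `L(z)` with itself. -/
def virSing (c : ℂ) (W : Fld M) : ℕ → Fld M
  | 0 => dfld W
  | 1 => (2 : ℂ) • W
  | 2 => 0
  | _ => (c / 2) • idFld M

/-- The operator product of `L(z)` with itself, in the shape that the commutator formula
`nprod_nprod` takes as hypothesis. The mode index is `m + 1`, so `m^3 - m` appears as `a (a - 1) (a
- 2)`. -/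
theorem sum_virSing (W : Fld M) (a b : ℤ) :
    ∑ r ∈ Finset.range 4, Ring.choose a r • (virSing c W r).1 (a + b - r) =
      ((a : ℂ) - b) • W.1 (a + b - 1) +
        (if a + b = 2 then c / 12 * (a * (a - 1) * (a - 2)) else 0) • 1 := by
  simp only [Finset.sum_range_succ, Finset.sum_range_zero, virSing, zero_add, Ring.choose_zero_right,
    one_smul, Ring.choose_one_right, Nat.cast_zero, Nat.cast_one, sub_zero]
  have e0 : (dfld W).1 (a + b) = (-(a + b) : ℂ) • W.1 (a + b - 1) := by
    change (-(a + b) : ℤ) • W.1 (a + b - 1) = _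
    rw [← Int.cast_smul_eq_zsmul ℂ]
    push_cast
    rfl
  have e1 : a • ((2 : ℂ) • W).1 (a + b - 1) = (2 * a : ℂ) • W.1 (a + b - 1) := by
    change a • (2 : ℂ) • W.1 (a + b - 1) = _
    rw [← Int.cast_smul_eq_zsmul ℂ, smul_smul, mul_comm]
  have e2 : Ring.choose a 2 • (0 : Fld M).1 (a + b - (2 : ℕ)) = 0 := smul_zero _
  have e3 : Ring.choose a 3 • ((c / 2) • idFld M).1 (a + b - (3 : ℕ)) =
      (if a + b = 2 then c / 12 * (a * (a - 1) * (a - 2)) else 0) • (1 : Module.End ℂ M) := by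
    change Ring.choose a 3 • (c / 2) • (if a + b - 3 = -1 then (1 : Module.End ℂ M) else 0) = _
    by_cases h : a + b = 2
    · rw [if_pos (by omega), if_pos h, ← Int.cast_smul_eq_zsmul ℂ, smul_smul]
      congr 1
      have := congrArg (Int.cast (R := ℂ)) (six_mul_choose_three a)
      push_cast at this
      linear_combination c / 12 * this
    · rw [if_neg (by omega), if_neg h, smul_zero, smul_zero, zero_smul]
  rw [e0, e1, e2, e3]
  rw [add_zero, ← add_smul]
  congr 2
  ring

namespace VirRep

variable (R : VirRep c M)

/-- The field `L(z)`, with modes `L_{n-1}`. -/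
def W : Fld M := ⟨fun n => R.L (n - 1), fun v => by
  obtain ⟨N, hN⟩ := R.trunc v
  exact ⟨N + 1, fun n hn => hN _ (by omega)⟩⟩

theorem W_apply (n : ℤ) : R.W.1 n = R.L (n - 1) := rfl

theorem W_comm (a b : ℤ) : R.W.1 a * R.W.1 b - R.W.1 b * R.W.1 a =
    ((a : ℂ) - b) • R.W.1 (a + b - 1) +
      (if a + b = 2 then c / 12 * (a * (a - 1) * (a - 2)) else 0) • 1 := by
  rw [W_apply, W_apply, R.comm, W_apply, show a - 1 + (b - 1) = a + b - 1 - 1 by ring]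
  congr 2
  · push_cast; ring
  · rw [if_congr (show a + b - 1 - 1 = 0 ↔ a + b = 2 by omega) rfl rfl]
    push_cast
    congr 1
    ring

/-- Each factor `z - w` takes a difference of coefficients that are polynomial in the mode index.
The linear term is gone after two factors and the cubic central term after four. -/
theorem local_W_W : Local R.W R.W := by
  refine ⟨4, ?_⟩
  have h1 : ∀ m n, jprod R.W R.W 1 m n = (2 : ℂ) • R.W.1 (m + n) +
      (if m + n = 1 then c / 12 * (3 * m * (m - 1)) else 0) • 1 := by
    intro m n
    rw [show (1 : ℤ) = 0 + 1 by ring, jprod_succ, jprod_zero, jprod_zero, W_comm, W_comm,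
      show m + 1 + n - 1 = m + n by ring, show m + (n + 1) - 1 = m + n by ring, add_sub_add_comm,
      ← sub_smul, ← sub_smul]
    congr 2
    · push_cast; ring
    · by_cases h : m + n = 1
      · rw [if_pos (by omega), if_pos (by omega), if_pos (by omega)]
        push_cast; ring
      · rw [if_neg (by omega), if_neg (by omega), if_neg (by omega), sub_zero]
  have h2 : ∀ m n, jprod R.W R.W 2 m n = (if m + n = 0 then c / 2 * m else 0) • 1 := by
    intro m n
    rw [show (2 : ℤ) = 1 + 1 by ring, jprod_succ, h1, h1,
      show m + 1 + n = m + n + 1 by ring, show m + (n + 1) = m + n + 1 by ring, add_sub_add_comm,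
      ← sub_smul, ← sub_smul, sub_self, zero_smul, zero_add]
    congr 1
    by_cases h : m + n = 0
    · rw [if_pos (by omega), if_pos (by omega), if_pos (by omega)]
      push_cast; ring
    · rw [if_neg (by omega), if_neg (by omega), if_neg (by omega), sub_zero]
  have h3 : ∀ m n, jprod R.W R.W 3 m n = (if m + n = -1 then c / 2 else 0) • 1 := by
    intro m n
    rw [show (3 : ℤ) = 2 + 1 by ring, jprod_succ, h2, h2,
      show m + 1 + n = m + n + 1 by ring, show m + (n + 1) = m + n + 1 by ring, ← sub_smul]
    congr 1
    by_cases h : m + n = -1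
    · rw [if_pos (by omega), if_pos (by omega), if_pos (by omega)]
      push_cast; ring
    · rw [if_neg (by omega), if_neg (by omega), if_neg (by omega), sub_zero]
  intro m n
  rw [show ((4 : ℕ) : ℤ) = 3 + 1 by norm_num, jprod_succ, h3, h3,
    show m + 1 + n = m + (n + 1) by ring, sub_self]

theorem W_comm_sing (a b : ℤ) : R.W.1 a * R.W.1 b - R.W.1 b * R.W.1 a =
    ∑ r ∈ Finset.range 4, Ring.choose a r • (virSing c R.W r).1 (a + b - r) := by
  rw [W_comm, sum_virSing]

/-- The key to the construction: since modes and product operators share one commutator formula, the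
space of all fields becomes a Virasoro module of the same central charge. The central term comes
from the product with the identity field, which is nonzero only at index `-1`. -/
theorem nprod_W_comm (m n : ℤ) : nprod R.W (m + 1) * nprod R.W (n + 1) -
    nprod R.W (n + 1) * nprod R.W (m + 1) = ((m : ℂ) - n) • nprod R.W (m + n + 1) +
      (if m + n = 0 then c / 12 * ((m : ℂ) ^ 3 - m) else 0) • (1 : Module.End ℂ (Fld M)) := by
  refine LinearMap.ext fun C => ?_
  have h := nprod_nprod R.W_comm_sing C (m + 1) (n + 1)
  refine h.trans ?_
  simp only [Finset.sum_range_succ, Finset.sum_range_zero, virSing, zero_add, Ring.choose_zero_right,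
    one_smul, Ring.choose_one_right, Nat.cast_zero, Nat.cast_one, sub_zero, nprod_dfld_left,
    nprod_smul_left, nprod_zero_left, smul_zero, add_zero, nprod_idFld_left, LinearMap.add_apply,
    LinearMap.smul_apply, Module.End.one_apply]
  rw [show m + 1 + (n + 1) - 1 = m + n + 1 by ring]
  congr 1
  · rw [← Int.cast_smul_eq_zsmul ℂ, ← Int.cast_smul_eq_zsmul ℂ, smul_smul, ← add_smul]
    congr 1
    push_cast
    ring
  · by_cases h : m + n = 0
    · rw [if_pos (by push_cast; omega), if_pos h, ← Int.cast_smul_eq_zsmul ℂ, smul_smul]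
      congr 1
      have := congrArg (Int.cast (R := ℂ)) (six_mul_choose_three (m + 1))
      push_cast at this
      linear_combination c / 12 * this
    · rw [if_neg (by push_cast; omega), if_neg h, smul_zero, smul_zero, zero_smul]

/-- The action of the Virasoro algebra on the space of fields. -/
def fieldHom : VirAlg c →ₐ[ℂ] Module.End ℂ (Fld M) :=
  virLift (fun n => nprod R.W (n + 1)) R.nprod_W_comm

theorem fieldHom_virL (n : ℤ) : R.fieldHom (virL c n) = nprod R.W (n + 1) :=
  virLift_virL _ _ n

/-- The vertex operators of elements of `Vir c` on a representation. -/
def Y : Vir c →ₗ[ℂ] Fld M :=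
  (Submodule.liftQ ((virIdeal c).restrictScalars ℂ)
    ((LinearMap.applyₗ (idFld M)) ∘ₗ R.fieldHom.toLinearMap) (by
      intro x hx
      rw [Submodule.restrictScalars_mem] at hx
      rw [LinearMap.mem_ker, LinearMap.comp_apply, LinearMap.applyₗ_apply_apply,
        AlgHom.toLinearMap_apply]
      induction hx using Submodule.span_induction with
      | mem x hx =>
        obtain ⟨n, hn, rfl⟩ := hx
        rw [fieldHom_virL, nprod_idFld_right_of_nonneg _ (by omega)]
      | zero => rw [map_zero, LinearMap.zero_apply]
      | add x y _ _ hx hy => rw [map_add, LinearMap.add_apply, hx, hy, add_zero]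
      | smul a x _ hx =>
        rw [smul_eq_mul, map_mul, Module.End.mul_apply, hx, map_zero])) ∘ₗ
    (Submodule.Quotient.restrictScalarsEquiv ℂ (virIdeal c)).symm.toLinearMap

theorem Y_mk (a : VirAlg c) : R.Y (Submodule.Quotient.mk a) = R.fieldHom a (idFld M) := rfl

theorem Y_vac : R.Y (virVac c) = idFld M := by
  rw [virVac, Y_mk, map_one, Module.End.one_apply]

theorem Y_virL (n : ℤ) (b : Vir c) : R.Y (virL c n • b) = nprod R.W (n + 1) (R.Y b) := by
  obtain ⟨a, rfl⟩ := Submodule.Quotient.mk_surjective _ b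
  rw [← Submodule.Quotient.mk_smul, Y_mk, Y_mk, smul_eq_mul, map_mul, fieldHom_virL,
    Module.End.mul_apply]

theorem Y_conf : R.Y (virL c (-2) • virVac c) = R.W := by
  rw [Y_virL, Y_vac, show (-2 : ℤ) + 1 = -1 by norm_num, nprod_idFld_right_neg_one]

theorem local_id (A : Fld M) : Local (idFld M) A := by
  refine ⟨0, fun m n => ?_⟩
  rw [Nat.cast_zero, jprod_zero]
  change (if m = -1 then (1 : Module.End ℂ M) else 0) * A.1 n -
    A.1 n * (if m = -1 then (1 : Module.End ℂ M) else 0) = 0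
  split_ifs <;> simp

/-- The elements of `Vir c` whose vertex operators are local with respect to `A`. -/
def localTo (A : Fld M) : Submodule ℂ (Vir c) where
  carrier := {b | Local (R.Y b) A}
  add_mem' {a b} ha hb := by
    change Local (R.Y (a + b)) A
    rw [map_add]
    exact ha.add_left hb
  zero_mem' := by
    change Local (R.Y 0) A
    rw [map_zero]
    exact Local.zero_left A
  smul_mem' r a ha := by
    change Local (R.Y (r • a)) A
    rw [map_smul]
    exact ha.smul_left r

theorem vac_mem_localTo (A : Fld M) : virVac c ∈ R.localTo A := by
  change Local (R.Y _) A
  rw [Y_vac]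
  exact local_id A

/-- Dong's lemma, by induction along the generation of `Vir c` from the vacuum. `local_Y_Y` then
repeats the argument with `R.Y b` in place of `L(z)`. -/
theorem local_Y_W (b : Vir c) : Local (R.Y b) R.W := by
  suffices R.localTo R.W = ⊤ from (this ▸ Submodule.mem_top : b ∈ R.localTo R.W)
  refine vir_eq_top (R.vac_mem_localTo _) fun n x hx => ?_
  change Local (R.Y _) _
  rw [Y_virL]
  exact (Local.symm hx).nprod R.local_W_W hx _

theorem local_Y_Y (a b : Vir c) : Local (R.Y a) (R.Y b) := by
  suffices R.localTo (R.Y b) = ⊤ from (this ▸ Submodule.mem_top : a ∈ R.localTo _)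
  refine vir_eq_top (R.vac_mem_localTo _) fun n x hx => ?_
  change Local (R.Y _) _
  rw [Y_virL]
  exact (R.local_Y_W x).symm.nprod (R.local_Y_W b).symm hx _

/-- Both `L_{-1}` and the derivative kill the vacuum, and moving either past `L_n` produces the same
correction `-(n + 1) L_{n-1}`. -/
theorem Y_translation (a : Vir c) : R.Y (virL c (-1) • a) = dfld (R.Y a) := by
  let S : Submodule ℂ (Vir c) := LinearMap.eqLocus (R.Y ∘ₗ lsmulL c (Vir c) (-1)) (dfld ∘ₗ R.Y)
  suffices S = ⊤ from (this ▸ Submodule.mem_top : a ∈ S)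
  refine vir_eq_top ?_ fun n x hx => ?_
  · change R.Y (virL c (-1) • virVac c) = dfld (R.Y (virVac c))
    rw [virL_smul_virVac le_rfl, map_zero, Y_vac]
    refine Fld.ext' fun n v => ?_
    rw [dfld_apply, idFld_apply]
    split_ifs with h
    · obtain rfl : n = 0 := by omega
      simp
    · simp
  · change R.Y (virL c (-1) • virL c n • x) = dfld (R.Y (virL c n • x))
    have hx' : R.Y (virL c (-1) • x) = dfld (R.Y x) := hx
    rw [Y_virL, Y_virL, dfld_nprod, ← hx', Y_virL]
    have := LinearMap.congr_fun (R.nprod_W_comm (-1) n) (R.Y x)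
    simp only [LinearMap.sub_apply, Module.End.mul_apply, LinearMap.add_apply,
      LinearMap.smul_apply, Module.End.one_apply] at this
    rw [sub_eq_iff_eq_add] at this
    rw [this, show -1 + n + 1 = n + 1 - 1 by ring, ← Int.cast_smul_eq_zsmul ℂ,
      -- `m^3 - m` vanishes at `m = -1`, so there is no central contribution.
      show (if -1 + n = 0 then c / 12 * (((-1 : ℤ) : ℂ) ^ 3 - ((-1 : ℤ) : ℂ)) else 0) = 0 by
        split_ifs <;> norm_num, zero_smul, add_zero]
    push_cast
    module

/-- In the recursive formula for `L_n x` the left half vanishes by induction and the right half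
because `L_n` kills the vacuum for `n ≥ -1`. -/
theorem Y_virVac_apply (a : Vir c) {k : ℤ} : 0 ≤ k → ((virSelf c).Y a).1 k (virVac c) = 0 := by
  intro hk
  let S : Submodule ℂ (Vir c) :=
    { carrier := {b | ∀ k : ℤ, 0 ≤ k → ((virSelf c).Y b).1 k (virVac c) = 0}
      add_mem' := fun {a b} ha hb k hk => by
        rw [map_add]
        change ((virSelf c).Y a).1 k (virVac c) + ((virSelf c).Y b).1 k (virVac c) = 0
        rw [ha k hk, hb k hk, add_zero]
      zero_mem' := fun k _ => by rw [map_zero]; rfl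
      smul_mem' := fun r a ha k hk => by
        rw [map_smul]
        change r • ((virSelf c).Y a).1 k (virVac c) = 0
        rw [ha k hk]
        exact smul_zero (A := Vir c) r }
  suffices S = ⊤ from (this ▸ Submodule.mem_top : a ∈ S) k hk
  refine vir_eq_top (fun k hk => ?_) fun n x hx k hk => ?_
  · rw [Y_vac, idFld_apply, if_neg (by omega)]
  · rw [Y_virL]
    change (lmap (virSelf c).W (n + 1) ((virSelf c).Y x)).1 k (virVac c) -
      sg (n + 1) • (rmap (virSelf c).W (n + 1) ((virSelf c).Y x)).1 k (virVac c) = 0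
    rw [lmap_apply, rmap_apply, bsum_congr _ fun i => by rw [hx _ (by omega), map_zero], bsum_zero,
      bsum_congr _ fun i => by
        rw [show (virSelf c).W.1 i (virVac c) = 0 from virL_smul_virVac (by omega), map_zero],
      bsum_zero, smul_zero, sub_zero]

theorem Y_creation (a : Vir c) : ((virSelf c).Y a).1 (-1) (virVac c) = a := by
  let S : Submodule ℂ (Vir c) := LinearMap.eqLocus
    (LinearMap.applyₗ (virVac c) ∘ₗ LinearMap.proj (-1) ∘ₗ (Fld (Vir c)).subtype ∘ₗ (virSelf c).Y)
    LinearMap.id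
  suffices S = ⊤ from (this ▸ Submodule.mem_top : a ∈ S)
  refine vir_eq_top ?_ fun n x hx => ?_
  · change ((virSelf c).Y (virVac c)).1 (-1) (virVac c) = virVac c
    rw [Y_vac, idFld_apply, if_pos rfl]
  · change ((virSelf c).Y (virL c n • x)).1 (-1) (virVac c) = virL c n • x
    have hx' : ((virSelf c).Y x).1 (-1) (virVac c) = x := hx
    rw [Y_virL]
    change (lmap (virSelf c).W (n + 1) ((virSelf c).Y x)).1 (-1) (virVac c) -
      sg (n + 1) • (rmap (virSelf c).W (n + 1) ((virSelf c).Y x)).1 (-1) (virVac c) = _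
    have hr : (rmap (virSelf c).W (n + 1) ((virSelf c).Y x)).1 (-1) (virVac c) = 0 := by
      rw [rmap_apply, bsum_congr (n + 1) (fun i => by
        rw [show (virSelf c).W.1 i (virVac c) = 0 from virL_smul_virVac (by omega), map_zero]),
        bsum_zero]
    rw [hr, smul_zero, sub_zero, lmap_apply, bsum, finsum_eq_single _ 0]
    · simp only [pow_zero, Ring.choose_zero_right, one_mul, one_smul, Nat.cast_zero, sub_zero,
        add_zero, hx', W_apply, add_sub_cancel_right]
      rfl
    · intro i hi
      rw [Y_virVac_apply x (by omega), map_zero, smul_zero]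

/-- Induction on `k` by passing from `a` to `L_{-1} a`: both sides become derivatives and pick up
the same nonzero factor `k + 1`, which is cancelled. -/
theorem nprod_idFld_right_eq (a : Vir c) (k : ℕ) :
    R.Y (((virSelf c).Y a).1 (-1 - k) (virVac c)) = nprod (R.Y a) (-1 - k) (idFld M) := by
  induction k generalizing a with
  | zero => rw [Nat.cast_zero, sub_zero, Y_creation, nprod_idFld_right_neg_one]
  | succ k ih =>
    have h := ih (virL c (-1) • a)
    rw [Y_translation, Y_translation, nprod_dfld_left, dfld_apply, map_zsmul,
      show (-1 : ℤ) - k - 1 = -1 - (k + 1 : ℕ) by push_cast; ring] at h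
    have hk : (-(-1 - k) : ℤ) ≠ 0 := by omega
    have h' : ((-(-1 - k) : ℤ) : ℂ) ≠ 0 := by exact_mod_cast hk
    rw [← Int.cast_smul_eq_zsmul ℂ, ← Int.cast_smul_eq_zsmul ℂ] at h
    exact smul_right_injective _ h' h

/-- The vertex operators of the products in `Vir c` are the products of the vertex operators. -/
theorem Y_Y (a b : Vir c) (l : ℤ) :
    R.Y (((virSelf c).Y a).1 l b) = nprod (R.Y a) l (R.Y b) := by
  let S : Submodule ℂ (Vir c) :=
    { carrier := {b | ∀ a l, R.Y (((virSelf c).Y a).1 l b) = nprod (R.Y a) l (R.Y b)}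
      add_mem' := fun {x y} hx hy a l => by rw [map_add, map_add, hx, hy, map_add, map_add]
      zero_mem' := fun a l => by rw [map_zero, map_zero, map_zero]
      smul_mem' := fun r x hx a l => by rw [map_smul, map_smul, hx, map_smul, map_smul] }
  suffices S = ⊤ from (this ▸ Submodule.mem_top : b ∈ S) a l
  refine vir_eq_top (fun a l => ?_) fun n x hx a l => ?_
  · rw [Y_vac]
    rcases le_or_gt 0 l with h | h
    · rw [Y_virVac_apply a h, map_zero, nprod_idFld_right_of_nonneg _ h]
    · obtain ⟨k, hk⟩ := Int.eq_ofNat_of_zero_le (show 0 ≤ -1 - l by omega)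
      obtain rfl : l = -1 - k := by omega
      exact R.nprod_idFld_right_eq a k
  -- The commutator of `L_n` with `a_(l)` on `Vir c`, and of the corresponding product operators on
  -- fields, are given by the same formula. One common `N` makes the two sums match term by term.
  · obtain ⟨N₁, h₁⟩ := ((virSelf c).local_Y_W a).symm
    obtain ⟨N₂, h₂⟩ := (R.local_Y_W a).symm
    set N := max N₁ N₂
    have h₁' : LocalAt (virSelf c).W ((virSelf c).Y a) N := h₁.of_le (by simp [N])
    have h₂' : LocalAt R.W (R.Y a) N := h₂.of_le (by simp [N])
    have e1 := LinearMap.congr_fun (h₁'.commutator (n + 1) l) x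
    simp only [LinearMap.sub_apply, Module.End.mul_apply, LinearMap.sum_apply] at e1
    have e2 := nprod_nprod h₂'.commutator (R.Y x) (n + 1) l
    have e3 : ((virSelf c).Y a).1 l (virL c n • x) =
        ((virSelf c).Y a).1 l ((virSelf c).W.1 (n + 1) x) := by
      rw [W_apply, add_sub_cancel_right]
      rfl
    have e4 : ∀ y, (virSelf c).W.1 (n + 1) y = virL c n • y := by
      intro y
      rw [W_apply, add_sub_cancel_right]
      rfl
    rw [e3, Y_virL]
    rw [sub_eq_iff_eq_add, ← sub_eq_iff_eq_add'] at e1 e2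
    rw [← e1, ← e2, map_sub, e4, Y_virL, hx, map_sum]
    congr 1
    refine Finset.sum_congr rfl fun r _ => ?_
    -- The products in the commutator formula are vertex operators of `L_{r-1} a`, to which the
    -- induction hypothesis for `x` applies; hence `a` and `l` are quantified inside `S`.
    have hW : ∀ R' : VirRep c (Vir c), nprod R'.W r (R'.Y a) = R'.Y (virL c (r - 1) • a) := by
      intro R'
      rw [Y_virL, sub_add_cancel]
    rw [LinearMap.smul_apply, map_zsmul, hW, hx, Y_virL, sub_add_cancel]

/-- The Jacobi identity for the vertex operators of elements of `Vir c`. -/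
theorem jacobi (a b : Vir c) (l m n : ℤ) : jprod (R.Y a) (R.Y b) l m n =
    ∑ᶠ i : ℕ, Ring.choose m i • (R.Y (((virSelf c).Y a).1 (l + i) b)).1 (m + n - i) := by
  obtain ⟨N, h⟩ := R.local_Y_Y a b
  rw [h.jacobi]
  simp only [Y_Y]

end VirRep

end VirasoroField

/-- Split off the `p`-component. The remainder lies in `E p` and in the sum of the other `E i`,
hence is zero. Used to show that gradings by eigenvalues and gradings by spans of monomials agree.
-/
theorem mem_of_mem_iSup_of_iSupIndep {X ι : Type*} [AddCommGroup X] [Module ℂ X]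
    {E S : ι → Submodule ℂ X} (hE : iSupIndep E) (hS : ∀ i, S i ≤ E i) {p : ι} {x : X}
    (hx : x ∈ E p) (hx' : x ∈ ⨆ i, S i) : x ∈ S p := by
  rw [iSup_split_single S p, Submodule.mem_sup] at hx'
  obtain ⟨t, ht, s, hs, rfl⟩ := hx'
  have h1 : s ∈ E p := by
    have := (E p).sub_mem hx (hS p ht)
    rwa [add_sub_cancel_left] at this
  have h2 : s ∈ ⨆ (i) (_ : i ≠ p), E i := iSup₂_mono (fun i _ => hS i) hs
  rw [Submodule.disjoint_def.1 (hE p) s h1 h2, add_zero]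
  exact ht

/-! ### The triangular decomposition of the Virasoro algebra -/

section Triangular

variable (c : ℂ)

/-- Monomials of degree `p` in the generators `L_n`, where `L_n` has degree `-n`. -/
inductive VirMon : ℤ → VirAlg c → Prop
  | one : VirMon 0 1
  | mul (n p : ℤ) (x : VirAlg c) : VirMon p x → VirMon (p - n) (virL c n * x)

/-- Monomials of degree `d` in the generators `L_n` with `n < 0`. -/
inductive LowMon : ℕ → VirAlg c → Prop
  | one : LowMon 0 1
  | mul (n d : ℕ) (x : VirAlg c) : LowMon d x → LowMon (n + 1 + d) (virL c (-(n + 1)) * x)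

/-- Monomials of degree `-e` in the generators `L_n` with `n > 0`. -/
inductive HighMon : ℕ → VirAlg c → Prop
  | one : HighMon 0 1
  | mul (n e : ℕ) (x : VirAlg c) : HighMon e x → HighMon (n + 1 + e) (virL c (n + 1) * x)

/-- The span of the products of a monomial in the `L_n` with `n < 0`, a polynomial in `L_0` and a
monomial in the `L_n` with `n > 0`. -/
def triSpan (p : ℤ) : Submodule ℂ (VirAlg c) :=
  Submodule.span ℂ {z | ∃ d e x y, ∃ g : Polynomial ℂ, LowMon c d x ∧ HighMon c e y ∧
    (d : ℤ) - e = p ∧ z = x * (Polynomial.aeval (virL c 0) g * y)}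

variable {c}

theorem mul_mem_triSpan {p : ℤ} {a z : VirAlg c} (n : ℕ) (ha : a = virL c (-(n + 1)))
    (hz : z ∈ triSpan c p) : a * z ∈ triSpan c (p + (n + 1)) := by
  subst ha
  induction hz using Submodule.span_induction with
  | mem z hz =>
    obtain ⟨d, e, x, y, g, hx, hy, hp, rfl⟩ := hz
    refine Submodule.subset_span ⟨n + 1 + d, e, _, y, g, hx.mul n, hy, ?_, (mul_assoc _ _ _).symm⟩
    push_cast
    omega
  | zero => rw [mul_zero]; exact zero_mem _
  | add x y _ _ hx hy => rw [mul_add]; exact add_mem hx hy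
  | smul r x _ hx => rw [mul_smul_comm]; exact Submodule.smul_mem _ r hx

/-- A consequence of `L_n L_0 = (L_0 + n) L_n`; it lets raising and lowering operators pass
polynomials in `L_0`. -/
theorem virL_mul_aeval (n : ℤ) (g : Polynomial ℂ) : virL c n * Polynomial.aeval (virL c 0) g =
    Polynomial.aeval (virL c 0) (g.comp (Polynomial.X + Polynomial.C (n : ℂ))) * virL c n := by
  induction g using Polynomial.induction_on' with
  | add p q hp hq => rw [map_add, mul_add, hp, hq, Polynomial.add_comp, map_add, add_mul]
  | monomial k r =>
    have h0 : virL c n * virL c 0 = (virL c 0 + (n : ℂ) • 1) * virL c n := by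
      rw [virL_mul, add_mul, smul_mul_assoc, one_mul, add_zero, Int.cast_zero, sub_zero]
      split_ifs with h
      · subst h; simp
      · rw [zero_smul, add_zero]
    have hk : virL c n * virL c 0 ^ k = (virL c 0 + (n : ℂ) • 1) ^ k * virL c n := by
      induction k with
      | zero => simp
      | succ k ih => rw [pow_succ, ← mul_assoc, ih, mul_assoc, h0, pow_succ, mul_assoc]
    rw [Polynomial.aeval_monomial, Polynomial.monomial_comp, map_mul, map_pow, map_add,
      Polynomial.aeval_X, Polynomial.aeval_C, Polynomial.aeval_C, ← mul_assoc,
      ← Algebra.commutes r (virL c n), mul_assoc, hk, mul_assoc,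
      Algebra.algebraMap_eq_smul_one (n : ℂ)]

/-- Straightening by induction on the lowering monomial: commuting `L_m` past its first factor
leaves shorter lowering monomials. The index `m` must be general because the bracket produces a new
`L`. -/
theorem virL_mul_mem_triSpan_of_mon {d e : ℕ} {x y : VirAlg c} (hx : LowMon c d x)
    (hy : HighMon c e y) (g : Polynomial ℂ) (m : ℤ) :
    virL c m * (x * (Polynomial.aeval (virL c 0) g * y)) ∈ triSpan c ((d : ℤ) - e - m) := by
  induction hx generalizing m with
  | one =>
    rcases lt_trichotomy m 0 with hm | rfl | hm
    · obtain ⟨n, rfl⟩ : ∃ n : ℕ, m = -((n : ℤ) + 1) := ⟨(-m - 1).toNat, by omega⟩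
      refine Submodule.subset_span ⟨n + 1 + 0, e, _, y, g, LowMon.one.mul n, hy, ?_, ?_⟩
      · push_cast; ring
      · rw [one_mul, mul_one]
    · refine Submodule.subset_span ⟨0, e, 1, y, Polynomial.X * g, LowMon.one, hy, ?_, ?_⟩
      · push_cast; ring
      · rw [one_mul, one_mul, map_mul, Polynomial.aeval_X, mul_assoc]
    · obtain ⟨n, rfl⟩ : ∃ n : ℕ, m = (n : ℤ) + 1 := ⟨(m - 1).toNat, by omega⟩
      refine Submodule.subset_span ⟨0, n + 1 + e, 1, _,
        g.comp (Polynomial.X + Polynomial.C (((n : ℤ) + 1 : ℤ) : ℂ)), LowMon.one, hy.mul n, ?_, ?_⟩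
      · push_cast; ring
      · rw [one_mul, one_mul, ← mul_assoc, virL_mul_aeval, mul_assoc]
  | mul n d x hx ih =>
    rw [mul_assoc, ← mul_assoc (virL c m), virL_mul, add_mul, add_mul, smul_mul_assoc,
      smul_mul_assoc, one_mul, mul_assoc]
    refine add_mem ?_ (add_mem (Submodule.smul_mem _ _ ?_) ?_)
    · have := mul_mem_triSpan n rfl (ih m)
      rwa [show (d : ℤ) - e - m + (n + 1) = ((n + 1 + d : ℕ) : ℤ) - e - m by push_cast; ring] at this
    · have := ih (m + -(n + 1))
      rwa [show (d : ℤ) - e - (m + -(n + 1)) = ((n + 1 + d : ℕ) : ℤ) - e - m by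
        push_cast; ring] at this
    · split_ifs with h
      · refine Submodule.smul_mem _ _ (Submodule.subset_span ⟨d, e, x, y, g, hx, hy, ?_, rfl⟩)
        push_cast; omega
      · rw [zero_smul]; exact zero_mem _

/-- Only spanning is needed here, so the factors within each half need not be ordered; independence
is tested later on Verma modules. -/
theorem VirMon.mem_triSpan {p : ℤ} {x : VirAlg c} (hx : VirMon c p x) : x ∈ triSpan c p := by
  induction hx with
  | one => exact Submodule.subset_span ⟨0, 0, 1, 1, 1, .one, .one, by simp, by simp⟩
  | mul n p x _ ih =>
    clear * - ih
    induction ih using Submodule.span_induction with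
    | mem z hz =>
      obtain ⟨d, e, x, y, g, hx, hy, rfl, rfl⟩ := hz
      exact virL_mul_mem_triSpan_of_mon hx hy g n
    | zero => rw [mul_zero]; exact zero_mem _
    | add x y _ _ hx hy => rw [mul_add]; exact add_mem hx hy
    | smul r x _ hx => rw [mul_smul_comm]; exact Submodule.smul_mem _ r hx

theorem LowMon.eq_one {x : VirAlg c} (h : LowMon c 0 x) : x = 1 := by
  generalize hd : 0 = d at h
  cases h with
  | one => rfl
  | mul n d x hx => omega

theorem LowMon.eq_virL {x : VirAlg c} (h : LowMon c 1 x) : x = virL c (-1) := by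
  generalize hd : 1 = d at h
  cases h with
  | one => omega
  | mul n d x hx =>
    obtain rfl : n = 0 := by omega
    obtain rfl : d = 0 := by omega
    rw [hx.eq_one, mul_one]
    norm_num

theorem HighMon.eq_one {x : VirAlg c} (h : HighMon c 0 x) : x = 1 := by
  generalize hd : 0 = d at h
  cases h with
  | one => rfl
  | mul n d x hx => omega

theorem HighMon.eq_virL {x : VirAlg c} (h : HighMon c 1 x) : x = virL c 1 := by
  generalize hd : 1 = d at h
  cases h with
  | one => omega
  | mul n d x hx =>
    obtain rfl : n = 0 := by omega
    obtain rfl : d = 0 := by omega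
    rw [hx.eq_one, mul_one]
    norm_num

theorem VirMon.high {e : ℕ} {x : VirAlg c} (h : HighMon c e x) : VirMon c (-e) x := by
  induction h with
  | one => exact VirMon.one
  | mul n e x _ ih =>
    have := ih.mul (n + 1)
    rwa [show (-e : ℤ) - (n + 1) = -((n + 1 + e : ℕ) : ℤ) by push_cast; ring] at this

theorem VirMon.low {d : ℕ} {x : VirAlg c} (h : LowMon c d x) : VirMon c d x := by
  induction h with
  | one => exact VirMon.one
  | mul n d x _ ih =>
    have := ih.mul (-(n + 1))
    rwa [show (d : ℤ) - -((n : ℤ) + 1) = ((n + 1 + d : ℕ) : ℤ) by push_cast; ring] at this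

theorem VirMon.virL_zero_mul {p : ℤ} {x : VirAlg c} (h : VirMon c p x) :
    virL c 0 * x = x * virL c 0 + (p : ℂ) • x := by
  induction h with
  | one => simp
  | mul n p x _ ih =>
    have h0 : virL c 0 * virL c n = virL c n * virL c 0 + (-n : ℂ) • virL c n := by
      rw [virL_mul]
      simp
    rw [← mul_assoc, h0, add_mul, mul_assoc, ih, mul_add, mul_smul_comm, smul_mul_assoc, mul_assoc,
      add_assoc, ← add_smul]
    push_cast
    ring_nf

end Triangular

/-! ### Highest weight modules -/

section HighestWeight

variable {c h : ℂ} {X : Type*} [AddCommGroup X] [Module ℂ X] [Module (VirAlg c) X]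
  [IsScalarTower ℂ (VirAlg c) X]

variable (c h) in
/-- `X` is generated by the highest weight vector `v` of weight `h`. -/
structure IsHighestWeight (v : X) : Prop where
  gen : ∀ x, ∃ a : VirAlg c, x = a • v
  pos : ∀ n : ℤ, 0 < n → virL c n • v = 0
  zero : virL c 0 • v = h • v

variable (c h X) in
/-- The part of degree `q` of a highest weight module of weight `h`. -/
def hwGr (q : ℤ) : Submodule ℂ X := Module.End.eigenspace (lsmulL c X 0) (h + q)

theorem mem_hwGr {q : ℤ} {x : X} : x ∈ hwGr c h X q ↔ virL c 0 • x = (h + q) • x :=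
  Module.End.mem_eigenspace_iff

theorem hwGr_iSupIndep : iSupIndep (hwGr c h X) := by
  have : Module.IsTorsionFree ℂ X := inferInstance
  exact (Module.End.eigenspaces_iSupIndep (lsmulL c X 0)).comp (f := fun q : ℤ => h + (q : ℂ))
    fun p q hpq => by simpa using hpq

theorem virL_smul_mem_hwGr (n : ℤ) {q : ℤ} {x : X} (hx : x ∈ hwGr c h X q) :
    virL c n • x ∈ hwGr c h X (q - n) := by
  rw [mem_hwGr] at hx ⊢
  have h0 : virL c 0 * virL c n = virL c n * virL c 0 + (-n : ℂ) • virL c n := by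
    rw [virL_mul]
    simp
  rw [← mul_smul, h0, add_smul, mul_smul, hx, smul_assoc, smul_comm, ← add_smul]
  congr 1
  push_cast
  ring

/-- The span of the monomials of degree `q` in the `L_n` with `n < 0`, applied to `v`. -/
def lowSub (c : ℂ) {X : Type*} [AddCommGroup X] [Module ℂ X] [Module (VirAlg c) X]
    (v : X) (q : ℤ) : Submodule ℂ X :=
  Submodule.span ℂ {y | ∃ d : ℕ, ∃ x : VirAlg c, (d : ℤ) = q ∧ LowMon c d x ∧ y = x • v}

theorem IsHighestWeight.lowSub_le {v : X} (hv : IsHighestWeight c h v) (q : ℤ) :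
    lowSub c v q ≤ hwGr c h X q := by
  rw [lowSub, Submodule.span_le]
  rintro _ ⟨d, x, rfl, hx, rfl⟩
  rw [SetLike.mem_coe, mem_hwGr, ← mul_smul, (VirMon.low hx).virL_zero_mul, add_smul, mul_smul,
    hv.zero, smul_comm, smul_assoc, ← add_smul]

/-- Apply the triangular decomposition to `v`: the raising part acts as a scalar, `L_0` acts by `h`,
and only lowering monomials survive. -/
theorem IsHighestWeight.iSup_lowSub {v : X} (hv : IsHighestWeight c h v) :
    ⨆ q, lowSub c v q = ⊤ := by
  have hmem : ∀ {d : ℕ} {x : VirAlg c}, LowMon c d x → x • v ∈ ⨆ q, lowSub c v q := fun hx =>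
    Submodule.mem_iSup_of_mem _ (Submodule.subset_span ⟨_, _, rfl, hx, rfl⟩)
  have hpoly : ∀ g : Polynomial ℂ, Polynomial.aeval (virL c 0) g • v = g.eval h • v := by
    intro g
    induction g using Polynomial.induction_on' with
    | add p q hp hq => rw [map_add, add_smul, hp, hq, Polynomial.eval_add, add_smul]
    | monomial k r =>
      have hk : virL c 0 ^ k • v = h ^ k • v := by
        induction k with
        | zero => simp
        | succ k ih => rw [pow_succ, mul_smul, hv.zero, smul_comm, ih, smul_smul, pow_succ']
      rw [Polynomial.aeval_monomial, Polynomial.eval_monomial, mul_smul, hk, algebraMap_smul,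
        smul_smul]
  have hhigh : ∀ {e : ℕ} {y : VirAlg c}, HighMon c e y → y • v ∈ Submodule.span ℂ {v} := by
    intro e y hy
    induction hy with
    | one => rw [one_smul]; exact Submodule.mem_span_singleton_self v
    | mul n e y _ ih =>
      obtain ⟨r, hr⟩ := Submodule.mem_span_singleton.1 ih
      rw [mul_smul, ← hr, smul_comm, hv.pos _ (by omega), smul_zero]
      exact zero_mem _
  refine eq_top_iff.2 fun x _ => ?_
  obtain ⟨a, rfl⟩ := hv.gen x
  have htri : ∀ p, ∀ z ∈ triSpan c p, z • v ∈ ⨆ q, lowSub c v q := by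
    intro p z hz
    induction hz using Submodule.span_induction with
    | mem z hz =>
      obtain ⟨d, e, x, y, g, hx, hy, -, rfl⟩ := hz
      obtain ⟨r, hr⟩ := Submodule.mem_span_singleton.1 (hhigh hy)
      rw [mul_smul, mul_smul, ← hr, smul_comm _ r v, hpoly, smul_comm x, smul_comm x]
      exact Submodule.smul_mem _ _ (Submodule.smul_mem _ _ (hmem hx))
    | zero => rw [zero_smul]; exact zero_mem _
    | add x y _ _ hx hy => rw [add_smul]; exact add_mem hx hy
    | smul r x _ hx => rw [smul_assoc]; exact Submodule.smul_mem _ r hx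
  -- The monomials in the `L_n` span the whole algebra, so the claim reduces to homogeneous
  -- elements.
  let S : Submodule ℂ (VirAlg c) := ⨆ p, Submodule.span ℂ {z | VirMon c p z}
  have ha : a • (1 : VirAlg c) ∈ S := by
    refine virAlg_smul_mem S (fun n x hx => ?_) a
      (Submodule.mem_iSup_of_mem 0 (Submodule.subset_span VirMon.one))
    refine Submodule.iSup_induction _ (motive := fun x => virL c n • x ∈ S) hx
      (fun p x hx => ?_) (by rw [smul_zero]; exact zero_mem _)
      (fun x y hx hy => by rw [smul_add]; exact add_mem hx hy)
    refine Submodule.mem_iSup_of_mem (p - n) ?_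
    induction hx using Submodule.span_induction with
    | mem z hz => exact Submodule.subset_span (hz.mul n)
    | zero => rw [smul_zero]; exact zero_mem _
    | add x y _ _ hx hy => rw [smul_add]; exact add_mem hx hy
    | smul r x _ hx => rw [smul_comm]; exact Submodule.smul_mem _ r hx
  rw [smul_eq_mul, mul_one] at ha
  refine Submodule.iSup_induction _ (motive := fun a : VirAlg c => a • v ∈ ⨆ q, lowSub c v q) ha
    (fun p x hx => ?_) (by rw [zero_smul]; exact zero_mem _)
    (fun x y hx hy => by rw [add_smul]; exact add_mem hx hy)
  exact htri p x ((Submodule.span_le.2 fun z hz => VirMon.mem_triSpan hz) hx)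

/-- The spans of lowering monomials exhaust the module and sit inside independent eigenspaces, so
each fills its eigenspace. -/
theorem IsHighestWeight.hwGr_eq {v : X} (hv : IsHighestWeight c h v) (q : ℤ) :
    hwGr c h X q = lowSub c v q := by
  refine le_antisymm (fun x hx => ?_) (hv.lowSub_le q)
  exact mem_of_mem_iSup_of_iSupIndep hwGr_iSupIndep hv.lowSub_le hx
    (hv.iSup_lowSub ▸ Submodule.mem_top)

theorem IsHighestWeight.hwGr_neg {v : X} (hv : IsHighestWeight c h v) {q : ℤ} (hq : q < 0) :
    hwGr c h X q = ⊥ := by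
  rw [hv.hwGr_eq, lowSub, Submodule.span_eq_bot]
  rintro _ ⟨d, x, hd, -, -⟩
  omega

theorem IsHighestWeight.hwGr_zero {v : X} (hv : IsHighestWeight c h v) :
    hwGr c h X 0 = Submodule.span ℂ {v} := by
  rw [hv.hwGr_eq, lowSub]
  congr 1
  ext y
  constructor
  · rintro ⟨d, x, hd, hx, rfl⟩
    obtain rfl : d = 0 := by omega
    rw [hx.eq_one, one_smul]
    rfl
  · rintro rfl
    exact ⟨0, 1, rfl, .one, (one_smul _ _).symm⟩

theorem IsHighestWeight.iSup_hwGr {v : X} (hv : IsHighestWeight c h v) :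
    ⨆ q : ℕ, hwGr c h X q = ⊤ := by
  rw [eq_top_iff, ← hv.iSup_lowSub]
  refine iSup_le fun q => ?_
  rw [← hv.hwGr_eq]
  rcases lt_or_ge q 0 with hq | hq
  · rw [hv.hwGr_neg hq]
    exact bot_le
  · obtain ⟨d, rfl⟩ := Int.eq_ofNat_of_zero_le hq
    exact le_iSup (fun q : ℕ => hwGr c h X q) d

/-- The part of degree `d > 0` is contained in the sum of the images under `L_{-(n+1)}`, `n < d`, of
the parts of degree `d - 1 - n`. -/
theorem lowSub_finite (v : X) (d : ℕ) : Module.Finite ℂ (lowSub c v (d : ℤ)) := by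
  induction d using Nat.strong_induction_on with
  | _ d ih =>
    rcases Nat.eq_zero_or_pos d with rfl | hd
    · refine Submodule.finiteDimensional_of_le (S₂ := Submodule.span ℂ {v}) ?_
      rw [lowSub, Submodule.span_le]
      rintro _ ⟨d, x, hd, hx, rfl⟩
      obtain rfl : d = 0 := by omega
      rw [hx.eq_one, one_smul]
      exact Submodule.mem_span_singleton_self v
    · have : ∀ n : Fin d, Module.Finite ℂ ((lowSub c v ((d - 1 - n : ℕ) : ℤ)).map
          (lsmulL c X (-((n : ℤ) + 1)))) := fun n => by
        have := ih (d - 1 - n) (by omega)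
        infer_instance
      refine Submodule.finiteDimensional_of_le (S₂ := ⨆ n : Fin d,
        (lowSub c v ((d - 1 - n : ℕ) : ℤ)).map (lsmulL c X (-((n : ℤ) + 1)))) ?_
      rw [lowSub, Submodule.span_le]
      rintro _ ⟨d', x, hd', hx, rfl⟩
      cases hx with
      | one => omega
      | mul n e x hx =>
        refine Submodule.mem_iSup_of_mem ⟨n, by omega⟩ ⟨x • v, Submodule.subset_span
          ⟨e, x, ?_, hx, rfl⟩, ?_⟩
        · simp only
          omega
        · rw [lsmulL_apply, mul_smul]

theorem IsHighestWeight.hwGr_finite {v : X} (hv : IsHighestWeight c h v) (d : ℕ) :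
    Module.Finite ℂ (hwGr c h X (d : ℤ)) := by
  rw [hv.hwGr_eq]
  exact lowSub_finite v d

/-- A highest weight module, as a representation. -/
def IsHighestWeight.rep {v : X} (hv : IsHighestWeight c h v) : VirRep c X :=
  virRepOfGenerator v hv.gen ⟨1, fun n hn => hv.pos n (by omega)⟩

theorem isHighestWeight_virVac : IsHighestWeight c 0 (virVac c) where
  gen x := by
    obtain ⟨a, rfl⟩ := Submodule.Quotient.mk_surjective _ x
    exact ⟨a, (smul_virVac a).symm⟩
  pos n hn := virL_smul_virVac (by omega)
  zero := (virL_smul_virVac (by omega)).trans (zero_smul ℂ (virVac c)).symm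

/-- The operators `a_(m)` are homogeneous. -/
theorem Y_mem_hwGr (R : VirRep c X) (hR : R.L = lsmulL c X) {k : ℕ} {a : Vir c}
    (ha : virL c 0 • a = (k : ℂ) • a) (m : ℤ) {q : ℤ} {x : X} (hx : x ∈ hwGr c h X q) :
    (R.Y a).1 m x ∈ hwGr c h X (q + k - m - 1) := by
  obtain ⟨N, hN⟩ := (R.local_Y_W a).symm
  -- The commutator with mode `1` of `L(z)`, that is with `L_0`, involves only the products `0` and
  -- `1`, since `(1 choose i) = 0` for `i ≥ 2`. The bound `N + 2` guarantees that both are in range.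
  have hN' : LocalAt R.W (R.Y a) (N + 2) := hN.of_le (by simp)
  have e := LinearMap.congr_fun (hN'.commutator 1 m) x
  have e' : ∑ i ∈ Finset.range (N + 2), (Ring.choose (1 : ℤ) i •
      (nprod R.W i (R.Y a)).1 (1 + m - i)) x = (k - m - 1 : ℂ) • (R.Y a).1 m x := by
    have h0 : nprod R.W 0 (R.Y a) = dfld (R.Y a) := by
      rw [← VirRep.Y_translation, VirRep.Y_virL, neg_add_cancel]
    have h1 : nprod R.W 1 (R.Y a) = (k : ℂ) • R.Y a := by
      rw [← map_smul, ← ha, VirRep.Y_virL, zero_add]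
    rw [Finset.sum_range_succ', Finset.sum_range_succ', Finset.sum_eq_zero]
    · simp only [Nat.cast_zero, zero_add, sub_zero, Ring.choose_zero_right, one_smul,
        Nat.cast_one, Ring.choose_one_right, h0, h1, dfld_apply]
      change (k : ℂ) • (R.Y a).1 (1 + m - 1) x + _ = _
      rw [show 1 + m - 1 = m by ring, ← Int.cast_smul_eq_zsmul ℂ, ← add_smul]
      congr 1
      push_cast
      ring
    · intro i _
      rw [show (1 : ℤ) = (1 : ℕ) by rfl, Ring.choose_natCast, Nat.choose_eq_zero_of_lt (by omega),
        Nat.cast_zero, zero_smul, LinearMap.zero_apply]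
  rw [LinearMap.sum_apply, e'] at e
  rw [mem_hwGr] at hx ⊢
  have hW : ∀ y, R.W.1 1 y = virL c 0 • y := fun y => by
    rw [VirRep.W_apply, hR, sub_self]
    rfl
  rw [LinearMap.sub_apply, Module.End.mul_apply, Module.End.mul_apply, hW, hW, hx, map_smul,
    sub_eq_iff_eq_add, ← add_smul] at e
  rw [e]
  congr 1
  push_cast
  ring

end HighestWeight

/-! ### The free field realization -/

section Heisenberg

variable {M : Type*} [AddCommGroup M] [Module ℂ M]

/-- The noncommutative Wick formula. For `l ≥ 0` the binomials `(l choose r)` cut the sum at `r =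
l`, whatever the order of locality. -/
theorem nprod_nprod_nat {A B : Fld M} (h : Local A B) (C : Fld M) (l : ℕ) (n : ℤ) :
    nprod A l (nprod B n C) = nprod B n (nprod A l C) +
      ∑ r ∈ Finset.range (l + 1), (l.choose r) • nprod (nprod A r B) (l + n - r) C := by
  obtain ⟨N, hN⟩ := h
  have hN' : LocalAt A B (N + (l + 1)) := hN.of_le (by push_cast; omega)
  have := nprod_nprod hN'.commutator C l n
  rw [sub_eq_iff_eq_add'] at this
  rw [this, add_comm N, Finset.sum_range_add, Finset.sum_eq_zero (s := Finset.range N), add_zero]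
  · congr 1
    refine Finset.sum_congr rfl fun r _ => ?_
    rw [Ring.choose_natCast, natCast_zsmul]
  · intro r _
    rw [Ring.choose_natCast, Nat.choose_eq_zero_of_lt (by omega), Nat.cast_zero, zero_smul]

theorem nprod_dfld_right (A C : Fld M) (l : ℤ) :
    nprod A l (dfld C) = dfld (nprod A l C) + l • nprod A (l - 1) C := by
  rw [dfld_nprod, sub_add_cancel]

theorem dfld_idFld : dfld (idFld M) = 0 := by
  refine Fld.ext' fun n v => ?_
  rw [dfld_apply, idFld_apply]
  split_ifs with h
  · obtain rfl : n = 0 := by omega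
    simp
  · simp

/-- The derivative is the product `A_(-2) 1` with the identity field, so Dong's lemma applies. -/
theorem Local.dfld {A C : Fld M} (h : Local A C) : Local (dfld A) C := by
  have e : VOA.dfld A = VOA.nprod A (-2) (idFld M) := by
    have := nprod_dfld_left A (idFld M) (-1)
    rwa [nprod_idFld_right_neg_one, neg_neg, one_smul] at this
  rw [e]
  exact (VirRep.local_id A).symm.nprod h (VirRep.local_id C) _

theorem idFld_val (n : ℤ) : (idFld M).1 n = (if n = -1 then (1 : ℂ) else 0) • 1 := by
  change (if n = -1 then (1 : Module.End ℂ M) else 0) = _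
  split_ifs <;> simp

variable {A : Fld M} (hA : ∀ m n, A.1 m * A.1 n - A.1 n * A.1 m =
  (if m + n = 0 then (m : ℂ) else 0) • 1)

include hA

theorem jprod_heis_one (m n : ℤ) :
    jprod A A 1 m n = (if m + n = -1 then (1 : ℂ) else 0) • 1 := by
  rw [show (1 : ℤ) = 0 + 1 by ring, jprod_succ, jprod_zero, jprod_zero, hA, hA, ← sub_smul]
  congr 1
  by_cases h : m + n = -1
  · rw [if_pos (by omega), if_pos (by omega), if_pos (by omega)]
    push_cast; ring
  · rw [if_neg (by omega), if_neg (by omega), if_neg (by omega), sub_zero]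

theorem localAt_heis : LocalAt A A 2 := by
  intro m n
  rw [show ((2 : ℕ) : ℤ) = 1 + 1 by norm_num, jprod_succ, jprod_heis_one hA, jprod_heis_one hA,
    show m + 1 + n = m + (n + 1) by ring, sub_self]

theorem nprod_heis_zero : nprod A 0 A = 0 := by
  refine Subtype.ext (funext fun n => ?_)
  rw [nprod_val, jprod_zero, hA]
  simp only [Int.cast_zero, ite_self, zero_smul]
  rfl

theorem nprod_heis_one : nprod A 1 A = idFld M := by
  refine Subtype.ext (funext fun n => ?_)
  rw [nprod_val, jprod_heis_one hA, zero_add, idFld_val]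

theorem nprod_heis_of_two_le {r : ℤ} (hr : 2 ≤ r) : nprod A r A = 0 :=
  Subtype.ext (funext fun n => (localAt_heis hA).of_le (by simpa using hr) 0 n)

omit hA in
variable (A) in
/-- The Virasoro field of a free field `A` with background charge `μ`. -/
def heisField (μ : ℂ) : Fld M := (1 / 2 : ℂ) • nprod A (-1) A + μ • dfld A

variable (μ : ℂ)

theorem nprod_heis_sq (k : ℕ) :
    nprod A k (nprod A (-1) A) = if k = 1 then (2 : ℂ) • A else 0 := by
  rw [nprod_nprod_nat ⟨2, localAt_heis hA⟩]
  rcases k with - | k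
  · simp [nprod_heis_zero hA, nprod_zero_left]
  · rw [Finset.sum_range_succ', Finset.sum_range_succ', Finset.sum_eq_zero]
    · rw [zero_add, zero_add, Nat.cast_one, nprod_heis_one hA, Nat.cast_zero, nprod_heis_zero hA,
        nprod_zero_left, smul_zero, add_zero, nprod_idFld_left]
      rcases k with - | k
      · rw [Nat.cast_one, nprod_heis_one hA, nprod_idFld_right_neg_one, if_pos (by norm_num),
          if_pos rfl, zero_add, Nat.choose_self, one_smul, two_smul]
      · rw [nprod_heis_of_two_le hA (by push_cast; omega), map_zero, zero_add,
          if_neg (by push_cast; omega), if_neg (by omega), smul_zero]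
    · intro r _
      rw [nprod_heis_of_two_le hA (by push_cast; omega), nprod_zero_left, smul_zero]

theorem nprod_heis_heisField (k : ℕ) : nprod A k (heisField A μ) =
    if k = 1 then A else if k = 2 then (2 * μ) • idFld M else 0 := by
  rw [heisField, map_add, map_smul, map_smul, nprod_heis_sq hA, nprod_dfld_right]
  match k with
  | 0 => simp [nprod_heis_zero hA]
  | 1 =>
    simp only [if_true, Nat.cast_one, nprod_heis_one hA, dfld_idFld, sub_self, nprod_heis_zero hA,
      smul_zero, add_zero]
    rw [smul_smul]; norm_num
  | 2 =>
    have e : ((2 : ℕ) : ℤ) - 1 = 1 := by norm_num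
    rw [e, nprod_heis_one hA, nprod_heis_of_two_le hA (by norm_num), if_neg (by norm_num),
      if_neg (by norm_num), if_pos rfl, map_zero, smul_zero, zero_add, zero_add,
      ← Int.cast_smul_eq_zsmul ℂ, smul_smul]
    congr 1
    push_cast; ring
  | k + 3 =>
    rw [nprod_heis_of_two_le hA (by push_cast; omega), nprod_heis_of_two_le hA (by push_cast; omega)]
    simp

theorem local_heis_heisField : Local A (heisField A μ) := by
  have h : Local A A := ⟨2, localAt_heis hA⟩
  exact (((h.nprod h h (-1)).smul_left _).add_left (h.dfld.smul_left μ)).symm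

theorem local_heisField_self : Local (heisField A μ) (heisField A μ) := by
  have h : Local A A := ⟨2, localAt_heis hA⟩
  have h' := local_heis_heisField hA μ
  exact ((h.nprod h' h' (-1)).smul_left _).add_left (h'.dfld.smul_left μ)

/-- The Wick formula gives the products of `A` with the Virasoro field. Reading off this mode
commutator and reversing it gives the products in the opposite order, with no appeal to skew
symmetry. -/
theorem heis_comm_heisField (m n : ℤ) : A.1 m * (heisField A μ).1 n - (heisField A μ).1 n * A.1 m =
    (m : ℂ) • A.1 (m + n - 1) + (if m + n = 1 then μ * (m * (m - 1)) else 0) • 1 := by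
  obtain ⟨N, hN⟩ := local_heis_heisField hA μ
  have hN' : LocalAt A (heisField A μ) (3 + N) := hN.of_le (by simp)
  rw [hN'.commutator, Finset.sum_range_add, Finset.sum_eq_zero (s := Finset.range N), add_zero]
  · have h2 : (2 : ℂ) * (Ring.choose m 2 : ℤ) = m * (m - 1) := by
      have := Ring.descPochhammer_eq_factorial_smul_choose m 2
      simp only [descPochhammer_succ_right, descPochhammer_zero] at this
      simp [Polynomial.smeval_mul, Polynomial.smeval_sub, Polynomial.smeval_X,
        -Nat.cast_ofNat] at this
      have := congrArg (Int.cast (R := ℂ)) this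
      push_cast at this
      linear_combination -this
    have e0 : Ring.choose m 0 • (0 : Fld M).1 (m + n - (0 : ℕ)) = 0 := smul_zero _
    have e2 : Ring.choose m 2 • ((2 * μ) • idFld M).1 (m + n - (2 : ℕ)) =
        (if m + n = 1 then μ * (m * (m - 1)) else 0) • (1 : Module.End ℂ M) := by
      change Ring.choose m 2 • (2 * μ) • (idFld M).1 (m + n - 2) = _
      rw [idFld_val, ← Int.cast_smul_eq_zsmul ℂ, smul_smul, smul_smul]
      congr 1
      by_cases h : m + n = 1
      · rw [if_pos (by omega), if_pos h]
        linear_combination μ * h2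
      · rw [if_neg (by omega), if_neg h, mul_zero]
    rw [Finset.sum_range_succ, Finset.sum_range_succ, Finset.sum_range_succ, Finset.sum_range_zero,
      zero_add, nprod_heis_heisField hA, nprod_heis_heisField hA, nprod_heis_heisField hA,
      if_neg (by norm_num), if_neg (by norm_num), e0, zero_add, if_pos rfl, if_neg (by norm_num),
      if_pos rfl, e2, Ring.choose_one_right, Nat.cast_one, ← Int.cast_smul_eq_zsmul ℂ]
  · intro i _
    rw [nprod_heis_heisField hA, if_neg (by omega), if_neg (by omega)]
    exact smul_zero _

theorem jprod_heisField_zero (m n : ℤ) : jprod (heisField A μ) A 0 m n =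
    -((n : ℂ) • A.1 (m + n - 1) + (if m + n = 1 then μ * (n * (n - 1)) else 0) • 1) := by
  rw [jprod_zero, ← neg_sub, heis_comm_heisField hA, add_comm n m]

theorem jprod_heisField_one (m n : ℤ) : jprod (heisField A μ) A 1 m n =
    A.1 (m + n) + (if m + n = 0 then 2 * μ * n else 0) • 1 := by
  rw [show (1 : ℤ) = 0 + 1 by ring, jprod_succ, jprod_heisField_zero hA, jprod_heisField_zero hA,
    show m + 1 + n - 1 = m + n by ring, show m + (n + 1) - 1 = m + n by ring]
  by_cases h : m + n = 0
  · rw [if_pos (by omega), if_pos (by omega), if_pos (by omega)]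
    push_cast; module
  · rw [if_neg (by omega), if_neg (by omega), if_neg (by omega)]
    push_cast; module

theorem jprod_heisField_two (m n : ℤ) : jprod (heisField A μ) A 2 m n =
    (-2 * μ) • (idFld M).1 (m + n) := by
  rw [show (2 : ℤ) = 1 + 1 by ring, jprod_succ, jprod_heisField_one hA, jprod_heisField_one hA,
    show m + 1 + n = m + n + 1 by ring, show m + (n + 1) = m + n + 1 by ring, idFld_val]
  by_cases h : m + n = -1
  · rw [if_pos (by omega), if_pos (by omega), if_pos (by omega)]
    push_cast; module
  · rw [if_neg (by omega), if_neg (by omega), if_neg (by omega)]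
    module

theorem nprod_heisField_zero : nprod (heisField A μ) 0 A = dfld A := by
  refine Subtype.ext (funext fun n => ?_)
  rw [nprod_val, jprod_heisField_zero hA]
  change _ = (-n : ℤ) • A.1 (n - 1)
  rw [← Int.cast_smul_eq_zsmul ℂ, zero_add]
  by_cases h : n = 1
  · subst h; simp
  · rw [if_neg (by omega)]
    push_cast; module

theorem nprod_heisField_one : nprod (heisField A μ) 1 A = A := by
  refine Subtype.ext (funext fun n => ?_)
  rw [nprod_val, jprod_heisField_one hA, zero_add]
  split_ifs with h
  · subst h; simp
  · simp

theorem nprod_heisField_two : nprod (heisField A μ) 2 A = (-2 * μ) • idFld M := by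
  refine Subtype.ext (funext fun n => ?_)
  rw [nprod_val, jprod_heisField_two hA, zero_add]
  rfl

theorem nprod_heisField_of_three_le {r : ℤ} (hr : 3 ≤ r) : nprod (heisField A μ) r A = 0 := by
  have h : LocalAt (heisField A μ) A 3 := by
    intro m n
    rw [show ((3 : ℕ) : ℤ) = 2 + 1 by norm_num, jprod_succ, jprod_heisField_two hA,
      jprod_heisField_two hA, show m + 1 + n = m + (n + 1) by ring, sub_self]
  exact Subtype.ext (funext fun n => h.of_le (by simpa using hr) 0 n)

theorem nprod_heisField_sq (k : ℕ) : nprod (heisField A μ) k (nprod A (-1) A) =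
    match k with
    | 0 => dfld (nprod A (-1) A)
    | 1 => (2 : ℂ) • nprod A (-1) A
    | 2 => (-4 * μ) • A
    | 3 => idFld M
    | _ => 0 := by
  rw [nprod_nprod_nat (local_heis_heisField hA μ).symm]
  match k with
  | 0 =>
    rw [dfld_nprod]
    simp [nprod_heisField_zero hA, nprod_dfld_left]
  | 1 =>
    simp [Finset.sum_range_succ, nprod_heisField_zero hA, nprod_heisField_one hA, nprod_dfld_left,
      two_smul]
  | 2 =>
    simp [Finset.sum_range_succ, nprod_heisField_zero hA, nprod_heisField_one hA,
      nprod_heisField_two hA, nprod_dfld_left, nprod_smul_left, nprod_idFld_left,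
      nprod_idFld_right_neg_one, nprod_heis_zero hA]
    module
  | 3 =>
    simp [Finset.sum_range_succ, nprod_heisField_zero hA, nprod_heisField_one hA,
      nprod_heisField_two hA, nprod_dfld_left, nprod_smul_left, nprod_idFld_left,
      nprod_heis_one hA, nprod_heisField_of_three_le hA, nprod_zero_left]
    module
  | k + 4 =>
    rw [Finset.sum_range_succ', Finset.sum_range_succ', Finset.sum_range_succ',
      Finset.sum_eq_zero, nprod_heisField_of_three_le hA μ (by push_cast; omega)]
    · simp only [zero_add, Nat.cast_zero, nprod_heisField_zero hA, Nat.cast_one, Nat.cast_ofNat,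
        nprod_heisField_one hA, nprod_heisField_two hA, nprod_dfld_left, nprod_smul_left,
        nprod_idFld_left, Nat.reduceAdd]
      rw [nprod_heis_of_two_le hA (by push_cast; omega), nprod_heis_of_two_le hA (by push_cast; omega),
        if_neg (by push_cast; omega)]
      simp
    · intro r _
      rw [nprod_heisField_of_three_le hA μ (by push_cast; omega), nprod_zero_left, smul_zero]

/-- The background charge cancels in the third-order pole: `-2 μ` from the quadratic part against `2
μ` from the derivative. In the fourth-order pole it adds `-6 μ^2` to `1 / 2`, which is half of `1 -
12 μ^2`. -/
theorem nprod_heisField_self (k : ℕ) : nprod (heisField A μ) k (heisField A μ) =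
    if k < 4 then virSing (1 - 12 * μ ^ 2) (heisField A μ) k else 0 := by
  conv_lhs => rw [show heisField A μ = (1 / 2 : ℂ) • nprod A (-1) A + μ • dfld A from rfl]
  change nprod (heisField A μ) k _ = _
  rw [map_add, map_smul, map_smul, nprod_heisField_sq hA, nprod_dfld_right]
  match k with
  | 0 =>
    simp [virSing, nprod_heisField_zero hA]
    simp [heisField]
  | 1 =>
    simp [virSing, nprod_heisField_zero hA, nprod_heisField_one hA]
    simp only [heisField]
    module
  | 2 =>
    simp [virSing, nprod_heisField_two hA, nprod_heisField_one hA, dfld_idFld]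
    module
  | 3 =>
    simp [virSing, nprod_heisField_two hA, nprod_heisField_of_three_le hA]
    module
  | k + 4 =>
    rw [nprod_heisField_of_three_le hA μ (by push_cast; omega),
      nprod_heisField_of_three_le hA μ (by push_cast; omega)]
    simp

/-- The free field representation of the Virasoro algebra. -/
def heisRep : VirRep (1 - 12 * μ ^ 2) M where
  L n := (heisField A μ).1 (n + 1)
  comm m n := by
    obtain ⟨N, hN⟩ := local_heisField_self hA μ
    have hN' : LocalAt (heisField A μ) (heisField A μ) (4 + N) := hN.of_le (by simp)
    rw [hN'.commutator, Finset.sum_range_add, Finset.sum_eq_zero (s := Finset.range N), add_zero]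
    · rw [Finset.sum_congr rfl fun r hr => by
        rw [nprod_heisField_self hA, if_pos (Finset.mem_range.1 hr)], sum_virSing,
        show m + 1 + (n + 1) - 1 = m + n + 1 by ring]
      congr 2
      · push_cast; ring
      · rw [if_congr (show m + 1 + (n + 1) = 2 ↔ m + n = 0 by omega) rfl rfl]
        push_cast
        congr 1
        ring
    · intro i _
      rw [nprod_heisField_self hA, if_neg (by omega)]
      exact smul_zero _
  trunc v := by
    obtain ⟨N, hN⟩ := (heisField A μ).2 v
    exact ⟨N, fun n hn => hN _ (by omega)⟩

omit hA in
-- On a vector killed by the positive modes the quadratic part leaves only `A_0^2 / 2`, and the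
-- derivative contributes `-μ A_0`. Mode `1` of the field is `L_0`, so the weight is `α^2 / 2 - μ
-- α`.
theorem heisField_apply_of_nonneg {α : ℂ} {v : M} (hv : ∀ n, 0 < n → A.1 n v = 0)
    (h0 : A.1 0 v = α • v) {n : ℤ} (hn : 0 < n) :
    (heisField A μ).1 n v = if n = 1 then (α ^ 2 / 2 - μ * α) • v else 0 := by
  have e : (heisField A μ).1 n v = (1 / 2 : ℂ) • ((lmap A (-1) A).1 n v +
      (rmap A (-1) A).1 n v) + μ • (dfld A).1 n v := by
    have : sg (-1) = -1 := by simp [sg]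
    change (1 / 2 : ℂ) • ((lmap A (-1) A).1 n v - sg (-1) • (rmap A (-1) A).1 n v) + _ = _
    rw [this, neg_smul, one_smul, sub_neg_eq_add]
    rfl
  have hr : (rmap A (-1) A).1 n v = if n = 1 then α ^ 2 • v else 0 := by
    rw [rmap_apply, bsum, finsum_eq_single _ 0]
    · rw [pow_zero, Ring.choose_zero_right, one_mul, one_smul, Nat.cast_zero, h0, map_smul, sub_zero]
      split_ifs with h
      · subst h
        rw [show (1 : ℤ) + -1 = 0 by norm_num, h0, smul_smul, sq]
      · rw [hv _ (by omega), smul_zero]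
    · intro i hi
      rw [hv _ (by omega), map_zero, smul_zero]
  rw [e, hr, lmap_apply, bsum_congr _ fun i => by rw [hv _ (by omega), map_zero], bsum_zero, zero_add,
    dfld_apply]
  split_ifs with h
  · subst h
    rw [sub_self, h0, ← Int.cast_smul_eq_zsmul ℂ]
    push_cast
    module
  · rw [hv _ (by omega), smul_zero, smul_zero, smul_zero, add_zero]

omit hA in
theorem heisField_apply_zero {v : M} (hv : ∀ n, 0 ≤ n → A.1 n v = 0) :
    (heisField A μ).1 0 v = 0 := by
  have e : (heisField A μ).1 0 v = (1 / 2 : ℂ) • ((lmap A (-1) A).1 0 v -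
      sg (-1) • (rmap A (-1) A).1 0 v) + μ • (dfld A).1 0 v := rfl
  rw [e, lmap_apply, bsum_congr _ fun i => by rw [hv _ (by omega), map_zero], bsum_zero,
    rmap_apply, bsum_congr _ fun i => by rw [hv _ (by omega), map_zero], bsum_zero, dfld_apply]
  simp

end Heisenberg

/-! ### The Fock space -/

section Fock

open MvPolynomial

/-- The modes of the free field on the Fock space. -/
def fockMode (α : ℂ) : ℤ → Module.End ℂ (MvPolynomial ℕ ℂ)
  | 0 => α • 1
  | (n + 1 : ℕ) => (n + 1 : ℂ) • (pderiv n).toLinearMap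
  | .negSucc n => LinearMap.mulLeft ℂ (X n)

theorem fockMode_natCast_succ (α : ℂ) (n : ℕ) :
    fockMode α ((n : ℤ) + 1) = (n + 1 : ℂ) • (pderiv n).toLinearMap := rfl

theorem pderiv_comm (i j : ℕ) (f : MvPolynomial ℕ ℂ) :
    pderiv i (pderiv j f) = pderiv j (pderiv i f) := by
  induction f using MvPolynomial.induction_on with
  | C a => simp
  | add p q hp hq => simp only [map_add, hp, hq]
  | mul_X p k hp =>
    have h : ∀ a b : ℕ, pderiv a (pderiv b (X k : MvPolynomial ℕ ℂ)) = 0 := fun a b => by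
      classical
      rw [pderiv_X, Pi.single_apply]
      split_ifs <;> simp
    simp only [pderiv_mul, map_add, hp, h]
    ring

theorem fockMode_comm (α : ℂ) (m n : ℤ) : fockMode α m * fockMode α n -
    fockMode α n * fockMode α m = (if m + n = 0 then (m : ℂ) else 0) • 1 := by
  have key : ∀ (i j : ℕ), fockMode α ((i : ℤ) + 1) * fockMode α (Int.negSucc j) -
      fockMode α (Int.negSucc j) * fockMode α ((i : ℤ) + 1) =
      (if i = j then (i + 1 : ℂ) else 0) • 1 := by
    intro i j
    refine LinearMap.ext fun f => ?_
    change (i + 1 : ℂ) • pderiv i (X j * f) - X j * ((i + 1 : ℂ) • pderiv i f) =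
      (if i = j then (i + 1 : ℂ) else 0) • f
    rw [pderiv_mul, smul_add, mul_smul_comm, add_sub_cancel_right]
    split_ifs with h
    · subst h
      rw [pderiv_X_self, one_mul]
    · rw [pderiv_X_of_ne (Ne.symm h), zero_mul, smul_zero, zero_smul]
  match m, n with
  | 0, n =>
    change α • 1 * _ - _ * α • 1 = _
    simp
  | (m + 1 : ℕ), 0 =>
    rw [if_neg (by omega), zero_smul]
    change _ * α • 1 - α • 1 * _ = _
    simp
  | .negSucc m, 0 =>
    rw [if_neg (by omega), zero_smul]
    change _ * α • 1 - α • 1 * _ = _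
    simp
  | (m + 1 : ℕ), (n + 1 : ℕ) =>
    rw [if_neg (by omega), zero_smul]
    refine LinearMap.ext fun f => ?_
    change (m + 1 : ℂ) • pderiv m ((n + 1 : ℂ) • pderiv n f) -
      (n + 1 : ℂ) • pderiv n ((m + 1 : ℂ) • pderiv m f) = 0
    rw [Derivation.map_smul, Derivation.map_smul, pderiv_comm, smul_comm, sub_self]
  | .negSucc m, .negSucc n =>
    rw [if_neg (by omega), zero_smul]
    refine LinearMap.ext fun f => ?_
    change X m * (X n * f) - X n * (X m * f) = 0
    ring
  | (m + 1 : ℕ), .negSucc n =>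
    refine (key m n).trans ?_
    congr 1
    refine if_ctx_congr (by omega) (fun _ => by push_cast; rfl) fun _ => rfl
  | .negSucc m, (n + 1 : ℕ) =>
    rw [← neg_sub]
    refine (congrArg Neg.neg (key n m)).trans ?_
    refine LinearMap.ext fun f => ?_
    change -((if n = m then (n + 1 : ℂ) else 0) • f) =
      (if Int.negSucc m + ((n + 1 : ℕ) : ℤ) = 0 then ((Int.negSucc m : ℤ) : ℂ) else 0) • f
    rw [← neg_smul]
    congr 1
    by_cases h : n = m
    · rw [if_pos h, if_pos (by omega), h, Int.cast_negSucc]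
      push_cast; ring
    · rw [if_neg h, if_neg (by omega), neg_zero]

/-- The free field on the Fock space. -/
def fockFld (α : ℂ) : Fld (MvPolynomial ℕ ℂ) := ⟨fockMode α, fun f => by
  -- Mode `k + 1` differentiates with respect to variable `k`; the bound makes `k` larger than every
  -- variable of `f`.
  refine ⟨(f.vars.sup id : ℕ) + 2, fun n hn => ?_⟩
  obtain ⟨k, rfl⟩ : ∃ k : ℕ, n = (k : ℤ) + 1 := ⟨(n - 1).toNat, by omega⟩
  rw [fockMode_natCast_succ, LinearMap.smul_apply]
  have : pderiv k f = 0 := pderiv_eq_zero_of_notMem_vars fun hk => by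
    have := Finset.le_sup (f := id) hk
    simp only [id] at this
    omega
  exact (congrArg _ this).trans (smul_zero _)⟩

theorem fockFld_pos (α : ℂ) {n : ℤ} (hn : 0 < n) : (fockFld α).1 n 1 = 0 := by
  obtain ⟨k, rfl⟩ : ∃ k : ℕ, n = (k : ℤ) + 1 := ⟨(n - 1).toNat, by omega⟩
  change (k + 1 : ℂ) • pderiv k (1 : MvPolynomial ℕ ℂ) = 0
  rw [pderiv_one, smul_zero]

/-- The Fock space realizes every pair `(c, h)` over `ℂ`: solve `12 μ^2 = 1 - c`, then `β^2 / 2 - μ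
β = h`, and use the vacuum polynomial `1`. -/
theorem exists_virRep (c h : ℂ) : ∃ R : VirRep c (MvPolynomial ℕ ℂ),
    (∀ n, 0 < n → R.L n 1 = 0) ∧ R.L 0 1 = h • 1 ∧ (h = 0 → R.L (-1) 1 = 0) := by
  obtain ⟨μ, hμ⟩ := IsAlgClosed.exists_pow_nat_eq ((1 - c) / 12) (n := 2) (by norm_num)
  -- For `h = 0` the root `β = 0` has to be taken rather than `2 μ`: then `A_0` kills the vacuum as
  -- well, and so does `L_{-1}`.
  obtain ⟨β, hβ⟩ : ∃ β : ℂ, β ^ 2 / 2 - μ * β = h ∧ (h = 0 → β = 0) := by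
    by_cases h0 : h = 0
    · exact ⟨0, by simp [h0], fun _ => rfl⟩
    · obtain ⟨s, hs⟩ := IsAlgClosed.exists_pow_nat_eq (μ ^ 2 + 2 * h) (n := 2) (by norm_num)
      exact ⟨μ + s, by linear_combination hs / 2, fun h' => (h0 h').elim⟩
  obtain rfl : c = 1 - 12 * μ ^ 2 := by linear_combination 12 * hμ
  have hp : ∀ n, 0 < n → (fockFld β).1 n 1 = 0 := fun n hn => fockFld_pos β hn
  have h0 : (fockFld β).1 0 1 = β • 1 := rfl
  refine ⟨heisRep (A := fockFld β) (fockMode_comm β) μ, fun n hn => ?_, ?_, fun hh => ?_⟩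
  · change (heisField _ μ).1 (n + 1) 1 = 0
    rw [heisField_apply_of_nonneg μ hp h0 (by omega), if_neg (by omega)]
  · change (heisField _ μ).1 (0 + 1) 1 = _
    rw [heisField_apply_of_nonneg μ hp h0 (by omega), if_pos (by omega), hβ.1]
  · change (heisField _ μ).1 (-1 + 1) 1 = _
    refine heisField_apply_zero μ fun n hn => ?_
    rcases hn.eq_or_lt with rfl | hn
    · rw [h0, hβ.2 hh, zero_smul]
    · exact hp n hn

end Fock

/-! ### Verma modules -/

section Verma

variable (c h : ℂ)

/-- The left ideal generated by the `L_n` with `n > 0` and by `L_0 - h`. -/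
def vermaIdeal : Submodule (VirAlg c) (VirAlg c) :=
  Submodule.span (VirAlg c) {x | (∃ n : ℤ, 0 < n ∧ x = virL c n) ∨
    x = virL c 0 - algebraMap ℂ (VirAlg c) h}

/-- The Verma module `M_{c,h}`. -/
abbrev Verma : Type := VirAlg c ⧸ vermaIdeal c h

/-- The highest weight vector of the Verma module. -/
def vermaVec : Verma c h := Submodule.Quotient.mk 1

theorem smul_vermaVec (a : VirAlg c) : a • vermaVec c h = Submodule.Quotient.mk a := by
  rw [vermaVec, ← Submodule.Quotient.mk_smul, smul_eq_mul, mul_one]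

theorem isHighestWeight_vermaVec : IsHighestWeight c h (vermaVec c h) where
  gen x := by
    obtain ⟨a, rfl⟩ := Submodule.Quotient.mk_surjective _ x
    exact ⟨a, (smul_vermaVec c h a).symm⟩
  pos n hn := by
    rw [smul_vermaVec]
    exact (Submodule.Quotient.mk_eq_zero _).2 (Submodule.subset_span (Or.inl ⟨n, hn, rfl⟩))
  zero := by
    rw [← algebraMap_smul (VirAlg c) h (vermaVec c h), smul_vermaVec, smul_vermaVec]
    exact (Submodule.Quotient.eq _).2 (Submodule.subset_span (Or.inr rfl))

variable {c} in
/-- The action of `VirAlg c` given by a representation. -/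
def VirRep.hom {M : Type*} [AddCommGroup M] [Module ℂ M] (R : VirRep c M) :
    VirAlg c →ₐ[ℂ] Module.End ℂ M := virLift R.L R.comm

variable {c} in
theorem VirRep.hom_virL {M : Type*} [AddCommGroup M] [Module ℂ M] (R : VirRep c M) (n : ℤ) :
    R.hom (virL c n) = R.L n := virLift_virL _ _ n

variable {c} in
-- The annihilator of `v` is a left ideal containing `S`, and it does not contain `1`. This avoids a
-- basis theorem for the enveloping algebra.
theorem VirRep.mk_one_ne_zero {M : Type*} [AddCommGroup M] [Module ℂ M] (R : VirRep c M) {v : M}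
    (hv : v ≠ 0) {S : Set (VirAlg c)} (hS : ∀ x ∈ S, R.hom x v = 0) :
    (Submodule.Quotient.mk 1 : VirAlg c ⧸ Submodule.span (VirAlg c) S) ≠ 0 := by
  rw [Ne, Submodule.Quotient.mk_eq_zero]
  intro h1
  have : ∀ x ∈ Submodule.span (VirAlg c) S, R.hom x v = 0 := by
    intro x hx
    induction hx using Submodule.span_induction with
    | mem x hx => exact hS x hx
    | zero => rw [map_zero, LinearMap.zero_apply]
    | add x y _ _ hx hy => rw [map_add, LinearMap.add_apply, hx, hy, add_zero]
    | smul a x _ hx => rw [smul_eq_mul, map_mul, Module.End.mul_apply, hx, map_zero]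
  have := this 1 h1
  rw [map_one] at this
  exact hv this

theorem vermaVec_ne_zero : vermaVec c h ≠ 0 := by
  obtain ⟨R, h1, h2, -⟩ := exists_virRep c h
  refine R.mk_one_ne_zero (v := 1) one_ne_zero ?_
  rintro _ (⟨n, hn, rfl⟩ | rfl)
  · rw [R.hom_virL, h1 n hn]
  · rw [map_sub, R.hom_virL, LinearMap.sub_apply, h2, AlgHom.commutes, Module.algebraMap_end_apply,
      sub_self]

theorem virVac_ne_zero : virVac c ≠ 0 := by
  obtain ⟨R, h1, h2, h3⟩ := exists_virRep c 0
  refine R.mk_one_ne_zero (v := 1) one_ne_zero ?_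
  rintro _ ⟨n, hn, rfl⟩
  rw [R.hom_virL]
  rcases lt_trichotomy n 0 with hn' | rfl | hn'
  · obtain rfl : n = -1 := by omega
    exact h3 rfl
  · rw [h2, zero_smul]
  · exact h1 n hn'

end Verma

/-! ### The vertex operator algebra -/

section VirVOA

/-- For a natural exponent the two expansions of `(z - w)^N` are the same finite polynomial, so
`jprod` is an alternating sum of commutators, the form in which the axiom `weak_comm` is stated. -/
theorem jprod_natCast {M : Type*} [AddCommGroup M] [Module ℂ M] (A B : Fld M) (N : ℕ) (m n : ℤ) :
    jprod A B N m n = ∑ i ∈ Finset.range (N + 1), ((-1 : ℤ) ^ i * (N.choose i : ℤ)) •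
      (A.1 (m + N - i) * B.1 (n + i) - B.1 (n + i) * A.1 (m + N - i)) := by
  refine LinearMap.ext fun v => ?_
  have hb : ∀ F : ℕ → M, bsum (N : ℤ) F =
      ∑ i ∈ Finset.range (N + 1), ((-1 : ℤ) ^ i * (N.choose i : ℤ)) • F i := fun F => by
    rw [bsum, finsum_eq_sum_range (N := N + 1)]
    · simp only [Ring.choose_natCast]
    · intro i hi
      rw [Ring.choose_natCast, Nat.choose_eq_zero_of_lt (by omega), Nat.cast_zero, mul_zero,
        zero_smul]
  rw [LinearMap.sum_apply]
  change lprod A B N m n v - sg N • lprod B A N n m v = _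
  -- Reversing the summation in the second expansion matches the mode indices and turns the sign
  -- `(-1)^N` into the sign of the first.
  rw [lprod_apply, lprod_apply, hb, hb, Finset.smul_sum, ← Finset.sum_range_reflect (fun x : ℕ =>
      sg (N : ℤ) • ((-1 : ℤ) ^ x * (N.choose x : ℤ)) • B.1 (n + N - x) (A.1 (m + x) v)),
    ← Finset.sum_sub_distrib]
  refine Finset.sum_congr rfl fun i hi => ?_
  have hi' : i ≤ N := by simpa [Nat.lt_succ_iff] using hi
  have e : sg (N : ℤ) * ((-1) ^ (N - i) * (N.choose i : ℤ)) = (-1) ^ i * (N.choose i : ℤ) := by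
    rw [sg_natCast, ← mul_assoc, ← pow_add]
    congr 1
    rw [show N + (N - i) = 2 * (N - i) + i by omega, pow_add, pow_mul]
    simp
  rw [LinearMap.smul_apply, LinearMap.sub_apply, smul_sub, Module.End.mul_apply,
    Module.End.mul_apply, show N + 1 - 1 - i = N - i by omega, Nat.choose_symm hi', smul_smul, e,
    Nat.cast_sub hi', show n + N - (N - i : ℤ) = n + i by ring,
    show m + (N - i : ℤ) = m + N - i by ring]

variable (c : ℂ)

/-- The universal Virasoro vertex operator algebra. -/
def virVOA : VOA (Vir c) where
  charge := c
  gr d := hwGr c 0 (Vir c) d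
  isInternal := DirectSum.isInternal_submodule_of_iSupIndep_of_iSup_eq_top
    (hwGr_iSupIndep.comp Nat.cast_injective) isHighestWeight_virVac.iSup_hwGr
  finite_gr d := isHighestWeight_virVac.hwGr_finite d
  finrank_gr_zero := by
    have := isHighestWeight_virVac.hwGr_zero (c := c)
    rw [Nat.cast_zero, this]
    exact finrank_span_singleton (virVac_ne_zero c)
  vac := virVac c
  vac_mem := by
    rw [mem_hwGr, isHighestWeight_virVac.zero]
    simp
  conf := virL c (-2) • virVac c
  conf_mem := by
    have := virL_smul_mem_hwGr (c := c) (h := 0) (-2) (q := 0) (x := virVac c) (by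
      rw [mem_hwGr, isHighestWeight_virVac.zero]; simp)
    exact this
  Y := (Fld (Vir c)).subtype ∘ₗ (virSelf c).Y
  field a b := ((virSelf c).Y a).2 b
  vac_mode m := by
    change ((virSelf c).Y (virVac c)).1 m = _
    rw [VirRep.Y_vac]
    rfl
  creation a := VirRep.Y_creation a
  creation_regular a m hm := VirRep.Y_virVac_apply a hm
  weak_comm a b := by
    obtain ⟨N, hN⟩ := (virSelf c).local_Y_Y a b
    refine ⟨N, fun m n => ?_⟩
    rw [← hN m n, jprod_natCast]
    rfl
  virasoro p q := by
    change ((virSelf c).Y (virL c (-2) • virVac c)).1 _ * ((virSelf c).Y (virL c (-2) • virVac c)).1 _ -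
      ((virSelf c).Y (virL c (-2) • virVac c)).1 _ * ((virSelf c).Y (virL c (-2) • virVac c)).1 _ =
      _ • ((virSelf c).Y (virL c (-2) • virVac c)).1 _ + _
    simp only [VirRep.Y_conf, VirRep.W_apply, add_sub_cancel_right]
    exact (virSelf c).comm p q
  conf_grading d a ha := by
    change ((virSelf c).Y (virL c (-2) • virVac c)).1 1 a = _
    rw [VirRep.Y_conf]
    have := mem_hwGr.1 ha
    rw [zero_add] at this
    exact this
  translation a m := by
    change ((virSelf c).Y (((virSelf c).Y (virL c (-2) • virVac c)).1 0 a)).1 m = _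
    rw [VirRep.Y_conf]
    change ((virSelf c).Y (virL c (-1) • a)).1 m = _
    rw [VirRep.Y_translation]
    change (-m : ℤ) • ((virSelf c).Y a).1 (m - 1) = -(m : ℂ) • ((virSelf c).Y a).1 (m - 1)
    rw [← Int.cast_smul_eq_zsmul ℂ, Int.cast_neg]

theorem isVirasoro_virVOA : (virVOA c).IsVirasoro where
  charge_eq := rfl
  vac_eq := rfl
  conf_eq := rfl
  mode_eq n x := by
    change ((virSelf c).Y (virL c (-2) • virVac c)).1 (n + 1) x = _
    rw [VirRep.Y_conf, VirRep.W_apply, add_sub_cancel_right]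
    rfl

end VirVOA

/-! ### Uniqueness of the vertex operators -/

section Uniqueness

variable {c : ℂ}

/-- A field which is local with respect to `L(z)` and annihilates the vacuum vanishes. -/
theorem eq_zero_of_local_of_vac {D : Fld (Vir c)} (hD : Local D (virSelf c).W)
    (hv : ∀ n, D.1 n (virVac c) = 0) : D = 0 := by
  have hW : ∀ n x, (virSelf c).W.1 (n + 1) x = virL c n • x := fun n x => by
    rw [VirRep.W_apply, add_sub_cancel_right]
    rfl
  -- The field `D` is quantified inside `S`: commuting it past `L_m` produces the products of `L(z)`
  -- with `D`, which are again local and kill the vacuum.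
  let S : Submodule ℂ (Vir c) :=
    { carrier := {x | ∀ D : Fld (Vir c), Local D (virSelf c).W → (∀ n, D.1 n (virVac c) = 0) →
        ∀ n, D.1 n x = 0}
      add_mem' := fun {x y} hx hy D h1 h2 n => by
        rw [map_add, hx D h1 h2, hy D h1 h2, add_zero]
      zero_mem' := fun D _ _ n => map_zero _
      smul_mem' := fun r x hx D h1 h2 n => by
        rw [map_smul, hx D h1 h2]
        exact smul_zero (A := Vir c) r }
  suffices S = ⊤ from Fld.ext' fun n x => (this ▸ Submodule.mem_top : x ∈ S) D hD hv n
  refine vir_eq_top (fun D _ h2 n => h2 n) fun m x hx D h1 h2 n => ?_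
  obtain ⟨N, hN⟩ := h1.symm
  have e := LinearMap.congr_fun (hN.commutator (m + 1) n) x
  rw [LinearMap.sub_apply, Module.End.mul_apply, Module.End.mul_apply, hx D h1 h2, map_zero,
    zero_sub, hW, LinearMap.sum_apply, Finset.sum_eq_zero, neg_eq_zero] at e
  · exact e
  · intro i _
    rw [LinearMap.smul_apply, hx _ (h1.symm.nprod (virSelf c).local_W_W h1 i), smul_zero]
    intro k
    change (lmap (virSelf c).W i D).1 k (virVac c) -
      sg i • (rmap (virSelf c).W i D).1 k (virVac c) = 0
    rw [lmap_apply, rmap_apply, bsum_congr _ fun j => by rw [h2, map_zero], bsum_zero,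
      bsum_congr _ fun j => by
        rw [show (virSelf c).W.1 j (virVac c) = 0 from virL_smul_virVac (by omega), map_zero],
      bsum_zero, smul_zero, sub_zero]

variable {H : VOA (Vir c)}

/-- The vertex operators of a vertex operator algebra structure, as fields. -/
def fld (H : VOA (Vir c)) (a : Vir c) : Fld (Vir c) := ⟨H.Y a, H.field a⟩

theorem IsVirasoro.fld_conf (hH : H.IsVirasoro) : H.fld H.conf = (virSelf c).W :=
  Fld.ext' fun n x => by
    have := hH.mode_eq (n - 1) x
    rw [sub_add_cancel] at this
    exact this

theorem local_fld (a b : Vir c) : Local (H.fld a) (H.fld b) := by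
  obtain ⟨N, hN⟩ := H.weak_comm a b
  refine ⟨N, fun m n => ?_⟩
  rw [jprod_natCast, ← hN m n]
  rfl

/-- The difference of the two fields is local to `L(z)`, and it kills the vacuum because the
creation and translation axioms determine every `a_(n) 1`. -/
theorem IsVirasoro.fld_eq (hH : H.IsVirasoro) (a : Vir c) : H.fld a = (virSelf c).Y a := by
  have hvac : H.vac = virVac c := hH.vac_eq
  have h0 : ∀ x, H.Y H.conf 0 x = virL c (-1) • x := fun x => by
    have := hH.mode_eq (-1) x
    rwa [neg_add_cancel] at this
  -- The vectors `a_(-1-k) 1` follow from the case `k = 0` on replacing `a` by `L_{-1} a` and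
  -- dividing by `k + 1`.
  have key : ∀ k : ℕ, ∀ a, H.Y a (-1 - k) (virVac c) = ((virSelf c).Y a).1 (-1 - k) (virVac c) := by
    intro k
    induction k with
    | zero =>
      intro a
      rw [Nat.cast_zero, sub_zero, VirRep.Y_creation, ← hvac, H.creation]
    | succ k ih =>
      intro a
      have e := ih (virL c (-1) • a)
      rw [← h0, H.translation, h0, VirRep.Y_translation, dfld_apply, ← Int.cast_smul_eq_zsmul ℂ,
        LinearMap.smul_apply, Int.cast_neg] at e
      rw [show (-1 : ℤ) - (k + 1 : ℕ) = -1 - k - 1 by push_cast; ring]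
      have hk : (-((-1 - (k : ℤ) : ℤ) : ℂ)) ≠ 0 := by
        have : (-1 - (k : ℤ) : ℤ) ≠ 0 := by omega
        exact neg_ne_zero.2 (by exact_mod_cast this)
      exact smul_right_injective _ hk e
  rw [← sub_eq_zero, sub_eq_add_neg, ← neg_one_smul ℂ ((virSelf c).Y a)]
  refine eq_zero_of_local_of_vac (Local.add_left ?_ (((virSelf c).local_Y_W a).smul_left _)) ?_
  · rw [← hH.fld_conf]
    exact local_fld a _
  · intro n
    change H.Y a n (virVac c) + (-1 : ℂ) • ((virSelf c).Y a).1 n (virVac c) = 0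
    have e : H.Y a n (virVac c) = ((virSelf c).Y a).1 n (virVac c) := by
      rcases le_or_gt 0 n with h | h
      · rw [VirRep.Y_virVac_apply a h, ← hvac, H.creation_regular a n h]
      · obtain ⟨k, hk⟩ := Int.eq_ofNat_of_zero_le (show 0 ≤ -1 - n by omega)
        obtain rfl : n = -1 - k := by omega
        exact key k a
    rw [e]
    exact (congrArg (_ + ·) (neg_one_smul ℂ (((virSelf c).Y a).1 n (virVac c)))).trans
      (add_neg_cancel (G := Vir c) _)

theorem IsVirasoro.Y_eq (hH : H.IsVirasoro) (a : Vir c) (m : ℤ) :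
    H.Y a m = ((virSelf c).Y a).1 m :=
  congrFun (congrArg Subtype.val (hH.fld_eq a)) m

/-- The axiom `conf_grading` puts each piece inside an eigenspace of `L_0`; since the pieces exhaust
the space, they are the full eigenspaces. -/
theorem IsVirasoro.mem_gr (hH : H.IsVirasoro) {d : ℕ} {a : Vir c} :
    a ∈ H.gr d ↔ virL c 0 • a = (d : ℂ) • a := by
  have hle : ∀ d, H.gr d ≤ hwGr c 0 (Vir c) (d : ℤ) := fun d a ha => by
    rw [mem_hwGr, zero_add, ← hH.mode_eq, zero_add, H.conf_grading d a ha]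
    rfl
  have hiff : a ∈ hwGr c 0 (Vir c) (d : ℤ) ↔ virL c 0 • a = (d : ℂ) • a := by
    rw [mem_hwGr, zero_add]
    rfl
  rw [← hiff]
  refine ⟨fun h => hle d h, fun h => ?_⟩
  exact mem_of_mem_iSup_of_iSupIndep (hwGr_iSupIndep.comp Nat.cast_injective) hle h
    (H.isInternal.submodule_iSup_eq_top ▸ Submodule.mem_top)

end Uniqueness

/-! ### The grading and the topology of the enveloping algebra -/

section EnvelopingTopology

variable {V : Type u} [AddCommGroup V] [Module ℂ V] (H : VOA V)

theorem finite_support_mode (a b : V) {E : Type*} [Zero E] (f : ℕ → V → E) (hf : ∀ i, f i 0 = 0) :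
    (Function.support fun k : ℕ => f k (H.Y a k b)).Finite := by
  obtain ⟨N, hN⟩ := H.field a b
  refine (Set.finite_lt_nat N.toNat).subset fun k hk => ?_
  by_contra hk'
  refine hk ?_
  beta_reduce
  rw [hN k (by simp only [Set.mem_ofPred_eq] at hk'; omega), hf]

theorem uMode_comm (a b : V) (i j : ℤ) :
    H.uMode i a * H.uMode j b - H.uMode j b * H.uMode i a =
      ∑ᶠ k : ℕ, Ring.choose i k • H.uMode (i + j - k) (H.Y a k b) := by
  have h := RingQuot.mkAlgHom_rel ℂ (URel.comm (H := H) a b i j)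
  rw [map_sub, map_mul, map_mul] at h
  refine h.trans ?_
  have := (RingQuot.mkAlgHom ℂ H.URel).toLinearMap.toAddMonoidHom.map_finsum
    (H.finite_support_mode a b (fun k y => Ring.choose i k • preMode (i + j - k) y)
      fun k => by rw [map_zero, smul_zero])
  refine this.trans (finsum_congr fun k => ?_)
  exact map_zsmul (RingQuot.mkAlgHom ℂ H.URel).toLinearMap _ _

theorem uMode_deriv (a : V) (n : ℤ) :
    H.uMode n (H.Y H.conf 0 a) = -(n : ℂ) • H.uMode (n - 1) a := by
  have h := RingQuot.mkAlgHom_rel ℂ (URel.deriv (H := H) a n)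
  rw [map_add, map_smul, map_zero] at h
  rw [neg_smul]
  exact eq_neg_of_add_eq_zero_left h

theorem uMode_vac_neg_one : H.uMode (-1) H.vac = 1 := by
  have h := RingQuot.mkAlgHom_rel ℂ (URel.vac (H := H))
  rwa [map_one] at h

theorem uMode_vac_of_ne {n : ℤ} (hn : n ≠ -1) : H.uMode n H.vac = 0 := by
  have h := H.uMode_deriv H.vac (n + 1)
  rw [H.creation_regular _ 0 le_rfl, map_zero, add_sub_cancel_right] at h
  have hn' : -((n + 1 : ℤ) : ℂ) ≠ 0 := neg_ne_zero.2 (by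
    have : n + 1 ≠ 0 := by omega
    exact_mod_cast this)
  exact (smul_eq_zero.1 h.symm).resolve_left hn'

/-- The commutator with `L_0` on the enveloping algebra. -/
def adL0 : Module.End ℂ H.U :=
  LinearMap.mulLeft ℂ (H.uMode 1 H.conf) - LinearMap.mulRight ℂ (H.uMode 1 H.conf)

theorem adL0_apply (x : H.U) : H.adL0 x = H.uMode 1 H.conf * x - x * H.uMode 1 H.conf := rfl

theorem adL0_mul (x y : H.U) : H.adL0 (x * y) = H.adL0 x * y + x * H.adL0 y := by
  simp only [adL0_apply]
  noncomm_ring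

theorem adL0_uMode {k : ℕ} {a : V} (ha : a ∈ H.gr k) (n : ℤ) :
    H.adL0 (H.uMode n a) = ((k - n - 1 : ℤ) : ℂ) • H.uMode n a := by
  rw [adL0_apply, uMode_comm, finsum_eq_sum_range (N := 2)]
  · rw [Finset.sum_range_succ, Finset.sum_range_one, Ring.choose_zero_right, one_smul,
      Nat.cast_one, Ring.choose_one_right, one_smul, Nat.cast_zero, uMode_deriv,
      H.conf_grading k a ha, map_smul, show 1 + n - 0 - 1 = n by ring, show 1 + n - 1 = n by ring,
      ← add_smul]
    congr 1
    push_cast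
    ring
  · intro i hi
    rw [show (1 : ℤ) = (1 : ℕ) by rfl, Ring.choose_natCast, Nat.choose_eq_zero_of_lt (by omega),
      Nat.cast_zero, zero_smul]

/-- The commutator with `L_0` is a derivation with the generators as eigenvectors. It shows that the
subspaces `U_p`, defined only as spans, are independent. -/
theorem Uh_le_eigenspace (p : ℤ) : H.Uh p ≤ Module.End.eigenspace H.adL0 (p : ℂ) := by
  rw [Uh, Submodule.span_le]
  intro x hx
  rw [SetLike.mem_coe, Module.End.mem_eigenspace_iff]
  induction hx with
  | one => rw [adL0_apply, mul_one, one_mul, sub_self, Int.cast_zero, zero_smul]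
  | mul k a n d x ha _ ih =>
    rw [adL0_mul, ih, H.adL0_uMode ha, smul_mul_assoc, mul_smul_comm, ← add_smul, ← Int.cast_add]

theorem iSupIndep_eigenspace_adL0 :
    iSupIndep fun p : ℤ => Module.End.eigenspace H.adL0 (p : ℂ) :=
  (Module.End.eigenspaces_iSupIndep H.adL0).comp Int.cast_injective

theorem NLtot_le_iSup_NL (n : ℤ) : H.NLtot n ≤ ⨆ p, H.NL n p := by
  rw [NLtot, ← H.iSup_Uh, Submodule.iSup_mul]
  refine iSup_le fun i => ?_
  simp only [Submodule.mul_iSup]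
  refine iSup₂_le fun j hj => ?_
  refine le_trans ?_ (le_iSup (H.NL n) (i + j))
  rw [NL]
  refine le_iSup₂_of_le j hj ?_
  rw [add_sub_cancel_right]

theorem NL_le_NLtot (n p : ℤ) : H.NL n p ≤ H.NLtot n :=
  iSup₂_le fun j hj => mul_le_mul' le_top (le_iSup₂_of_le j hj le_rfl)

/-- The left ideal `U · U_{≤ -n}` is the sum of its pieces `NL n p`, so a homogeneous element of it
lies in the piece of its own degree. -/
theorem mem_NL_of_mem {n p : ℤ} {x : H.U} (hx : x ∈ H.Uh p) (hx' : x ∈ H.NLtot n) :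
    x ∈ H.NL n p :=
  mem_of_mem_iSup_of_iSupIndep H.iSupIndep_eigenspace_adL0
    (fun p => (H.NL_le_Uh n p).trans (H.Uh_le_eigenspace p)) (H.Uh_le_eigenspace p hx)
    (H.NLtot_le_iSup_NL n hx')

theorem clos_NLtot_mem_nhds (n : ℕ) : (H.clos (H.NLtot n) : Set H.Compl) ∈ nhds 0 := by
  have h : (H.NLtot n : Set H.U) ∈ nhds (0 : H.U) := H.mem_nhds_zero.2 ⟨n, subset_rfl⟩
  exact (UniformSpace.Completion.isDenseInducing_coe (α := H.U)).closure_image_mem_nhds h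

theorem exists_clos_NLtot_subset {s : Set H.Compl} (hs : s ∈ nhds 0) :
    ∃ n : ℕ, (H.clos (H.NLtot n) : Set H.Compl) ⊆ s := by
  obtain ⟨t, ht, htc, hts⟩ := exists_mem_nhds_isClosed_subset hs
  have h : (fun x : H.U => (x : H.Compl)) ⁻¹' t ∈ nhds (0 : H.U) :=
    (UniformSpace.Completion.continuous_coe H.U).continuousAt.preimage_mem_nhds
      (by rwa [UniformSpace.Completion.coe_zero])
  obtain ⟨n, hn⟩ := H.mem_nhds_zero.1 h
  refine ⟨n, (closure_minimal ?_ htc).trans hts⟩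
  rintro _ ⟨x, hx, rfl⟩
  exact hn hx

theorem exists_sub_mem_of_mem_closure {T : Set H.Compl} {x : H.Compl} (hx : x ∈ closure T) (n : ℕ) :
    ∃ y ∈ T, x - y ∈ H.clos (H.NLtot n) := by
  have h : {y | x - y ∈ H.clos (H.NLtot n)} ∈ nhds x := by
    have hc : Continuous fun y : H.Compl => x - y := continuous_const.sub continuous_id
    refine hc.continuousAt.preimage_mem_nhds ?_
    rw [sub_self]
    exact H.clos_NLtot_mem_nhds n
  obtain ⟨y, hy, hyT⟩ := mem_closure_iff_nhds.1 hx _ h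
  exact ⟨y, hyT, hy⟩

theorem exists_sub_mem_clos {S : Submodule ℂ H.U} {x : H.Compl} (hx : x ∈ H.clos S) (n : ℕ) :
    ∃ u ∈ S, x - H.toCompl u ∈ H.clos (H.NLtot n) := by
  obtain ⟨_, ⟨u, hu, rfl⟩, h⟩ := H.exists_sub_mem_of_mem_closure hx n
  exact ⟨u, hu, h⟩

theorem mem_clos_top (x : H.Compl) : x ∈ H.clos ⊤ := by
  have := (UniformSpace.Completion.denseRange_coe (α := H.U)) x
  refine closure_mono ?_ this
  rintro _ ⟨u, rfl⟩
  exact ⟨u, trivial, rfl⟩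

theorem mem_clos_of_forall {S : Submodule ℂ H.U} {x : H.Compl} (K : ℕ)
    (h : ∀ n : ℕ, K ≤ n → ∃ u ∈ S, x - H.toCompl u ∈ H.clos (H.NLtot n)) : x ∈ H.clos S := by
  refine mem_closure_iff_nhds.2 fun t ht => ?_
  have ht' : (fun y : H.Compl => x - y) ⁻¹' t ∈ nhds (0 : H.Compl) :=
    (continuous_const.sub continuous_id).continuousAt.preimage_mem_nhds (by simpa using ht)
  obtain ⟨n, hn⟩ := H.exists_clos_NLtot_subset ht'
  obtain ⟨u, hu, hxu⟩ := h (max n K) (le_max_right _ _)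
  refine ⟨H.toCompl u, ?_, u, hu, rfl⟩
  have := hn (H.clos_mono (H.NLtot_anti (by simp)) hxu)
  simpa using this

/-- The topology of `U` is induced from the completion, and an open subgroup is closed. -/
theorem mem_NLtot_of_toCompl_mem {n : ℕ} {u : H.U} (hu : H.toCompl u ∈ H.clos (H.NLtot n)) :
    u ∈ H.NLtot n := by
  have h1 : u ∈ closure (H.NLtot n : Set H.U) := by
    rw [(UniformSpace.Completion.isDenseInducing_coe (α := H.U)).isInducing.closure_eq_preimage_closure_image]
    exact hu
  have h2 : {y | u - y ∈ (H.NLtot n : Set H.U)} ∈ nhds u := by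
    have hc : Continuous fun y : H.U => u - y := continuous_const.sub continuous_id
    refine hc.continuousAt.preimage_mem_nhds ?_
    rw [sub_self]
    exact H.mem_nhds_zero.2 ⟨n, subset_rfl⟩
  obtain ⟨y, hy, hyn⟩ := mem_closure_iff_nhds.1 h1 _ h2
  have := (H.NLtot n).add_mem hy hyn
  rwa [sub_add_cancel] at this

/-- Approximate by elements of `U_p`. If the approximation is at least as fine as the `N`-th
neighbourhood, the approximants themselves lie in the left ideal, hence in its part of degree `p`.
-/
theorem mem_clos_NL {p : ℤ} {N : ℕ} {x : H.Compl} (hp : x ∈ H.clos (H.Uh p))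
    (hx : x ∈ H.clos (H.NLtot N)) : x ∈ H.clos (H.NL N p) := by
  refine H.mem_clos_of_forall N fun n hn => ?_
  obtain ⟨w, hw, hxw⟩ := H.exists_sub_mem_clos hp n
  refine ⟨w, H.mem_NL_of_mem hw (H.mem_NLtot_of_toCompl_mem ?_), hxw⟩
  have := (H.clos _).sub_mem hx (H.clos_mono (H.NLtot_anti (by exact_mod_cast hn)) hxw)
  rwa [sub_sub_cancel] at this

/-- An element of degree `p` of the completion is the sum of an element of `U_p` and an element of
the closure of `∑_{j ≤ -n} U_{p-j} U_j`. -/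
theorem exists_sub_mem_clos_NL {p : ℤ} {x : H.Compl} (hx : x ∈ H.clos (H.Uh p)) (N : ℕ) :
    ∃ u ∈ H.Uh p, x - H.toCompl u ∈ H.clos (H.NL N p) := by
  obtain ⟨u, hu, hxu⟩ := H.exists_sub_mem_clos hx N
  exact ⟨u, hu, H.mem_clos_NL ((H.clos _).sub_mem hx (subset_closure ⟨u, hu, rfl⟩)) hxu⟩

instance : NonarchimedeanRing H.U := H.isBasis.nonarchimedean

theorem summable_of_mem_NLtot {f : ℕ → H.Compl}
    (h : ∀ n : ℕ, ∃ K, ∀ i, K ≤ i → f i ∈ H.clos (H.NLtot n)) : Summable f := by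
  refine NonarchimedeanAddGroup.summable_of_tendsto_cofinite_zero ?_
  rw [Nat.cofinite_eq_atTop]
  intro s hs
  obtain ⟨n, hn⟩ := H.exists_clos_NLtot_subset hs
  obtain ⟨K, hK⟩ := h n
  exact Filter.mem_map.2 (Filter.mem_atTop_sets.2 ⟨K, fun i hi => hn (hK i hi)⟩)

theorem hasSum_sub_sum_mem {f : ℕ → H.Compl} {s : H.Compl} (h : HasSum f s) (n : ℕ) :
    ∃ K, ∀ k, K ≤ k → s - ∑ i ∈ Finset.range k, f i ∈ H.clos (H.NLtot n) := by
  have h1 := h.tendsto_sum_nat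
  have h2 : {y | s - y ∈ H.clos (H.NLtot n)} ∈ nhds s := by
    have hc : Continuous fun y : H.Compl => s - y := continuous_const.sub continuous_id
    refine hc.continuousAt.preimage_mem_nhds ?_
    rw [sub_self]
    exact H.clos_NLtot_mem_nhds n
  exact Filter.mem_atTop_sets.1 (h1 h2)

end EnvelopingTopology

/-! ### The action of the enveloping algebras on modules -/

section Action

variable {V : Type u} [AddCommGroup V] [Module ℂ V]

/-- A graded representation of a vertex operator algebra on `X`. -/
structure GradedRep (H : VOA V) (X : Type*) [AddCommGroup X] [Module ℂ X] where
  act : V →ₗ[ℂ] Fld X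
  grading : ℤ → Submodule ℂ X
  grading_neg : ∀ q < 0, grading q = ⊥
  iSup_grading : ⨆ q, grading q = ⊤
  deriv : ∀ a, act (H.Y H.conf 0 a) = dfld (act a)
  vac : act H.vac = idFld X
  jacobi : ∀ a b l m n, jprod (act a) (act b) l m n =
    ∑ᶠ i : ℕ, Ring.choose m i • (act (H.Y a (l + i) b)).1 (m + n - i)
  homog : ∀ (k : ℕ), ∀ a ∈ H.gr k, ∀ (m q : ℤ), ∀ x ∈ grading q,
    (act a).1 m x ∈ grading (q + k - m - 1)

namespace GradedRep

variable {H : VOA V} {X : Type*} [AddCommGroup X] [Module ℂ X] (T : H.GradedRep X)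

/-- The action of `a ⊗ t^n` on a representation. -/
def tensorAct : TensorAlgebra ℂ (ℤ →₀ V) →ₐ[ℂ] Module.End ℂ X :=
  TensorAlgebra.lift ℂ (Finsupp.lsum ℂ fun n =>
    LinearMap.proj n ∘ₗ (Fld X).subtype ∘ₗ T.act)

theorem tensorAct_preMode (n : ℤ) (a : V) : T.tensorAct (preMode n a) = (T.act a).1 n := by
  change T.tensorAct (TensorAlgebra.ι ℂ (Finsupp.single n a)) = _
  rw [tensorAct, TensorAlgebra.lift_ι_apply, Finsupp.lsum_single]
  rfl

/-- The action of the enveloping algebra on a representation. -/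
def uAct : H.U →ₐ[ℂ] Module.End ℂ X :=
  RingQuot.liftAlgHom ℂ ⟨T.tensorAct, by
    rintro _ _ (⟨a, n⟩ | ⟨a, b, i, j⟩ | _)
    · rw [map_add, map_smul, tensorAct_preMode, tensorAct_preMode, map_zero, T.deriv]
      change (-n : ℤ) • (T.act a).1 (n - 1) + (n : ℂ) • (T.act a).1 (n - 1) = 0
      rw [← Int.cast_smul_eq_zsmul ℂ, ← add_smul]
      push_cast
      rw [neg_add_cancel, zero_smul]
    · rw [map_sub, map_mul, map_mul, tensorAct_preMode, tensorAct_preMode, ← jprod_zero, T.jacobi]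
      have := T.tensorAct.toLinearMap.toAddMonoidHom.map_finsum
        (H.finite_support_mode a b (fun k y => Ring.choose i k • preMode (i + j - k) y)
          fun k => by rw [map_zero, smul_zero])
      refine ((finsum_congr fun k => ?_).trans this.symm)
      rw [zero_add, ← tensorAct_preMode]
      exact (map_zsmul T.tensorAct.toLinearMap _ _).symm
    · rw [map_one, tensorAct_preMode, T.vac]
      rfl⟩

theorem uAct_uMode (n : ℤ) (a : V) : T.uAct (H.uMode n a) = (T.act a).1 n :=
  (RingQuot.liftAlgHom_mkAlgHom_apply ℂ _ _ (preMode n a)).trans (T.tensorAct_preMode n a)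

theorem uAct_mem {p q : ℤ} {u : H.U} (hu : u ∈ H.Uh p) {x : X} (hx : x ∈ T.grading q) :
    T.uAct u x ∈ T.grading (q + p) := by
  induction hu using Submodule.span_induction with
  | mem u hu =>
    induction hu with
    | one => rwa [map_one, Module.End.one_apply, add_zero]
    | mul k a n d u ha _ ih =>
      rw [map_mul, Module.End.mul_apply, uAct_uMode]
      have := T.homog k a ha n _ _ ih
      rwa [show q + d + k - n - 1 = q + (k - n - 1 + d) by ring] at this
  | zero => rw [map_zero]; exact zero_mem _
  | add u w _ _ hu hw => rw [map_add]; exact add_mem hu hw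
  | smul r u _ hu => rw [map_smul]; exact Submodule.smul_mem _ r hu

/-- Operators of degree `≤ -n` send degree `q < n` to negative degrees, where the representation
vanishes. -/
theorem uAct_NLtot {n q : ℤ} (hq : q < n) {u : H.U} (hu : u ∈ H.NLtot n) {x : X}
    (hx : x ∈ T.grading q) : T.uAct u x = 0 := by
  induction hu using Submodule.mul_induction_on' with
  | mem_mul_mem a _ b hb =>
    have hb0 : T.uAct b x = 0 := by
      refine Submodule.iSup_induction _ (motive := fun b => T.uAct b x = 0) hb (fun j b hb => ?_)
        (by rw [map_zero, LinearMap.zero_apply])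
        (fun b b' h h' => by rw [map_add, LinearMap.add_apply, h, h', add_zero])
      by_cases hj : j ≤ -n
      · rw [iSup_pos hj] at hb
        have := T.uAct_mem hb hx
        rwa [T.grading_neg _ (by omega), Submodule.mem_bot] at this
      · rw [iSup_neg hj, Submodule.mem_bot] at hb
        rw [hb, map_zero, LinearMap.zero_apply]
    rw [map_mul, Module.End.mul_apply, hb0, map_zero]
  | add a _ b _ ha hb => rw [map_add, LinearMap.add_apply, ha, hb, add_zero]

/-- The vector `x` is annihilated by `U · U_{≤ -n}`. -/
def Killed (n : ℕ) (x : X) : Prop := ∀ u ∈ H.NLtot n, T.uAct u x = 0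

theorem Killed.mono {n m : ℕ} (h : n ≤ m) {x : X} (hx : T.Killed n x) : T.Killed m x :=
  fun u hu => hx u (H.NLtot_anti (by exact_mod_cast h) hu)

theorem exists_killed (x : X) : ∃ n, T.Killed n x := by
  have hx : x ∈ ⨆ q, T.grading q := T.iSup_grading ▸ Submodule.mem_top
  induction hx using Submodule.iSup_induction' with
  | mem q x hx => exact ⟨(q + 1).toNat, fun u hu => T.uAct_NLtot (by omega) hu hx⟩
  | zero => exact ⟨0, fun u _ => map_zero _⟩
  | add x y _ _ hx hy =>
    obtain ⟨a, ha⟩ := hx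
    obtain ⟨b, hb⟩ := hy
    refine ⟨max a b, fun u hu => ?_⟩
    rw [map_add, Killed.mono T (le_max_left a b) ha u hu, Killed.mono T (le_max_right a b) hb u hu,
      add_zero]

/-- The result of applying an element of the completed enveloping algebra to a vector. -/
def cFun (z : H.Compl) (x : X) : X :=
  T.uAct (H.exists_sub_mem_clos (H.mem_clos_top z) (T.exists_killed x).choose).choose x

/-- Independence of the approximation: two approximants of `z` are compared through a third, finer
than both, and differ from it by elements that kill `x`. -/
theorem cFun_eq {z : H.Compl} {x : X} {n : ℕ} (hx : T.Killed n x) {u : H.U}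
    (hu : z - H.toCompl u ∈ H.clos (H.NLtot n)) : T.cFun z x = T.uAct u x := by
  have h0 := (T.exists_killed x).choose_spec
  set n₀ := (T.exists_killed x).choose with hn₀
  have hu₀ := (H.exists_sub_mem_clos (H.mem_clos_top z) n₀).choose_spec.2
  change T.uAct (H.exists_sub_mem_clos (H.mem_clos_top z) n₀).choose x = _
  set u₀ := (H.exists_sub_mem_clos (H.mem_clos_top z) n₀).choose
  obtain ⟨u₁, -, h₁⟩ := H.exists_sub_mem_clos (H.mem_clos_top z) (max n n₀)
  have key : ∀ (k : ℕ) (w : H.U), k ≤ max n n₀ → T.Killed k x →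
      z - H.toCompl w ∈ H.clos (H.NLtot k) → T.uAct w x = T.uAct u₁ x := by
    intro k w hk hkx hw
    have hm := (H.clos _).sub_mem (H.clos_mono (H.NLtot_anti (by exact_mod_cast hk)) h₁) hw
    rw [sub_sub_sub_cancel_left, ← map_sub] at hm
    have := hkx _ (H.mem_NLtot_of_toCompl_mem hm)
    rwa [map_sub, LinearMap.sub_apply, sub_eq_zero] at this
  rw [key n₀ u₀ (le_max_right _ _) h0 hu₀, key n u (le_max_left _ _) hx hu]

theorem cFun_toCompl (u : H.U) (x : X) : T.cFun (H.toCompl u) x = T.uAct u x := by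
  obtain ⟨n, hn⟩ := T.exists_killed x
  exact T.cFun_eq hn (by rw [sub_self]; exact zero_mem _)

theorem cFun_add_right (z : H.Compl) (x y : X) : T.cFun z (x + y) = T.cFun z x + T.cFun z y := by
  obtain ⟨a, ha⟩ := T.exists_killed x
  obtain ⟨b, hb⟩ := T.exists_killed y
  have ha' := Killed.mono T (le_max_left a b) ha
  have hb' := Killed.mono T (le_max_right a b) hb
  have hab : T.Killed (max a b) (x + y) := fun u hu => by
    rw [map_add, ha' u hu, hb' u hu, add_zero]
  obtain ⟨u, -, hu⟩ := H.exists_sub_mem_clos (H.mem_clos_top z) (max a b)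
  rw [T.cFun_eq ha' hu, T.cFun_eq hb' hu, T.cFun_eq hab hu, map_add]

theorem cFun_smul_right (z : H.Compl) (r : ℂ) (x : X) : T.cFun z (r • x) = r • T.cFun z x := by
  obtain ⟨a, ha⟩ := T.exists_killed x
  have har : T.Killed a (r • x) := fun u hu => by rw [map_smul, ha u hu, smul_zero]
  obtain ⟨u, -, hu⟩ := H.exists_sub_mem_clos (H.mem_clos_top z) a
  rw [T.cFun_eq ha hu, T.cFun_eq har hu, map_smul]

theorem cFun_add_left (z w : H.Compl) (x : X) : T.cFun (z + w) x = T.cFun z x + T.cFun w x := by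
  obtain ⟨a, ha⟩ := T.exists_killed x
  obtain ⟨u, -, hu⟩ := H.exists_sub_mem_clos (H.mem_clos_top z) a
  obtain ⟨u', -, hu'⟩ := H.exists_sub_mem_clos (H.mem_clos_top w) a
  have h := (H.clos _).add_mem hu hu'
  rw [← add_sub_add_comm, ← map_add] at h
  rw [T.cFun_eq ha hu, T.cFun_eq ha hu', T.cFun_eq ha h, map_add, LinearMap.add_apply]

theorem cFun_smul_left (r : ℂ) (z : H.Compl) (x : X) : T.cFun (r • z) x = r • T.cFun z x := by
  obtain ⟨a, ha⟩ := T.exists_killed x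
  obtain ⟨u, -, hu⟩ := H.exists_sub_mem_clos (H.mem_clos_top z) a
  have h := (H.clos _).smul_mem r hu
  rw [smul_sub, ← map_smul] at h
  rw [T.cFun_eq ha hu, T.cFun_eq ha h, map_smul, LinearMap.smul_apply]

theorem cFun_mul (z w : H.Compl) (x : X) : T.cFun (z * w) x = T.cFun z (T.cFun w x) := by
  obtain ⟨a, ha⟩ := T.exists_killed x
  obtain ⟨u, -, hu⟩ := H.exists_sub_mem_clos (H.mem_clos_top w) a
  obtain ⟨b, hb⟩ := T.exists_killed (T.uAct u x)
  obtain ⟨m, hm⟩ := H.exists_mul_mem_NLtot a u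
  obtain ⟨u', -, hu'⟩ := H.exists_sub_mem_clos (H.mem_clos_top z) (max b m)
  have hle1 : (⊤ : Submodule ℂ H.U) * H.NLtot a ≤ H.NLtot a :=
    Submodule.mul_le.2 fun x _ y hy => H.mul_mem_NLtot a x hy
  have h1 : z * (w - H.toCompl u) ∈ H.clos (H.NLtot a) :=
    H.clos_mono hle1 (H.mul_mem_clos (H.mem_clos_top z) hu)
  have hle2 : H.NLtot m * Submodule.span ℂ {u} ≤ H.NLtot a := by
    refine Submodule.mul_le.2 fun x hx y hy => ?_
    obtain ⟨r, rfl⟩ := Submodule.mem_span_singleton.1 hy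
    rw [mul_smul_comm]
    exact Submodule.smul_mem _ r (hm x hx)
  have hum : H.toCompl u ∈ H.clos (Submodule.span ℂ {u}) :=
    subset_closure ⟨u, Submodule.mem_span_singleton_self u, rfl⟩
  have hum' : z - H.toCompl u' ∈ H.clos (H.NLtot m) :=
    H.clos_mono (H.NLtot_anti (by simp)) hu'
  have h2 : (z - H.toCompl u') * H.toCompl u ∈ H.clos (H.NLtot a) :=
    H.clos_mono hle2 (H.mul_mem_clos hum' hum)
  -- `z w - u' u = z (w - u) + (z - u') u`. Closeness of `z` and `u'` survives right multiplication
  -- by `u` only after enlarging the order to `m`; the order `b` serves the action on `u x`.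
  have h := (H.clos _).add_mem h1 h2
  rw [mul_sub, sub_mul, sub_add_sub_cancel, ← H.toCompl_mul] at h
  have hub : z - H.toCompl u' ∈ H.clos (H.NLtot b) :=
    H.clos_mono (H.NLtot_anti (by simp)) hu'
  rw [T.cFun_eq ha h, T.cFun_eq ha hu, T.cFun_eq hb hub, map_mul, Module.End.mul_apply]

/-- The action of an element of the completed enveloping algebra on a representation. -/
def cEnd (z : H.Compl) : Module.End ℂ X where
  toFun := T.cFun z
  map_add' := T.cFun_add_right z
  map_smul' := T.cFun_smul_right z

/-- The action of the completed enveloping algebra on a representation. -/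
def cAct : H.Compl →ₐ[ℂ] Module.End ℂ X :=
  AlgHom.ofLinearMap
    { toFun := T.cEnd
      map_add' := fun z w => LinearMap.ext (T.cFun_add_left z w)
      map_smul' := fun r z => LinearMap.ext (T.cFun_smul_left r z) }
    (LinearMap.ext fun x => by
      change T.cFun 1 x = x
      rw [← H.toCompl_one, T.cFun_toCompl, map_one, Module.End.one_apply])
    (fun z w => LinearMap.ext (T.cFun_mul z w))

theorem cAct_apply (z : H.Compl) (x : X) : T.cAct z x = T.cFun z x := rfl

theorem cAct_eq {z : H.Compl} {x : X} {n : ℕ} (hx : T.Killed n x) {u : H.U}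
    (hu : z - H.toCompl u ∈ H.clos (H.NLtot n)) : T.cAct z x = T.uAct u x := by
  rw [cAct_apply, T.cFun_eq hx hu]

theorem cAct_toCompl (u : H.U) : T.cAct (H.toCompl u) = T.uAct u :=
  LinearMap.ext fun x => (T.cAct_apply _ x).trans (T.cFun_toCompl u x)

theorem cAct_cMode (n : ℤ) (a : V) : T.cAct (H.cMode n a) = (T.act a).1 n := by
  rw [← uAct_uMode, ← cAct_toCompl]
  rfl

theorem cAct_of_mem_clos {z : H.Compl} {x : X} {n : ℕ} (hx : T.Killed n x)
    (hz : z ∈ H.clos (H.NLtot n)) : T.cAct z x = 0 := by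
  rw [T.cAct_eq hx (u := 0) (by rwa [map_zero, sub_zero]), map_zero, LinearMap.zero_apply]

theorem cAct_hasSum {f : ℕ → H.Compl} {s : H.Compl} (h : HasSum f s) (x : X) :
    ∃ K, ∀ k, K ≤ k → T.cAct s x = ∑ i ∈ Finset.range k, T.cAct (f i) x := by
  obtain ⟨n, hn⟩ := T.exists_killed x
  obtain ⟨K, hK⟩ := H.hasSum_sub_sum_mem h n
  refine ⟨K, fun k hk => ?_⟩
  have := T.cAct_of_mem_clos hn (hK k hk)
  rwa [map_sub, LinearMap.sub_apply, sub_eq_zero, map_sum, LinearMap.sum_apply] at this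

/-- Applied to one vector, the convergent sum in the completion becomes a finite one, and the
relator becomes the Jacobi identity of the representation. -/
theorem cAct_jacobiRelators {r : H.Uhat} (hr : r ∈ H.jacobiRelators) : T.cAct r = 0 := by
  obtain ⟨a, b, l, m, n, s, hs, hr⟩ := hr
  refine LinearMap.ext fun x => ?_
  obtain ⟨N, hN⟩ := H.field a b
  have h2 : T.cAct (∑ᶠ i : ℕ, Ring.choose m i • H.cMode (m + n - i) (H.Y a (l + i) b)) =
      jprod (T.act a) (T.act b) l m n := by
    rw [T.jacobi]
    refine (T.cAct.toLinearMap.toAddMonoidHom.map_finsum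
      ((Set.finite_lt_nat (N - l).toNat).subset fun k hk => ?_)).trans (finsum_congr fun k => ?_)
    · by_contra hk'
      refine hk ?_
      beta_reduce
      rw [hN _ (by simp only [Set.mem_ofPred_eq] at hk'; omega), map_zero, smul_zero]
    · rw [← cAct_cMode]
      exact map_zsmul T.cAct.toLinearMap _ _
  rw [hr, map_sub, h2, LinearMap.sub_apply, LinearMap.zero_apply, sub_eq_zero]
  obtain ⟨K, hK⟩ := T.cAct_hasSum hs x
  obtain ⟨K₁, h₁⟩ := Fld.evZero_left (T.act b) n x fun i => (T.act a).1 (m + l - i)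
  obtain ⟨K₂, h₂⟩ := Fld.evZero_left (T.act a) m x fun i => (T.act b).1 (n + l - i)
  rw [hK (max K (max K₁ K₂)) (le_max_left _ _)]
  change _ = lprod _ _ l m n x - sg l • lprod _ _ l n m x
  rw [lprod_apply, lprod_apply,
    bsum_eq_sum (N := max K (max K₁ K₂)) (fun i hi => h₁ i (le_trans (by simp) hi)),
    bsum_eq_sum (N := max K (max K₁ K₂)) (fun i hi => h₂ i (le_trans (by simp) hi)),
    Finset.smul_sum, ← Finset.sum_sub_distrib]
  refine Finset.sum_congr rfl fun i _ => ?_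
  rw [map_zsmul, map_sub, map_zsmul, map_mul, map_mul, cAct_cMode, cAct_cMode, cAct_cMode,
    cAct_cMode, smul_comm (sg l), ← smul_sub]
  rfl

theorem jacobiIdeal_le {z : H.Uhat} (hz : z ∈ H.jacobiIdeal) : T.cAct z = 0 := by
  have h : H.jacobiIdeal ≤ TwoSidedIdeal.ker (T.cAct.comp H.Uhat.val) :=
    TwoSidedIdeal.span_le.2 fun r hr => (TwoSidedIdeal.mem_ker _).2 (T.cAct_jacobiRelators hr)
  exact (TwoSidedIdeal.mem_ker _).1 (h hz)

/-- Closures are harmless: on a given vector, elements that are close enough act in the same way. -/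
theorem jacobiClosure_le : H.jacobiClosure ≤ TwoSidedIdeal.ker (T.cAct.comp H.Uhat.val) := by
  refine TwoSidedIdeal.span_le.2 fun z hz => (TwoSidedIdeal.mem_ker _).2 ?_
  obtain ⟨p, hz⟩ := hz
  refine LinearMap.ext fun x => ?_
  obtain ⟨n, hn⟩ := T.exists_killed x
  obtain ⟨y, ⟨-, w, hw, rfl⟩, hy⟩ := H.exists_sub_mem_of_mem_closure hz n
  have := T.cAct_of_mem_clos hn hy
  rw [map_sub, T.jacobiIdeal_le hw, sub_zero] at this
  exact this

/-- The action of the universal enveloping algebra on a representation. -/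
def envAct : H.Env →ₐ[ℂ] Module.End ℂ X :=
  RingCon.liftₐ H.jacobiClosure.ringCon (T.cAct.comp H.Uhat.val) fun {a b} hab => by
    have := T.jacobiClosure_le ((TwoSidedIdeal.rel_iff _ _ _).1 hab)
    rw [TwoSidedIdeal.mem_ker, map_sub, sub_eq_zero] at this
    exact this

theorem envAct_envMode (n : ℤ) (a : V) : T.envAct (H.envMode n a) = (T.act a).1 n :=
  T.cAct_cMode n a

theorem envAct_mem {p q : ℤ} {z : H.Env} (hz : z ∈ H.deg p) {x : X} (hx : x ∈ T.grading q) :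
    T.envAct z x ∈ T.grading (q + p) := by
  obtain ⟨z, hz, rfl⟩ := hz
  obtain ⟨n, hn⟩ := T.exists_killed x
  obtain ⟨u, hu, h⟩ := H.exists_sub_mem_clos hz n
  change T.cAct (H.Uhat.val.toLinearMap z) x ∈ _
  rw [T.cAct_eq hn h]
  exact T.uAct_mem hu hx

/-- This detects nonzero elements: whatever lies in `N_L^n` must kill every vector of degree less
than `n` in every graded representation. -/
theorem envAct_envNL {n p q : ℤ} (hq : q < n) {z : H.Env} (hz : z ∈ H.envNL n p) {x : X}
    (hx : x ∈ T.grading q) : T.envAct z x = 0 := by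
  obtain ⟨z, hz, rfl⟩ := hz
  obtain ⟨k, hk⟩ := T.exists_killed x
  obtain ⟨u, hu, h⟩ := H.exists_sub_mem_clos hz k
  change T.cAct (H.Uhat.val.toLinearMap z) x = _
  rw [T.cAct_eq hk h]
  exact T.uAct_NLtot hq (H.NL_le_NLtot n p hu) hx

end GradedRep

end Action

/-- A highest weight module, as a graded representation. -/
def IsVirasoro.gradedRep {c h : ℂ} {H : VOA (Vir c)} (hH : H.IsVirasoro) {X : Type*}
    [AddCommGroup X] [Module ℂ X] [Module (VirAlg c) X] [IsScalarTower ℂ (VirAlg c) X] {v : X}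
    (hv : IsHighestWeight c h v) : H.GradedRep X where
  act := hv.rep.Y
  grading := hwGr c h X
  grading_neg _ hq := hv.hwGr_neg hq
  iSup_grading := eq_top_iff.2 (hv.iSup_hwGr ▸ iSup_le fun q => le_iSup (hwGr c h X) (q : ℤ))
  deriv a := by
    have := hH.mode_eq (-1) a
    rw [neg_add_cancel] at this
    rw [this, VirRep.Y_translation]
  vac := by
    rw [hH.vac_eq]
    exact VirRep.Y_vac _
  jacobi a b l m n := by
    simp only [hH.Y_eq]
    exact VirRep.jacobi _ a b l m n
  homog k a ha m q x hx := Y_mem_hwGr _ rfl (hH.mem_gr.1 ha) m hx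

/-! ### The universal enveloping algebra is topologically generated by the conformal vector -/

section Generation

section General

variable {V : Type u} [AddCommGroup V] [Module ℂ V] (H : VOA V)

theorem mem_Uhat_of_mem_clos {p : ℤ} {x : H.Compl} (hx : x ∈ H.clos (H.Uh p)) : x ∈ H.Uhat :=
  Algebra.subset_adjoin (Set.mem_iUnion.2 ⟨p, hx⟩)

theorem toCompl_mem_clos {S : Submodule ℂ H.U} {u : H.U} (hu : u ∈ S) : H.toCompl u ∈ H.clos S :=
  subset_closure ⟨u, hu, rfl⟩

theorem toCompl_mem_Uhat (u : H.U) : H.toCompl u ∈ H.Uhat := by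
  have hu : u ∈ ⨆ p, H.Uh p := H.iSup_Uh ▸ Submodule.mem_top
  refine Submodule.iSup_induction _ (motive := fun u => H.toCompl u ∈ H.Uhat) hu
    (fun p u hu => H.mem_Uhat_of_mem_clos (H.toCompl_mem_clos hu))
    (by rw [map_zero]; exact zero_mem _) (fun u w h h' => by rw [map_add]; exact add_mem h h')

/-- The canonical map from the enveloping algebra `U` to `𝒰`. -/
def uEnv : H.U →ₐ[ℂ] H.Env :=
  H.toEnv.comp ((AlgHom.ofLinearMap H.toCompl H.toCompl_one H.toCompl_mul).codRestrict H.Uhat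
    H.toCompl_mem_Uhat)

theorem uEnv_uMode (n : ℤ) (a : V) : H.uEnv (H.uMode n a) = H.envMode n a := rfl

theorem uEnv_mem_bar {S : Submodule ℂ H.U} {u : H.U} (hu : u ∈ S) : H.uEnv u ∈ H.bar S :=
  ⟨⟨H.toCompl u, H.toCompl_mem_Uhat u⟩, H.toCompl_mem_clos hu, rfl⟩

theorem envNL_anti {m n : ℤ} (h : m ≤ n) (p : ℤ) : H.envNL n p ≤ H.envNL m p :=
  H.bar_mono (H.NL_anti h p)

theorem exists_sub_mem_envNL {p : ℤ} {x : H.Env} (hx : x ∈ H.deg p) (N : ℤ) :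
    ∃ u ∈ H.Uh p, x - H.uEnv u ∈ H.envNL N p := by
  obtain ⟨x, hx, rfl⟩ := hx
  obtain ⟨u, hu, h⟩ := H.exists_sub_mem_clos_NL hx N.toNat
  refine ⟨u, hu, H.envNL_anti (Int.self_le_toNat N) p
    ⟨x - ⟨H.toCompl u, H.toCompl_mem_Uhat u⟩, h, ?_⟩⟩
  exact map_sub H.toEnv x ⟨H.toCompl u, H.toCompl_mem_Uhat u⟩

theorem toEnv_eq_zero {p : ℤ} {r : H.Uhat} (hr : r ∈ H.jacobiRelators)
    (hp : (r : H.Compl) ∈ H.clos (H.Uh p)) : H.toEnv r = 0 := by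
  have h1 : r ∈ H.jacobiIdeal := TwoSidedIdeal.subset_span hr
  have h2 : r ∈ H.jacobiClosure :=
    TwoSidedIdeal.subset_span ⟨p, subset_closure ⟨hp, r, h1, rfl⟩⟩
  have h3 : H.jacobiClosure.ringCon r 0 := (TwoSidedIdeal.mem_iff _ _).1 h2
  have h4 : H.toEnv r = H.toEnv 0 := (RingCon.eq _).2 h3
  rw [h4, map_zero]

theorem mem_NLtot_of_mem_Uh {j : ℤ} {n : ℤ} (hj : j ≤ -n) {u : H.U} (hu : u ∈ H.Uh j) :
    u ∈ H.NLtot n := by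
  have : (1 : H.U) * u ∈ H.NLtot n :=
    Submodule.mul_mem_mul trivial (Submodule.mem_iSup_of_mem j (Submodule.mem_iSup_of_mem hj hu))
  rwa [one_mul] at this

/-- The Jacobi identity in `𝒰`, with the infinite sum replaced by a partial sum. -/
theorem exists_jacobi_sum (a b : V) (j k : ℤ) (ha : ∀ n, H.uMode n a ∈ H.Uh (j - n - 1))
    (hb : ∀ n, H.uMode n b ∈ H.Uh (k - n - 1)) (l n : ℤ)
    (hab : H.uMode n (H.Y a l b) ∈ H.Uh (j + k - l - n - 2)) (N : ℤ) :
    ∃ K, H.envMode n (H.Y a l b) -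
      ∑ i ∈ Finset.range K, ((-1 : ℤ) ^ i * Ring.choose l i) •
        (H.envMode (l - i) a * H.envMode (n + i) b -
          sg l • (H.envMode (n + l - i) b * H.envMode i a)) ∈ H.envNL N (j + k - l - n - 2) := by
  set p := j + k - l - n - 2 with hp
  let g : ℕ → H.U := fun i => ((-1 : ℤ) ^ i * Ring.choose l i) •
    (H.uMode (0 + l - i) a * H.uMode (n + i) b -
      sg l • (H.uMode (n + l - i) b * H.uMode (0 + i) a))
  have hg : ∀ i, g i ∈ H.Uh p := by
    intro i
    refine zsmul_mem (sub_mem ?_ (zsmul_mem ?_ _)) _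
    · have := H.Uh_mul_Uh _ _ (Submodule.mul_mem_mul (ha (0 + l - i)) (hb (n + i)))
      rwa [show j - (0 + l - i) - 1 + (k - (n + i) - 1) = p by rw [hp]; ring] at this
    · have := H.Uh_mul_Uh _ _ (Submodule.mul_mem_mul (hb (n + l - i)) (ha (0 + i)))
      rwa [show k - (n + l - i) - 1 + (j - (0 + i) - 1) = p by rw [hp]; ring] at this
  have hgN : ∀ m : ℕ, ∃ K, ∀ i, K ≤ i → g i ∈ H.NLtot m := by
    intro m
    -- From this index on, the right-hand factors `b_[n+i]` and `a_[i]` have degree at most `-m`.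
    refine ⟨(max (m + k - n - 1) (m + j - 1)).toNat, fun i hi => ?_⟩
    refine zsmul_mem (sub_mem (H.mul_mem_NLtot _ _ ?_) (zsmul_mem (H.mul_mem_NLtot _ _ ?_) _)) _
    · exact H.mem_NLtot_of_mem_Uh (by omega) (hb (n + i))
    · exact H.mem_NLtot_of_mem_Uh (by omega) (ha (0 + i))
  obtain ⟨s, hs⟩ := H.summable_of_mem_NLtot (f := fun i => H.toCompl (g i)) fun m => by
    obtain ⟨K, hK⟩ := hgN m
    exact ⟨K, fun i hi => H.toCompl_mem_clos (hK i hi)⟩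
  have hsp : s ∈ H.clos (H.Uh p) := by
    refine mem_closure_of_tendsto hs.tendsto_sum_nat (Filter.Eventually.of_forall fun K => ?_)
    rw [← map_sum]
    exact ⟨_, sum_mem fun i _ => hg i, rfl⟩
  obtain ⟨K, hK⟩ := H.hasSum_sub_sum_mem hs N.toNat
  -- With middle index `0` in the Jacobi relator only the term `i = 0` survives, which isolates the
  -- single mode of `a_(l) b`.
  have hmode : ∑ᶠ i : ℕ, Ring.choose (0 : ℤ) i • H.cMode (0 + n - i) (H.Y a (l + i) b) =
      H.cMode n (H.Y a l b) := by
    rw [finsum_eq_single _ 0]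
    · rw [Ring.choose_zero_right, one_smul, Nat.cast_zero, zero_add, sub_zero, add_zero]
    · intro i hi
      rw [Ring.choose_zero_pos ℤ (Nat.pos_of_ne_zero hi), zero_smul]
  have hcm : H.cMode n (H.Y a l b) ∈ H.clos (H.Uh p) := H.toCompl_mem_clos hab
  have hrp : s - H.cMode n (H.Y a l b) ∈ H.clos (H.Uh p) := sub_mem hsp hcm
  have hr0 := H.toEnv_eq_zero (r := ⟨_, H.mem_Uhat_of_mem_clos hrp⟩)
    ⟨a, b, l, 0, n, s, ?_, by rw [hmode]⟩ hrp
  swap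
  · have e : (fun i => H.toCompl (g i)) = fun i : ℕ => ((-1 : ℤ) ^ i * Ring.choose l i) •
        (H.cMode (0 + l - i) a * H.cMode (n + i) b -
          sg l • (H.cMode (n + l - i) b * H.cMode (0 + i) a)) := by
      funext i
      rw [map_zsmul, map_sub, map_zsmul, H.toCompl_mul, H.toCompl_mul]
      rfl
    rwa [e] at hs
  refine ⟨K, ?_⟩
  have hd : s - ∑ i ∈ Finset.range K, H.toCompl (g i) ∈ H.clos (H.NL N.toNat p) :=
    H.mem_clos_NL (sub_mem hsp (sum_mem fun i _ => H.toCompl_mem_clos (hg i))) (hK K le_rfl)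
  refine H.envNL_anti (Int.self_le_toNat N) p
    ⟨⟨s, H.mem_Uhat_of_mem_clos hsp⟩ - ∑ i ∈ Finset.range K, ⟨H.toCompl (g i), H.toCompl_mem_Uhat _⟩,
      ?_, ?_⟩
  · rw [SetLike.mem_coe, Submodule.mem_comap, map_sub, map_sum]
    exact hd
  · change H.toEnv _ = _
    rw [map_sub, map_sum]
    have e1 : H.toEnv ⟨s, H.mem_Uhat_of_mem_clos hsp⟩ = H.envMode n (H.Y a l b) := by
      rw [← sub_eq_zero, ← hr0]
      exact (map_sub H.toEnv _ ⟨H.cMode n (H.Y a l b), H.cMode_mem n _⟩).symm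
    rw [e1]
    congr 1
    refine Finset.sum_congr rfl fun i _ => ?_
    change H.uEnv (((-1 : ℤ) ^ i * Ring.choose l i) •
      (H.uMode (0 + l - i) a * H.uMode (n + i) b -
        sg l • (H.uMode (n + l - i) b * H.uMode (0 + i) a))) = _
    rw [map_zsmul, map_sub, map_zsmul, map_mul, map_mul, zero_add, zero_add]
    rfl

end General

end Generation

/-! ### Triangular decomposition of `𝒰` for the Virasoro vertex operator algebra -/

section GenerationVir

variable {c : ℂ}

theorem virL_smul_conf {k : ℤ} (hk : 1 ≤ k) : virL c k • virL c (-2) • virVac c =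
    (if k = 2 then c / 2 else 0) • virVac c := by
  rw [← mul_smul, virL_mul, add_smul, add_smul, mul_smul, virL_smul_virVac (by omega), smul_zero,
    zero_add, smul_assoc, virL_smul_virVac (by omega), smul_assoc, one_smul]
  refine (congrArg (· + _) (smul_zero (A := Vir c) ((k : ℂ) - ((-2 : ℤ) : ℂ)))).trans ?_
  rw [zero_add]
  congr 1
  by_cases h : k = 2
  · subst h; norm_num; ring
  · rw [if_neg (by omega), if_neg h]

namespace IsVirasoro

variable {H : VOA (Vir c)} (hH : H.IsVirasoro)

include hH

theorem Y_conf_apply (n : ℤ) (x : Vir c) : H.Y H.conf n x = virL c (n - 1) • x := by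
  have := hH.mode_eq (n - 1) x
  rwa [sub_add_cancel] at this

theorem uMode_conf_comm (m n : ℤ) : H.uMode (m + 1) H.conf * H.uMode (n + 1) H.conf -
    H.uMode (n + 1) H.conf * H.uMode (m + 1) H.conf =
      ((m : ℂ) - n) • H.uMode (m + n + 1) H.conf +
        (if m + n = 0 then c / 12 * ((m : ℂ) ^ 3 - m) else 0) • 1 := by
  have h2 : ∀ k : ℕ, 2 ≤ k → H.Y H.conf k H.conf = (if k = 3 then c / 2 else 0) • H.vac := by
    intro k hk
    rw [hH.Y_conf_apply, hH.conf_eq, hH.vac_eq]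
    refine (virL_smul_conf (by omega)).trans ?_
    rw [if_congr (show (k : ℤ) - 1 = 2 ↔ k = 3 by omega) rfl rfl]
    rfl
  have hY2 : H.Y H.conf (2 : ℕ) H.conf = 0 := (h2 2 le_rfl).trans (zero_smul ℂ H.vac)
  have hY3 : H.Y H.conf (3 : ℕ) H.conf = (c / 2) • H.vac := h2 3 (by norm_num)
  have h1 : H.Y H.conf (1 : ℕ) H.conf = (2 : ℂ) • H.conf := by
    rw [Nat.cast_one, H.conf_grading 2 _ H.conf_mem]
    norm_num
  rw [H.uMode_comm, finsum_eq_sum_range (N := 4)]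
  · rw [Finset.sum_range_succ, Finset.sum_range_succ, Finset.sum_range_succ, Finset.sum_range_one,
      hY2, hY3, h1, map_zero,
      smul_zero, add_zero, Nat.cast_zero, H.uMode_deriv, Ring.choose_zero_right, one_smul,
      Ring.choose_one_right, map_smul, map_smul, sub_zero, Nat.cast_one,
      show m + 1 + (n + 1) - 1 = m + n + 1 by ring, ← Int.cast_smul_eq_zsmul ℂ (m + 1), smul_smul,
      ← add_smul]
    congr 1
    · congr 1
      push_cast
      ring
    · by_cases h : m + n = 0
      · rw [if_pos h, show m + 1 + (n + 1) - (3 : ℕ) = -1 by push_cast; omega,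
          H.uMode_vac_neg_one, ← Int.cast_smul_eq_zsmul ℂ, smul_smul]
        congr 1
        have := congrArg (Int.cast (R := ℂ)) (six_mul_choose_three (m + 1))
        push_cast at this
        linear_combination c / 12 * this
      · rw [if_neg h, H.uMode_vac_of_ne (by push_cast; omega), smul_zero, smul_zero, zero_smul]
  · intro k hk
    have hYk : H.Y H.conf k H.conf = 0 := by
      rw [h2 k (by omega), if_neg (by omega)]
      exact zero_smul ℂ H.vac
    rw [hYk, map_zero, smul_zero]

/-- The canonical map from the enveloping algebra of the Virasoro algebra to `U`. -/
def uVir : VirAlg c →ₐ[ℂ] H.U := virLift (fun n => H.uMode (n + 1) H.conf) hH.uMode_conf_comm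

theorem uVir_virL (n : ℤ) : hH.uVir (virL c n) = H.uMode (n + 1) H.conf := virLift_virL _ _ n

/-- The canonical map from the enveloping algebra of the Virasoro algebra to `𝒰`. -/
def nu : VirAlg c →ₐ[ℂ] H.Env := H.uEnv.comp hH.uVir

theorem nu_virL (n : ℤ) : hH.nu (virL c n) = H.envMode (n + 1) H.conf := by
  rw [nu, AlgHom.comp_apply, uVir_virL, H.uEnv_uMode]

theorem uVir_mem {p : ℤ} {x : VirAlg c} (hx : VirMon c p x) : hH.uVir x ∈ H.Uh p := by
  induction hx with
  | one => rw [map_one]; exact H.one_mem_Uh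
  | mul n p x _ ih =>
    rw [map_mul, uVir_virL]
    have := H.Uh_mul_Uh _ _ (Submodule.mul_mem_mul (H.uMode_mem_Uh H.conf_mem (n + 1)) ih)
    rwa [show ((2 : ℕ) : ℤ) - (n + 1) - 1 + p = p - n by push_cast; ring] at this

theorem nu_mem_deg {p : ℤ} {x : VirAlg c} (hx : VirMon c p x) : hH.nu x ∈ H.deg p :=
  H.uEnv_mem_bar (hH.uVir_mem hx)

/-- The subspace of `𝒰_p` generated by the `L_n` and by `N_L^N 𝒰_p`. -/
def genSub (N p : ℤ) : Submodule ℂ H.Env :=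
  (Submodule.span ℂ {x | VirMon c p x}).map hH.nu.toLinearMap ⊔ H.envNL N p

theorem nu_mem_genSub {p : ℤ} {x : VirAlg c} (hx : VirMon c p x) (N : ℤ) :
    hH.nu x ∈ hH.genSub N p :=
  Submodule.mem_sup_left ⟨x, Submodule.subset_span hx, rfl⟩

omit hH in
theorem _root_.VOA.VirMon.mul' {p q : ℤ} {x y : VirAlg c} (hx : VirMon c p x)
    (hy : VirMon c q y) : VirMon c (p + q) (x * y) := by
  induction hx with
  | one => rwa [zero_add, one_mul]
  | mul n p x _ ih =>
    rw [mul_assoc, show p - n + q = p + q - n by ring]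
    exact ih.mul n

/-- Right multiplication by degree `q` shifts the filtration, `N_L^(N+q) 𝒰_p · 𝒰_q ⊆ N_L^N 𝒰_(p+q)`,
so the left factor must be known to order `N + q`. -/
theorem mul_mem_genSub {N p q r : ℤ} (hr : p + q = r) {x y : H.Env}
    (hx : x ∈ hH.genSub (N + q) p) (hy : y ∈ hH.genSub N q) : x * y ∈ hH.genSub N r := by
  subst hr
  have hdeg : ∀ {p : ℤ} {x : VirAlg c}, x ∈ Submodule.span ℂ {x | VirMon c p x} →
      hH.nu x ∈ H.deg p := by
    intro p x hx
    exact (Submodule.span_le.2 fun x hx => hH.nu_mem_deg hx :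
      _ ≤ (H.deg p).comap hH.nu.toLinearMap) hx
  obtain ⟨_, ⟨x, hx', rfl⟩, e, he, rfl⟩ := Submodule.mem_sup.1 hx
  obtain ⟨_, ⟨y, hy', rfl⟩, f, hf, rfl⟩ := Submodule.mem_sup.1 hy
  rw [add_mul, mul_add, mul_add]
  refine add_mem (add_mem (Submodule.mem_sup_left ⟨x * y, ?_, map_mul hH.nu x y⟩)
    (Submodule.mem_sup_right (H.mul_mem_envNL (hdeg hx') hf)))
    (Submodule.mem_sup_right (add_mem ?_ (H.mul_mem_envNL (H.envNL_le _ _ he) hf)))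
  · have := Submodule.mul_mem_mul hx' hy'
    rw [Submodule.span_mul_span] at this
    refine Submodule.span_mono ?_ this
    rintro _ ⟨a, ha, b, hb, rfl⟩
    exact ha.mul' hb
  · have := H.envNL_mul_mem he (hdeg hy')
    rwa [add_sub_cancel_right] at this

theorem uMode_mem {d : ℤ} {b : Vir c} (hb : b ∈ hwGr c 0 (Vir c) d) (n : ℤ) :
    H.uMode n b ∈ H.Uh (d - n - 1) := by
  rcases lt_or_ge d 0 with hd | hd
  · rw [isHighestWeight_virVac.hwGr_neg hd, Submodule.mem_bot] at hb
    rw [hb, map_zero]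
    exact zero_mem _
  · obtain ⟨k, rfl⟩ := Int.eq_ofNat_of_zero_le hd
    rw [mem_hwGr, zero_add] at hb
    exact H.uMode_mem_Uh (hH.mem_gr.2 hb) n

/-- Induction on the monomial. The Jacobi identity writes the modes of `L_{-(m+1)} b` through
products of modes of `ω` and of `b`, a finite sum up to `N_L^N`. Both `n` and `N` are general
because other modes of `b`, known to other orders, enter. -/
theorem envMode_low_mem_genSub {d : ℕ} {x : VirAlg c} (hx : LowMon c d x) (n N : ℤ) :
    H.envMode n (x • virVac c) ∈ hH.genSub N (d - n - 1) := by
  have hvac : H.vac = virVac c := hH.vac_eq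
  induction hx generalizing n N with
  | one =>
    rw [one_smul, ← hvac, ← H.uEnv_uMode]
    by_cases hn : n = -1
    · subst hn
      rw [H.uMode_vac_neg_one, map_one, ← map_one hH.nu]
      exact hH.nu_mem_genSub VirMon.one N
    · rw [H.uMode_vac_of_ne hn, map_zero]
      exact zero_mem _
  | mul m d x hx ih =>
    have hb : x • virVac c ∈ hwGr c 0 (Vir c) (d : ℤ) :=
      isHighestWeight_virVac.lowSub_le _ (Submodule.subset_span ⟨d, x, rfl, hx, rfl⟩)
    have hb' : virL c (-(m + 1)) • x • virVac c ∈ hwGr c 0 (Vir c) ((m + 1 + d : ℕ) : ℤ) := by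
      have := virL_smul_mem_hwGr (-((m : ℤ) + 1)) hb
      rwa [show (d : ℤ) - -((m : ℤ) + 1) = ((m + 1 + d : ℕ) : ℤ) by push_cast; ring] at this
    have hY : H.Y H.conf (-m) (x • virVac c) = virL c (-(m + 1)) • x • virVac c := by
      rw [hH.Y_conf_apply, show -(m : ℤ) - 1 = -(m + 1) by ring]
    have hconf : ∀ n, H.uMode n H.conf ∈ H.Uh (2 - n - 1) := H.uMode_mem_Uh H.conf_mem
    obtain ⟨K, hK⟩ := H.exists_jacobi_sum H.conf (x • virVac c) 2 d hconf (hH.uMode_mem hb) (-m) n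
      (by
        rw [hY]
        have := hH.uMode_mem hb' n
        rwa [show ((m + 1 + d : ℕ) : ℤ) - n - 1 = 2 + d - -m - n - 2 by push_cast; ring] at this) N
    rw [hY, ← mul_smul] at hK
    have hp : 2 + (d : ℤ) - -m - n - 2 = ((m + 1 + d : ℕ) : ℤ) - n - 1 := by push_cast; ring
    rw [hp] at hK
    rw [← sub_add_cancel (H.envMode n _) (∑ i ∈ Finset.range K, ((-1 : ℤ) ^ i * Ring.choose (-m : ℤ) i) •
        (H.envMode (-m - i) H.conf * H.envMode (n + i) (x • virVac c) -
          sg (-m) • (H.envMode (n + -m - i) (x • virVac c) * H.envMode i H.conf)))]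
    refine add_mem (Submodule.mem_sup_right hK) (sum_mem fun i _ => zsmul_mem (sub_mem ?_
      (zsmul_mem ?_ _)) _)
    · have h1 : ∀ N, H.envMode (-m - i) H.conf ∈ hH.genSub N (0 - (-m - i - 1)) := fun N => by
        have := hH.nu_mem_genSub ((VirMon.one (c := c)).mul (-m - i - 1)) N
        rwa [mul_one, nu_virL, sub_add_cancel] at this
      exact hH.mul_mem_genSub (by push_cast; ring) (h1 _) (ih (n + i) N)
    · have h1 : ∀ N, H.envMode i H.conf ∈ hH.genSub N (0 - (i - 1)) := fun N => by
        have := hH.nu_mem_genSub ((VirMon.one (c := c)).mul (i - 1)) N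
        rwa [mul_one, nu_virL, sub_add_cancel] at this
      exact hH.mul_mem_genSub (by push_cast; ring) (ih (n + -m - i) _) (h1 N)

theorem envMode_mem_genSub {k : ℕ} {a : Vir c} (ha : a ∈ H.gr k) (n N : ℤ) :
    H.envMode n a ∈ hH.genSub N (k - n - 1) := by
  have h : a ∈ hwGr c 0 (Vir c) (k : ℤ) := by
    rw [mem_hwGr, zero_add]
    exact hH.mem_gr.1 ha
  rw [isHighestWeight_virVac.hwGr_eq] at h
  refine (Submodule.span_le.2 ?_ : lowSub c (virVac c) k ≤ (hH.genSub N (k - n - 1)).comap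
    (H.envMode n)) h
  rintro _ ⟨d, x, hd, hx, rfl⟩
  obtain rfl : d = k := by omega
  exact hH.envMode_low_mem_genSub hx n N

/-- An element of `𝒰_p` is approximated by a polynomial in modes of arbitrary vectors, and each such
mode by polynomials in the `L_n`. -/
theorem deg_le_genSub (N p : ℤ) : H.deg p ≤ hH.genSub N p := by
  intro x hx
  obtain ⟨u, hu, h⟩ := H.exists_sub_mem_envNL hx N
  rw [← sub_add_cancel x (H.uEnv u)]
  refine add_mem (Submodule.mem_sup_right h) ?_
  clear h hx
  induction hu using Submodule.span_induction with
  | mem u hu =>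
    induction hu generalizing N with
    | one =>
      rw [map_one, ← map_one hH.nu]
      exact hH.nu_mem_genSub VirMon.one N
    | mul k a n d u ha _ ih =>
      rw [map_mul, H.uEnv_uMode]
      exact hH.mul_mem_genSub rfl (hH.envMode_mem_genSub ha n _) (ih N)
  | zero => rw [map_zero]; exact zero_mem _
  | add u w _ _ hu hw => rw [map_add]; exact add_mem hu hw
  | smul r u _ hu => rw [map_smul]; exact Submodule.smul_mem _ r hu

theorem aeval_virL_zero_mem_deg (g : Polynomial ℂ) :
    hH.nu (Polynomial.aeval (virL c 0) g) ∈ H.deg 0 := by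
  have h0 : hH.nu (virL c 0) ∈ H.U0 := by
    have := hH.nu_mem_deg ((VirMon.one (c := c)).mul 0)
    rwa [sub_zero, mul_one] at this
  have : hH.nu (Polynomial.aeval (virL c 0) g) =
      ((Polynomial.aeval (⟨hH.nu (virL c 0), h0⟩ : H.U0) g : H.U0) : H.Env) := by
    rw [← Polynomial.aeval_algHom_apply]
    exact Polynomial.aeval_algHom_apply H.U0.val ⟨hH.nu (virL c 0), h0⟩ g
  rw [this]
  exact (Polynomial.aeval (⟨hH.nu (virL c 0), h0⟩ : H.U0) g).2

theorem tri_mem_envNL {d e : ℕ} {x y : VirAlg c} (hx : LowMon c d x) (hy : HighMon c e y)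
    (g : Polynomial ℂ) {p : ℤ} (hp : (d : ℤ) - e = p) :
    hH.nu (x * (Polynomial.aeval (virL c 0) g * y)) ∈ H.envNL e p := by
  rw [map_mul, map_mul, ← mul_assoc]
  have h1 := H.mul_mem_deg (hH.nu_mem_deg (VirMon.low hx)) (hH.aeval_virL_zero_mem_deg g)
  rw [add_zero] at h1
  refine H.bar_mono ?_ (H.mul_mem_bar h1 (hH.nu_mem_deg (VirMon.high hy)))
  refine le_iSup₂_of_le (-(e : ℤ)) le_rfl ?_
  rw [show p - -(e : ℤ) = d by omega]

/-- The triangular decomposition of `𝒰_p` modulo `N_L^N 𝒰_p`. -/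
theorem mem_span_tri {N p : ℤ} {z : H.Env} (hz : z ∈ H.deg p) :
    z ∈ Submodule.span ℂ {w | ∃ d e x y, ∃ g : Polynomial ℂ, LowMon c d x ∧ HighMon c e y ∧
      (d : ℤ) - e = p ∧ (e : ℤ) < N ∧ w = hH.nu (x * (Polynomial.aeval (virL c 0) g * y))} ⊔
      H.envNL N p := by
  refine (sup_le ?_ le_sup_right : hH.genSub N p ≤ _) (hH.deg_le_genSub N p hz)
  have h1 : Submodule.span ℂ {x | VirMon c p x} ≤ triSpan c p :=
    Submodule.span_le.2 fun z hz => VirMon.mem_triSpan hz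
  refine (Submodule.map_mono h1).trans ?_
  rw [triSpan, Submodule.map_span, Submodule.span_le]
  rintro _ ⟨_, ⟨d, e, x, y, g, hx, hy, hp, rfl⟩, rfl⟩
  by_cases he : (e : ℤ) < N
  · exact Submodule.mem_sup_left (Submodule.subset_span ⟨d, e, x, y, g, hx, hy, hp, he, rfl⟩)
  · exact Submodule.mem_sup_right (H.envNL_anti (by omega) p (hH.tri_mem_envNL hx hy g hp))

/-- The polynomial `g(L_0)`, multiplied by elements of the enveloping algebra. -/
def polyMap (x y : VirAlg c) : Polynomial ℂ →ₗ[ℂ] H.Env :=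
  hH.nu.toLinearMap ∘ₗ LinearMap.mulLeft ℂ x ∘ₗ LinearMap.mulRight ℂ y ∘ₗ
    (Polynomial.aeval (virL c 0)).toLinearMap

theorem polyMap_apply (x y : VirAlg c) (g : Polynomial ℂ) :
    hH.polyMap x y g = hH.nu (x * (Polynomial.aeval (virL c 0) g * y)) := rfl

/-- For suitable `p` and `N` the degrees leave a single choice `(x₀, y₀)` for the outer monomials,
and only the polynomial in `L_0` remains free. -/
theorem exists_polyMap_sub_mem {N p : ℤ} {x₀ y₀ : VirAlg c}
    (h : ∀ d e x y, LowMon c d x → HighMon c e y → (d : ℤ) - e = p → (e : ℤ) < N →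
      x = x₀ ∧ y = y₀) {z : H.Env} (hz : z ∈ H.deg p) :
    ∃ g : Polynomial ℂ, z - hH.polyMap x₀ y₀ g ∈ H.envNL N p := by
  obtain ⟨w, hw, e, he, rfl⟩ := Submodule.mem_sup.1 (hH.mem_span_tri (N := N) hz)
  have : w ∈ LinearMap.range (hH.polyMap x₀ y₀) := by
    refine Submodule.span_le.2 ?_ hw
    rintro _ ⟨d, e, x, y, g, hx, hy, hp, he, rfl⟩
    obtain ⟨rfl, rfl⟩ := h d e x y hx hy hp he
    exact ⟨g, rfl⟩
  obtain ⟨g, rfl⟩ := this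
  exact ⟨g, by rwa [add_sub_cancel_left]⟩

theorem exists_sub_mem_deg_zero {z : H.Env} (hz : z ∈ H.deg 0) :
    ∃ g : Polynomial ℂ, z - hH.nu (Polynomial.aeval (virL c 0) g) ∈ H.envNL 1 0 := by
  obtain ⟨g, hg⟩ := hH.exists_polyMap_sub_mem (N := 1) (x₀ := 1) (y₀ := 1)
    (fun d e x y hx hy hp he => by
      obtain rfl : e = 0 := by omega
      obtain rfl : d = 0 := by omega
      exact ⟨hx.eq_one, hy.eq_one⟩) hz
  rw [polyMap_apply, one_mul, mul_one] at hg
  exact ⟨g, hg⟩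

theorem exists_sub_mem_deg_one {z : H.Env} (hz : z ∈ H.deg 1) :
    ∃ g : Polynomial ℂ,
      z - hH.nu (virL c (-1)) * hH.nu (Polynomial.aeval (virL c 0) g) ∈ H.envNL 1 1 := by
  obtain ⟨g, hg⟩ := hH.exists_polyMap_sub_mem (N := 1) (x₀ := virL c (-1)) (y₀ := 1)
    (fun d e x y hx hy hp he => by
      obtain rfl : e = 0 := by omega
      obtain rfl : d = 1 := by omega
      exact ⟨hx.eq_virL, hy.eq_one⟩) hz
  rw [polyMap_apply, mul_one, map_mul] at hg
  exact ⟨g, hg⟩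

theorem exists_sub_mem_deg_neg_one {z : H.Env} (hz : z ∈ H.deg (-1)) :
    ∃ g : Polynomial ℂ,
      z - hH.nu (Polynomial.aeval (virL c 0) g) * hH.nu (virL c 1) ∈ H.envNR 1 (-1) := by
  -- In degree `-1` one has `N_R^1 = N_L^2`; hence `N = 2`, which admits exactly the raising
  -- monomial `L_1`.
  obtain ⟨g, hg⟩ := hH.exists_polyMap_sub_mem (N := 2) (x₀ := 1) (y₀ := virL c 1)
    (fun d e x y hx hy hp he => by
      obtain rfl : e = 1 := by omega
      obtain rfl : d = 0 := by omega
      exact ⟨hx.eq_one, hy.eq_virL⟩) hz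
  rw [polyMap_apply, one_mul, map_mul] at hg
  exact ⟨g, by rw [H.envNR_eq]; exact hg⟩

end IsVirasoro

end GenerationVir

/-! ### The first mode transition algebra of the Virasoro vertex operator algebra -/

section Mode

theorem toZhu_eq_zero_iff {V : Type u} [AddCommGroup V] [Module ℂ V] (H : VOA V) {d : ℕ}
    {x : H.U0} : H.toZhu d x = 0 ↔ (x : H.Env) ∈ H.envNL (d + 1) 0 := by
  refine ⟨fun h => ?_, H.toZhu_eq_zero⟩
  rw [← map_zero (H.toZhu d)] at h
  have := (RingCon.eq _).1 h
  exact H.mem_zhuIdeal.1 ((TwoSidedIdeal.mem_iff _ _).2 this)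

theorem toZhu_surjective {V : Type u} [AddCommGroup V] [Module ℂ V] (H : VOA V) (d : ℕ) :
    Function.Surjective (H.toZhu d) :=
  RingCon.mkₐ_surjective _

theorem zhuProj_toZhu {V : Type u} [AddCommGroup V] [Module ℂ V] (H : VOA V) {m n : ℕ} (h : m ≤ n)
    (x : H.U0) : H.zhuProj h (H.toZhu n x) = H.toZhu m x := rfl

variable {c : ℂ}

theorem virAlg_hom_ext {R : Type*} [Ring R] [Algebra ℂ R] {f g : VirAlg c →ₐ[ℂ] R}
    (h : ∀ n, f (virL c n) = g (virL c n)) : f = g := by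
  refine RingQuot.ringQuot_ext' ℂ _ _ (FreeAlgebra.hom_ext (funext fun n => ?_))
  exact h n

theorem aeval_smul_of_eigen {X : Type*} [AddCommGroup X] [Module ℂ X] [Module (VirAlg c) X]
    [IsScalarTower ℂ (VirAlg c) X] {x : X} {r : ℂ} (hx : virL c 0 • x = r • x)
    (g : Polynomial ℂ) : Polynomial.aeval (virL c 0) g • x = g.eval r • x := by
  induction g using Polynomial.induction_on' with
  | add p q hp hq => rw [map_add, add_smul, hp, hq, Polynomial.eval_add, add_smul]
  | monomial k s =>
    have hk : virL c 0 ^ k • x = r ^ k • x := by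
      induction k with
      | zero => simp
      | succ k ih => rw [pow_succ, mul_smul, hx, smul_comm, ih, smul_smul, pow_succ']
    rw [Polynomial.aeval_monomial, Polynomial.eval_monomial, mul_smul, hk, algebraMap_smul,
      smul_smul]

theorem virL_one_mul_virL_neg_one :
    virL c 1 * virL c (-1) = virL c (-1) * virL c 1 + (2 : ℂ) • virL c 0 := by
  rw [virL_mul]
  norm_num

theorem IsHighestWeight.virL_one_smul {h : ℂ} {X : Type*} [AddCommGroup X] [Module ℂ X]
    [Module (VirAlg c) X] [IsScalarTower ℂ (VirAlg c) X] {v : X} (hv : IsHighestWeight c h v) :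
    virL c 1 • virL c (-1) • v = (2 * h) • v := by
  rw [← mul_smul, virL_one_mul_virL_neg_one, add_smul, mul_smul, hv.pos 1 one_pos, smul_zero,
    zero_add, smul_assoc, hv.zero, smul_smul]

/-- A polynomial with infinitely many roots vanishes. Weight `0` is left out because `L_1 L_{-1} v =
2 h v` gives no information there. -/
theorem eq_zero_of_eval {g : Polynomial ℂ} (h : ∀ r : ℂ, r ≠ 0 → g.eval r = 0) : g = 0 := by
  refine Polynomial.eq_zero_of_infinite_isRoot g (Set.Infinite.mono (s := {0}ᶜ) ?_ ?_)
  · exact fun r hr => h r hr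
  · exact (Set.finite_singleton (0 : ℂ)).infinite_compl

theorem IsHighestWeight.mem_hwGr_zero {h : ℂ} {X : Type*} [AddCommGroup X] [Module ℂ X]
    [Module (VirAlg c) X] [IsScalarTower ℂ (VirAlg c) X] {v : X} (hv : IsHighestWeight c h v) :
    v ∈ hwGr c h X 0 := by
  rw [hv.hwGr_zero]
  exact Submodule.mem_span_singleton_self _

theorem IsHighestWeight.mem_hwGr_one {h : ℂ} {X : Type*} [AddCommGroup X] [Module ℂ X]
    [Module (VirAlg c) X] [IsScalarTower ℂ (VirAlg c) X] {v : X} (hv : IsHighestWeight c h v) :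
    virL c (-1) • v ∈ hwGr c h X 1 := by
  have := virL_smul_mem_hwGr (-1) hv.mem_hwGr_zero
  rwa [show (0 : ℤ) - -1 = 1 by norm_num] at this

namespace IsVirasoro

variable {H : VOA (Vir c)} (hH : H.IsVirasoro)

include hH

theorem envAct_nu {h : ℂ} {X : Type*} [AddCommGroup X] [Module ℂ X] [Module (VirAlg c) X]
    [IsScalarTower ℂ (VirAlg c) X] {v : X} (hv : IsHighestWeight c h v) (x : VirAlg c) (y : X) :
    (hH.gradedRep hv).envAct (hH.nu x) y = x • y := by
  have : (hH.gradedRep hv).envAct.comp hH.nu = Algebra.lsmul ℂ ℂ X := by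
    refine virAlg_hom_ext fun n => ?_
    rw [AlgHom.comp_apply, nu_virL, GradedRep.envAct_envMode, hH.conf_eq]
    change (hv.rep.Y (virL c (-2) • virVac c)).1 (n + 1) = _
    rw [VirRep.Y_conf, VirRep.W_apply, add_sub_cancel_right]
    rfl
  exact LinearMap.congr_fun (AlgHom.congr_fun this x) y

theorem smul_eq_zero_of_mem_envNL {h : ℂ} {X : Type*} [AddCommGroup X] [Module ℂ X]
    [Module (VirAlg c) X] [IsScalarTower ℂ (VirAlg c) X] {v : X} (hv : IsHighestWeight c h v)
    {n p q : ℤ} (hq : q < n) {x : VirAlg c} (hx : hH.nu x ∈ H.envNL n p) {y : X}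
    (hy : y ∈ hwGr c h X q) : x • y = 0 := by
  rw [← hH.envAct_nu hv]
  exact (hH.gradedRep hv).envAct_envNL hq hx hy

theorem nu_virL_mem (n : ℤ) : hH.nu (virL c n) ∈ H.deg (-n) := by
  have := hH.nu_mem_deg ((VirMon.one (c := c)).mul n)
  rwa [zero_sub, mul_one] at this

/-- The map `g ↦ g(L_0)` to `𝒰_0`. -/
def pol : Polynomial ℂ →ₐ[ℂ] H.U0 :=
  (hH.nu.comp (Polynomial.aeval (virL c 0))).codRestrict H.U0 hH.aeval_virL_zero_mem_deg

theorem coe_pol (g : Polynomial ℂ) :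
    (hH.pol g : H.Env) = hH.nu (Polynomial.aeval (virL c 0) g) := rfl

/-- `L_{-1}`, as an element of `𝒰_1`. -/
def lowL : H.deg (1 : ℕ) := ⟨hH.nu (virL c (-1)), by
  have := hH.nu_virL_mem (-1)
  rwa [neg_neg] at this⟩

/-- `L_1`, as an element of `𝒰_{-1}`. -/
def highL : H.deg (-(1 : ℕ)) := ⟨hH.nu (virL c 1), by
  rw [Nat.cast_one]
  exact hH.nu_virL_mem 1⟩

theorem coe_lowL : (hH.lowL : H.Env) = hH.nu (virL c (-1)) := rfl

theorem coe_highL : (hH.highL : H.Env) = hH.nu (virL c 1) := rfl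

/-- The map `g ↦ L_{-1} ⊗ g(L_0) ⊗ L_1`. -/
def modeMap : Polynomial ℂ →ₗ[ℂ] H.ModeAlg 1 where
  toFun g := H.tmul hH.lowL (hH.pol g) hH.highL
  map_add' f g := by rw [map_add, (H.balanced_tmul _ _).add_mid]
  map_smul' r g := by rw [map_smul, (H.balanced_tmul _ _).smul_mid, RingHom.id_apply]

theorem modeMap_apply (g : Polynomial ℂ) :
    hH.modeMap g = H.tmul hH.lowL (hH.pol g) hH.highL := rfl

theorem exists_pol_eq (u : H.U0) : ∃ g : Polynomial ℂ, ∃ k : H.U0,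
    (k : H.Env) ∈ H.envNL 1 0 ∧ u = hH.pol g + k := by
  obtain ⟨g, hg⟩ := hH.exists_sub_mem_deg_zero u.2
  exact ⟨g, u - hH.pol g, hg, by rw [add_sub_cancel]⟩

theorem tmul_mid {i j : ℤ} (a : H.deg i) (b : H.deg j) (u : H.U0) :
    ∃ g : Polynomial ℂ, H.tmul a u b = H.tmul a (hH.pol g) b := by
  obtain ⟨g, k, hk, rfl⟩ := hH.exists_pol_eq u
  exact ⟨g, by rw [(H.balanced_tmul _ _).add_mid, (H.balanced_tmul _ _).kill_mid _ _ _ hk, add_zero]⟩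

/-- Reduce the outer factors to `L_{-1} f(L_0)` and `g(L_0) L_1`, move the polynomials into the
middle by balancing, and reduce the middle factor to a polynomial in `L_0`. -/
theorem tmul_mem_range (a : H.deg (1 : ℕ)) (u : H.U0) (b : H.deg (-(1 : ℕ))) :
    H.tmul a u b ∈ LinearMap.range hH.modeMap := by
  have hb := H.balanced_tmul ((1 : ℕ) : ℤ) (-(1 : ℕ))
  obtain ⟨f, hf⟩ := hH.exists_sub_mem_deg_one a.2
  obtain ⟨g, hg⟩ := hH.exists_sub_mem_deg_neg_one b.2
  have ha : a = H.rmul0 hH.lowL (hH.pol f) + (a - H.rmul0 hH.lowL (hH.pol f)) := by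
    rw [add_sub_cancel]
  have hb' : b = H.lmul0 (hH.pol g) hH.highL + (b - H.lmul0 (hH.pol g) hH.highL) := by
    rw [add_sub_cancel]
  rw [ha, hb.add_left, hb.kill_left (a - _) u b hf, add_zero, hb.bal_left, hb', hb.add_right,
    hb.kill_right _ _ (b - _) hg, add_zero, ← hb.bal_right]
  obtain ⟨p, hp⟩ := hH.tmul_mid hH.lowL hH.highL (hH.pol f * u * hH.pol g)
  exact ⟨p, by rw [hp]; rfl⟩

theorem modeMap_surjective : Function.Surjective hH.modeMap := by
  rw [← LinearMap.range_eq_top, ← Submodule.ker_mkQ (LinearMap.range hH.modeMap),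
    LinearMap.ker_eq_top]
  refine H.mode_ext fun a u b => ?_
  rw [Submodule.mkQ_apply, LinearMap.zero_apply, Submodule.Quotient.mk_eq_zero]
  exact hH.tmul_mem_range a u b

/-- The inner pair is `L_1 L_{-1} = 2 L_0 + L_{-1} L_1`, and its last term lies in `N_L^1`, so it
dies in `A_0`. -/
theorem star_modeMap (f g : Polynomial ℂ) :
    H.star 1 (hH.modeMap f) (hH.modeMap g) = hH.modeMap (2 * Polynomial.X * f * g) := by
  have hb := H.balanced_tmul ((1 : ℕ) : ℤ) (-(1 : ℕ))
  have hk : hH.nu (virL c (-1) * virL c 1) ∈ H.envNL 1 0 := by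
    have h1 : LowMon c 1 (virL c (-1)) := by
      have := (LowMon.one (c := c)).mul 0
      rwa [mul_one] at this
    have h2 : HighMon c 1 (virL c 1) := by
      have := (HighMon.one (c := c)).mul 0
      rwa [mul_one] at this
    have := hH.tri_mem_envNL h1 h2 1 (sub_self _)
    rwa [map_one, one_mul] at this
  have hU : hH.nu (virL c (-1) * virL c 1) ∈ H.U0 := H.envNL_le 1 0 hk
  have hpair : H.dpair (neg_add_cancel _) hH.highL hH.lowL =
      hH.pol (2 * Polynomial.X) + ⟨hH.nu (virL c (-1) * virL c 1), hU⟩ := by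
    refine Subtype.ext ?_
    change hH.nu (virL c 1) * hH.nu (virL c (-1)) =
      hH.nu (Polynomial.aeval (virL c 0) (2 * Polynomial.X)) + hH.nu (virL c (-1) * virL c 1)
    rw [← map_mul, virL_one_mul_virL_neg_one, ← map_add, add_comm, map_mul, Polynomial.aeval_X,
      Algebra.smul_def, map_ofNat (algebraMap ℂ (VirAlg c)) 2,
      map_ofNat (Polynomial.aeval (virL c 0)) 2]
  rw [modeMap_apply, modeMap_apply, H.star_tmul, hpair, mul_add, add_mul, hb.add_mid,
    hb.kill_mid _ (hH.pol f * ⟨hH.nu (virL c (-1) * virL c 1), hU⟩ * hH.pol g) _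
      (envNL0_mul_mem (mul_mem_envNL0 (hH.pol f).2 hk) (hH.pol g).2), add_zero,
    ← map_mul, ← map_mul, modeMap_apply]
  congr 2
  ring

theorem mu_modeMap (g : Polynomial ℂ) : H.mu 1 (hH.modeMap g) =
    H.toZhu 1 (H.dpair (add_neg_cancel _) (H.rmul0 hH.lowL (hH.pol g)) hH.highL) := by
  rw [modeMap_apply, mu, lift_tmul]

theorem coe_dpair_modeMap (g : Polynomial ℂ) :
    (H.dpair (add_neg_cancel _) (H.rmul0 hH.lowL (hH.pol g)) hH.highL : H.Env) =
      hH.nu (virL c (-1) * (Polynomial.aeval (virL c 0) g * virL c 1)) := by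
  change hH.nu (virL c (-1)) * hH.nu (Polynomial.aeval (virL c 0) g) * hH.nu (virL c 1) = _
  rw [map_mul, map_mul, mul_assoc]

/-- Test on the vector `L_{-1} v` of degree `1` in the Verma module of weight `r`: the element acts
by `2 r g(r)` and must act by zero. -/
theorem eq_zero_of_mem_envNL_two {g : Polynomial ℂ}
    (h : hH.nu (virL c (-1) * (Polynomial.aeval (virL c 0) g * virL c 1)) ∈ H.envNL 2 0) :
    g = 0 := by
  refine eq_zero_of_eval fun r hr => ?_
  have hv := isHighestWeight_vermaVec c r
  have e := hH.smul_eq_zero_of_mem_envNL hv (by norm_num) h hv.mem_hwGr_one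
  rw [mul_smul, mul_smul, hv.virL_one_smul, smul_comm _ (2 * r), aeval_smul_of_eigen hv.zero,
    smul_comm (virL c (-1)), smul_comm (virL c (-1))] at e
  -- Applying `L_1` once more returns to `v`, so that only `v ≠ 0` is needed and not `L_{-1} v ≠ 0`.
  have e' := congrArg (virL c 1 • ·) e
  simp only [smul_zero] at e'
  rw [smul_comm, smul_comm (virL c 1), hv.virL_one_smul, smul_smul, smul_smul, smul_eq_zero] at e'
  have := e'.resolve_right (vermaVec_ne_zero c r)
  simpa [hr] using this

/-- Injectivity of the composite serves twice: for the independence of the elements `L_{-1} ⊗ g(L_0)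
⊗ L_1`, and, with surjectivity of `modeMap`, for the injectivity of `μ_1`. -/
theorem mu_modeMap_injective : Function.Injective (H.mu 1 ∘ₗ hH.modeMap) := by
  rw [injective_iff_map_eq_zero]
  intro g hg
  rw [LinearMap.comp_apply, mu_modeMap, toZhu_eq_zero_iff, coe_dpair_modeMap] at hg
  exact hH.eq_zero_of_mem_envNL_two hg

/-- The linear isomorphism between `ℂ[t]` and `𝔄_1`. -/
def modeEquiv : Polynomial ℂ ≃ₗ[ℂ] H.ModeAlg 1 :=
  LinearEquiv.ofBijective hH.modeMap
    ⟨by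
      have := hH.mu_modeMap_injective
      rw [LinearMap.coe_comp] at this
      exact this.of_comp, hH.modeMap_surjective⟩

theorem modeEquiv_apply (g : Polynomial ℂ) : hH.modeEquiv g = hH.modeMap g :=
  LinearEquiv.ofBijective_apply _ _

theorem modeEquiv_symm_star (x y : H.ModeAlg 1) : hH.modeEquiv.symm (H.star 1 x y) =
    2 * Polynomial.X * hH.modeEquiv.symm x * hH.modeEquiv.symm y := by
  obtain ⟨f, rfl⟩ := hH.modeEquiv.surjective x
  obtain ⟨g, rfl⟩ := hH.modeEquiv.surjective y
  rw [LinearEquiv.symm_apply_eq, LinearEquiv.symm_apply_apply, LinearEquiv.symm_apply_apply,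
    modeEquiv_apply, modeEquiv_apply, modeEquiv_apply, star_modeMap]

theorem not_exists_one :
    ¬ ∃ u : H.ModeAlg 1, ∀ x, H.star 1 u x = x ∧ H.star 1 x u = x := by
  rintro ⟨u, hu⟩
  -- Multiplying the element attached to `1` by an identity `u` would give `2 t u = 1`, which fails
  -- at `t = 0`.
  have h := congrArg hH.modeEquiv.symm (hu (hH.modeEquiv 1)).1
  rw [modeEquiv_symm_star, LinearEquiv.symm_apply_apply, mul_one] at h
  have := congrArg (Polynomial.eval 0) h
  simp at this

theorem mu_star (x y : H.ModeAlg 1) : H.mu 1 (H.star 1 x y) = H.mu 1 x * H.mu 1 y := by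
  obtain ⟨f, rfl⟩ := hH.modeMap_surjective x
  obtain ⟨g, rfl⟩ := hH.modeMap_surjective y
  rw [mu_modeMap, mu_modeMap, ← map_mul, modeMap_apply, modeMap_apply, H.star_tmul, mu, lift_tmul]
  refine congrArg _ (Subtype.ext ?_)
  change (hH.lowL : H.Env) * ((hH.pol f * (hH.highL * hH.lowL)) * hH.pol g) * hH.highL =
    (hH.lowL * hH.pol f * hH.highL) * (hH.lowL * hH.pol g * hH.highL)
  simp only [mul_assoc]

theorem mu_injective : Function.Injective (H.mu 1) := by
  refine (injective_iff_map_eq_zero _).2 fun x hx => ?_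
  obtain ⟨g, rfl⟩ := hH.modeMap_surjective x
  rw [(injective_iff_map_eq_zero _).1 hH.mu_modeMap_injective g hx, map_zero]

/-- In degree `0` modulo `N_L^2` the two outer monomials have equal degree `0` or `1`, which leaves
two families. -/
theorem exists_sub_mem_envNL_two {z : H.Env} (hz : z ∈ H.deg 0) : ∃ f g : Polynomial ℂ,
    z - hH.nu (Polynomial.aeval (virL c 0) f) -
      hH.nu (virL c (-1) * (Polynomial.aeval (virL c 0) g * virL c 1)) ∈ H.envNL 2 0 := by
  obtain ⟨w, hw, e, he, rfl⟩ := Submodule.mem_sup.1 (hH.mem_span_tri (N := 2) hz)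
  have : w ∈ LinearMap.range (hH.polyMap 1 1) ⊔
      LinearMap.range (hH.polyMap (virL c (-1)) (virL c 1)) := by
    refine Submodule.span_le.2 ?_ hw
    rintro _ ⟨d, e, x, y, g, hx, hy, hp, he, rfl⟩
    obtain rfl : d = e := by omega
    obtain rfl | rfl : d = 0 ∨ d = 1 := by omega
    · rw [hx.eq_one, hy.eq_one]
      exact Submodule.mem_sup_left ⟨g, rfl⟩
    · rw [hx.eq_virL, hy.eq_virL]
      exact Submodule.mem_sup_right ⟨g, rfl⟩
  obtain ⟨_, ⟨f, rfl⟩, _, ⟨g, rfl⟩, rfl⟩ := Submodule.mem_sup.1 this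
  refine ⟨f, g, ?_⟩
  rw [polyMap_apply, polyMap_apply, one_mul, mul_one]
  rwa [sub_sub, add_sub_cancel_left]

/-- The family `L_{-1} g(L_0) L_1` is the image of `μ_1` and lies in `N_L^1`; the other family
`f(L_0)` meets `N_L^1` only in zero. -/
theorem range_mu : Set.range (H.mu 1) = {z | H.zhuProj (Nat.zero_le 1) z = 0} := by
  have hone : ∀ g : Polynomial ℂ,
      hH.nu (virL c (-1) * (Polynomial.aeval (virL c 0) g * virL c 1)) ∈ H.envNL 1 0 := by
    intro g
    have h1 : LowMon c 1 (virL c (-1)) := by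
      have := (LowMon.one (c := c)).mul 0
      rwa [mul_one] at this
    have h2 : HighMon c 1 (virL c 1) := by
      have := (HighMon.one (c := c)).mul 0
      rwa [mul_one] at this
    exact hH.tri_mem_envNL h1 h2 g (sub_self _)
  ext z
  constructor
  · rintro ⟨x, rfl⟩
    obtain ⟨g, rfl⟩ := hH.modeMap_surjective x
    rw [Set.mem_ofPred_eq, mu_modeMap, zhuProj_toZhu, toZhu_eq_zero_iff, coe_dpair_modeMap]
    exact hone g
  · intro hz
    obtain ⟨z, rfl⟩ := H.toZhu_surjective 1 z
    rw [Set.mem_ofPred_eq, zhuProj_toZhu, toZhu_eq_zero_iff] at hz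
    have hz : (z : H.Env) ∈ H.envNL 1 0 := hz
    obtain ⟨f, g, hfg⟩ := hH.exists_sub_mem_envNL_two z.2
    have hf' : hH.nu (Polynomial.aeval (virL c 0) f) ∈ H.envNL 1 0 := by
      have := sub_mem (sub_mem hz (H.envNL_anti (by norm_num) 0 hfg)) (hone g)
      have e : ∀ x y z : H.Env, x - (x - y - z) - z = y := fun x y z => by abel
      rwa [e] at this
    -- Elements of `N_L^1` kill highest weight vectors, on which `f(L_0)` acts by `f(r)`.
    have hf : f = 0 := by
      refine eq_zero_of_eval fun r _ => ?_
      have hv := isHighestWeight_vermaVec c r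
      have e := hH.smul_eq_zero_of_mem_envNL hv (by norm_num) hf' hv.mem_hwGr_zero
      rw [aeval_smul_of_eigen hv.zero] at e
      exact (smul_eq_zero.1 e).resolve_right (vermaVec_ne_zero c r)
    refine ⟨hH.modeMap g, ?_⟩
    rw [mu_modeMap, ← sub_eq_zero, ← map_sub, toZhu_eq_zero_iff, ← neg_mem_iff]
    rw [hf, map_zero, map_zero, sub_zero, ← hH.coe_dpair_modeMap] at hfg
    simpa using hfg

end IsVirasoro

end Mode

/-! ### Modules over the Virasoro vertex operator algebra -/

namespace IsVirasoro

variable {c : ℂ} {H : VOA (Vir c)} (hH : H.IsVirasoro)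

/-- The adjoint module. -/
def selfMod : H.Mod (Vir c) where
  act := H.Y
  field := H.field
  vac_mode := H.vac_mode
  jacobi a b l m n w := by
    have hf : (fun i : ℕ => Ring.choose m i •
        (((virSelf c).Y (((virSelf c).Y a).1 (l + i) b)).1 (m + n - i))).HasFiniteSupport := by
      obtain ⟨N, hN⟩ := Fld.exists_bound_nat ((virSelf c).Y a) b l
      refine (Set.finite_lt_nat N).subset fun i hi => ?_
      by_contra hc
      exact hi (by
        beta_reduce
        rw [hN i (not_lt.1 hc), map_zero]
        exact smul_zero _)
    have e := LinearMap.congr_fun ((virSelf c).jacobi a b l m n) w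
    have e' := (LinearMap.applyₗ (R := ℂ) w).toAddMonoidHom.map_finsum hf
    simp only [hH.Y_eq]
    refine .trans ?_ (e.trans (.trans e' ?_))
    · rw [jprod, LinearMap.sub_apply, LinearMap.smul_apply, lprod_apply, lprod_apply,
        ← bsum_zsmul (Fld.evZero_left ((virSelf c).Y a) m w fun i => ((virSelf c).Y b).1 (n + l - i)),
        ← bsum_sub (Fld.evZero_left ((virSelf c).Y b) n w fun i => ((virSelf c).Y a).1 (m + l - i))
          ((Fld.evZero_left ((virSelf c).Y a) m w fun i =>
            ((virSelf c).Y b).1 (n + l - i)).zsmul fun _ => sg l)]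
      rfl
    · rfl
  virasoro := H.virasoro
  translation := H.translation
  exists_grading := by
    refine ⟨H.gr, H.isInternal, fun k a ha m n w hw => ?_⟩
    have hw' : w ∈ hwGr c 0 (Vir c) (n : ℤ) := by
      rw [mem_hwGr, zero_add]
      exact hH.mem_gr.1 hw
    have e := Y_mem_hwGr (virSelf c) rfl (hH.mem_gr.1 ha) m hw'
    rw [← hH.Y_eq] at e
    rcases lt_or_ge ((n : ℤ) + k - m - 1) 0 with h | h
    · rw [isHighestWeight_virVac.hwGr_neg h, Submodule.mem_bot] at e
      rw [e]
      exact zero_mem _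
    · obtain ⟨p, hp⟩ := Int.eq_ofNat_of_zero_le h
      refine Submodule.mem_iSup_of_mem p (Submodule.mem_iSup_of_mem hp.symm ?_)
      rw [hp, mem_hwGr, zero_add] at e
      exact hH.mem_gr.2 e

end IsVirasoro

/-! ### Matrix coefficients of the mode transition algebra -/

section Coefficient

namespace GradedRep

variable {V : Type u} [AddCommGroup V] [Module ℂ V] {H : VOA V} {X : Type*} [AddCommGroup X]
  [Module ℂ X] (T : H.GradedRep X)

/-- The function `a ⊗ u ⊗ b ↦ a u b y`, for `y` of degree `1`, is balanced. -/
theorem balanced_act (i : ℤ) {y : X} (hy : y ∈ T.grading 1) :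
    H.Balanced fun (a : H.deg i) (u : H.U0) (b : H.deg (-(1 : ℕ))) =>
      T.envAct (a * u * b) y := by
  refine ⟨fun _ _ _ _ => ?_, fun _ _ _ _ => ?_, fun _ _ _ _ => ?_, fun _ _ _ _ => ?_,
    fun _ _ _ _ => ?_, fun _ _ _ _ => ?_, fun a u b h => ?_, fun a u b h => ?_, fun a u b h => ?_⟩
  · simp [add_mul]
  · simp [add_mul, mul_add]
  · simp [mul_add]
  · simp
  · simp [rmul0, dmul, mul_assoc]
  · simp [lmul0, dmul, mul_assoc]
  -- The vector `u b y` has degree `0`, where `N_L^1` acts by zero.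
  · rw [mul_assoc, map_mul, Module.End.mul_apply]
    exact T.envAct_envNL (q := 0) (by norm_num) h
      (by simpa using T.envAct_mem (H.mul_mem_deg (p := 0) u.2 b.2) hy)
  · rw [mul_assoc, map_mul, Module.End.mul_apply, map_mul, Module.End.mul_apply,
      T.envAct_envNL (q := 0) (by norm_num) h (by simpa using T.envAct_mem b.2 hy), map_zero]
  -- In degree `-1` the right neighbourhood `N_R^1` is `N_L^2`, which kills the vector `y` of degree
  -- `1`.
  · rw [envNR_eq] at h
    rw [map_mul, Module.End.mul_apply, T.envAct_envNL (q := 1) (by norm_num) h hy, map_zero]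

/-- The linear map `a ⊗ u ⊗ b ↦ a u b y` on `𝔄_{i,-1}`, extended by zero to `𝔄`. -/
def coefficient (i : ℤ) {y : X} (hy : y ∈ T.grading 1) : H.ModeTotal →ₗ[ℂ] X :=
  lift (T.balanced_act i hy) ∘ₗ
    DirectSum.component ℂ (ℤ × ℤ) (fun ij => H.Mode ij.1 ij.2) (i, -(1 : ℕ))

theorem coefficient_lof (i : ℤ) {y : X} (hy : y ∈ T.grading 1) (x : H.Mode i (-(1 : ℕ))) :
    T.coefficient i hy (DirectSum.lof ℂ (ℤ × ℤ) (fun ij => H.Mode ij.1 ij.2) (i, -(1 : ℕ)) x) =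
      lift (T.balanced_act i hy) x := by
  rw [coefficient, LinearMap.comp_apply, DirectSum.component.lof_self]

theorem coefficient_lof_tmul {i j k : ℤ} (hj : j = -(1 : ℕ)) (hk : i = k) {y : X}
    (hy : y ∈ T.grading 1) (a : H.deg i) (u : H.U0) (b : H.deg j) :
    T.coefficient k hy (DirectSum.lof ℂ (ℤ × ℤ) (fun ij => H.Mode ij.1 ij.2) (i, j)
      (H.tmul a u b)) = T.envAct (a * u * b) y := by
  subst hj hk
  rw [coefficient_lof, lift_tmul]

theorem coefficient_lof_of_ne {k : ℤ} {ij : ℤ × ℤ} (h : ij ≠ (k, -((1 : ℕ) : ℤ))) {y : X}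
    (hy : y ∈ T.grading 1) (x : H.Mode ij.1 ij.2) :
    T.coefficient k hy (DirectSum.lof ℂ (ℤ × ℤ) (fun ij => H.Mode ij.1 ij.2) ij x) = 0 := by
  rw [coefficient, LinearMap.comp_apply, DirectSum.component.of, dif_neg h, map_zero]

end GradedRep

variable {V : Type u} [AddCommGroup V] [Module ℂ V] (H : VOA V)

theorem proj_of_mem {d : ℕ} {a : V} (ha : a ∈ H.gr d) (h : ℕ) :
    H.proj h a = if h = d then a else 0 := by
  have : (LinearEquiv.ofBijective (DirectSum.coeLinearMap H.gr) H.isInternal).symm a =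
      DirectSum.lof ℂ ℕ (fun d => H.gr d) d ⟨a, ha⟩ := by
    rw [LinearEquiv.symm_apply_eq]
    exact (DirectSum.coeLinearMap_lof H.gr d ⟨a, ha⟩).symm
  rw [proj, LinearMap.comp_apply, LinearMap.comp_apply, LinearEquiv.coe_coe, this]
  split_ifs with h'
  · subst h'
    rw [DirectSum.component.lof_self]
    rfl
  · rw [DirectSum.component.of, dif_neg (Ne.symm h')]
    rfl

theorem coe_envModeProj (h : ℕ) (n : ℤ) (a : V) :
    (H.envModeProj h n a : H.Env) = H.envMode n (H.proj h a) := rfl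

/-- Left multiplication by `b_[n]` on `𝔄`, where `b` is the component of weight `h` of `a`. -/
def leftComp (h : ℕ) (n : ℤ) (a : V) : H.ModeTotal →ₗ[ℂ] H.ModeTotal :=
  DirectSum.toModule ℂ (ℤ × ℤ) H.ModeTotal
    (fun ij => DirectSum.lof ℂ (ℤ × ℤ) (fun ij => H.Mode ij.1 ij.2) (h - n - 1 + ij.1, ij.2) ∘ₗ
      lift (H.balanced_left rfl (H.envModeProj h n a) ij.2))

/-- Right multiplication by `b_[n]` on `𝔄`, where `b` is the component of weight `h` of `a`. -/
def rightComp (h : ℕ) (n : ℤ) (a : V) : H.ModeTotal →ₗ[ℂ] H.ModeTotal :=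
  DirectSum.toModule ℂ (ℤ × ℤ) H.ModeTotal
    (fun ij => DirectSum.lof ℂ (ℤ × ℤ) (fun ij => H.Mode ij.1 ij.2) (ij.1, ij.2 + (h - n - 1)) ∘ₗ
      lift (H.balanced_right rfl (H.envModeProj h n a) ij.1))

theorem leftMode_eq (n : ℤ) (a : V) (x : H.ModeTotal) :
    H.leftMode n a x = ∑ᶠ h : ℕ, H.leftComp h n a x := rfl

theorem rightMode_eq (n : ℤ) (a : V) (x : H.ModeTotal) :
    H.rightMode n a x = ∑ᶠ h : ℕ, H.rightComp h n a x := rfl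

theorem leftComp_lof_tmul (h : ℕ) (n : ℤ) (a : V) {i j : ℤ} (x : H.deg i) (u : H.U0)
    (b : H.deg j) : H.leftComp h n a
      (DirectSum.lof ℂ (ℤ × ℤ) (fun ij => H.Mode ij.1 ij.2) (i, j) (H.tmul x u b)) =
    DirectSum.lof ℂ (ℤ × ℤ) (fun ij => H.Mode ij.1 ij.2) (h - n - 1 + i, j)
      (H.tmul (H.dmul rfl (H.envModeProj h n a) x) u b) := by
  rw [leftComp, DirectSum.toModule_lof, LinearMap.comp_apply, lift_tmul]

theorem rightComp_lof_tmul (h : ℕ) (n : ℤ) (a : V) {i j : ℤ} (x : H.deg i) (u : H.U0)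
    (b : H.deg j) : H.rightComp h n a
      (DirectSum.lof ℂ (ℤ × ℤ) (fun ij => H.Mode ij.1 ij.2) (i, j) (H.tmul x u b)) =
    DirectSum.lof ℂ (ℤ × ℤ) (fun ij => H.Mode ij.1 ij.2) (i, j + (h - n - 1))
      (H.tmul x u (H.dmul rfl b (H.envModeProj h n a))) := by
  rw [rightComp, DirectSum.toModule_lof, LinearMap.comp_apply, lift_tmul]

theorem modeTotal_ext {M : Type*} [AddCommMonoid M] [Module ℂ M] {F G : H.ModeTotal →ₗ[ℂ] M}
    (h : ∀ (i j : ℤ) (a : H.deg i) (u : H.U0) (b : H.deg j),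
      F (DirectSum.lof ℂ (ℤ × ℤ) (fun ij => H.Mode ij.1 ij.2) (i, j) (H.tmul a u b)) =
        G (DirectSum.lof ℂ (ℤ × ℤ) (fun ij => H.Mode ij.1 ij.2) (i, j) (H.tmul a u b))) :
    F = G := by
  refine DirectSum.linearMap_ext ℂ fun ij => LinearMap.ext fun x => ?_
  obtain ⟨x, rfl⟩ := Submodule.mkQ_surjective _ x
  suffices (F ∘ₗ DirectSum.lof ℂ (ℤ × ℤ) (fun ij => H.Mode ij.1 ij.2) ij) ∘ₗ Submodule.mkQ _ =
      (G ∘ₗ DirectSum.lof ℂ (ℤ × ℤ) (fun ij => H.Mode ij.1 ij.2) ij) ∘ₗ Submodule.mkQ _ from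
    LinearMap.congr_fun this x
  apply Finsupp.lhom_ext'
  rintro ⟨a, u, b⟩
  apply LinearMap.ext_ring
  exact h _ _ a u b

theorem leftComp_eq_zero {h : ℕ} {a : V} (ha : H.proj h a = 0) (n : ℤ) :
    H.leftComp h n a = 0 := by
  refine H.modeTotal_ext fun i j x u b => ?_
  rw [leftComp_lof_tmul, (H.balanced_tmul _ _).kill_left, map_zero, LinearMap.zero_apply]
  change (H.envModeProj h n a : H.Env) * x ∈ _
  rw [coe_envModeProj, ha, map_zero, zero_mul]
  exact zero_mem _

theorem rightComp_eq_zero {h : ℕ} {a : V} (ha : H.proj h a = 0) (n : ℤ) :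
    H.rightComp h n a = 0 := by
  refine H.modeTotal_ext fun i j x u b => ?_
  rw [rightComp_lof_tmul, (H.balanced_tmul _ _).kill_right, map_zero, LinearMap.zero_apply]
  change (b : H.Env) * (H.envModeProj h n a : H.Env) ∈ _
  rw [coe_envModeProj, ha, map_zero, mul_zero]
  exact zero_mem _

theorem leftMode_of_mem {d : ℕ} {a : V} (ha : a ∈ H.gr d) (n : ℤ) (x : H.ModeTotal) :
    H.leftMode n a x = H.leftComp d n a x := by
  rw [leftMode_eq, finsum_eq_single _ d]
  intro h hd
  rw [leftComp_eq_zero H (by rw [H.proj_of_mem ha, if_neg hd]), LinearMap.zero_apply]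

theorem rightMode_of_mem {d : ℕ} {a : V} (ha : a ∈ H.gr d) (n : ℤ) (x : H.ModeTotal) :
    H.rightMode n a x = H.rightComp d n a x := by
  rw [rightMode_eq, finsum_eq_single _ d]
  intro h hd
  rw [rightComp_eq_zero H (by rw [H.proj_of_mem ha, if_neg hd]), LinearMap.zero_apply]

theorem leftMode_zero (n : ℤ) (x : H.ModeTotal) : H.leftMode n 0 x = 0 := by
  rw [H.leftMode_of_mem (d := 0) (zero_mem _), H.leftComp_eq_zero (map_zero (H.proj 0)),
    LinearMap.zero_apply]

theorem rightMode_zero (n : ℤ) (x : H.ModeTotal) : H.rightMode n 0 x = 0 := by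
  rw [H.rightMode_of_mem (d := 0) (zero_mem _), H.rightComp_eq_zero (map_zero (H.proj 0)),
    LinearMap.zero_apply]

variable {H}

/-- The coefficient maps turn left multiplication on `𝔄` into the action on the representation,
which reduces an equation in `𝔄` to equations in Verma modules. -/
theorem GradedRep.coefficient_leftComp {X : Type*} [AddCommGroup X] [Module ℂ X]
    (T : H.GradedRep X) {d : ℕ} {a : V} (ha : a ∈ H.gr d) (n : ℤ) {i k : ℤ}
    (hk : d - n - 1 + i = k) {y : X} (hy : y ∈ T.grading 1) (x : H.ModeTotal) :
    T.coefficient k hy (H.leftComp d n a x) = (T.act a).1 n (T.coefficient i hy x) := by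
  suffices T.coefficient k hy ∘ₗ H.leftComp d n a = (T.act a).1 n ∘ₗ T.coefficient i hy from
    LinearMap.congr_fun this x
  refine H.modeTotal_ext fun p q z u b => ?_
  rw [LinearMap.comp_apply, LinearMap.comp_apply, leftComp_lof_tmul]
  by_cases h : (p, q) = (i, -((1 : ℕ) : ℤ))
  · obtain ⟨rfl, rfl⟩ := Prod.mk.inj h
    rw [T.coefficient_lof_tmul rfl hk, T.coefficient_lof_tmul rfl rfl, ← T.envAct_envMode,
      ← Module.End.mul_apply, ← map_mul, ← mul_assoc, ← mul_assoc]
    congr 4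
    change H.envMode n (H.proj d a) * _ = _
    rw [H.proj_of_mem ha, if_pos rfl]
  · rw [T.coefficient_lof_of_ne, T.coefficient_lof_of_ne h, map_zero]
    intro h'
    obtain ⟨h1, rfl⟩ := Prod.mk.inj h'
    exact h (Prod.ext (by rw [← hk] at h1; exact add_left_cancel h1) rfl)

end Coefficient

/-! ### The obstruction to smoothing inside `𝔄` -/

namespace IsVirasoro

variable {c : ℂ} {H : VOA (Vir c)} (hH : H.IsVirasoro)

include hH

theorem mem_grading_one {h : ℂ} {X : Type*} [AddCommGroup X] [Module ℂ X]
    [Module (VirAlg c) X] [IsScalarTower ℂ (VirAlg c) X] {v : X} (hv : IsHighestWeight c h v) :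
    virL c (-1) • v ∈ (hH.gradedRep hv).grading 1 :=
  hv.mem_hwGr_one

theorem coefficient_rightMode_modeOne {h : ℂ} {X : Type*} [AddCommGroup X] [Module ℂ X]
    [Module (VirAlg c) X] [IsScalarTower ℂ (VirAlg c) X] {v : X} (hv : IsHighestWeight c h v) :
    (hH.gradedRep hv).coefficient 0 (hH.mem_grading_one hv) (H.rightMode 2 (-H.conf) H.modeOne) =
      -((2 * h) • v) := by
  rw [H.rightMode_of_mem (neg_mem H.conf_mem), modeOne, rightComp_lof_tmul,
    GradedRep.coefficient_lof_tmul _ (by norm_num) rfl]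
  change (hH.gradedRep hv).envAct (1 * 1 * (1 * H.envMode 2 (H.proj 2 (-H.conf)))) _ = _
  rw [H.proj_of_mem (neg_mem H.conf_mem), if_pos rfl, mul_one, one_mul, one_mul, map_neg,
    show (2 : ℤ) = 1 + 1 by norm_num, ← hH.nu_virL, map_neg, LinearMap.neg_apply, hH.envAct_nu hv,
    hv.virL_one_smul]

/-- No element `x` satisfies `L_1 · x = 1 · L_1`. Evaluated at `L_{-1} v` in Verma modules of weight
`h ≠ 0`, the equation reads `2 h (2 h g(h) - 1) = 0`, so `2 t g = 1`, which fails at `t = 0`. -/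
theorem leftMode_add_rightMode_ne_zero (x : H.ModeTotal) :
    H.leftMode 2 H.conf x + H.rightMode 2 (-H.conf) H.modeOne ≠ 0 := by
  intro e
  -- Only the component of `x` in `𝔄_{1,-1}` contributes to `𝔄_{0,-1}` under `L_1`, and it is of the
  -- form `L_{-1} ⊗ g(L_0) ⊗ L_1`.
  obtain ⟨g, hg⟩ := hH.modeMap_surjective
    (DirectSum.component ℂ (ℤ × ℤ) (fun ij => H.Mode ij.1 ij.2) (((1 : ℕ) : ℤ), -((1 : ℕ) : ℤ)) x)
  have key : 2 * Polynomial.X * g - 1 = 0 := by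
    refine eq_zero_of_eval fun r hr => ?_
    have hv := isHighestWeight_vermaVec c r
    have e' := congrArg ((hH.gradedRep hv).coefficient 0 (hH.mem_grading_one hv)) e
    rw [map_add, map_zero, hH.coefficient_rightMode_modeOne, H.leftMode_of_mem H.conf_mem,
      GradedRep.coefficient_leftComp _ H.conf_mem _ (i := ((1 : ℕ) : ℤ)) (by norm_num),
      GradedRep.coefficient, LinearMap.comp_apply, ← hg, modeMap_apply, lift_tmul,
      ← GradedRep.envAct_envMode, show (2 : ℤ) = 1 + 1 by norm_num, ← hH.nu_virL, coe_lowL,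
      coe_highL, coe_pol, ← map_mul, ← map_mul, hH.envAct_nu hv, hH.envAct_nu hv, mul_smul,
      mul_smul, hv.virL_one_smul, smul_comm _ (2 * r), aeval_smul_of_eigen hv.zero,
      smul_comm (virL c (-1)), smul_comm (virL c (-1)), smul_comm (virL c 1),
      smul_comm (virL c 1), hv.virL_one_smul, smul_smul, smul_smul, ← sub_eq_add_neg, ← sub_smul,
      smul_eq_zero] at e'
    have e'' := e'.resolve_right (vermaVec_ne_zero c r)
    have h2 : (2 * r) * (2 * r * g.eval r - 1) = 0 := by linear_combination e''
    simpa using (mul_eq_zero.1 h2).resolve_left (by simpa using hr)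
  simpa using congrArg (Polynomial.eval 0) key

end IsVirasoro

end VOA

/-! ### Laurent polynomials and Laurent series -/

section Laurent

/-- The power `t^n`. -/
def Lau.mono (n : ℤ) : Lau := (HahnSeries.single n (1 : ℂ) : LaurentSeries ℂ)

theorem Lau.coeff_mono (r n : ℤ) : Lau.coeff r (Lau.mono n) = if r = n then 1 else 0 :=
  HahnSeries.coeff_single.trans (by congr)

theorem Lau.mono_mul (m n : ℤ) : Lau.mono m * Lau.mono n = Lau.mono (m + n) := by
  change (HahnSeries.single m (1 : ℂ) * HahnSeries.single n (1 : ℂ) : LaurentSeries ℂ) = _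
  rw [HahnSeries.single_mul_single, one_mul]
  rfl

theorem Lau.mono_zero : Lau.mono 0 = 1 := rfl

theorem Lau.ext_coeff {f g : Lau} (h : ∀ r, Lau.coeff r f = Lau.coeff r g) : f = g :=
  HahnSeries.ext (funext h)

theorem Lau.hasse_mono (k : ℕ) (n : ℤ) :
    (Lau.mono n).hasse k = ((Ring.choose n k : ℤ) : ℂ) • Lau.mono (n - k) := by
  refine Lau.ext_coeff fun r => ?_
  rw [map_smul, Lau.coeff_mono]
  change HahnSeries.coeff (LaurentSeries.hasseDeriv ℂ k (HahnSeries.single n (1 : ℂ))) r = _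
  rw [LaurentSeries.hasseDeriv_single, HahnSeries.coeff_single]
  split_ifs
  · rw [zsmul_eq_mul, smul_eq_mul]
  · rw [smul_zero]

theorem Lau.exists_coeff_eq_zero (f : Lau) : ∃ N : ℤ, ∀ r < N, Lau.coeff r f = 0 := by
  refine ⟨HahnSeries.order (show LaurentSeries ℂ from f), fun r hr => ?_⟩
  exact HahnSeries.coeff_eq_zero_of_lt_order hr

/-- The homomorphism from Laurent polynomials to Laurent series with `T ↦ t^e`. -/
def lauHom (e : ℤ) : LaurentPolynomial ℂ →ₐ[ℂ] Lau :=
  AddMonoidAlgebra.lift ℂ Lau ℤ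
    { toFun n := Lau.mono (e * n.toAdd)
      map_one' := by rw [toAdd_one, mul_zero, Lau.mono_zero]
      map_mul' m n := by rw [Lau.mono_mul, toAdd_mul, mul_add] }

theorem lauHom_C_mul_T (e n : ℤ) (a : ℂ) :
    lauHom e (LaurentPolynomial.C a * LaurentPolynomial.T n) = a • Lau.mono (e * n) := by
  rw [← LaurentPolynomial.single_eq_C_mul_T, lauHom, AddMonoidAlgebra.lift_single]
  rfl

theorem lauHom_T (e n : ℤ) : lauHom e (LaurentPolynomial.T n) = Lau.mono (e * n) := by
  have := lauHom_C_mul_T e n 1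
  rwa [map_one, one_mul, one_smul] at this

/-- The condition `e * e = 1` means `e = ±1`: the local coordinate is `T` at the node and `T⁻¹` at
infinity. -/
theorem coeff_lauHom {e : ℤ} (he : e * e = 1) (r : ℤ) (p : LaurentPolynomial ℂ) :
    Lau.coeff r (lauHom e p) = p.coeff (e * r) := by
  induction p using LaurentPolynomial.induction_on' with
  | add p q hp hq => rw [map_add, map_add, hp, hq]; rfl
  | C_mul_T n a =>
    rw [lauHom_C_mul_T, map_smul, Lau.coeff_mono, ← LaurentPolynomial.single_eq_C_mul_T,
      AddMonoidAlgebra.coeff_single, Finsupp.single_apply]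
    have : r = e * n ↔ n = e * r := by
      constructor <;> rintro rfl <;> rw [← mul_assoc, he, one_mul]
    simp [this]

theorem exists_principal_part {e : ℤ} (he : e * e = 1) (f : Lau) : ∃ p : LaurentPolynomial ℂ,
    (∀ r < 0, Lau.coeff r (lauHom e p) = Lau.coeff r f) ∧ ∀ r, 0 ≤ r → p.coeff (e * r) = 0 := by
  obtain ⟨N, hN⟩ := f.exists_coeff_eq_zero
  have key : ∀ r, Lau.coeff r (lauHom e (∑ n ∈ Finset.Ico N 0,
      LaurentPolynomial.C (Lau.coeff n f) * LaurentPolynomial.T (e * n))) =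
      if r ∈ Finset.Ico N 0 then Lau.coeff r f else 0 := by
    intro r
    rw [map_sum, map_sum, ← Finset.sum_ite_eq (Finset.Ico N 0) r fun n => Lau.coeff n f]
    refine Finset.sum_congr rfl fun n _ => ?_
    rw [lauHom_C_mul_T, map_smul, ← mul_assoc, he, one_mul, Lau.coeff_mono]
    simp
  refine ⟨∑ n ∈ Finset.Ico N 0, LaurentPolynomial.C (Lau.coeff n f) * LaurentPolynomial.T (e * n),
    fun r hr => ?_, fun r hr => ?_⟩
  · rw [key]
    split_ifs with h
    · rfl
    · exact (hN r (by simpa [hr] using h)).symm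
  · rw [← coeff_lauHom he, key, if_neg (by simp [hr])]

/-- The derivation `T d/dT` of the Laurent polynomials. -/
def eulerDerivation : Derivation ℂ (LaurentPolynomial ℂ) (LaurentPolynomial ℂ) :=
  Derivation.mk' ((AddMonoidAlgebra.coeffLinearEquiv ℂ).symm.toLinearMap ∘ₗ
      Finsupp.lsum ℂ (fun n : ℤ => (n : ℂ) • Finsupp.lsingle n) ∘ₗ
      (AddMonoidAlgebra.coeffLinearEquiv (S := ℂ) ℂ).toLinearMap) (by
    have h : ∀ (n : ℤ) (a : ℂ), ((AddMonoidAlgebra.coeffLinearEquiv ℂ).symm.toLinearMap ∘ₗ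
      Finsupp.lsum ℂ (fun n : ℤ => (n : ℂ) • Finsupp.lsingle n) ∘ₗ
      (AddMonoidAlgebra.coeffLinearEquiv (S := ℂ) (M := ℤ) ℂ).toLinearMap)
        (AddMonoidAlgebra.single n a) = AddMonoidAlgebra.single n (n * a) := by
      intro n a
      rw [LinearMap.comp_apply, LinearMap.comp_apply, LinearEquiv.coe_coe, LinearEquiv.coe_coe,
        LinearEquiv.symm_apply_eq]
      change Finsupp.lsum ℂ _ (Finsupp.single n a) = Finsupp.single n (n * a)
      rw [Finsupp.lsum_single, LinearMap.smul_apply, Finsupp.lsingle_apply, Finsupp.smul_single,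
        smul_eq_mul]
    intro p q
    induction p using LaurentPolynomial.induction_on' with
    | add p p' hp hp' => rw [add_mul, map_add, hp, hp', map_add, smul_add, add_smul]; abel
    | C_mul_T m a =>
      induction q using LaurentPolynomial.induction_on' with
      | add q q' hq hq' => rw [mul_add, map_add, hq, hq', map_add, smul_add, add_smul]; abel
      | C_mul_T n b =>
        rw [← LaurentPolynomial.single_eq_C_mul_T, ← LaurentPolynomial.single_eq_C_mul_T,
          AddMonoidAlgebra.single_mul_single, h, h, h, smul_eq_mul, smul_eq_mul,
          AddMonoidAlgebra.single_mul_single, AddMonoidAlgebra.single_mul_single, add_comm n m,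
          ← AddMonoidAlgebra.single_add]
        congr 1
        push_cast
        ring)

theorem eulerDerivation_T (n : ℤ) :
    eulerDerivation (LaurentPolynomial.T n) = (n : ℂ) • LaurentPolynomial.T n := by
  change (AddMonoidAlgebra.coeffLinearEquiv ℂ).symm
    (Finsupp.lsum ℂ (fun n : ℤ => (n : ℂ) • Finsupp.lsingle n) (Finsupp.single n (1 : ℂ))) = _
  rw [Finsupp.lsum_single]
  rfl

instance : Algebra.FormallySmooth ℂ (LaurentPolynomial ℂ) := by
  have : Algebra.FormallySmooth (Polynomial ℂ) (LaurentPolynomial ℂ) :=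
    Algebra.FormallySmooth.of_isLocalization (Submonoid.powers Polynomial.X)
  have : IsScalarTower ℂ (Polynomial ℂ) (LaurentPolynomial ℂ) :=
    .of_algebraMap_eq fun r => (Polynomial.toLaurent_C r).symm
  exact Algebra.FormallySmooth.comp ℂ (Polynomial ℂ) (LaurentPolynomial ℂ)

end Laurent

/-! ### Two projective lines meeting in a point -/

section TwoLines

open LaurentPolynomial (T C)

/-- The coordinate ring of two disjoint punctured affine lines. -/
abbrev TwoLines : Type := Fin 2 → LaurentPolynomial ℂ

theorem TwoLines.adjoin_eq_top : Algebra.adjoin ℂ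
    ({fun _ => T 1, fun _ => T (-1), Pi.single 0 1} : Set TwoLines) = ⊤ := by
  rw [eq_top_iff]
  set S := Algebra.adjoin ℂ ({fun _ => T 1, fun _ => T (-1), Pi.single 0 1} : Set TwoLines)
  have hT : (fun _ => T 1) ∈ S := Algebra.subset_adjoin (by simp)
  have hT' : (fun _ => T (-1)) ∈ S := Algebra.subset_adjoin (by simp)
  have he : Pi.single 0 1 ∈ S := Algebra.subset_adjoin (by simp)
  have hc : ∀ p : LaurentPolynomial ℂ, (fun _ => p) ∈ S := by
    intro p
    induction p using LaurentPolynomial.induction_on with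
    | h_C a => exact S.algebraMap_mem a
    | h_add hp hq => exact S.add_mem hp hq
    | h_C_mul_T n a h =>
      have := S.mul_mem h hT
      convert this using 2
      rw [Pi.mul_apply, LaurentPolynomial.T_add, mul_assoc]
    | h_C_mul_T_Z n a h =>
      have := S.mul_mem h hT'
      convert this using 2
      rw [Pi.mul_apply, sub_eq_add_neg, LaurentPolynomial.T_add, mul_assoc]
  intro f _
  have : f = Pi.single 0 1 * (fun _ => f 0) + (1 - Pi.single 0 1) * (fun _ => f 1) := by
    ext1 i
    fin_cases i <;> simp
  rw [this]
  exact S.add_mem (S.mul_mem he (hc _)) (S.mul_mem (S.sub_mem S.one_mem he) (hc _))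

theorem TwoLines.smooth : Algebra.Smooth ℂ TwoLines where
  finitePresentation := Algebra.FinitePresentation.of_finiteType.1
    ⟨⟨{fun _ => T 1, fun _ => T (-1), Pi.single 0 1}, by simpa using TwoLines.adjoin_eq_top⟩⟩

theorem TwoLines.span_D :
    Submodule.span TwoLines {KaehlerDifferential.D ℂ TwoLines fun _ => T 1} = ⊤ := by
  rw [eq_top_iff, ← KaehlerDifferential.span_range_derivation, Submodule.span_le]
  set S := Submodule.span TwoLines {KaehlerDifferential.D ℂ TwoLines fun _ => T 1}
  let D := KaehlerDifferential.D ℂ TwoLines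
  have hT : D (fun _ => T 1) ∈ S := Submodule.mem_span_singleton_self _
  rintro _ ⟨f, rfl⟩
  have hf : f ∈ Algebra.adjoin ℂ
    ({fun _ => T 1, fun _ => T (-1), Pi.single 0 1} : Set TwoLines) :=
      TwoLines.adjoin_eq_top ▸ trivial
  induction hf using Algebra.adjoin_induction with
  | mem x hx =>
    obtain rfl | rfl | rfl := hx
    · exact hT
    -- Differentiating `T · T⁻¹ = 1` expresses `d(T⁻¹)` through `dT`.
    · have h := D.leibniz (fun _ => T 1) (fun _ => T (-1))
      have h1 : (fun _ => T 1 : TwoLines) * (fun _ => T (-1)) = 1 := by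
        ext1 i
        rw [Pi.mul_apply, ← LaurentPolynomial.T_add, add_neg_cancel]
        rfl
      rw [h1, D.map_one_eq_zero] at h
      have h2 := congrArg ((fun _ => T (-1) : TwoLines) • ·) h
      simp only [smul_add, smul_smul] at h2
      rw [mul_comm _ (fun _ => T 1), h1, one_smul, smul_zero] at h2
      rw [← neg_eq_of_add_eq_zero_left h2.symm]
      exact S.neg_mem (S.smul_mem _ hT)
    -- The differential of an idempotent vanishes: `de = 2 e de` gives `e de = 2 e de`, so `e de =
    -- 0` and then `de = 0`.
    · set e : TwoLines := Pi.single 0 1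
      have he : e * e = e := by
        simp [e, ← Pi.single_mul]
      have h := D.leibniz e e
      rw [he] at h
      have h2 := congrArg (e • ·) h
      simp only [smul_add, smul_smul, he] at h2
      rw [left_eq_add] at h2
      rw [h2, add_zero] at h
      rw [h]
      exact S.zero_mem
  | algebraMap r => rw [Derivation.map_algebraMap]; exact S.zero_mem
  | add x y _ _ hx hy => rw [map_add]; exact S.add_mem hx hy
  | mul x y _ _ hx hy =>
    rw [Derivation.leibniz]
    exact S.add_mem (S.smul_mem _ hy) (S.smul_mem _ hx)

/-- The derivation `T d/dT` on both lines. -/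
def TwoLines.euler : Derivation ℂ TwoLines TwoLines :=
  Derivation.mk' (LinearMap.pi fun i => eulerDerivation.toLinearMap ∘ₗ LinearMap.proj i)
    fun f g => by
      ext1 i
      exact eulerDerivation.leibniz (f i) (g i)

/-- Pairing with the derivation `T d/dT` sends `dT` to the unit `T`. -/
theorem TwoLines.smul_D_eq_zero {f : TwoLines}
    (h : f • KaehlerDifferential.D ℂ TwoLines (fun _ => T 1) = 0) : f = 0 := by
  have h1 := congrArg TwoLines.euler.liftKaehlerDifferential h
  rw [map_smul, Derivation.liftKaehlerDifferential_comp_D, map_zero] at h1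
  ext1 i
  have h2 : f i * eulerDerivation (T 1) = 0 := congrFun h1 i
  rw [eulerDerivation_T, Int.cast_one, one_smul] at h2
  exact ((LaurentPolynomial.isUnit_T 1).mul_left_eq_zero).1 h2

end TwoLines

/-! ### The nodal curve: expansions, cohomology and coordinate changes -/

section TwoLines

open LaurentPolynomial (T C)

/-- The component of a special point. -/
def Puncture.line : Puncture 2 0 → Fin 2
  | .marked i => i
  | .extra j => j.elim0
  | .plus => 0
  | .minus => 1

/-- The order of `T` at a special point. -/
def Puncture.ord : Puncture 2 0 → ℤ
  | .marked _ => -1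
  | _ => 1

theorem Puncture.ord_mul_ord (x : Puncture 2 0) : x.ord * x.ord = 1 := by
  cases x <;> rfl

/-- The preimage of the node on a component. -/
def Puncture.node (i : Fin 2) : Puncture 2 0 := if i = 0 then .plus else .minus

theorem Puncture.node_eq (i : Fin 2) : (Puncture.node i).line = i ∧ (Puncture.node i).ord = 1 := by
  fin_cases i <;> exact ⟨rfl, rfl⟩

/-- The Laurent expansions on the two lines. -/
def TwoLines.expansion (x : Puncture 2 0) : TwoLines →ₐ[ℂ] Lau :=
  (lauHom x.ord).comp (Pi.evalAlgHom ℂ (fun _ => LaurentPolynomial ℂ) x.line)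

theorem TwoLines.expansion_apply (x : Puncture 2 0) (f : TwoLines) :
    TwoLines.expansion x f = lauHom x.ord (f x.line) := rfl

theorem TwoLines.coeff_expansion (x : Puncture 2 0) (f : TwoLines) (r : ℤ) :
    Lau.coeff r (TwoLines.expansion x f) = (f x.line).coeff (x.ord * r) :=
  coeff_lauHom x.ord_mul_ord _ _

/-- On each line the principal part at infinity is a polynomial in `T` and the one at the node a
polynomial in `T⁻¹`, both without constant term. Neither creates a pole at the other point, so
principal parts can be prescribed freely. -/
theorem TwoLines.sup_eq_top :
    LinearMap.range (LinearMap.pi fun x => (TwoLines.expansion x).toLinearMap) ⊔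
      Submodule.span ℂ {f : Puncture 2 0 → Lau | ∀ x, ∀ r < 0, Lau.coeff r (f x) = 0} = ⊤ := by
  rw [eq_top_iff]
  intro f _
  choose p hp hp' using fun x : Puncture 2 0 => exists_principal_part x.ord_mul_ord (f x)
  let g : TwoLines := fun i => p (.marked i) + p (Puncture.node i)
  refine Submodule.mem_sup.2 ⟨_, ⟨g, rfl⟩, f - LinearMap.pi
    (fun x => (TwoLines.expansion x).toLinearMap) g, Submodule.subset_span ?_, by abel⟩
  intro x r hr
  rw [Pi.sub_apply, map_sub, sub_eq_zero, ← hp x r hr]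
  change _ = Lau.coeff r (TwoLines.expansion x g)
  rw [TwoLines.coeff_expansion, coeff_lauHom x.ord_mul_ord]
  change _ = (p (.marked x.line)).coeff _ + (p (Puncture.node x.line)).coeff _
  have h1 : ∀ x : Puncture 2 0, x.ord = -1 → (p (Puncture.node x.line)).coeff (x.ord * r) = 0 := by
    intro x hx
    have := hp' (Puncture.node x.line) (-r) (by omega)
    rwa [(Puncture.node_eq _).2, one_mul, ← neg_one_mul, ← hx] at this
  have h2 : ∀ x : Puncture 2 0, x.ord = 1 → (p (.marked x.line)).coeff (x.ord * r) = 0 := by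
    intro x hx
    have := hp' (.marked x.line) (-r) (by omega)
    rw [show (Puncture.marked x.line : Puncture 2 0).ord = -1 from rfl, neg_mul_neg] at this
    rwa [hx]
  cases x with
  | marked i => rw [h1 _ rfl, add_zero]; rfl
  | extra j => exact j.elim0
  | plus => rw [h2 _ rfl, zero_add]; rfl
  | minus => rw [h2 _ rfl, zero_add]; rfl

/-- Regularity at the node excludes negative powers of `T`, regularity at infinity positive ones,
and the values at the node identify the two constants. -/
theorem TwoLines.eq_algebraMap {f : TwoLines}
    (h : ∀ x, ∀ r < 0, Lau.coeff r (TwoLines.expansion x f) = 0)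
    (h0 : Lau.coeff 0 (TwoLines.expansion .plus f) = Lau.coeff 0 (TwoLines.expansion .minus f)) :
    ∃ c : ℂ, f = algebraMap ℂ TwoLines c := by
  simp only [TwoLines.coeff_expansion, mul_zero] at h h0
  refine ⟨(f 0).coeff 0, ?_⟩
  ext i n
  have hn : n ≠ 0 → (f i).coeff n = 0 := by
    intro hn
    rcases lt_or_gt_of_ne hn with hn | hn
    · have := h (Puncture.node i) n hn
      rwa [(Puncture.node_eq i).1, (Puncture.node_eq i).2, one_mul] at this
    · have := h (.marked i) (-n) (by omega)
      rwa [show (Puncture.marked i : Puncture 2 0).ord = -1 from rfl, neg_mul_neg, one_mul] at this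
  have hc : (f i).coeff 0 = (f 0).coeff 0 := by
    fin_cases i
    · rfl
    · exact h0.symm
  rw [Pi.algebraMap_apply, ← LaurentPolynomial.C_eq_algebraMap, LaurentPolynomial.C_apply]
  split_ifs with hn'
  · rw [hn', hc]
  · exact hn hn'

/-- The exponents of the change of coordinates from `t` to `t` or `t⁻¹`. -/
def Puncture.exponent : Puncture 2 0 → ℕ → Lau
  -- At infinity `s = 1 / t`, and `1 / (t + z) - 1 / t = -t⁻² z / (1 + z / t)`, which is `κ_0 z / (1
  -- - κ_1 z)` for these two values.
  | .marked _ => fun k => if k = 0 then -Lau.mono (-2) else if k = 1 then -Lau.mono (-1) else 0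
  | _ => fun k => if k = 0 then 1 else 0

/-- With only `κ_0` and `κ_1` present, `(κ_1 z^2 d/dz)^j` applied to `κ_0 z` is the monomial `j!
κ_1^j κ_0 z^(j+1)`. -/
theorem vectorField_iterate {κ : ℕ → Lau} (h : ∀ k, 2 ≤ k → κ k = 0) (j : ℕ) :
    (vectorField κ)^[j] (fun i => if i = 1 then κ 0 else 0) =
      fun i => if i = j + 1 then (j.factorial : ℂ) • (κ 1 ^ j * κ 0) else 0 := by
  induction j with
  | zero => simp
  | succ j ih =>
    rw [Function.iterate_succ_apply', ih]
    funext k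
    rw [vectorField]
    split_ifs with hk
    · subst hk
      rw [Finset.sum_eq_single (j + 1)]
      · rw [if_pos rfl, show j + 1 + 1 - (j + 1) = 1 by omega, mul_smul_comm, smul_smul,
          ← mul_assoc, ← pow_succ', Nat.factorial_succ, Nat.cast_mul]
      · intro m _ hm
        rw [if_neg hm, mul_zero, smul_zero]
      · intro hm
        exact absurd (Finset.mem_range.2 (by omega)) hm
    · refine Finset.sum_eq_zero fun m hm => ?_
      split_ifs with h'
      · rw [h _ (by have := Finset.mem_range.1 hm; omega), zero_mul, smul_zero]
      · rw [mul_zero, smul_zero]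

/-- The factorials cancel and the exponential sums to the geometric series of `κ_0 z / (1 - κ_1 z)`,
the flow of a Möbius transformation. -/
theorem sum_vectorField {κ : ℕ → Lau} (h : ∀ k, 2 ≤ k → κ k = 0) (k : ℕ) :
    ∑ j ∈ Finset.range (k + 1), (1 / (j.factorial : ℂ)) •
      ((vectorField κ)^[j] fun i => if i = 1 then κ 0 else 0) (k + 1) = κ 1 ^ k * κ 0 := by
  rw [Finset.sum_eq_single k]
  · rw [vectorField_iterate h]
    beta_reduce
    rw [if_pos rfl, smul_smul, one_div,
      inv_mul_cancel₀ (Nat.cast_ne_zero.2 k.factorial_ne_zero), one_smul]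
  · intro j _ hj
    rw [vectorField_iterate h]
    beta_reduce
    rw [if_neg (by omega), smul_zero]
  · intro hk
    exact absurd (Finset.mem_range.2 (by omega)) hk

theorem Lau.neg_mono_pow (n : ℤ) (k : ℕ) :
    (-Lau.mono n) ^ k = ((-1 : ℂ) ^ k) • Lau.mono (n * k) := by
  induction k with
  | zero => simp [Lau.mono_zero]
  | succ k ih =>
    rw [pow_succ, ih, smul_mul_assoc, mul_neg, Lau.mono_mul, pow_succ, mul_neg_one, neg_smul,
      smul_neg]
    congr 3
    push_cast
    ring

theorem Lau.hasse_mono_one (k : ℕ) : (Lau.mono 1).hasse (k + 1) = if k = 0 then 1 else 0 := by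
  rw [Lau.hasse_mono]
  split_ifs with h
  · subst h
    simp [Lau.mono_zero]
  · rw [show (1 : ℤ) = (1 : ℕ) by rfl, Ring.choose_natCast, Nat.choose_eq_zero_of_lt (by omega)]
    simp

theorem ring_choose_neg_one (k : ℕ) : Ring.choose (-1 : ℤ) k = (-1) ^ k := by
  rw [Ring.choose_neg, add_sub_cancel_left, Ring.choose_natCast, Nat.choose_self, Nat.cast_one,
    Units.smul_def, smul_eq_mul, mul_one]
  exact VOA.sg_natCast k

theorem Puncture.exponent_spec (x : Puncture 2 0) (k : ℕ) (hk : 1 ≤ k) :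
    ∑ j ∈ Finset.range k, (1 / (j.factorial : ℂ)) •
      ((vectorField x.exponent)^[j] fun i => if i = 1 then x.exponent 0 else 0) k =
    (TwoLines.expansion x fun _ => T 1).hasse k := by
  obtain ⟨k, rfl⟩ := Nat.exists_eq_add_of_le' hk
  have h2 : ∀ k, 2 ≤ k → x.exponent k = 0 := by
    intro k hk
    cases x <;> simp [Puncture.exponent, show k ≠ 0 by omega, show k ≠ 1 by omega]
  rw [sum_vectorField h2, TwoLines.expansion_apply, lauHom_T]
  have key : ∀ x : Puncture 2 0, x.exponent = (fun k => if k = 0 then 1 else 0) → x.ord = 1 →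
      x.exponent 1 ^ k * x.exponent 0 = (Lau.mono (x.ord * 1)).hasse (k + 1) := by
    intro x hx hx'
    rw [hx, hx', one_mul, Lau.hasse_mono_one]
    beta_reduce
    rw [if_neg one_ne_zero, if_pos rfl, mul_one, zero_pow_eq]
  cases x with
  | marked i =>
    change (-Lau.mono (-1)) ^ k * -Lau.mono (-2) = (Lau.mono (-1 * 1)).hasse (k + 1)
    rw [Lau.neg_mono_pow, smul_mul_assoc, mul_neg, Lau.mono_mul, mul_one, Lau.hasse_mono,
      ring_choose_neg_one, Int.cast_pow, Int.cast_neg, Int.cast_one, smul_neg, ← neg_smul, pow_succ,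
      mul_neg_one]
    congr 2
    push_cast
    ring
  | extra j => exact key _ rfl rfl
  | plus => exact key _ rfl rfl
  | minus => exact key _ rfl rfl

/-- Two projective lines meeting in a point, with one marked point on each of them. -/
abbrev twoLines : NodalCurve 2 where
  m := 0
  A := TwoLines
  smooth := TwoLines.smooth
  s := fun _ => T 1
  generates := TwoLines.span_D
  free _ h := TwoLines.smul_D_eq_zero h
  ε := TwoLines.expansion
  finite_H1 := by
    rw [TwoLines.sup_eq_top]
    infer_instance
  constants _ h h0 := TwoLines.eq_algebraMap h h0
  affine e _ he := by
    by_contra! h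
    refine he (funext fun i => LaurentPolynomial.ext fun n => ?_)
    have := TwoLines.coeff_expansion (.marked i) e (-n)
    rw [h i, map_zero, show (Puncture.marked i : Puncture 2 0).ord = -1 from rfl, neg_mul_neg,
      one_mul] at this
    exact this.symm
  κ := Puncture.exponent
  κ_spec := Puncture.exponent_spec

end TwoLines

/-! ### A section over the smoothing that obstructs smoothing maps -/

namespace VOA

section NotSmoothing

variable {V : Type u} [AddCommGroup V] [Module ℂ V] (H : VOA V)

theorem coeffV_tmul (r : ℤ) (a : V) (f : Lau) : coeffV r (a ⊗ₜ[ℂ] f) = Lau.coeff r f • a := by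
  rw [coeffV, LinearMap.lTensor_tmul, TensorProduct.rid_tmul]

theorem coeffV_zero (r : ℤ) : coeffV r (0 : V ⊗[ℂ] Lau) = 0 := by
  rw [coeffV, map_zero, map_zero]

theorem scaleOp_tmul {d : ℕ} {a : V} (ha : a ∈ H.gr d) (κ f : Lau) :
    H.scaleOp κ (a ⊗ₜ f) = a ⊗ₜ (κ⁻¹ ^ d * f) := by
  rw [scaleOp, finsum_eq_single _ d, TensorProduct.map_tmul, H.proj_of_mem ha, if_pos rfl]
  · rfl
  · intro h hd
    rw [TensorProduct.map_tmul, H.proj_of_mem ha, if_neg hd, TensorProduct.zero_tmul]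

theorem scaleOp_zero (κ : Lau) : H.scaleOp κ 0 = 0 := by
  simp only [scaleOp, map_zero, finsum_zero]

theorem sumOp_zero (κ : ℕ → Lau) : H.sumOp κ 0 = 0 := by
  simp only [sumOp, map_zero, finsum_zero]

theorem coordOp_zero (κ : ℕ → Lau) : H.coordOp κ 0 = 0 := by
  have : ∀ j, (H.sumOp κ)^[j] 0 = 0 := fun j => Function.iterate_fixed (H.sumOp_zero κ) j
  simp only [coordOp, scaleOp_zero, this, smul_zero, finsum_zero]

theorem coordOp_of_eq_ite {κ : ℕ → Lau} (hκ : κ = fun k => if k = 0 then 1 else 0)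
    {d : ℕ} {a : V} (ha : a ∈ H.gr d) (f : Lau) : H.coordOp κ (a ⊗ₜ f) = a ⊗ₜ f := by
  have h0 : ∀ x, H.sumOp κ x = 0 := by
    intro x
    refine finsum_eq_zero_of_forall_eq_zero fun i => ?_
    rw [hκ]
    beta_reduce
    rw [if_neg (Nat.succ_ne_zero i), LinearMap.mulLeft_zero_eq_zero, TensorProduct.map_zero_right,
      LinearMap.zero_apply]
  rw [coordOp, finsum_eq_single _ 0]
  · rw [Function.iterate_zero, id, H.scaleOp_tmul ha, hκ]
    simp
  · intro j hj
    obtain ⟨j, rfl⟩ := Nat.exists_eq_succ_of_ne_zero hj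
    rw [Function.iterate_succ_apply', h0, smul_zero]

theorem expand_zero {n : ℕ} (C : NodalCurve n) (x : Puncture n C.m) : H.expand C x 0 = 0 := by
  rw [expand, map_zero, coordOp_zero]

/-- At the two preimages of the node the global coordinate restricts to the formal one, so the
change of coordinates is trivial there. -/
theorem expand_twoLines_tmul {x : Puncture 2 0}
    (hx : x.exponent = fun k => if k = 0 then 1 else 0) (hx' : x.ord = 1) {d : ℕ} {a : V}
    (ha : a ∈ H.gr d) (f : TwoLines) :
    H.expand twoLines x (a ⊗ₜ[ℂ] f) = a ⊗ₜ TwoLines.expansion x f := by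
  have h1 : (TwoLines.expansion x fun _ => LaurentPolynomial.T 1).hasse 1 = 1 := by
    rw [TwoLines.expansion_apply, lauHom_T, hx', mul_one, Lau.hasse_mono_one 0, if_pos rfl]
  have h2 : H.expand twoLines x (a ⊗ₜ[ℂ] f) = H.coordOp x.exponent (a ⊗ₜ
      ((TwoLines.expansion x fun _ => LaurentPolynomial.T 1).hasse 1 *
        TwoLines.expansion x f)) := rfl
  rw [h2, h1, one_mul, H.coordOp_of_eq_ite hx ha]

theorem leftAct_zero (x : H.ModeTotal) : H.leftAct 0 x = 0 := by
  simp only [leftAct, coeffV_zero, leftMode_zero, finsum_zero]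

theorem smul_modeTotal_zero (r : ℂ) : r • (0 : H.ModeTotal) = 0 :=
  smul_zero (A := H.ModeTotal) r

theorem rightThetaAct_zero (x : H.ModeTotal) : H.rightThetaAct 0 x = 0 := by
  simp only [rightThetaAct, coeffV_zero, map_zero, rightMode_zero, smul_modeTotal_zero, finsum_zero]

theorem leftAct_tmul_mono (a : V) (n : ℤ) (x : H.ModeTotal) :
    H.leftAct (a ⊗ₜ Lau.mono n) x = H.leftMode n a x := by
  rw [leftAct, finsum_eq_single _ n, coeffV_tmul, Lau.coeff_mono, if_pos rfl, one_smul]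
  intro r hr
  rw [coeffV_tmul, Lau.coeff_mono, if_neg hr, zero_smul, leftMode_zero]

/-- For a quasi-primary vector, one with `L_1 a = 0`, only the term `i = 0` of `θ` remains. -/
theorem rightThetaAct_tmul_mono {d : ℕ} {a : V} (ha : a ∈ H.gr d) (ha' : H.Y H.conf 2 a = 0)
    (n : ℤ) (x : H.ModeTotal) :
    H.rightThetaAct (a ⊗ₜ Lau.mono n) x = (-1 : ℂ) ^ d • H.rightMode (2 * d - n - 2) a x := by
  rw [rightThetaAct, finsum_eq_single _ n, finsum_eq_single _ d, finsum_eq_single _ 0, coeffV_tmul,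
    Lau.coeff_mono, if_pos rfl, one_smul, H.proj_of_mem ha, if_pos rfl, pow_zero,
    Module.End.one_apply, Nat.factorial_zero, Nat.cast_one, div_one, Nat.cast_zero, sub_zero]
  · intro i hi
    obtain ⟨i, rfl⟩ := Nat.exists_eq_succ_of_ne_zero hi
    rw [coeffV_tmul, Lau.coeff_mono, if_pos rfl, one_smul, H.proj_of_mem ha, if_pos rfl, pow_succ,
      Module.End.mul_apply, ha', map_zero, rightMode_zero, smul_modeTotal_zero]
  · intro h hd
    simp only [coeffV_tmul, Lau.coeff_mono, if_pos, one_smul, H.proj_of_mem ha, if_neg hd, map_zero,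
      rightMode_zero, smul_modeTotal_zero, finsum_zero]
  · intro r hr
    simp only [coeffV_tmul, Lau.coeff_mono, if_neg hr, zero_smul, map_zero,
      rightMode_zero, smul_modeTotal_zero, finsum_zero]

theorem gam_zero : H.gam 0 = 0 := by
  simp only [gam, map_zero, smul_zero, finsum_zero]

theorem gam_of_mem {d : ℕ} {a : V} (ha : a ∈ H.gr d) (ha' : H.Y H.conf 2 a = 0) :
    H.gam a = (-1 : ℂ) ^ d • a := by
  rw [gam, finsum_eq_single _ d, finsum_eq_single _ 0, H.proj_of_mem ha, if_pos rfl, pow_zero,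
    Module.End.one_apply, Nat.factorial_zero, Nat.cast_one, div_one]
  · intro i hi
    obtain ⟨i, rfl⟩ := Nat.exists_eq_succ_of_ne_zero hi
    rw [H.proj_of_mem ha, if_pos rfl, pow_succ, Module.End.mul_apply, ha', map_zero, smul_zero]
  · intro h hd
    simp only [H.proj_of_mem ha, if_neg hd, map_zero, smul_zero, finsum_zero]

theorem coeffJ_zero (k : ℕ) (r : ℤ) : H.coeffJ k (fun _ => 0) r = 0 := by
  simp only [coeffJ, map_zero, ite_self, finsum_zero]

theorem coeffJ_ite {d : ℕ} {a : V} (ha : a ∈ H.gr d) (k m : ℕ) (r : ℤ) :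
    H.coeffJ k (fun i => if i = m then a else 0) r =
      if r = (d : ℤ) + m - k - 1 then a else 0 := by
  rw [coeffJ, finsum_eq_single _ d]
  · split_ifs with h1 h2 h3 h4
    · rw [H.proj_of_mem ha, if_pos rfl]
    · omega
    · omega
    · exact map_zero _
    · omega
    · rfl
  · intro h hd
    split_ifs
    · rw [H.proj_of_mem ha, if_neg hd]
    · exact map_zero _
    · rfl

/-- The section of `𝒱 ⊗ ω` over the smoothing of `twoLines` given by `J_0(a) s_+` near the node,
for a quasi-primary vector `a` of weight `2`. -/
def chiralSection {a : V} (ha : a ∈ H.gr 2) (ha' : H.Y H.conf 2 a = 0) :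
    H.ChiralSection twoLines where
  -- At `Q_+` the element `J_0(a) s_+` is `a ⊗ t · t = a ⊗ t^2`, which extends to the line as `T^2`.
  -- At `Q_-` one has `s_+ = q s_-⁻¹`, so the section starts at order `q`, as `-a ⊗ t^0`. Poles at
  -- infinity are allowed, since those points are marked.
  σ k := if k = 0 then a ⊗ₜ[ℂ] (Pi.single 0 (LaurentPolynomial.T 2) : TwoLines) else
    if k = 1 then (-a) ⊗ₜ[ℂ] (Pi.single 1 1 : TwoLines) else 0
  g i k := if k = 0 then if i = 1 then a else 0 else 0
  bounded := by
    have hp : ∀ h, 2 < h → H.proj h a = 0 := fun h hh => by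
      rw [H.proj_of_mem ha, if_neg (by omega)]
    refine ⟨2, fun h hh => ⟨fun k => ?_, fun i k => ?_⟩⟩
    · split_ifs
      · rw [LinearMap.rTensor_tmul, hp h hh, TensorProduct.zero_tmul]
      · rw [LinearMap.rTensor_tmul, map_neg, hp h hh, neg_zero, TensorProduct.zero_tmul]
      · exact map_zero _
    · split_ifs
      · exact hp h hh
      · exact map_zero _
      · exact map_zero _
  regular _ j := j.elim0
  glue_plus k r := by
    split_ifs with h0 h1
    · rw [H.expand_twoLines_tmul rfl rfl ha, TwoLines.expansion_apply, h0, H.coeffJ_ite ha]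
      change coeffV r (a ⊗ₜ lauHom 1 (LaurentPolynomial.T 2)) = _
      rw [lauHom_T, coeffV_tmul, Lau.coeff_mono]
      norm_num
    · rw [H.expand_twoLines_tmul rfl rfl (neg_mem ha), TwoLines.expansion_apply, coeffJ_zero]
      change coeffV r ((-a) ⊗ₜ lauHom 1 0) = 0
      rw [map_zero, TensorProduct.tmul_zero, coeffV_zero]
    · rw [expand_zero, coeffJ_zero, coeffV_zero]
  glue_minus k r := by
    have hg : ∀ j, H.gam (if j = 0 then if k = 1 then a else 0 else 0) =
        if j = 0 then if k = 1 then a else 0 else 0 := by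
      intro j
      split_ifs
      · rw [H.gam_of_mem ha ha', neg_one_sq, one_smul]
      · exact H.gam_zero
      · exact H.gam_zero
    simp only [hg]
    split_ifs with h0 h1 h2
    · omega
    · simp only [ite_self]
      rw [H.expand_twoLines_tmul rfl rfl ha, TwoLines.expansion_apply, coeffJ_zero, neg_zero]
      change coeffV r (a ⊗ₜ lauHom 1 0) = 0
      rw [map_zero, TensorProduct.tmul_zero, coeffV_zero]
    · rw [H.expand_twoLines_tmul rfl rfl (neg_mem ha), TwoLines.expansion_apply, h2,
        H.coeffJ_ite ha]
      change coeffV r ((-a) ⊗ₜ lauHom 1 1) = _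
      rw [map_one, coeffV_tmul, ← Lau.mono_zero, Lau.coeff_mono]
      norm_num
    · simp only [ite_self]
      rw [expand_zero, coeffJ_zero, coeffV_zero, neg_zero]

end NotSmoothing

section NotSmoothing

/-- Nonzero vectors over a field have functionals with value `1`; their product strips the factor
`w` from the smoothing equation and leaves an equation in `𝔄`. -/
theorem exists_tensor_functional {ι K : Type*} [Fintype ι] {W : ι → Type*}
    [∀ i, AddCommGroup (W i)] [∀ i, Module ℂ (W i)] [AddCommMonoid K] [Module ℂ K] {w : ∀ i, W i}
    (hw : ∀ i, w i ≠ 0) : ∃ F : PiTensorProduct ℂ W ⊗[ℂ] K →ₗ[ℂ] K,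
      ∀ y, F (PiTensorProduct.tprod ℂ w ⊗ₜ y) = y := by
  choose f hf using fun i => Module.Projective.exists_dual_eq_one ℂ (hw i)
  refine ⟨(TensorProduct.lid ℂ K).toLinearMap ∘ₗ LinearMap.rTensor K (PiTensorProduct.lift
    ((MultilinearMap.mkPiAlgebra ℂ ι ℂ).compLinearMap f)), fun y => ?_⟩
  rw [LinearMap.comp_apply, LinearMap.rTensor_tmul, PiTensorProduct.lift.tprod]
  simp [hf]

variable {V : Type u} [AddCommGroup V] [Module ℂ V] (H : VOA V) {a : V} (ha : a ∈ H.gr 2)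
  (ha' : H.Y H.conf 2 a = 0)

theorem expand_plus_chiralSection_zero :
    H.expand twoLines .plus ((H.chiralSection ha ha').σ 0) = a ⊗ₜ Lau.mono 2 := by
  change H.expand twoLines .plus (a ⊗ₜ[ℂ] (Pi.single 0 (LaurentPolynomial.T 2) : TwoLines)) = _
  rw [H.expand_twoLines_tmul rfl rfl ha, TwoLines.expansion_apply]
  change a ⊗ₜ lauHom 1 (LaurentPolynomial.T 2) = _
  rw [lauHom_T, one_mul]

theorem expand_minus_chiralSection_zero :
    H.expand twoLines .minus ((H.chiralSection ha ha').σ 0) = 0 := by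
  change H.expand twoLines .minus (a ⊗ₜ[ℂ] (Pi.single 0 (LaurentPolynomial.T 2) : TwoLines)) = _
  rw [H.expand_twoLines_tmul rfl rfl ha, TwoLines.expansion_apply]
  change a ⊗ₜ lauHom 1 0 = _
  rw [map_zero, TensorProduct.tmul_zero]

theorem expand_plus_chiralSection_one :
    H.expand twoLines .plus ((H.chiralSection ha ha').σ 1) = 0 := by
  change H.expand twoLines .plus ((-a) ⊗ₜ[ℂ] (Pi.single 1 1 : TwoLines)) = _
  rw [H.expand_twoLines_tmul rfl rfl (neg_mem ha), TwoLines.expansion_apply]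
  change (-a) ⊗ₜ lauHom 1 0 = _
  rw [map_zero, TensorProduct.tmul_zero]

theorem expand_minus_chiralSection_one :
    H.expand twoLines .minus ((H.chiralSection ha ha').σ 1) = (-a) ⊗ₜ Lau.mono 0 := by
  change H.expand twoLines .minus ((-a) ⊗ₜ[ℂ] (Pi.single 1 1 : TwoLines)) = _
  rw [H.expand_twoLines_tmul rfl rfl (neg_mem ha), TwoLines.expansion_apply]
  change (-a) ⊗ₜ lauHom 1 1 = _
  rw [map_one, Lau.mono_zero]

theorem one_smul_modeTotal (x : H.ModeTotal) : (1 : ℂ) • x = x := one_smul ℂ x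

include ha ha' in
/-- The condition on a smoothing map over the smoothing of `twoLines` that comes from the section
`J_0(a) s_+`, at order one. -/
theorem IsSmoothingMap.leftMode_add_rightMode {W : Fin 2 → Type u} [∀ i, AddCommGroup (W i)]
    [∀ i, Module ℂ (W i)] {M : ∀ i, H.Mod (W i)} {I : ℕ → H.ModeTotal}
    (hI : H.IsSmoothingMap twoLines W M I) {w : ∀ i, W i} (hw : ∀ i, w i ≠ 0) :
    H.leftMode 2 a (I 1) + H.rightMode 2 (-a) H.modeOne = 0 := by
  obtain ⟨F, hF⟩ := exists_tensor_functional (K := H.ModeTotal) hw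
  have e := congrArg F (hI.2 (H.chiralSection ha ha') w 1)
  have h1 : (Finset.HasAntidiagonal.antidiagonal 1 : Finset (ℕ × ℕ)) = {(0, 1), (1, 0)} := rfl
  have hm : H.Y H.conf 2 (-a) = 0 := by rw [map_neg, ha', neg_zero]
  rw [h1, Finset.sum_pair (by simp), Finset.sum_pair (by simp), expand_plus_chiralSection_zero,
    expand_minus_chiralSection_zero, expand_plus_chiralSection_one, expand_minus_chiralSection_one,
    leftAct_zero, rightThetaAct_zero, leftAct_tmul_mono,
    H.rightThetaAct_tmul_mono (neg_mem ha) hm, hI.1, neg_one_sq,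
    one_smul_modeTotal, show 2 * ((2 : ℕ) : ℤ) - 0 - 2 = 2 by norm_num] at e
  simp only [map_add, hF] at e
  -- The terms from the marked points occur identically on both sides. Cancelling them leaves the
  -- actions at `Q_+` on `𝓘_1` and at `Q_-` on `𝓘_0 = 1`.
  let _ : AddCommGroup H.ModeTotal := Module.addCommMonoidToAddCommGroup ℂ
  have cancel : ∀ x y z t : H.ModeTotal, x + y = x + z + 0 + (y + 0 + t) → z + t = 0 := by
    intro x y z t h
    have h' : x + y + (z + t) = x + y + 0 := by
      rw [add_zero]
      refine .trans ?_ h.symm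
      abel
    exact add_left_cancel h'
  exact cancel _ _ _ _ e

end NotSmoothing

/-! ### Failure of smoothing for `Vir c` -/

namespace IsVirasoro

variable {c : ℂ} {H : VOA (Vir c)} (hH : H.IsVirasoro)

include hH

/-- `[L_1, L_{-2}] = 3 L_{-1}` and `L_1`, `L_{-1}` kill the vacuum, so `ω` is quasi-primary and may
serve as the vector `a` above. -/
theorem virL_one_conf : H.Y H.conf 2 H.conf = 0 := by
  have h := hH.mode_eq 1 H.conf
  rw [show (1 : ℤ) + 1 = 2 by norm_num] at h
  rw [h, hH.conf_eq]
  change virL c 1 • virL c (-2) • virVac c = 0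
  rw [← mul_smul, virL_mul, if_neg (by norm_num), add_smul, add_smul, mul_smul,
    virL_smul_virVac (by norm_num), smul_zero (A := Vir c), smul_assoc,
    virL_smul_virVac (by norm_num)]
  simp only [Int.cast_one, Int.cast_neg, Int.cast_ofNat, zero_smul, add_zero, zero_add]
  exact smul_zero (A := Vir c) ((1 : ℂ) - -2)

theorem not_satisfiesSmoothing : ¬ H.SatisfiesSmoothing := by
  intro h
  -- The adjoint module at both marked points suffices; all that matters is a nonzero vector, here
  -- the vacuum.
  obtain ⟨I, hI⟩ := h 2 twoLines (fun _ => Vir c) fun _ => hH.selfMod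
  exact hH.leftMode_add_rightMode_ne_zero (I 1)
    (hI.leftMode_add_rightMode H H.conf_mem hH.virL_one_conf (w := fun _ => virVac c)
      fun _ => virVac_ne_zero c)

end IsVirasoro

end VOA

end

/-! ### The main theorem -/

theorem proposition8p1p1 (c : ℂ) :
    (∃ H : VOA (Vir c), H.IsVirasoro) ∧
    ∀ H : VOA (Vir c), H.IsVirasoro →
      ((∃ e : H.ModeAlg 1 ≃ₗ[ℂ] Polynomial ℂ,
          ∀ x y, e (H.star 1 x y) = 2 * Polynomial.X * e x * e y) ∧
        (¬ ∃ u : H.ModeAlg 1, ∀ x, H.star 1 u x = x ∧ H.star 1 x u = x) ∧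
        ¬ H.SatisfiesSmoothing) ∧
      ((∀ x y, H.mu 1 (H.star 1 x y) = H.mu 1 x * H.mu 1 y) ∧
        Function.Injective (H.mu 1) ∧
        Set.range (H.mu 1) = {z | H.zhuProj (Nat.zero_le 1) z = 0}) :=
  ⟨⟨VOA.virVOA c, VOA.isVirasoro_virVOA c⟩, fun _ hH =>
    ⟨⟨⟨hH.modeEquiv.symm, hH.modeEquiv_symm_star⟩, hH.not_exists_one, hH.not_satisfiesSmoothing⟩,
      hH.mu_star, hH.mu_injective, hH.range_mu⟩⟩
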